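/- Let $m\ge 2$ and let $\mathcal C\ell_m$ be either the real Clifford algebra $\mathbb R_{0,m}$ generated by $e_1,\dots,e_m$ with $e_ie_j+e_je_i=-2\delta_{ij}$, or its complexification $\mathbb C_m$; correspondingly put $\mathbb K=\mathbb R$ or $\mathbb K=\mathbb C$. Let $\mathcal C\ell_m^s$ be the space of $s$-vectors (spanned by the products $e_{a_1}\cdots e_{a_s}$, $a_1<\dots<a_s$), $\mathcal C\ell_m^S=\bigoplus_{s\in S}\mathcal C\ell_m^s$ for $S\subset\{0,1,\dots,m\}$, and $S'=\{s: s-1\in S\text{ and }s+1\in S\}$. For a vector $u$ and an $s$-vector $v$ put $u\bullet v=\frac12(uv-(-1)^svu)$ and $u\wedge v=\frac12(uv+(-1)^svu)$, extended linearly in $v$. Identify $x\in\mathbb R^m$ with $x_1e_1+\cdots+x_me_m$ and let $\partial=e_1\partial_{x_1}+\cdots+e_m\partial_{x_m}$. Let $\mathbb B_m$ be the open unit ball of $\mathbb R^m$, and let $L^2(\mathbb B_m,\mathcal C\ell_m^S)\cap\operatorname{Ker}\partial$ be the $\mathbb K$-space of square-integrable, continuously differentiable $f:\mathbb B_m\to\mathcal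 C\ell_m^S$ with $\partial f=0$, with inner product $(f,g)=\int_{\mathbb B_m}[\bar f g]_0\,d\lambda^m$, where $[a]_0$ is the scalar part and $\bar a$ the Clifford conjugate (the anti-automorphism with $\bar e_i=-e_i$, which also conjugates complex scalars). *Dimension two.* Put $f^0_0=1$ and $f^2_0=e_2e_1$. For $k\ge0$ put $f^{\pm1}_k=(x_1-e_1e_2x_2)^ke^{\pm}$ with $e^+=e_1$, $e^-=e_2$ if $\mathbb K=\mathbb R$, and $f^{\pm1}_k=(x_1\mp ix_2)^k(e_1\mp ie_2)$ if $\mathbb K=\mathbb C$. *Embedding factors.* For $r\ge3$ and $x\in\mathbb R^r$ write $\underline x=x_1e_1+\cdots+x_{r-1}e_{r-1}$, $(a)_n=a(a+1)\cdots(a+n-1)$, $C^\nu_n(z)=\sum_{i=0}^{\lfloor n/2\rfloor}\frac{(-1)^i(\nu)_{n-i}}{i!\,(n-2i)!}(2z)^{n-2i}$, $$F^{(n)}_{r,j}(x)=\frac{(j+1)_n}{(r-2+2j)_n}|x|^nC_n^{r/2+j-1}(x_r/|x|),\qquad X^{(n)}_{r,j}=F^{(n)}_{r,j}+\frac{j+1}{r+2j-1}F^{(n-1)}_{r,j+1}\,\underline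 x\,e_r,$$ with $F^{(-1)}_{r,j}=0$ and $X^{(-1)}_{r,j}=0$, and $$X^{s,t,r}_{k,j}=X^{(k-j)}_{r,j}e_r^{s-t}+\alpha X^{(k-1-j)}_{r,j+1}\bigl(\beta^{t-s}(\underline x\wedge)+\beta^{t-s+1}(\underline x\bullet)\bigr)e_r^{s-t+1},$$ where $\beta=-(j+r-1-t)/(j+t)$ and $\alpha=-(j+1)/(r+2j-1)$ if $t\ne0,r-1$, while the second summand is absent ($\alpha=0$) if $t\in\{0,r-1\}$. These act by left multiplication on $\mathcal C\ell_{r-1}$-valued functions of $(x_1,\dots,x_{r-1})$. *Indices.* For $r\ge 3$ let $N^{s,r}_k$ be the set of pairs $(t,j)\in\{0,\dots,r-1\}\times\{0,\dots,k\}$ with $t\in\{s-1,s\}$ and with $j=0$ if $t\in\{0,r-1\}$; but let $N^{s,r}_k=\emptyset$ if $s\in\{0,r\}$ and $k\ge1$. Let $I^{s,m}_k$ be the set of pairs $(\nu,\mu)$, $\nu=(s_{m-1},\dots,s_3,t_2)$, $\mu=(k_{m-1},\dots,k_2)$, with $(t_2,k_2)\in\{(0,0),(2,0)\}\cup\{(\pm1,l):l\in\mathbb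 N_0\}$ and $(s_{r-1},k_{r-1})\in N^{s_r,r}_{k_r}$ for $r=3,\dots,m$, where $s_m=s$, $k_m=k$, $s_2=|t_2|$. For $(\nu,\mu)\in I^{s,m}_k$ put $$f^{s,\nu}_{k,\mu}=X^{s,s_{m-1},m}_{k,k_{m-1}}X^{s_{m-1},s_{m-2},m-1}_{k_{m-1},k_{m-2}}\cdots X^{s_3,s_2,3}_{k_3,k_2}\,f^{t_2}_{k_2}.$$ (For $m=2$ these are the $f^{t_2}_{k}$ with $|t_2|=s$ themselves.) **Theorem.** For every $S\subset\{0,1,\dots,m\}$, an orthogonal basis of the Hilbert space $L^2(\mathbb B_m,\mathcal C\ell_m^S)\cap\operatorname{Ker}\partial$ (nonzero, mutually orthogonal elements whose linear span is dense in this space, which is closed in $L^2$) is formed by the polynomials $$f^{s,\nu}_{k,\mu}\quad\text{for } s\in S,\ k\in\mathbb N_0,\ (\nu,\mu)\in I^{s,m}_k,$$ together with the polynomials $$\bigl((x\wedge)+\beta^{s,m}_{k-1}(x\bullet)\bigr)f^{s,\nu}_{k-1,\mu}\quad\text{for } s\in S',\ k\in\mathbb N,\ (\nu,\mu)\in I^{s,m}_{k-1},\qquad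 \beta^{s,m}_k=-\frac{k+m-s}{k+s}.$$ -/

import Mathlib

open MeasureTheory CliffordAlgebra
open scoped symmDiff InnerProductSpace

noncomputable section

namespace GMT

/-! ### The Clifford algebra `ℝ_{0,m}` (for `𝕜 = ℝ`) or `ℂ_m` (for `𝕜 = ℂ`) -/

/-- The quadratic form `v ↦ -(v₁² + ⋯ + v_m²)` on `𝕜^m`. -/
def negForm (𝕜 : Type) [RCLike 𝕜] (m : ℕ) : QuadraticForm 𝕜 (Fin m → 𝕜) :=
  QuadraticMap.weightedSumSquares 𝕜 (fun _ : Fin m => (-1 : 𝕜))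

/-- The Clifford algebra over `𝕜` generated by `e₁, …, e_m` with `e_i e_j + e_j e_i = -2 δ_ij`. -/
abbrev Cl (𝕜 : Type) [RCLike 𝕜] (m : ℕ) : Type := CliffordAlgebra (negForm 𝕜 m)

variable (𝕜 : Type) [RCLike 𝕜]

/-- The generator `e_i`; the index `i : Fin m` is zero-based. -/
def gen {m : ℕ} (i : Fin m) : Cl 𝕜 m := ι (negForm 𝕜 m) (Pi.single i 1)

/-- `e_A = e_{a₁} ⋯ e_{a_s}` for `A = {a₁ < ⋯ < a_s}`. -/
def blade {m : ℕ} (A : Finset (Fin m)) : Cl 𝕜 m := ((A.sort (· ≤ ·)).map (gen 𝕜)).prod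

lemma negForm_apply {m : ℕ} (v : Fin m → 𝕜) : negForm 𝕜 m v = -∑ i, v i * v i := by
  simp [negForm, QuadraticMap.weightedSumSquares_apply]

/-! The next declarations, up to `bladeBasis`, show that the `e_A` form a basis: the algebra is
represented on its coordinate space by left multiplication. -/

/-- The sign picked up when `e_i` moves past (or cancels) `e_b`. -/
def tau {m : ℕ} (i b : Fin m) : 𝕜 := if b ≤ i then -1 else 1

/-- The sign in `e_i e_B = ± e_{B ∆ {i}}`. -/
def sgn {m : ℕ} (i : Fin m) (B : Finset (Fin m)) : 𝕜 := ∏ b ∈ B, tau 𝕜 i b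

lemma tau_mul_self {m : ℕ} (i b : Fin m) : tau 𝕜 i b * tau 𝕜 i b = 1 := by
  unfold tau; split_ifs <;> simp

lemma sgn_mul_self {m : ℕ} (i : Fin m) (B : Finset (Fin m)) : sgn 𝕜 i B * sgn 𝕜 i B = 1 := by
  simp [sgn, ← Finset.prod_mul_distrib, tau_mul_self]

lemma symmDiff_singleton_of_mem {m : ℕ} {j : Fin m} {B : Finset (Fin m)} (h : j ∈ B) :
    B ∆ {j} = B.erase j := by
  ext a; simp only [Finset.mem_symmDiff, Finset.mem_singleton, Finset.mem_erase]
  by_cases h' : a = j <;> simp [h', h]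

lemma symmDiff_singleton_of_notMem {m : ℕ} {j : Fin m} {B : Finset (Fin m)} (h : j ∉ B) :
    B ∆ {j} = insert j B := by
  ext a; simp only [Finset.mem_symmDiff, Finset.mem_singleton, Finset.mem_insert]
  by_cases h' : a = j <;> simp [h', h]

lemma sgn_symmDiff {m : ℕ} (i j : Fin m) (B : Finset (Fin m)) :
    sgn 𝕜 i (B ∆ {j}) = tau 𝕜 i j * sgn 𝕜 i B := by
  by_cases h : j ∈ B
  · rw [symmDiff_singleton_of_mem h, sgn, sgn, ← Finset.mul_prod_erase B _ h, ← mul_assoc,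
      tau_mul_self, one_mul]
  · rw [symmDiff_singleton_of_notMem h, sgn, sgn, Finset.prod_insert h]

/-- Left multiplication by `e_i` in coordinates. -/
def leftGen {m : ℕ} (i : Fin m) : Module.End 𝕜 (Finset (Fin m) → 𝕜) where
  toFun f A := sgn 𝕜 i (A ∆ {i}) * f (A ∆ {i})
  map_add' f g := by ext A; simp [mul_add]
  map_smul' c f := by ext A; simp [mul_left_comm]

lemma leftGen_apply {m : ℕ} (i : Fin m) (f : Finset (Fin m) → 𝕜) (A : Finset (Fin m)) :
    leftGen 𝕜 i f A = sgn 𝕜 i (A ∆ {i}) * f (A ∆ {i}) := rfl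

lemma leftGen_anticomm {m : ℕ} (i j : Fin m) :
    leftGen 𝕜 i * leftGen 𝕜 j + leftGen 𝕜 j * leftGen 𝕜 i = if i = j then -2 else 0 := by
  refine LinearMap.ext fun f => funext fun A => ?_
  simp only [LinearMap.add_apply, Module.End.mul_apply, Pi.add_apply, leftGen_apply, sgn_symmDiff]
  rw [symmDiff_right_comm A {j} {i}]
  split_ifs with h
  · subst h
    have h1 := sgn_mul_self 𝕜 i A
    have h2 : (-2 : Module.End 𝕜 (Finset (Fin m) → 𝕜)) f = (-2 : 𝕜) • f := by
      rw [LinearMap.neg_apply, neg_smul, ← Nat.cast_ofNat, Module.End.natCast_apply]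
      simp [two_smul]
    rw [h2]
    simp only [tau, le_refl, if_true, symmDiff_symmDiff_cancel_right, Pi.smul_apply, smul_eq_mul]
    linear_combination (-2 * f A) * h1
  · have : tau 𝕜 i j + tau 𝕜 j i = 0 := by
      rcases lt_or_gt_of_ne h with h | h <;> simp [tau, h.le, not_le.2 h]
    simp only [tau, le_refl, if_true] at *
    simp only [LinearMap.zero_apply, Pi.zero_apply]
    linear_combination (sgn 𝕜 i A * sgn 𝕜 j A * f (A ∆ {i} ∆ {j})) * this

/-- Left multiplication by a vector in coordinates. -/
def leftVec (m : ℕ) : (Fin m → 𝕜) →ₗ[𝕜] Module.End 𝕜 (Finset (Fin m) → 𝕜) :=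
  ∑ i, (LinearMap.proj i).smulRight (leftGen 𝕜 i)

lemma leftVec_apply {m : ℕ} (v : Fin m → 𝕜) : leftVec 𝕜 m v = ∑ i, v i • leftGen 𝕜 i := by
  simp [leftVec, LinearMap.sum_apply]

lemma leftVec_sq {m : ℕ} (v : Fin m → 𝕜) :
    leftVec 𝕜 m v * leftVec 𝕜 m v = algebraMap 𝕜 _ (negForm 𝕜 m v) := by
  have key : (2 : 𝕜) • (leftVec 𝕜 m v * leftVec 𝕜 m v) =
      (2 : 𝕜) • algebraMap 𝕜 (Module.End 𝕜 (Finset (Fin m) → 𝕜)) (negForm 𝕜 m v) := by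
    have e1 : leftVec 𝕜 m v * leftVec 𝕜 m v =
        ∑ i, ∑ j, (v i * v j) • (leftGen 𝕜 i * leftGen 𝕜 j) := by
      rw [leftVec_apply, Finset.sum_mul_sum]
      refine Finset.sum_congr rfl fun i _ => Finset.sum_congr rfl fun j _ => ?_
      rw [smul_mul_smul_comm]
    have e2 : leftVec 𝕜 m v * leftVec 𝕜 m v =
        ∑ i, ∑ j, (v i * v j) • (leftGen 𝕜 j * leftGen 𝕜 i) := by
      rw [e1, Finset.sum_comm]
      refine Finset.sum_congr rfl fun i _ => Finset.sum_congr rfl fun j _ => ?_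
      rw [mul_comm (v j)]
    rw [two_smul]
    nth_rewrite 1 [e1]
    rw [e2, ← Finset.sum_add_distrib]
    simp only [← Finset.sum_add_distrib, ← smul_add, leftGen_anticomm]
    simp only [smul_ite, smul_zero, Finset.sum_ite_eq, Finset.mem_univ, if_true]
    rw [negForm_apply, Algebra.algebraMap_eq_smul_one, neg_smul, Finset.sum_smul, smul_neg,
      Finset.smul_sum, ← Finset.sum_neg_distrib]
    refine Finset.sum_congr rfl fun i _ => ?_
    rw [smul_neg, smul_comm (2 : 𝕜)]
    congr 2
    rw [two_smul]; norm_num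
  exact smul_right_injective _ (two_ne_zero (α := 𝕜)) key

/-- Left multiplication in coordinates. -/
def leftRep (m : ℕ) : Cl 𝕜 m →ₐ[𝕜] Module.End 𝕜 (Finset (Fin m) → 𝕜) :=
  CliffordAlgebra.lift (negForm 𝕜 m) ⟨leftVec 𝕜 m, leftVec_sq 𝕜⟩

lemma leftRep_gen {m : ℕ} (i : Fin m) : leftRep 𝕜 m (gen 𝕜 i) = leftGen 𝕜 i := by
  simp [leftRep, gen, leftVec_apply, Pi.single_apply]

lemma leftGen_single {m : ℕ} (i : Fin m) (B : Finset (Fin m)) (h : ∀ b ∈ B, i < b) :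
    leftGen 𝕜 i (Pi.single B 1) = Pi.single (insert i B) 1 := by
  have hi : i ∉ B := fun hb => lt_irrefl _ (h i hb)
  have hB : (insert i B) ∆ {i} = B := by
    rw [← symmDiff_singleton_of_notMem hi, symmDiff_symmDiff_cancel_right]
  funext A
  rw [leftGen_apply]
  by_cases hA : A = insert i B
  · subst hA
    rw [hB, Pi.single_eq_same, Pi.single_eq_same, mul_one, sgn]
    exact Finset.prod_eq_one fun b hb => by simp [tau, h b hb]
  · have hA' : A ∆ {i} ≠ B := by
      rintro rfl
      exact hA (by rw [← symmDiff_singleton_of_notMem hi, symmDiff_symmDiff_cancel_right])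
    rw [Pi.single_eq_of_ne hA', Pi.single_eq_of_ne hA, mul_zero]

lemma leftRep_list {m : ℕ} (l : List (Fin m)) (hl : l.Pairwise (· < ·)) :
    leftRep 𝕜 m (l.map (gen 𝕜)).prod (Pi.single ∅ 1) = Pi.single l.toFinset 1 := by
  induction l with
  | nil => simp
  | cons a l ih =>
    rw [List.pairwise_cons] at hl
    rw [List.map_cons, List.prod_cons, map_mul, Module.End.mul_apply, ih hl.2, leftRep_gen,
      List.toFinset_cons, leftGen_single]
    intro b hb
    exact hl.1 b (List.mem_toFinset.1 hb)

lemma leftRep_blade {m : ℕ} (A : Finset (Fin m)) :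
    leftRep 𝕜 m (blade 𝕜 A) (Pi.single ∅ 1) = Pi.single A 1 := by
  rw [blade, leftRep_list 𝕜 _ (Finset.sortedLT_sort A).pairwise, Finset.sort_toFinset]

lemma blade_linearIndependent (m : ℕ) : LinearIndependent 𝕜 (blade 𝕜 (m := m)) := by
  let φ : Cl 𝕜 m →ₗ[𝕜] (Finset (Fin m) → 𝕜) :=
    (LinearMap.applyₗ (Pi.single ∅ 1)).comp (leftRep 𝕜 m).toLinearMap
  refine LinearIndependent.of_comp φ ?_
  have : φ ∘ blade 𝕜 = fun A => Pi.single A (1 : 𝕜) := funext fun A => leftRep_blade 𝕜 A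
  rw [this]
  exact Pi.linearIndependent_single_one _ _

lemma card_eq_finrank_Cl (m : ℕ) :
    Fintype.card (Finset (Fin m)) = Module.finrank 𝕜 (Cl 𝕜 m) := by
  let _ : Invertible (2 : 𝕜) := invertibleOfNonzero two_ne_zero
  rw [(CliffordAlgebra.equivExterior (negForm 𝕜 m)).finrank_eq,
    Module.finrank_eq_card_basis (Pi.basisFun 𝕜 (Fin m)).ExteriorAlgebra]

/-- The basis `(e_A)` of the Clifford algebra. -/
def bladeBasis (m : ℕ) : Module.Basis (Finset (Fin m)) 𝕜 (Cl 𝕜 m) :=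
  basisOfLinearIndependentOfCardEqFinrank (blade_linearIndependent 𝕜 m) (card_eq_finrank_Cl 𝕜 m)

lemma bladeBasis_apply {m : ℕ} (A : Finset (Fin m)) : bladeBasis 𝕜 m A = blade 𝕜 A := by
  simp [bladeBasis]

/-! ### Conjugation, scalar part and the inner product `[ā b]₀` -/

variable {𝕜}

/-- The conjugation `a ↦ ā`: the anti-automorphism with `ē_i = -e_i` (on the `e_A` this is `star`,
the composition of reversion and grade involution), conjugating the complex scalars. -/
def conjugate {m : ℕ} (a : Cl 𝕜 m) : Cl 𝕜 m :=
  ∑ A, starRingEnd 𝕜 ((bladeBasis 𝕜 m).repr a A) • star (blade 𝕜 A)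

/-- The scalar part `[a]₀`. -/
def scalarPart {m : ℕ} (a : Cl 𝕜 m) : 𝕜 := (bladeBasis 𝕜 m).repr a ∅

lemma repr_eq_leftRep {m : ℕ} (a : Cl 𝕜 m) (A : Finset (Fin m)) :
    (bladeBasis 𝕜 m).repr a A = leftRep 𝕜 m a (Pi.single ∅ 1) A := by
  conv_rhs => rw [← (bladeBasis 𝕜 m).sum_repr a]
  simp [bladeBasis_apply, leftRep_blade, Pi.single_apply, map_sum, LinearMap.sum_apply]

lemma leftGen_transpose {m : ℕ} (i : Fin m) (f g : Finset (Fin m) → 𝕜) :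
    ∑ A, leftGen 𝕜 i f A * g A = -∑ A, f A * leftGen 𝕜 i g A := by
  rw [← Finset.sum_neg_distrib]
  refine Fintype.sum_equiv (Function.Involutive.toPerm (fun A : Finset (Fin m) => A ∆ {i})
    (fun A => symmDiff_symmDiff_cancel_right _ _)) _ _ fun A => ?_
  change _ = -(f (A ∆ {i}) * leftGen 𝕜 i g (A ∆ {i}))
  simp only [leftGen_apply, symmDiff_symmDiff_cancel_right, sgn_symmDiff, tau, le_refl, if_true]
  ring

lemma leftRep_transpose {m : ℕ} (a : Cl 𝕜 m) (f g : Finset (Fin m) → 𝕜) :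
    ∑ A, leftRep 𝕜 m a f A * g A = ∑ A, f A * leftRep 𝕜 m (star a) g A := by
  induction a using CliffordAlgebra.induction generalizing f g with
  | algebraMap r => simp [Module.algebraMap_end_apply, mul_assoc, mul_left_comm]
  | ι v =>
    have h : leftRep 𝕜 m (ι (negForm 𝕜 m) v) = ∑ i, v i • leftGen 𝕜 i := by
      simp [leftRep, leftVec_apply]
    rw [star_ι, map_neg, h]
    simp only [LinearMap.neg_apply, LinearMap.sum_apply, LinearMap.smul_apply, Pi.neg_apply,
      Finset.sum_apply, Pi.smul_apply, smul_eq_mul, Finset.sum_mul, Finset.mul_sum, mul_neg,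
      Finset.sum_neg_distrib]
    rw [Finset.sum_comm, Finset.sum_comm (f := fun A i => f A * (v i * leftGen 𝕜 i g A)),
      ← Finset.sum_neg_distrib]
    refine Finset.sum_congr rfl fun i _ => ?_
    have := leftGen_transpose i f g
    simp only [mul_assoc, mul_left_comm (f _) (v i), ← Finset.mul_sum, this, mul_neg]
  | mul a b ha hb =>
    rw [map_mul, star_mul, map_mul]
    simp only [Module.End.mul_apply]
    rw [ha, hb]
  | add a b ha hb =>
    rw [map_add, star_add, map_add]
    simp only [LinearMap.add_apply, Pi.add_apply, add_mul, mul_add, Finset.sum_add_distrib, ha, hb]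

lemma scalarPart_star_blade_mul {m : ℕ} (A : Finset (Fin m)) (b : Cl 𝕜 m) :
    scalarPart (star (blade 𝕜 A) * b) = (bladeBasis 𝕜 m).repr b A := by
  have h := leftRep_transpose (blade 𝕜 A) (Pi.single ∅ 1) (leftRep 𝕜 m b (Pi.single ∅ 1))
  rw [leftRep_blade] at h
  simp only [Pi.single_apply, ite_mul, one_mul, zero_mul, Finset.sum_ite_eq', Finset.mem_univ,
    if_true] at h
  rw [scalarPart, repr_eq_leftRep, repr_eq_leftRep, map_mul, Module.End.mul_apply]
  convert h.symm using 3

lemma scalarPart_conjugate_mul {m : ℕ} (a b : Cl 𝕜 m) :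
    scalarPart (conjugate a * b) =
      ∑ A, starRingEnd 𝕜 ((bladeBasis 𝕜 m).repr a A) * (bladeBasis 𝕜 m).repr b A := by
  have h (A : Finset (Fin m)) : (bladeBasis 𝕜 m).repr (star (blade 𝕜 A) * b) ∅ =
      (bladeBasis 𝕜 m).repr b A := scalarPart_star_blade_mul A b
  simp [conjugate, scalarPart, Finset.sum_mul, h]

/-- The inner product `(a, b) ↦ [ā b]₀`. -/
abbrev innerCore (𝕜 : Type) [RCLike 𝕜] (m : ℕ) : InnerProductSpace.Core 𝕜 (Cl 𝕜 m) where
  inner a b := scalarPart (conjugate a * b)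
  conj_inner_symm a b := by
    simp [scalarPart_conjugate_mul, mul_comm]
  re_inner_nonneg a := by
    rw [scalarPart_conjugate_mul, map_sum]
    refine Finset.sum_nonneg fun A _ => ?_
    rw [RCLike.conj_mul]
    norm_cast
    positivity
  add_left a b c := by
    simp [scalarPart_conjugate_mul, add_mul, Finset.sum_add_distrib]
  smul_left a b r := by
    simp [scalarPart_conjugate_mul, Finset.mul_sum, mul_assoc]
  definite a h := by
    rw [scalarPart_conjugate_mul] at h
    simp only [RCLike.conj_mul] at h
    norm_cast at h
    rw [Finset.sum_eq_zero_iff_of_nonneg (fun A _ => by positivity)] at h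
    refine (bladeBasis 𝕜 m).ext_elem fun A => ?_
    simpa using h A (Finset.mem_univ A)

instance instNormedAddCommGroupCl (m : ℕ) : NormedAddCommGroup (Cl 𝕜 m) :=
  @InnerProductSpace.Core.toNormedAddCommGroup 𝕜 _ _ _ _ (innerCore 𝕜 m)

instance instInnerProductSpaceCl (m : ℕ) : InnerProductSpace 𝕜 (Cl 𝕜 m) :=
  InnerProductSpace.ofCore (innerCore 𝕜 m).toCore

instance instNormedSpaceRealCl (m : ℕ) : NormedSpace ℝ (Cl 𝕜 m) where
  norm_smul_le r a := by
    rw [← algebraMap_smul 𝕜 r a, norm_smul]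
    simp

lemma inner_Cl {m : ℕ} (a b : Cl 𝕜 m) : inner 𝕜 a b = scalarPart (conjugate a * b) := rfl

/-! ### Multivectors, inner and outer products, the Dirac operator -/

variable (𝕜) in
/-- The space of `s`-vectors. -/
def multivectors (m s : ℕ) : Submodule 𝕜 (Cl 𝕜 m) :=
  Submodule.span 𝕜 {a | ∃ A : Finset (Fin m), A.card = s ∧ a = blade 𝕜 A}

variable (𝕜) in
/-- The sum of the spaces of `s`-vectors over `s ∈ S`. -/
def multivectorsOf (m : ℕ) (S : Set ℕ) : Submodule 𝕜 (Cl 𝕜 m) :=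
  ⨆ s ∈ S, multivectors 𝕜 m s

/-- `u ∧ v = (uv + (-1)^s vu)/2` for an `s`-vector `v`, extended linearly: the grade involution
`involute` is multiplication by `(-1)^s` on `s`-vectors. -/
def outer {m : ℕ} (u v : Cl 𝕜 m) : Cl 𝕜 m := (1 / 2 : 𝕜) • (u * v + involute v * u)

/-- `u • v = (uv - (-1)^s vu)/2` for an `s`-vector `v`, extended linearly. -/
def contract {m : ℕ} (u v : Cl 𝕜 m) : Cl 𝕜 m := (1 / 2 : 𝕜) • (u * v - involute v * u)

/-- `ℝ^m` with its Euclidean norm. -/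
abbrev Euc (m : ℕ) : Type := EuclideanSpace ℝ (Fin m)

variable (𝕜) in
/-- The identification of `x ∈ ℝ^m` with `x₁e₁ + ⋯ + x_m e_m`. -/
def vec {m : ℕ} (x : Euc m) : Cl 𝕜 m := ∑ i, (x i : 𝕜) • gen 𝕜 i

/-- The Dirac operator `∂ = e₁∂_{x₁} + ⋯ + e_m∂_{x_m}`. -/
def dirac {m : ℕ} (f : Euc m → Cl 𝕜 m) (x : Euc m) : Cl 𝕜 m :=
  ∑ i, gen 𝕜 i * fderiv ℝ f x (EuclideanSpace.single i 1)

/-- `f` is continuously differentiable and satisfies `∂f = 0` in the (open) set `Ω`. -/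
def IsMonogenicOn {m : ℕ} (f : Euc m → Cl 𝕜 m) (Ω : Set (Euc m)) : Prop :=
  ContDiffOn ℝ 1 f Ω ∧ ∀ x ∈ Ω, dirac f x = 0

/-- Lebesgue measure on the open unit ball of `ℝ^m`. -/
def ballMeasure (m : ℕ) : Measure (Euc m) := volume.restrict (Metric.ball 0 1)

variable (𝕜) in
/-- The space `L²(B_m, Cl_m^S) ∩ Ker ∂` of square-integrable solutions on the unit ball of the
generalized Moisil–Théodoresco system, inside the Hilbert space `L²(B_m, Cl_m)` with inner product
`(f, g) = ∫_{B_m} [f̄ g]₀`. -/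
def gmtSpace (m : ℕ) (S : Set ℕ) : Submodule 𝕜 (Lp (Cl 𝕜 m) 2 (ballMeasure m)) where
  carrier := {u | ∃ f : Euc m → Cl 𝕜 m, IsMonogenicOn f (Metric.ball 0 1) ∧
    (∀ x ∈ Metric.ball (0 : Euc m) 1, f x ∈ multivectorsOf 𝕜 m S) ∧ u =ᵐ[ballMeasure m] f}
  zero_mem' := by
    refine ⟨0, ⟨contDiffOn_const, fun x _ => ?_⟩, fun x _ => Submodule.zero_mem _, Lp.coeFn_zero ..⟩
    simp [dirac]
  add_mem' := by
    rintro u v ⟨f, ⟨hf, hf0⟩, hfS, huf⟩ ⟨g, ⟨hg, hg0⟩, hgS, hvg⟩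
    refine ⟨f + g, ⟨hf.add hg, fun x hx => ?_⟩, fun x hx => Submodule.add_mem _ (hfS x hx) (hgS x hx),
      (Lp.coeFn_add u v).trans (huf.add hvg)⟩
    have hx' := Metric.isOpen_ball.mem_nhds hx
    have h1 := (hf.contDiffAt hx').differentiableAt one_ne_zero
    have h2 := (hg.contDiffAt hx').differentiableAt one_ne_zero
    have h3 := hf0 x hx
    have h4 := hg0 x hx
    unfold dirac at *
    simp only [fderiv_add h1 h2, add_apply, mul_add, Finset.sum_add_distrib, h3, h4, add_zero]
  smul_mem' := by
    rintro c u ⟨f, ⟨hf, hf0⟩, hfS, huf⟩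
    refine ⟨c • f, ⟨hf.const_smul c, fun x hx => ?_⟩, fun x hx => Submodule.smul_mem _ c (hfS x hx),
      (Lp.coeFn_smul c u).trans (huf.const_smul c)⟩
    have h1 := (hf.contDiffAt (Metric.isOpen_ball.mem_nhds hx)).differentiableAt one_ne_zero
    have h3 := hf0 x hx
    unfold dirac at *
    simp only [fderiv_const_smul h1, _root_.smul_apply, mul_smul_comm, ← Finset.smul_sum, h3, smul_zero]

/-- The functions `b i` are square-integrable on the unit ball and form an orthogonal basis of the
subspace `H` of `L²(B_m, Cl_m)`: they are nonzero and mutually orthogonal, and the closure of their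
linear span is `H`. -/
def IsOrthogonalBasis {m : ℕ} {I : Type} (b : I → Euc m → Cl 𝕜 m)
    (H : Submodule 𝕜 (Lp (Cl 𝕜 m) 2 (ballMeasure m))) : Prop :=
  ∃ hb : ∀ i, MemLp (b i) 2 (ballMeasure m),
    (∀ i, (hb i).toLp (b i) ≠ 0) ∧
    (∀ i j, i ≠ j → inner 𝕜 ((hb i).toLp (b i)) ((hb j).toLp (b j)) = 0) ∧
    (Submodule.span 𝕜 (Set.range fun i => (hb i).toLp (b i))).topologicalClosure = H

/-! ### Passing from dimension `r` to dimension `r + 1` -/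

/-- `x = (x̲, x_{r+1}) ↦ x̲`. -/
def pod {r : ℕ} (x : Euc (r + 1)) : Euc r := WithLp.toLp 2 fun i => x i.castSucc

variable (𝕜) in
/-- The inclusion `Cl_r ⊂ Cl_{r+1}` given by `e_i ↦ e_i` for `i ≤ r`. -/
def incl (r : ℕ) : Cl 𝕜 r →ₐ[𝕜] Cl 𝕜 (r + 1) :=
  CliffordAlgebra.map
    { toLinearMap := LinearMap.pi
        (Fin.snoc (α := fun _ => (Fin r → 𝕜) →ₗ[𝕜] 𝕜) (fun i : Fin r => LinearMap.proj i) 0)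
      map_app' := fun v => by simp [negForm_apply, Fin.sum_univ_castSucc] }

lemma incl_gen {r : ℕ} (i : Fin r) : incl 𝕜 r (gen 𝕜 i) = gen 𝕜 i.castSucc := by
  rw [incl, gen, CliffordAlgebra.map_apply_ι, gen]
  congr 1
  funext j
  change LinearMap.pi (Fin.snoc (α := fun _ => (Fin r → 𝕜) →ₗ[𝕜] 𝕜)
    (fun i : Fin r => LinearMap.proj i) 0) (Pi.single i 1) j = _
  refine Fin.lastCases ?_ (fun j => ?_) j
  · simp [(Fin.castSucc_lt_last i).ne']
  · simp [Pi.single_apply]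

/-- The rising factorial `(a)_n = a (a + 1) ⋯ (a + n - 1)`. -/
def rising (a : ℝ) (n : ℕ) : ℝ := (ascPochhammer ℝ n).eval a

/-- The Gegenbauer polynomial `C_n^ν`. -/
def gegenbauer (ν : ℝ) (n : ℕ) (z : ℝ) : ℝ :=
  ∑ i ∈ Finset.range (n / 2 + 1),
    (-1) ^ i * rising ν (n - i) / (i.factorial * (n - 2 * i).factorial) * (2 * z) ^ (n - 2 * i)

/-- The polynomial `F^{(n)}_{M,j}` on `ℝ^M`, `M = r + 1`. (Where `‖x‖ = 0`, the formula has the value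
of the polynomial, which is `1` if `n = 0` and `0` otherwise.) -/
def harmonicFactor {r : ℕ} (n j : ℕ) (x : Euc (r + 1)) : ℝ :=
  let M : ℝ := (r + 1 : ℕ)
  rising (j + 1) n / rising (M - 2 + 2 * j) n *
    (‖x‖ ^ n * gegenbauer (M / 2 + j - 1) n (x (Fin.last r) / ‖x‖))

variable (𝕜) in
/-- The polynomial `X^{(n)}_{M,j} = F^{(n)}_{M,j} + (j+1)/(M+2j-1) F^{(n-1)}_{M,j+1} x̲ e_M` on `ℝ^M`,
`M = r + 1`, with `F^{(-1)} = 0`. -/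
def monogenicFactor {r : ℕ} (n j : ℕ) (x : Euc (r + 1)) : Cl 𝕜 (r + 1) :=
  let M : ℝ := (r + 1 : ℕ)
  algebraMap 𝕜 _ (harmonicFactor n j x : 𝕜) +
    (((j + 1) / (M + 2 * j - 1) * (if 1 ≤ n then harmonicFactor (n - 1) (j + 1) x else 0) : ℝ) : 𝕜) •
      (incl 𝕜 r (vec 𝕜 (pod x)) * gen 𝕜 (Fin.last r))

/-- The embedding factor `X^{s,t,M}_{k,j}`, `M = r + 1`, applied to a `Cl_r`-valued function `P` on
`ℝ^r`; used for `s ∈ {t, t + 1}` and `j ≤ k` only. -/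
def embeddingFactor {r : ℕ} (s t k j : ℕ) (P : Euc r → Cl 𝕜 r) (x : Euc (r + 1)) : Cl 𝕜 (r + 1) :=
  let M : ℝ := (r + 1 : ℕ)
  let e : Cl 𝕜 (r + 1) := gen 𝕜 (Fin.last r)
  let y : Cl 𝕜 (r + 1) := incl 𝕜 r (vec 𝕜 (pod x))
  let p : Cl 𝕜 (r + 1) := incl 𝕜 r (P (pod x))
  let β : ℝ := -(j + M - 1 - t) / (j + t)
  let α : ℝ := if t = 0 ∨ t = r then 0 else -(j + 1) / (M + 2 * j - 1)
  monogenicFactor 𝕜 (k - j) j x * (e ^ (s - t) * p) +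
    (α : 𝕜) • ((if j < k then monogenicFactor 𝕜 (k - 1 - j) (j + 1) x else 0) *
      (((β ^ ((t : ℤ) - s) : ℝ) : 𝕜) • outer y (e ^ (s - t + 1) * p) +
        ((β ^ ((t : ℤ) - s + 1) : ℝ) : 𝕜) • contract y (e ^ (s - t + 1) * p)))

/-! ### The Gelfand–Tsetlin polynomials -/

/-- The set `N^{s,M}_k` of pairs `(t, j)` that occur in the branching of the `k`-homogeneous monogenic
`s`-vector valued polynomials on `ℝ^M`. These vanish if `s ∈ {0, M}` and `k ≥ 1`, and the set is empty
then. -/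
def branching (M s k : ℕ) : Set (ℕ × ℕ) :=
  {p | (s = 0 ∨ s = M → k = 0) ∧ p.1 + 1 ≤ M ∧ p.2 ≤ k ∧ (p.1 + 1 = s ∨ p.1 = s) ∧
    (p.1 = 0 ∨ p.1 + 1 = M → p.2 = 0)}

/-- `GTIndex m s k` is the set `I^{s,m}_k` of pairs `(ν, μ)`, `ν = (s_{m-1}, …, s₃, t₂)`,
`μ = (k_{m-1}, …, k₂)`: it starts with `(t₂, k₂) ∈ {(0,0), (2,0)} ∪ {(±1, k)}`, and
`(s_{r-1}, k_{r-1}) ∈ N^{s_r,r}_{k_r}` for `3 ≤ r ≤ m`, where `s₂ = |t₂|`, `s_m = s`, `k_m = k`. -/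
inductive GTIndex : ℕ → ℕ → ℕ → Type
  /-- `(t₂, k₂) = (0, 0)` -/
  | scalar : GTIndex 2 0 0
  /-- `(t₂, k₂) = (2, 0)` -/
  | bivector : GTIndex 2 2 0
  /-- `(t₂, k₂) = (1, k)` if `positive` is true and `(-1, k)` otherwise -/
  | vector (positive : Bool) (k : ℕ) : GTIndex 2 1 k
  /-- prepending `(s_{r-1}, k_{r-1}) = (t, j)` to a sequence for dimension `r - 1` -/
  | step {r s k t j : ℕ} (h : (t, j) ∈ branching (r + 1) s k) (i : GTIndex r t j) :
      GTIndex (r + 1) s k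

variable (𝕜) in
/-- The real case in dimension two: `f_k^{±1} = (x₁ - e₁₂ x₂)^k e^{1,±1}`, `e^{1,1} = e₁`,
`e^{1,-1} = e₂`. -/
def planarReal (positive : Bool) (k : ℕ) (x : Euc 2) : Cl 𝕜 2 :=
  (algebraMap 𝕜 _ (x 0 : 𝕜) - (x 1 : 𝕜) • (gen 𝕜 0 * gen 𝕜 1)) ^ k *
    (if positive then gen 𝕜 0 else gen 𝕜 1)

/-- The complex case in dimension two: `f_k^{±1} = (x₁ ∓ i x₂)^k (e₁ ∓ i e₂)`. -/
def planarComplex (positive : Bool) (k : ℕ) (x : Euc 2) : Cl ℂ 2 :=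
  let c : ℂ := if positive then -Complex.I else Complex.I
  ((x 0 : ℂ) + c * (x 1 : ℂ)) ^ k • (gen ℂ 0 + c • gen ℂ 1)

/-- The polynomial `f^{s,ν}_{k,μ}` on `ℝ^m`, starting from the planar polynomials `b`. -/
def gtPoly (b : Bool → ℕ → Euc 2 → Cl 𝕜 2) :
    {m s k : ℕ} → GTIndex m s k → Euc m → Cl 𝕜 m
  | _, _, _, .scalar => fun _ => 1
  | _, _, _, .bivector => fun _ => gen 𝕜 1 * gen 𝕜 0
  | _, _, _, .vector positive k => b positive k
  | _, s, k, .step (t := t) (j := j) _ i => embeddingFactor s t k j (gtPoly b i)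

/-! ### The basis of the generalized Moisil–Théodoresco system -/

/-- `S' = {s : s ± 1 ∈ S}`. -/
def between (S : Set ℕ) : Set ℕ := {s | 1 ≤ s ∧ s - 1 ∈ S ∧ s + 1 ∈ S}

/-- The indices of the two families: `s ∈ S`, `k ≥ 0`, `(ν, μ) ∈ I^{s,m}_k`, and `s ∈ S'`, `k ≥ 0`,
`(ν, μ) ∈ I^{s,m}_k` (here `k` is the degree of the factor `f^{s,ν}_{k,μ}`, which is one less than the
degree of the basis element). -/
abbrev GMTIndex (m : ℕ) (S : Set ℕ) : Type :=
  (Σ s : S, Σ k : ℕ, GTIndex m s k) ⊕ (Σ s : between S, Σ k : ℕ, GTIndex m s k)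

/-- The polynomials `f^{s,ν}_{k,μ}` for `s ∈ S` and `((x ∧) + β (x •)) f^{s,ν}_{k,μ}` for `s ∈ S'`, where
`β = -(k + m - s)/(k + s)`. -/
def gmtFamily (b : Bool → ℕ → Euc 2 → Cl 𝕜 2) (m : ℕ) (S : Set ℕ) :
    GMTIndex m S → Euc m → Cl 𝕜 m
  | .inl ⟨_, _, i⟩ => gtPoly b i
  | .inr ⟨s, k, i⟩ => fun x =>
      outer (vec 𝕜 x) (gtPoly b i x) +
        ((-((k : ℝ) + m - (s : ℕ)) / (k + (s : ℕ)) : ℝ) : 𝕜) • contract (vec 𝕜 x) (gtPoly b i x)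

end GMT

end

open scoped ContDiff

noncomputable section

namespace GMT

variable {𝕜 : Type} [RCLike 𝕜] {m n r : ℕ}

/-! ### Coordinates in the Clifford algebra -/

/-! The Dirac operator splits as `∂ = ∂∧ + ∂•` (`dw`, `dc`), one part raising the grade and the
other lowering it. A field with values in a single grade is monogenic exactly when both parts
annihilate it. On homogeneous monogenic fields the anticommutators of `∂∧` with `x•` and of `∂•`
with `x∧` are scalars given by degree and grade (`dw_xDot`, `dc_xWedge`), and most of the algebra
rests on these two scalars.

Spanning. Let `P` be a homogeneous solution with grades in `S`. The `s`-component of `∂∧P = -∂•P`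
comes from the `(s-1)`-component of `P` and equally from its `(s+1)`-component, so it vanishes
unless `s ∈ S'`, and it is monogenic. The operator `x∧ + βx•` inverts both parts of `∂` on it up to
a scalar. Subtracting these images leaves a field all of whose components are monogenic
(`HomSolution.mem_of_mem`). Homogeneous monogenic `s`-vector fields are then treated by induction on
the dimension: the last nonvanishing derivative in the last variable is a field in the remaining
variables and splits into monogenic fields of grades `s` and `s - 1`. The embedding factors are
Appell sequences in the last variable, so a field with any such derivative is available and can be
subtracted (`HomMonogenic.mem_of_embeddings`). In the plane the fields are explicit powers.

Orthogonality. On the ball the adjoint of `∂∧` acting on homogeneous fields is `∂•` up to a boundary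
term, which homogeneity rewrites as a ball integral (`ip_dw`, `ip_dc`). Hence monogenic fields of
equal grade and different degree are orthogonal, and the products of `x∧p, x∧q` and of `x•p, x•q`
are multiples of that of `p, q`. An embedded field is a combination of `p`, `x̲∧p`, `x̲•p` and
`x̲∧(x̲•p)` with coefficients depending only on `x_{r+1}` and `|x̲|` (`exists_form_same`,
`exists_form_succ`). Fubini and polar coordinates therefore carry orthogonality from dimension `r`
to `r + 1`.

Completeness. Let `f` be a square-integrable solution orthogonal to all polynomial solutions. The
Fischer decomposition `Q = π_S(xR) + M`, with `M` a solution, and the divergence theorem with weight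
`1 - |x|²` give recurrences between the moments of `f` against `|x|^{2i}Q`; all of them vanish
(`IsHom.moment_eq_zero`), and Stone–Weierstrass gives `f = 0`. The weight vanishes on the sphere, so
no boundary values of `f` are needed.

Closedness. Solutions are harmonic, so the mean value property bounds values and first derivatives
inside the ball by the `L²` norm; `L²` limits of polynomial solutions are again C¹ solutions
(`topologicalClosure_smoothSolutions_le`). Projecting a solution orthogonally onto the closed span
leaves a remainder that is a solution orthogonal to every polynomial solution, hence zero. -/

/-- The coefficient of `e_A` in `a`. -/
abbrev coord (A : Finset (Fin m)) : Cl 𝕜 m →ₗ[𝕜] 𝕜 := (bladeBasis 𝕜 m).coord A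

lemma coord_ext {a b : Cl 𝕜 m} (h : ∀ A, coord A a = coord A b) : a = b :=
  (bladeBasis 𝕜 m).ext_elem h

lemma coord_blade (A B : Finset (Fin m)) :
    coord A (blade 𝕜 B) = if B = A then 1 else 0 := by
  rw [← bladeBasis_apply, Module.Basis.coord_apply, Module.Basis.repr_self, Finsupp.single_apply]

lemma coord_gen_mul (i : Fin m) (a : Cl 𝕜 m) (A : Finset (Fin m)) :
    coord A (gen 𝕜 i * a) = sgn 𝕜 i (A ∆ {i}) * coord (A ∆ {i}) a := by
  simp only [Module.Basis.coord_apply]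
  rw [repr_eq_leftRep, map_mul, Module.End.mul_apply, leftRep_gen, leftGen_apply,
    ← repr_eq_leftRep]

lemma inner_eq_sum_coord (a b : Cl 𝕜 m) :
    inner 𝕜 a b = ∑ A, starRingEnd 𝕜 (coord A a) * coord A b := by
  rw [inner_Cl, scalarPart_conjugate_mul]; rfl

lemma conj_sgn (i : Fin m) (A : Finset (Fin m)) : starRingEnd 𝕜 (sgn 𝕜 i A) = sgn 𝕜 i A := by
  rw [sgn, map_prod]
  refine Finset.prod_congr rfl fun b _ => ?_
  unfold tau; split_ifs <;> simp

lemma sgn_symmDiff_self (i : Fin m) (A : Finset (Fin m)) :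
    sgn 𝕜 i (A ∆ {i}) = -sgn 𝕜 i A := by
  rw [sgn_symmDiff]; simp [tau]

lemma gen_mul_gen_add (i j : Fin m) :
    gen 𝕜 i * gen 𝕜 j + gen 𝕜 j * gen 𝕜 i = if i = j then -2 else 0 := by
  rw [gen, gen, CliffordAlgebra.ι_mul_ι_add_swap]
  have h : QuadraticMap.polar (negForm 𝕜 m) (Pi.single i 1) (Pi.single j 1) =
      if i = j then -2 else 0 := by
    rw [QuadraticMap.polar, negForm_apply, negForm_apply, negForm_apply]
    simp only [Pi.add_apply, ← pow_two, Pi.single_apply]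
    have e (x : Fin m) : ((if x = i then (1 : 𝕜) else 0) + if x = j then 1 else 0) ^ 2 =
        (if x = i then 1 else 0) + (if x = j then 1 else 0) +
          (if x = i then if x = j then 2 else 0 else 0) := by
      split_ifs <;> norm_num
    simp only [e, Finset.sum_add_distrib, Finset.sum_ite_eq', Finset.mem_univ, if_true, ite_pow,
      one_pow, zero_pow (two_ne_zero)]
    split_ifs <;> norm_num
  rw [h]
  split_ifs
  · rw [map_neg, map_ofNat]
  · simp

lemma gen_mul_self (i : Fin m) : gen 𝕜 i * gen 𝕜 i = -1 := by
  have h := gen_mul_gen_add (𝕜 := 𝕜) i i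
  rw [if_pos rfl, ← two_smul 𝕜, show (-2 : Cl 𝕜 m) = (2 : 𝕜) • (-1) by
    rw [smul_neg, two_smul]; norm_num] at h
  exact smul_right_injective _ (two_ne_zero (α := 𝕜)) h

lemma gen_mul_gen_of_ne {i j : Fin m} (h : i ≠ j) :
    gen 𝕜 i * gen 𝕜 j = -(gen 𝕜 j * gen 𝕜 i) := by
  rw [eq_neg_iff_add_eq_zero, gen_mul_gen_add, if_neg h]

lemma involute_gen (i : Fin m) : involute (gen 𝕜 i) = -gen 𝕜 i := involute_ι _

/-- The sign of the grade involution cancels the sign from moving `e_i` past each factor different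
from it. A factor equal to `e_i` commutes instead, and in a list without repetitions there is at
most one. -/
lemma involute_prod_mul_gen (i : Fin m) (l : List (Fin m)) (hl : l.Nodup) :
    involute (l.map (gen 𝕜)).prod * gen 𝕜 i =
      (if i ∈ l then -1 else 1 : 𝕜) • (gen 𝕜 i * (l.map (gen 𝕜)).prod) := by
  induction l with
  | nil => simp
  | cons a l ih =>
    rw [List.nodup_cons] at hl
    rw [List.map_cons, List.prod_cons, map_mul, mul_assoc, ih hl.2, involute_gen, mul_smul_comm,
      neg_mul, ← mul_assoc, ← mul_assoc]
    by_cases h : i = a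
    · subst h; simp [hl.1]
    · rw [gen_mul_gen_of_ne (Ne.symm h)]
      simp [h]

lemma involute_blade_mul_gen (i : Fin m) (A : Finset (Fin m)) :
    involute (blade 𝕜 A) * gen 𝕜 i = (if i ∈ A then -1 else 1 : 𝕜) • (gen 𝕜 i * blade 𝕜 A) := by
  rw [blade, involute_prod_mul_gen i _ (Finset.sort_nodup _ _)]
  simp

/-! ### Outer and inner multiplication as linear maps -/

/-- `v ↦ u ∧ v` -/
def outerL (u : Cl 𝕜 m) : Cl 𝕜 m →ₗ[𝕜] Cl 𝕜 m :=
  (1 / 2 : 𝕜) • (LinearMap.mulLeft 𝕜 u + (LinearMap.mulRight 𝕜 u).comp involute.toLinearMap)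

/-- `v ↦ u • v` -/
def contractL (u : Cl 𝕜 m) : Cl 𝕜 m →ₗ[𝕜] Cl 𝕜 m :=
  (1 / 2 : 𝕜) • (LinearMap.mulLeft 𝕜 u - (LinearMap.mulRight 𝕜 u).comp involute.toLinearMap)

lemma outerL_apply (u v : Cl 𝕜 m) : outerL u v = outer u v := rfl

lemma contractL_apply (u v : Cl 𝕜 m) : contractL u v = contract u v := rfl

lemma outer_add_contract (u v : Cl 𝕜 m) : outer u v + contract u v = u * v := by
  rw [outer, contract, ← smul_add]
  rw [show u * v + involute v * u + (u * v - involute v * u) = (2 : 𝕜) • (u * v) by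
    rw [two_smul]; abel, smul_smul]
  norm_num

/-- `v ↦ e_i ∧ v` -/
abbrev wedge (i : Fin m) : Cl 𝕜 m →ₗ[𝕜] Cl 𝕜 m := outerL (gen 𝕜 i)

/-- `v ↦ e_i • v` -/
abbrev dot (i : Fin m) : Cl 𝕜 m →ₗ[𝕜] Cl 𝕜 m := contractL (gen 𝕜 i)

lemma wedge_add_dot (i : Fin m) (a : Cl 𝕜 m) : wedge i a + dot i a = gen 𝕜 i * a :=
  outer_add_contract _ _

lemma wedge_blade (i : Fin m) (A : Finset (Fin m)) :
    wedge i (blade 𝕜 A) = if i ∈ A then 0 else gen 𝕜 i * blade 𝕜 A := by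
  rw [outerL_apply, outer, involute_blade_mul_gen]
  split_ifs
  · simp
  · rw [one_smul, ← two_smul 𝕜, smul_smul]; norm_num

lemma mem_symmDiff_singleton_self (i : Fin m) (A : Finset (Fin m)) : i ∈ A ∆ {i} ↔ i ∉ A := by
  simp [Finset.mem_symmDiff]

/-- In coordinates `e_i ∧` is the part of left multiplication by `e_i` that enlarges the index set,
and `e_i •` the part that shrinks it. The identities below thereby become sign checks. -/
lemma coord_wedge (i : Fin m) (a : Cl 𝕜 m) (A : Finset (Fin m)) :
    coord A (wedge i a) = if i ∈ A then sgn 𝕜 i (A ∆ {i}) * coord (A ∆ {i}) a else 0 := by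
  have : (coord A).comp (wedge i) =
      (if i ∈ A then sgn 𝕜 i (A ∆ {i}) • coord (𝕜 := 𝕜) (A ∆ {i}) else 0) := by
    refine (bladeBasis 𝕜 m).ext fun B => ?_
    rw [bladeBasis_apply, LinearMap.comp_apply, wedge_blade]
    by_cases hB : i ∈ B
    · rw [if_pos hB, map_zero]
      split_ifs with hA
      · rw [LinearMap.smul_apply, coord_blade, if_neg, smul_zero]
        rintro rfl
        exact (mem_symmDiff_singleton_self i A).1 hB hA
      · rfl
    · rw [if_neg hB, coord_gen_mul]
      split_ifs with hA
      · rfl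
      · rw [coord_blade, if_neg, mul_zero]; · rfl
        rintro rfl
        exact hB ((mem_symmDiff_singleton_self i A).2 hA)
  have h := LinearMap.congr_fun this a
  rw [LinearMap.comp_apply] at h
  rw [h]; split_ifs <;> rfl

lemma coord_dot (i : Fin m) (a : Cl 𝕜 m) (A : Finset (Fin m)) :
    coord A (dot i a) = if i ∈ A then 0 else sgn 𝕜 i (A ∆ {i}) * coord (A ∆ {i}) a := by
  have h := congrArg (coord A) (wedge_add_dot i a)
  rw [map_add, coord_gen_mul, coord_wedge] at h
  split_ifs at h ⊢ with hA
  · simpa using h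
  · simpa using h

/-- The substitution `A ↦ A ∆ {i}` exchanges sets with and without `i` and reverses `sgn`. This skew
adjointness is what integration by parts uses. -/
lemma inner_wedge_left (i : Fin m) (a b : Cl 𝕜 m) :
    inner 𝕜 (wedge i a) b = -inner 𝕜 a (dot i b) := by
  simp only [inner_eq_sum_coord, coord_wedge, coord_dot]
  rw [← Finset.sum_neg_distrib]
  refine Fintype.sum_equiv (Function.Involutive.toPerm (fun A : Finset (Fin m) => A ∆ {i})
    (fun A => symmDiff_symmDiff_cancel_right _ _)) _ _ fun A => ?_
  change _ = -(starRingEnd 𝕜 (coord (A ∆ {i}) a) * (if i ∈ A ∆ {i} then 0 else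
    sgn 𝕜 i (A ∆ {i} ∆ {i}) * coord (A ∆ {i} ∆ {i}) b))
  simp only [symmDiff_symmDiff_cancel_right, mem_symmDiff_singleton_self]
  by_cases h : i ∈ A
  · simp only [h, if_true, not_true_eq_false, if_false, map_mul, conj_sgn,
      sgn_symmDiff_self, map_neg]
    ring
  · simp [h]

lemma inner_dot_left (i : Fin m) (a b : Cl 𝕜 m) :
    inner 𝕜 (dot i a) b = -inner 𝕜 a (wedge i b) := by
  rw [← inner_conj_symm, eq_neg_iff_add_eq_zero, ← inner_conj_symm a, inner_wedge_left]
  simp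

lemma inner_gen_mul_left (i : Fin m) (a b : Cl 𝕜 m) :
    inner 𝕜 (gen 𝕜 i * a) b = -inner 𝕜 a (gen 𝕜 i * b) := by
  rw [← wedge_add_dot, ← wedge_add_dot, inner_add_left, inner_add_right, inner_wedge_left,
    inner_dot_left]
  ring

/-- Each `i ∈ A` contributes `-1` and the other indices contribute nothing, so the sum counts the
grade. -/
lemma sum_wedge_dot_coord (a : Cl 𝕜 m) (A : Finset (Fin m)) :
    coord A (∑ i, wedge i (dot i a)) = -(A.card : 𝕜) * coord A a := by
  rw [map_sum]
  have h (i : Fin m) : coord A (wedge i (dot i a)) = if i ∈ A then -coord A a else 0 := by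
    simp only [coord_wedge, coord_dot, symmDiff_symmDiff_cancel_right,
      mem_symmDiff_singleton_self, sgn_symmDiff_self]
    by_cases hA : i ∈ A
    · have := sgn_mul_self 𝕜 i A
      simp only [hA, if_true, not_true_eq_false, if_false]
      linear_combination (-coord A a) * this
    · simp [hA]
  simp only [h]
  rw [← Finset.sum_filter]
  simp

/-! ### Multivectors -/

lemma mem_multivectorsOf {S : Set ℕ} {a : Cl 𝕜 m} :
    a ∈ multivectorsOf 𝕜 m S ↔ ∀ A : Finset (Fin m), A.card ∉ S → coord A a = 0 := by
  constructor
  · intro h A hA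
    have : multivectorsOf 𝕜 m S ≤ LinearMap.ker (coord (𝕜 := 𝕜) A) := by
      refine iSup₂_le fun s hs => Submodule.span_le.2 ?_
      rintro _ ⟨B, hB, rfl⟩
      rw [SetLike.mem_coe, LinearMap.mem_ker, coord_blade, if_neg]
      rintro rfl
      exact hA (hB ▸ hs)
    exact this h
  · intro h
    rw [← (bladeBasis 𝕜 m).sum_repr a]
    refine Submodule.sum_mem _ fun A _ => ?_
    by_cases hA : A.card ∈ S
    · refine Submodule.smul_mem _ _ (Submodule.mem_iSup_of_mem A.card (Submodule.mem_iSup_of_mem hA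
        (Submodule.subset_span ⟨A, rfl, bladeBasis_apply ..⟩)))
    · rw [show (bladeBasis 𝕜 m).repr a A = 0 from h A hA, zero_smul]
      exact Submodule.zero_mem _

lemma multivectorsOf_singleton (s : ℕ) : multivectorsOf 𝕜 m {s} = multivectors 𝕜 m s := by
  simp [multivectorsOf]

lemma mem_multivectors {s : ℕ} {a : Cl 𝕜 m} :
    a ∈ multivectors 𝕜 m s ↔ ∀ A : Finset (Fin m), A.card ≠ s → coord A a = 0 := by
  rw [← multivectorsOf_singleton, mem_multivectorsOf]; simp

lemma multivectors_le_multivectorsOf {S : Set ℕ} {s : ℕ} (hs : s ∈ S) :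
    multivectors 𝕜 m s ≤ multivectorsOf 𝕜 m S :=
  le_iSup₂_of_le s hs le_rfl

lemma multivectors_eq_bot {s : ℕ} (hs : m < s) {a : Cl 𝕜 m} (ha : a ∈ multivectors 𝕜 m s) :
    a = 0 := by
  refine coord_ext fun A => ?_
  rw [mem_multivectors.1 ha A, map_zero]
  have := A.card_le_univ
  rw [Fintype.card_fin] at this
  omega

lemma card_symmDiff_singleton (i : Fin m) (A : Finset (Fin m)) :
    (A ∆ {i}).card = if i ∈ A then A.card - 1 else A.card + 1 := by
  split_ifs with h
  · rw [symmDiff_singleton_of_mem h, Finset.card_erase_of_mem h]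
  · rw [symmDiff_singleton_of_notMem h, Finset.card_insert_of_notMem h]

lemma wedge_mem {s : ℕ} (i : Fin m) {a : Cl 𝕜 m} (ha : a ∈ multivectors 𝕜 m s) :
    wedge i a ∈ multivectors 𝕜 m (s + 1) := by
  rw [mem_multivectors] at ha ⊢
  intro A hA
  rw [coord_wedge]
  split_ifs with h
  · rw [ha _, mul_zero]
    rw [card_symmDiff_singleton, if_pos h]
    have := Finset.card_pos.2 ⟨i, h⟩
    omega
  · rfl

lemma dot_mem {s : ℕ} (i : Fin m) {a : Cl 𝕜 m} (ha : a ∈ multivectors 𝕜 m (s + 1)) :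
    dot i a ∈ multivectors 𝕜 m s := by
  rw [mem_multivectors] at ha ⊢
  intro A hA
  rw [coord_dot]
  split_ifs with h
  · rfl
  · rw [ha _, mul_zero]
    rw [card_symmDiff_singleton, if_neg h]
    omega

lemma dot_scalar (i : Fin m) {a : Cl 𝕜 m} (ha : a ∈ multivectors 𝕜 m 0) : dot i a = 0 := by
  rw [mem_multivectors] at ha
  refine coord_ext fun A => ?_
  rw [coord_dot, map_zero]
  split_ifs with h
  · rfl
  · rw [ha _, mul_zero]
    rw [card_symmDiff_singleton, if_neg h]
    omega

lemma sum_wedge_dot {s : ℕ} {a : Cl 𝕜 m} (ha : a ∈ multivectors 𝕜 m s) :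
    ∑ i, wedge i (dot i a) = -((s : 𝕜) • a) := by
  refine coord_ext fun A => ?_
  rw [sum_wedge_dot_coord, map_neg, map_smul, smul_eq_mul]
  by_cases h : A.card = s
  · rw [h, neg_mul]
  · rw [mem_multivectors.1 ha A h]; simp

lemma inner_eq_zero_of_grade_ne {s t : ℕ} (h : s ≠ t) {a b : Cl 𝕜 m}
    (ha : a ∈ multivectors 𝕜 m s) (hb : b ∈ multivectors 𝕜 m t) : inner 𝕜 a b = 0 := by
  rw [inner_eq_sum_coord]
  refine Finset.sum_eq_zero fun A _ => ?_
  by_cases hA : A.card = s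
  · rw [mem_multivectors.1 hb A (hA ▸ h), mul_zero]
  · rw [mem_multivectors.1 ha A hA, map_zero, zero_mul]

/-- The projection onto the sum of the spaces of `s`-vectors, `s ∈ S`. -/
def gradeProj (S : Set ℕ) : Cl 𝕜 m →ₗ[𝕜] Cl 𝕜 m :=
  open Classical in
  (bladeBasis 𝕜 m).constr 𝕜 fun A => if A.card ∈ S then blade 𝕜 A else 0

open Classical in
lemma coord_gradeProj (S : Set ℕ) (a : Cl 𝕜 m) (A : Finset (Fin m)) :
    coord A (gradeProj S a) = if A.card ∈ S then coord A a else 0 := by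
  have : (coord A).comp (gradeProj S) = if A.card ∈ S then coord (𝕜 := 𝕜) A else 0 := by
    refine (bladeBasis 𝕜 m).ext fun B => ?_
    rw [LinearMap.comp_apply, gradeProj, Module.Basis.constr_basis, bladeBasis_apply]
    by_cases hAB : B = A
    · subst hAB; split_ifs <;> simp
    · have hc : coord A (blade 𝕜 B) = 0 := by rw [coord_blade, if_neg hAB]
      split_ifs <;> simp only [hc, map_zero, LinearMap.zero_apply]
  have h := LinearMap.congr_fun this a
  rw [LinearMap.comp_apply] at h
  rw [h]; split_ifs <;> rfl

lemma gradeProj_mem (S : Set ℕ) (a : Cl 𝕜 m) : gradeProj S a ∈ multivectorsOf 𝕜 m S := by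
  classical
  rw [mem_multivectorsOf]
  intro A hA
  rw [coord_gradeProj, if_neg hA]

lemma gradeProj_singleton_mem (s : ℕ) (a : Cl 𝕜 m) : gradeProj {s} a ∈ multivectors 𝕜 m s := by
  rw [← multivectorsOf_singleton]
  exact gradeProj_mem _ _

lemma gradeProj_of_mem {S : Set ℕ} {a : Cl 𝕜 m} (ha : a ∈ multivectorsOf 𝕜 m S) :
    gradeProj S a = a := by
  classical
  refine coord_ext fun A => ?_
  rw [coord_gradeProj]
  split_ifs with h
  · rfl
  · rw [mem_multivectorsOf.1 ha A h]

lemma inner_gradeProj_left (S : Set ℕ) (a b : Cl 𝕜 m) :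
    inner 𝕜 (gradeProj S a) b = inner 𝕜 a (gradeProj S b) := by
  classical
  simp only [inner_eq_sum_coord, coord_gradeProj]
  refine Finset.sum_congr rfl fun A _ => ?_
  split_ifs <;> simp

lemma sum_gradeProj (a : Cl 𝕜 m) : ∑ s ∈ Finset.range (m + 1), gradeProj {s} a = a := by
  classical
  refine coord_ext fun A => ?_
  rw [map_sum]
  simp only [coord_gradeProj, Set.mem_singleton_iff]
  rw [Finset.sum_ite_eq, if_pos]
  have := A.card_le_univ
  rw [Fintype.card_fin] at this
  rw [Finset.mem_range]; omega

lemma gradeProj_wedge (s : ℕ) (i : Fin m) (a : Cl 𝕜 m) :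
    gradeProj {s + 1} (wedge i a) = wedge i (gradeProj {s} a) := by
  classical
  refine coord_ext fun A => ?_
  simp only [coord_gradeProj, coord_wedge, card_symmDiff_singleton, Set.mem_singleton_iff]
  by_cases h : i ∈ A
  · have := Finset.card_pos.2 ⟨i, h⟩
    simp only [h, if_true]
    by_cases h' : A.card = s + 1
    · rw [if_pos h', if_pos (by omega)]
    · rw [if_neg h', if_neg (by omega), mul_zero]
  · simp [h]

lemma gradeProj_dot (s : ℕ) (i : Fin m) (a : Cl 𝕜 m) :
    gradeProj {s} (dot i a) = dot i (gradeProj {s + 1} a) := by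
  classical
  refine coord_ext fun A => ?_
  simp only [coord_gradeProj, coord_dot, card_symmDiff_singleton, Set.mem_singleton_iff]
  by_cases h : i ∈ A
  · simp [h]
  · simp only [h, if_false]
    by_cases h' : A.card = s
    · rw [if_pos h', if_pos (by omega)]
    · rw [if_neg h', if_neg (by omega), mul_zero]

lemma gradeProj_zero_wedge (i : Fin m) (a : Cl 𝕜 m) : gradeProj {0} (wedge i a) = 0 := by
  classical
  refine coord_ext fun A => ?_
  simp only [coord_gradeProj, coord_wedge, Set.mem_singleton_iff, map_zero]
  by_cases h : A.card = 0
  · rw [Finset.card_eq_zero] at h; subst h; simp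
  · rw [if_neg h]

/-! ### Anticommutation relations -/

lemma wedge_wedge (i j : Fin m) (a : Cl 𝕜 m) : wedge i (wedge j a) = -wedge j (wedge i a) := by
  refine coord_ext fun A => ?_
  rw [map_neg]
  by_cases hij : i = j
  · subst hij
    simp only [coord_wedge, mem_symmDiff_singleton_self]
    split_ifs <;> simp
  · have h1 : j ∈ A ∆ {i} ↔ j ∈ A := by simp [Finset.mem_symmDiff, Ne.symm hij]
    have h2 : i ∈ A ∆ {j} ↔ i ∈ A := by simp [Finset.mem_symmDiff, hij]
    simp only [coord_wedge, h1, h2, sgn_symmDiff]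
    rw [symmDiff_right_comm A {j} {i}]
    -- Of two distinct indices exactly one precedes the other, so the two transposition signs are
    -- opposite.
    have : tau 𝕜 i j + tau 𝕜 j i = 0 := by
      rcases lt_or_gt_of_ne hij with h | h <;> simp [tau, h.le, not_le.2 h]
    have h3 : tau 𝕜 i i = -1 := by simp [tau]
    have h4 : tau 𝕜 j j = -1 := by simp [tau]
    by_cases hi : i ∈ A <;> by_cases hj : j ∈ A <;> simp only [hi, hj, if_true, if_false, mul_zero,
      neg_zero]
    rw [h3, h4]
    linear_combination (sgn 𝕜 i A * sgn 𝕜 j A * coord (A ∆ {i} ∆ {j}) a) * this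

/-- Creation and annihilation operators: they anticommute up to `-δ_ij`, the sign coming from `e_i²
= -1`. -/
lemma dot_wedge (i j : Fin m) (a : Cl 𝕜 m) :
    dot i (wedge j a) = -wedge j (dot i a) - if i = j then a else 0 := by
  refine coord_ext fun A => ?_
  rw [map_sub, map_neg]
  by_cases hij : i = j
  · subst hij
    have := sgn_mul_self 𝕜 i A
    simp only [coord_wedge, coord_dot, mem_symmDiff_singleton_self, if_true, sgn_symmDiff_self,
      symmDiff_symmDiff_cancel_right]
    by_cases hi : i ∈ A <;> simp only [hi, if_true, if_false, not_true_eq_false, not_false_eq_true,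
      mul_zero, neg_zero]
    · linear_combination (-coord A a) * this
    · linear_combination (-coord A a) * this
  · have h1 : j ∈ A ∆ {i} ↔ j ∈ A := by simp [Finset.mem_symmDiff, Ne.symm hij]
    have h2 : i ∈ A ∆ {j} ↔ i ∈ A := by simp [Finset.mem_symmDiff, hij]
    simp only [coord_wedge, coord_dot, h1, h2, sgn_symmDiff, if_neg hij, map_zero]
    rw [symmDiff_right_comm A {j} {i}]
    have : tau 𝕜 i j + tau 𝕜 j i = 0 := by
      rcases lt_or_gt_of_ne hij with h | h <;> simp [tau, h.le, not_le.2 h]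
    have h3 : tau 𝕜 i i = -1 := by simp [tau]
    have h4 : tau 𝕜 j j = -1 := by simp [tau]
    by_cases hi : i ∈ A <;> by_cases hj : j ∈ A <;> simp only [hi, hj, if_true, if_false, mul_zero,
      neg_zero, sub_zero]
    rw [h3, h4]
    linear_combination (sgn 𝕜 i A * sgn 𝕜 j A * coord (A ∆ {i} ∆ {j}) a) * this

lemma wedge_dot (i j : Fin m) (a : Cl 𝕜 m) :
    wedge i (dot j a) = -dot j (wedge i a) - if i = j then a else 0 := by
  rw [dot_wedge j i a]
  simp only [eq_comm (a := j)]
  abel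

lemma dot_dot (i j : Fin m) (a : Cl 𝕜 m) : dot i (dot j a) = -dot j (dot i a) := by
  refine ext_inner_right 𝕜 fun b => ?_
  rw [inner_neg_left, inner_dot_left, inner_dot_left, inner_dot_left, inner_dot_left, wedge_wedge,
    inner_neg_right]

lemma sum_dot_wedge {s : ℕ} {a : Cl 𝕜 m} (ha : a ∈ multivectors 𝕜 m s) :
    ∑ i, dot i (wedge i a) = -(((m : 𝕜) - s) • a) := by
  simp only [dot_wedge, if_true, Finset.sum_sub_distrib, Finset.sum_neg_distrib, sum_wedge_dot ha]
  rw [Finset.sum_const, Finset.card_univ, Fintype.card_fin, sub_smul, Nat.cast_smul_eq_nsmul]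
  abel

/-! ### The inclusion `Cl_r ⊂ Cl_{r+1}` -/

lemma incl_blade (A : Finset (Fin r)) :
    incl 𝕜 r (blade 𝕜 A) = blade 𝕜 (A.map Fin.castSuccEmb) := by
  have h := Finset.map_sort (r := (· ≤ ·)) (r' := (· ≤ ·)) Fin.castSuccEmb A
    (fun a _ b _ => (Fin.castSucc_le_castSucc_iff (a := a) (b := b)).symm)
  rw [blade, blade, map_list_prod, List.map_map, ← h, List.map_map]
  refine congrArg List.prod (List.map_congr_left fun i _ => ?_)
  exact incl_gen i

/-- The `Cl_r`-component of an element of `Cl_{r+1} = Cl_r ⊕ e_{r+1} Cl_r`. -/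
def restrictL (r : ℕ) : Cl 𝕜 (r + 1) →ₗ[𝕜] Cl 𝕜 r where
  toFun a := ∑ A, coord (A.map Fin.castSuccEmb) a • blade 𝕜 A
  map_add' a b := by simp only [map_add, add_smul, Finset.sum_add_distrib]
  map_smul' c a := by simp only [map_smul, smul_eq_mul, mul_smul, Finset.smul_sum, RingHom.id_apply]

lemma coord_restrictL (a : Cl 𝕜 (r + 1)) (A : Finset (Fin r)) :
    coord A (restrictL r a) = coord (A.map Fin.castSuccEmb) a := by
  change coord A (∑ B, coord (B.map Fin.castSuccEmb) a • blade 𝕜 B) = _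
  rw [map_sum, Finset.sum_eq_single A]
  · rw [map_smul, coord_blade, if_pos rfl, smul_eq_mul, mul_one]
  · intro B _ h
    rw [map_smul, coord_blade, if_neg h, smul_zero]
  · simp

lemma last_notMem_map (A : Finset (Fin r)) : Fin.last r ∉ A.map Fin.castSuccEmb := by
  simp only [Finset.mem_map, not_exists, not_and]
  exact fun i _ h => (Fin.castSucc_lt_last i).ne h

lemma exists_eq_map {A : Finset (Fin (r + 1))} (h : Fin.last r ∉ A) :
    ∃ B : Finset (Fin r), A = B.map Fin.castSuccEmb := by
  refine ⟨Finset.univ.filter fun i => i.castSucc ∈ A, ?_⟩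
  ext i
  refine Fin.lastCases ?_ (fun i => ?_) i
  · exact iff_of_false h (last_notMem_map _)
  · simp

lemma coord_incl (a : Cl 𝕜 r) (A : Finset (Fin r)) :
    coord (A.map Fin.castSuccEmb) (incl 𝕜 r a) = coord A a := by
  have : (coord (𝕜 := 𝕜) (A.map Fin.castSuccEmb)).comp (incl 𝕜 r).toLinearMap = coord A := by
    refine (bladeBasis 𝕜 r).ext fun B => ?_
    rw [bladeBasis_apply, LinearMap.comp_apply, AlgHom.toLinearMap_apply, incl_blade, coord_blade,
      coord_blade]
    simp only [Finset.map_inj]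
  exact LinearMap.congr_fun this a

lemma coord_incl_of_mem (a : Cl 𝕜 r) {A : Finset (Fin (r + 1))} (h : Fin.last r ∈ A) :
    coord A (incl 𝕜 r a) = 0 := by
  have : (coord (𝕜 := 𝕜) A).comp (incl 𝕜 r).toLinearMap = 0 := by
    refine (bladeBasis 𝕜 r).ext fun B => ?_
    rw [bladeBasis_apply, LinearMap.comp_apply, AlgHom.toLinearMap_apply, incl_blade, coord_blade,
      if_neg]
    · rfl
    · rintro rfl
      exact last_notMem_map _ h
  exact LinearMap.congr_fun this a

variable (𝕜 r) in
/-- The last generator `e_{r+1}`. -/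
abbrev lastGen : Cl 𝕜 (r + 1) := gen 𝕜 (Fin.last r)

lemma coord_lastGen_incl_of_notMem (a : Cl 𝕜 r) {A : Finset (Fin (r + 1))} (h : Fin.last r ∉ A) :
    coord A (lastGen 𝕜 r * incl 𝕜 r a) = 0 := by
  rw [coord_gen_mul, coord_incl_of_mem _ ((mem_symmDiff_singleton_self _ _).2 h), mul_zero]

lemma restrictL_incl (a : Cl 𝕜 r) : restrictL r (incl 𝕜 r a) = a :=
  coord_ext fun A => by rw [coord_restrictL, coord_incl]

lemma restrictL_lastGen_incl (a : Cl 𝕜 r) : restrictL r (lastGen 𝕜 r * incl 𝕜 r a) = 0 :=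
  coord_ext fun A => by
    rw [coord_restrictL, coord_lastGen_incl_of_notMem _ (last_notMem_map A), map_zero]

lemma incl_injective : Function.Injective (incl 𝕜 r) :=
  Function.LeftInverse.injective restrictL_incl

lemma lastGen_mul_lastGen_mul (a : Cl 𝕜 (r + 1)) :
    lastGen 𝕜 r * (lastGen 𝕜 r * a) = -a := by
  rw [← mul_assoc, gen_mul_self, neg_one_mul]

/-- The component `a₁` in `a = a₀ + e_{r+1} a₁`. -/
def restrictLastL (r : ℕ) : Cl 𝕜 (r + 1) →ₗ[𝕜] Cl 𝕜 r :=
  -(restrictL r).comp (LinearMap.mulLeft 𝕜 (lastGen 𝕜 r))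

lemma restrictLastL_apply (a : Cl 𝕜 (r + 1)) :
    restrictLastL r a = -restrictL r (lastGen 𝕜 r * a) := rfl

lemma restrictLastL_incl (a : Cl 𝕜 r) : restrictLastL r (incl 𝕜 r a) = 0 := by
  rw [restrictLastL_apply, restrictL_lastGen_incl, neg_zero]

lemma restrictLastL_lastGen_incl (a : Cl 𝕜 r) :
    restrictLastL r (lastGen 𝕜 r * incl 𝕜 r a) = a := by
  rw [restrictLastL_apply, lastGen_mul_lastGen_mul, map_neg, restrictL_incl, neg_neg]

/-- The splitting `Cl_{r+1} = Cl_r ⊕ e_{r+1} Cl_r`: blades either avoid the last index or contain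
it. -/
lemma incl_restrictL_add (a : Cl 𝕜 (r + 1)) :
    incl 𝕜 r (restrictL r a) + lastGen 𝕜 r * incl 𝕜 r (restrictLastL r a) = a := by
  refine coord_ext fun A => ?_
  rw [map_add]
  by_cases h : Fin.last r ∈ A
  · rw [coord_incl_of_mem _ h, zero_add, coord_gen_mul]
    obtain ⟨B, hB⟩ := exists_eq_map (A := A ∆ {Fin.last r})
      (fun h' => (mem_symmDiff_singleton_self _ _).1 h' h)
    have h2 := coord_gen_mul (𝕜 := 𝕜) (Fin.last r) a (A ∆ {Fin.last r})
    rw [symmDiff_symmDiff_cancel_right] at h2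
    have h3 := sgn_mul_self 𝕜 (Fin.last r) A
    rw [sgn_symmDiff_self]
    rw [hB] at h2 ⊢
    rw [coord_incl, restrictLastL_apply, map_neg, coord_restrictL, h2]
    linear_combination (coord A a) * h3
  · rw [coord_lastGen_incl_of_notMem _ h, add_zero]
    obtain ⟨B, rfl⟩ := exists_eq_map h
    rw [coord_incl, coord_restrictL]

lemma incl_mem {s : ℕ} {a : Cl 𝕜 r} (ha : a ∈ multivectors 𝕜 r s) :
    incl 𝕜 r a ∈ multivectors 𝕜 (r + 1) s := by
  rw [mem_multivectors] at ha ⊢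
  intro A hA
  by_cases h : Fin.last r ∈ A
  · exact coord_incl_of_mem _ h
  · obtain ⟨B, rfl⟩ := exists_eq_map h
    rw [coord_incl, ha]
    simpa using hA

lemma restrictL_mem {s : ℕ} {a : Cl 𝕜 (r + 1)} (ha : a ∈ multivectors 𝕜 (r + 1) s) :
    restrictL r a ∈ multivectors 𝕜 r s := by
  rw [mem_multivectors] at ha ⊢
  intro A hA
  rw [coord_restrictL, ha]
  simpa using hA

lemma wedge_last_incl (a : Cl 𝕜 r) : wedge (Fin.last r) (incl 𝕜 r a) = lastGen 𝕜 r * incl 𝕜 r a := by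
  refine coord_ext fun A => ?_
  rw [coord_wedge, coord_gen_mul]
  split_ifs with h
  · rfl
  · rw [coord_incl_of_mem _ ((mem_symmDiff_singleton_self _ _).2 h), mul_zero]

lemma lastGen_incl_mem {s : ℕ} {a : Cl 𝕜 r} (ha : a ∈ multivectors 𝕜 r s) :
    lastGen 𝕜 r * incl 𝕜 r a ∈ multivectors 𝕜 (r + 1) (s + 1) := by
  rw [← wedge_last_incl]
  exact wedge_mem _ (incl_mem ha)

lemma restrictLastL_mem {s : ℕ} {a : Cl 𝕜 (r + 1)} (ha : a ∈ multivectors 𝕜 (r + 1) (s + 1)) :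
    restrictLastL r a ∈ multivectors 𝕜 r s := by
  rw [mem_multivectors] at ha ⊢
  intro A hA
  rw [restrictLastL_apply, map_neg, coord_restrictL, coord_gen_mul, ha, mul_zero, neg_zero]
  rw [card_symmDiff_singleton, if_neg (last_notMem_map A), Finset.card_map]
  omega

lemma restrictLastL_scalar {a : Cl 𝕜 (r + 1)} (ha : a ∈ multivectors 𝕜 (r + 1) 0) :
    restrictLastL r a = 0 := by
  rw [mem_multivectors] at ha
  refine coord_ext fun A => ?_
  rw [restrictLastL_apply, map_neg, coord_restrictL, coord_gen_mul, ha, mul_zero, neg_zero, map_zero]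
  rw [card_symmDiff_singleton, if_neg (last_notMem_map A), Finset.card_map]
  omega

lemma inner_incl_incl (a b : Cl 𝕜 r) : inner 𝕜 (incl 𝕜 r a) (incl 𝕜 r b) = inner 𝕜 a b := by
  rw [inner_eq_sum_coord, inner_eq_sum_coord]
  symm
  rw [← Finset.sum_subset (Finset.subset_univ (Finset.univ.map
    ⟨Finset.map Fin.castSuccEmb, Finset.map_injective _⟩))]
  · rw [Finset.sum_map]
    refine Finset.sum_congr rfl fun A _ => ?_
    simp only [Function.Embedding.coeFn_mk, coord_incl]
  · intro A _ hA
    by_cases h : Fin.last r ∈ A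
    · rw [coord_incl_of_mem _ h, map_zero, zero_mul]
    · obtain ⟨B, rfl⟩ := exists_eq_map h
      exact absurd (Finset.mem_map.2 ⟨B, Finset.mem_univ _, rfl⟩) hA

lemma inner_incl_lastGen (a b : Cl 𝕜 r) :
    inner 𝕜 (incl 𝕜 r a) (lastGen 𝕜 r * incl 𝕜 r b) = 0 := by
  rw [inner_eq_sum_coord]
  refine Finset.sum_eq_zero fun A _ => ?_
  by_cases h : Fin.last r ∈ A
  · rw [coord_incl_of_mem _ h, map_zero, zero_mul]
  · rw [coord_lastGen_incl_of_notMem _ h, mul_zero]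

lemma inner_lastGen_incl (a b : Cl 𝕜 r) :
    inner 𝕜 (lastGen 𝕜 r * incl 𝕜 r a) (incl 𝕜 r b) = 0 := by
  rw [← inner_conj_symm, inner_incl_lastGen, map_zero]

lemma inner_lastGen_lastGen (a b : Cl 𝕜 r) :
    inner 𝕜 (lastGen 𝕜 r * incl 𝕜 r a) (lastGen 𝕜 r * incl 𝕜 r b) = inner 𝕜 a b := by
  rw [inner_gen_mul_left, lastGen_mul_lastGen_mul, inner_neg_right, neg_neg, inner_incl_incl]

lemma involute_incl (a : Cl 𝕜 r) : involute (incl 𝕜 r a) = incl 𝕜 r (involute a) := by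
  have : (involute (Q := negForm 𝕜 (r + 1))).comp (incl 𝕜 r) = (incl 𝕜 r).comp involute := by
    refine CliffordAlgebra.hom_ext (LinearMap.ext fun v => ?_)
    simp [incl]
  exact AlgHom.congr_fun this a

lemma outer_incl (u v : Cl 𝕜 r) : outer (incl 𝕜 r u) (incl 𝕜 r v) = incl 𝕜 r (outer u v) := by
  simp only [outer, involute_incl, map_smul, map_add, map_mul]

lemma contract_incl (u v : Cl 𝕜 r) :
    contract (incl 𝕜 r u) (incl 𝕜 r v) = incl 𝕜 r (contract u v) := by
  simp only [contract, involute_incl, map_smul, map_sub, map_mul]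

lemma incl_gen_mul_lastGen (i : Fin r) :
    gen 𝕜 i.castSucc * lastGen 𝕜 r = -(lastGen 𝕜 r * gen 𝕜 i.castSucc) :=
  gen_mul_gen_of_ne (Fin.castSucc_lt_last i).ne

/-! ### Vectors -/

lemma real_smul_eq (c : ℝ) (a : Cl 𝕜 m) : (c : 𝕜) • a = c • a := by
  rw [← algebraMap_smul 𝕜 c a]

lemma vec_eq (x : Euc m) : vec 𝕜 x = ∑ i, x i • gen 𝕜 i := by
  simp only [vec, real_smul_eq]

instance instFiniteDimensionalCl : FiniteDimensional 𝕜 (Cl 𝕜 m) :=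
  Module.Basis.finiteDimensional_of_finite (bladeBasis 𝕜 m)

instance instIsScalarTowerCl : IsScalarTower ℝ 𝕜 (Cl 𝕜 m) := inferInstance

instance instFiniteDimensionalRealCl : FiniteDimensional ℝ (Cl 𝕜 m) :=
  FiniteDimensional.trans ℝ 𝕜 (Cl 𝕜 m)

instance instCompleteSpaceCl : CompleteSpace (Cl 𝕜 m) := FiniteDimensional.complete 𝕜 _

/-- `v ↦ x ∧ v` -/
abbrev xWedge (x : Euc m) : Cl 𝕜 m →ₗ[𝕜] Cl 𝕜 m := outerL (vec 𝕜 x)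

/-- `v ↦ x • v` -/
abbrev xDot (x : Euc m) : Cl 𝕜 m →ₗ[𝕜] Cl 𝕜 m := contractL (vec 𝕜 x)

lemma xWedge_eq (x : Euc m) (a : Cl 𝕜 m) : xWedge x a = ∑ i, x i • wedge i a := by
  simp only [outerL_apply, outer, vec_eq, Finset.sum_mul, Finset.mul_sum, smul_mul_assoc,
    mul_smul_comm, ← Finset.sum_add_distrib, Finset.smul_sum]
  refine Finset.sum_congr rfl fun i _ => ?_
  rw [← smul_add, smul_comm]

lemma xDot_eq (x : Euc m) (a : Cl 𝕜 m) : xDot x a = ∑ i, x i • dot i a := by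
  simp only [contractL_apply, contract, vec_eq, Finset.sum_mul, Finset.mul_sum, smul_mul_assoc,
    mul_smul_comm, ← Finset.sum_sub_distrib, Finset.smul_sum]
  refine Finset.sum_congr rfl fun i _ => ?_
  rw [← smul_sub, smul_comm]

lemma vec_mul (x : Euc m) (a : Cl 𝕜 m) : vec 𝕜 x * a = ∑ i, x i • (gen 𝕜 i * a) := by
  simp only [vec_eq, Finset.sum_mul, smul_mul_assoc]

lemma xWedge_add_xDot (x : Euc m) (a : Cl 𝕜 m) : xWedge x a + xDot x a = vec 𝕜 x * a :=
  outer_add_contract _ _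

lemma inner_real_smul_left (c : ℝ) (a b : Cl 𝕜 m) : inner 𝕜 (c • a) b = (c : 𝕜) * inner 𝕜 a b := by
  rw [← real_smul_eq, inner_smul_left, RCLike.conj_ofReal]

lemma inner_real_smul_right (c : ℝ) (a b : Cl 𝕜 m) :
    inner 𝕜 a (c • b) = (c : 𝕜) * inner 𝕜 a b := by
  rw [← real_smul_eq, inner_smul_right]

lemma inner_xWedge_left (x : Euc m) (a b : Cl 𝕜 m) :
    inner 𝕜 (xWedge x a) b = -inner 𝕜 a (xDot x b) := by
  simp only [xWedge_eq, xDot_eq, sum_inner, inner_sum, inner_real_smul_left, inner_real_smul_right,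
    inner_wedge_left, mul_neg, Finset.sum_neg_distrib]

lemma inner_xDot_left (x : Euc m) (a b : Cl 𝕜 m) :
    inner 𝕜 (xDot x a) b = -inner 𝕜 a (xWedge x b) := by
  simp only [xWedge_eq, xDot_eq, sum_inner, inner_sum, inner_real_smul_left, inner_real_smul_right,
    inner_dot_left, mul_neg, Finset.sum_neg_distrib]

lemma xWedge_mem {s : ℕ} (x : Euc m) {a : Cl 𝕜 m} (ha : a ∈ multivectors 𝕜 m s) :
    xWedge x a ∈ multivectors 𝕜 m (s + 1) := by
  rw [xWedge_eq]
  refine Submodule.sum_mem _ fun i _ => ?_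
  rw [← real_smul_eq]
  exact Submodule.smul_mem _ _ (wedge_mem i ha)

lemma xDot_mem {s : ℕ} (x : Euc m) {a : Cl 𝕜 m} (ha : a ∈ multivectors 𝕜 m (s + 1)) :
    xDot x a ∈ multivectors 𝕜 m s := by
  rw [xDot_eq]
  refine Submodule.sum_mem _ fun i _ => ?_
  rw [← real_smul_eq]
  exact Submodule.smul_mem _ _ (dot_mem i ha)

lemma xDot_scalar (x : Euc m) {a : Cl 𝕜 m} (ha : a ∈ multivectors 𝕜 m 0) : xDot x a = 0 := by
  rw [xDot_eq]
  exact Finset.sum_eq_zero fun i _ => by rw [dot_scalar i ha, smul_zero]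

lemma xWedge_top (x : Euc m) {a : Cl 𝕜 m} (ha : a ∈ multivectors 𝕜 m m) : xWedge x a = 0 :=
  multivectors_eq_bot (Nat.lt_succ_self m) (xWedge_mem x ha)

lemma sum_sum_eq_zero_of_antisymm {M : Type*} [AddCommGroup M] [Module ℝ M] (x : Euc m)
    (F : Fin m → Fin m → M) (hF : ∀ i j, F i j = -F j i) :
    ∑ i, x i • ∑ j, x j • F i j = 0 := by
  have h : ∑ i, x i • ∑ j, x j • F i j = -∑ i, x i • ∑ j, x j • F i j := by
    conv_lhs => simp only [Finset.smul_sum]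
    rw [Finset.sum_comm]
    simp only [Finset.smul_sum, ← Finset.sum_neg_distrib]
    refine Finset.sum_congr rfl fun i _ => Finset.sum_congr rfl fun j _ => ?_
    rw [hF j i, smul_neg, smul_neg, smul_comm]
  have h2 : (2 : ℝ) • ∑ i, x i • ∑ j, x j • F i j = 0 := by
    rw [two_smul]; nth_rewrite 1 [h]; exact neg_add_cancel _
  exact (smul_eq_zero.1 h2).resolve_left two_ne_zero

lemma xWedge_xWedge (x : Euc m) (a : Cl 𝕜 m) : xWedge x (xWedge x a) = 0 := by
  simp only [xWedge_eq, map_sum, LinearMap.map_smul_of_tower]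
  exact sum_sum_eq_zero_of_antisymm x _ fun i j => wedge_wedge j i a

lemma xDot_xDot (x : Euc m) (a : Cl 𝕜 m) : xDot x (xDot x a) = 0 := by
  simp only [xDot_eq, map_sum, LinearMap.map_smul_of_tower]
  exact sum_sum_eq_zero_of_antisymm x _ fun i j => dot_dot j i a

lemma norm_sq_eq_sum (x : Euc m) : ‖x‖ ^ 2 = ∑ i, x i * x i := by
  rw [EuclideanSpace.norm_sq_eq]
  simp [pow_two]

lemma xDot_xWedge (x : Euc m) (a : Cl 𝕜 m) :
    xDot x (xWedge x a) = -xWedge x (xDot x a) - ‖x‖ ^ 2 • a := by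
  simp only [xDot_eq, xWedge_eq, map_sum, LinearMap.map_smul_of_tower, dot_wedge, smul_sub, smul_neg,
    Finset.sum_sub_distrib, Finset.sum_neg_distrib, smul_ite, smul_zero, Finset.sum_ite_eq',
    Finset.mem_univ, if_true, norm_sq_eq_sum, Finset.sum_smul, mul_smul]
  congr 2
  simp only [Finset.smul_sum]
  rw [Finset.sum_comm]
  exact Finset.sum_congr rfl fun i _ => Finset.sum_congr rfl fun j _ => smul_comm _ _ _

lemma vec_mul_vec_mul (x : Euc m) (a : Cl 𝕜 m) : vec 𝕜 x * (vec 𝕜 x * a) = -(‖x‖ ^ 2 • a) := by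
  simp only [← xWedge_add_xDot, map_add, xWedge_xWedge, xDot_xDot, xDot_xWedge]
  abel

/-! ### Partial derivatives -/

section Partial

variable {E F : Type*} [NormedAddCommGroup E] [NormedSpace ℝ E] [NormedAddCommGroup F]
  [NormedSpace ℝ F]

/-- The partial derivative `∂_{x_i} f`. -/
def pd (i : Fin m) (f : Euc m → E) (x : Euc m) : E := fderiv ℝ f x (EuclideanSpace.single i 1)

lemma contDiff_pd (i : Fin m) {f : Euc m → E} (hf : ContDiff ℝ ∞ f) : ContDiff ℝ ∞ (pd i f) :=
  (hf.fderiv_right (by simp)).clm_apply contDiff_const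

lemma _root_.ContDiff.diffAt {f : Euc m → E} (hf : ContDiff ℝ ∞ f) (x : Euc m) :
    DifferentiableAt ℝ f x :=
  (hf.differentiable (by simp)) x

lemma pd_congr {f g : Euc m → E} (h : ∀ x, f x = g x) (i : Fin m) (x : Euc m) :
    pd i f x = pd i g x := by
  rw [show f = g from funext h]

lemma pd_const (i : Fin m) (a : E) (x : Euc m) : pd i (fun _ => a) x = 0 := by
  simp [pd]

lemma pd_add (i : Fin m) {f g : Euc m → E} {x : Euc m} (hf : DifferentiableAt ℝ f x)
    (hg : DifferentiableAt ℝ g x) : pd i (fun x => f x + g x) x = pd i f x + pd i g x := by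
  rw [pd, fderiv_fun_add hf hg]; rfl

lemma pd_sub (i : Fin m) {f g : Euc m → E} {x : Euc m} (hf : DifferentiableAt ℝ f x)
    (hg : DifferentiableAt ℝ g x) : pd i (fun x => f x - g x) x = pd i f x - pd i g x := by
  rw [pd, fderiv_fun_sub hf hg]; rfl

lemma pd_sum {ι : Type*} (i : Fin m) (s : Finset ι) {f : ι → Euc m → E} {x : Euc m}
    (hf : ∀ a ∈ s, DifferentiableAt ℝ (f a) x) :
    pd i (fun x => ∑ a ∈ s, f a x) x = ∑ a ∈ s, pd i (f a) x := by
  rw [pd, fderiv_fun_sum hf, sum_apply]; rfl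

lemma pd_clm (i : Fin m) (T : E →L[ℝ] F) {f : Euc m → E} {x : Euc m}
    (hf : DifferentiableAt ℝ f x) : pd i (fun x => T (f x)) x = T (pd i f x) := by
  have h := T.hasFDerivAt.comp x hf.hasFDerivAt
  rw [pd, show (fun x => T (f x)) = T ∘ f from rfl, h.fderiv]; rfl

lemma pd_const_smul (i : Fin m) (c : ℝ) {f : Euc m → E} {x : Euc m}
    (hf : DifferentiableAt ℝ f x) : pd i (fun x => c • f x) x = c • pd i f x :=
  pd_clm i (c • ContinuousLinearMap.id ℝ E) hf

lemma pd_smul (i : Fin m) {g : Euc m → ℝ} {f : Euc m → E} {x : Euc m}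
    (hg : DifferentiableAt ℝ g x) (hf : DifferentiableAt ℝ f x) :
    pd i (fun x => g x • f x) x = pd i g x • f x + g x • pd i f x := by
  rw [pd, fderiv_fun_smul hg hf]
  simp [pd, add_comm]

lemma contDiff_coord (j : Fin m) : ContDiff ℝ ∞ fun x : Euc m => x j :=
  (EuclideanSpace.proj (𝕜 := ℝ) j).contDiff

lemma pd_coord (i j : Fin m) (x : Euc m) :
    pd i (fun x : Euc m => x j) x = if i = j then 1 else 0 := by
  have h := (EuclideanSpace.proj (𝕜 := ℝ) j : Euc m →L[ℝ] ℝ).hasFDerivAt (x := x)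
  rw [pd, show (fun x : Euc m => x j) = (EuclideanSpace.proj (𝕜 := ℝ) j : Euc m →L[ℝ] ℝ) from rfl,
    h.fderiv]
  simp [eq_comm]

lemma pd_coord_smul (i j : Fin m) {f : Euc m → E} {x : Euc m} (hf : DifferentiableAt ℝ f x) :
    pd i (fun x => x j • f x) x = (if i = j then f x else 0) + x j • pd i f x := by
  rw [pd_smul i ((contDiff_coord j).diffAt x) hf, pd_coord]
  split_ifs <;> simp

lemma contDiff_normSq : ContDiff ℝ ∞ fun x : Euc m => ‖x‖ ^ 2 := contDiff_norm_sq ℝ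

lemma pd_normSq (i : Fin m) (x : Euc m) : pd i (fun x : Euc m => ‖x‖ ^ 2) x = 2 * x i := by
  simp only [norm_sq_eq_sum]
  rw [pd_sum i _ fun a _ => ((contDiff_coord a).mul (contDiff_coord a)).diffAt x]
  simp only [← smul_eq_mul (a := (_ : Euc m) _)]
  simp only [pd_coord_smul i _ ((contDiff_coord _).diffAt x), pd_coord]
  simp [Finset.sum_add_distrib, two_mul]

lemma pd_comm (i j : Fin m) {f : Euc m → E} (hf : ContDiff ℝ ∞ f) (x : Euc m) :
    pd i (pd j f) x = pd j (pd i f) x := by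
  have hs : IsSymmSndFDerivAt ℝ f x := by
    refine (hf.contDiffAt).isSymmSndFDerivAt ?_
    rw [minSmoothness_of_isRCLikeNormedField]
    exact WithTop.coe_le_coe.2 (le_top : (2 : ℕ∞) ≤ ⊤)
  have h2 : ContDiff ℝ ∞ (fderiv ℝ f) := hf.fderiv_right (by simp)
  have key (a b : Fin m) : pd a (pd b f) x =
      fderiv ℝ (fderiv ℝ f) x (EuclideanSpace.single a 1) (EuclideanSpace.single b 1) :=
    pd_clm (E := Euc m →L[ℝ] E) a (ContinuousLinearMap.apply ℝ E (EuclideanSpace.single b 1))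
      (h2.diffAt x)
  rw [key, key]
  exact hs _ _

lemma sum_coord_smul_pd (f : Euc m → E) (x y : Euc m) :
    ∑ i, y i • pd i f x = fderiv ℝ f x y := by
  have : y = ∑ i, y i • EuclideanSpace.single i (1 : ℝ) := by
    ext j
    simp [Pi.single_apply]
  conv_rhs => rw [this, map_sum]
  simp only [map_smul]; rfl

lemma eq_of_pd_eq_zero {f : Euc m → E} (hf : ContDiff ℝ ∞ f) (h : ∀ i x, pd i f x = 0)
    (x y : Euc m) : f x = f y := by
  refine is_const_of_fderiv_eq_zero (𝕜 := ℝ) (hf.differentiable (by simp)) (fun x => ?_) x y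
  ext v
  rw [← sum_coord_smul_pd]
  simp [h]

/-! ### Homogeneous polynomial maps -/

/-- Smooth maps homogeneous of degree `k`, that is, homogeneous polynomial maps of degree `k`. -/
structure IsHom (k : ℕ) (f : Euc m → E) : Prop where
  smooth : ContDiff ℝ ∞ f
  map_smul : ∀ (c : ℝ) (x : Euc m), f (c • x) = c ^ k • f x

lemma IsHom.diffAt {k : ℕ} {f : Euc m → E} (hf : IsHom k f) (x : Euc m) :
    DifferentiableAt ℝ f x := hf.smooth.diffAt x

/-- The derivative of `c ↦ f (c x)` at `c = 1` is computed by the chain rule and by homogeneity. -/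
lemma IsHom.euler {k : ℕ} {f : Euc m → E} (hf : IsHom k f) (x : Euc m) :
    ∑ i, x i • pd i f x = (k : ℝ) • f x := by
  rw [sum_coord_smul_pd]
  have h1 : HasDerivAt (fun c : ℝ => f (c • x)) (fderiv ℝ f x x) 1 := by
    have h2 : HasFDerivAt f (fderiv ℝ f x) ((1 : ℝ) • x) := by
      rw [one_smul]; exact (hf.diffAt x).hasFDerivAt
    have h3 : HasDerivAt (fun c : ℝ => c • x) x 1 := by
      simpa using (hasDerivAt_id (1 : ℝ)).smul_const x
    exact h2.comp_hasDerivAt 1 h3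
  have h4 : HasDerivAt (fun c : ℝ => f (c • x)) ((k : ℝ) • f x) 1 := by
    simp only [hf.map_smul]
    simpa using (hasDerivAt_pow k (1 : ℝ)).smul_const (f x)
  exact h1.unique h4

lemma IsHom.eq_const {f : Euc m → E} (hf : IsHom 0 f) (x : Euc m) : f x = f 0 := by
  have := hf.map_smul 0 x
  simpa using this.symm

lemma IsHom.zero_apply {k : ℕ} {f : Euc m → E} (hf : IsHom (k + 1) f) : f 0 = 0 := by
  have := hf.map_smul 0 0
  simpa using this

lemma IsHom.pd_of_zero {f : Euc m → E} (hf : IsHom 0 f) (i : Fin m) (x : Euc m) :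
    pd i f x = 0 := by
  rw [pd_congr hf.eq_const, pd_const]

/-- Differentiating `f (c x) = c^{k+1} f x` in `x` produces the claim multiplied by `c`. -/
lemma IsHom.pd {k : ℕ} {f : Euc m → E} (hf : IsHom (k + 1) f) (i : Fin m) :
    IsHom k (pd i f) := by
  refine ⟨contDiff_pd i hf.smooth, fun c x => ?_⟩
  have key (c : ℝ) : c • GMT.pd i f (c • x) = c ^ (k + 1) • GMT.pd i f x := by
    have h1 : HasFDerivAt (fun x => f (c • x))
        ((fderiv ℝ f (c • x)).comp (c • ContinuousLinearMap.id ℝ (Euc m))) x :=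
      (hf.diffAt (c • x)).hasFDerivAt.comp x (c • ContinuousLinearMap.id ℝ (Euc m)).hasFDerivAt
    have h2 : HasFDerivAt (fun x => f (c • x)) (c ^ (k + 1) • fderiv ℝ f x) x := by
      simp only [hf.map_smul]
      exact (hf.diffAt x).hasFDerivAt.const_smul (c ^ (k + 1))
    have := congrArg (fun T : Euc m →L[ℝ] E => T (EuclideanSpace.single i 1)) (h1.unique h2)
    simpa [GMT.pd] using this
  have h0 : ∀ c : ℝ, c ≠ 0 → GMT.pd i f (c • x) = c ^ k • GMT.pd i f x := by
    intro c hc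
    have := key c
    rw [pow_succ', mul_smul] at this
    exact smul_right_injective E hc this
  have hcont : Continuous fun c : ℝ => GMT.pd i f (c • x) :=
    (contDiff_pd i hf.smooth).continuous.comp (continuous_id.smul continuous_const)
  have hcont' : Continuous fun c : ℝ => c ^ k • GMT.pd i f x :=
    (continuous_pow k).smul continuous_const
  -- Division by `c` excludes `c = 0`; that value is recovered by continuity of both sides.
  have hd : Dense ({0}ᶜ : Set ℝ) := dense_compl_singleton 0
  exact congrFun (hcont.ext_on hd hcont' fun c hc => h0 c hc) c

lemma IsHom.zero (k : ℕ) : IsHom k (fun _ : Euc m => (0 : E)) :=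
  ⟨contDiff_const, fun c x => by simp⟩

lemma IsHom.const (a : E) : IsHom 0 (fun _ : Euc m => a) :=
  ⟨contDiff_const, fun c x => by simp⟩

lemma IsHom.add {k : ℕ} {f g : Euc m → E} (hf : IsHom k f) (hg : IsHom k g) :
    IsHom k fun x => f x + g x :=
  ⟨hf.smooth.add hg.smooth, fun c x => by rw [hf.map_smul, hg.map_smul, smul_add]⟩

lemma IsHom.sub {k : ℕ} {f g : Euc m → E} (hf : IsHom k f) (hg : IsHom k g) :
    IsHom k fun x => f x - g x :=
  ⟨hf.smooth.sub hg.smooth, fun c x => by rw [hf.map_smul, hg.map_smul, smul_sub]⟩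

lemma IsHom.sum {ι : Type*} (s : Finset ι) {k : ℕ} {f : ι → Euc m → E}
    (hf : ∀ i ∈ s, IsHom k (f i)) : IsHom k fun x => ∑ i ∈ s, f i x :=
  ⟨ContDiff.sum fun i hi => (hf i hi).smooth, fun c x => by
    rw [Finset.smul_sum]; exact Finset.sum_congr rfl fun i hi => (hf i hi).map_smul c x⟩

lemma IsHom.clm {k : ℕ} {f : Euc m → E} (hf : IsHom k f) (T : E →L[ℝ] F) :
    IsHom k fun x => T (f x) :=
  ⟨T.contDiff.comp hf.smooth, fun c x => by rw [hf.map_smul, _root_.map_smul]⟩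

lemma IsHom.smul {j k : ℕ} {g : Euc m → ℝ} {f : Euc m → E} (hg : IsHom j g) (hf : IsHom k f) :
    IsHom (j + k) fun x => g x • f x :=
  ⟨hg.smooth.smul hf.smooth, fun c x => by
    rw [hf.map_smul, hg.map_smul, smul_smul, smul_smul, smul_eq_mul, pow_add]; ring_nf⟩

lemma IsHom.coord (i : Fin m) : IsHom 1 fun x : Euc m => x i :=
  ⟨contDiff_coord i, fun c x => by simp⟩

lemma IsHom.coord_smul {k : ℕ} {f : Euc m → E} (hf : IsHom k f) (i : Fin m) :
    IsHom (k + 1) fun x => x i • f x := by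
  rw [add_comm]; exact (IsHom.coord i).smul hf

lemma IsHom.congr {k : ℕ} {f g : Euc m → E} (hf : IsHom k f) (h : ∀ x, f x = g x) : IsHom k g := by
  rwa [← show f = g from funext h]

lemma IsHom.eq_zero_of_pd {k : ℕ} {f : Euc m → E} (hf : IsHom (k + 1) f)
    (h : ∀ i x, GMT.pd i f x = 0) (x : Euc m) : f x = 0 := by
  rw [eq_of_pd_eq_zero hf.smooth h x 0, hf.zero_apply]

lemma IsHom.iterate_pd {k : ℕ} {f : Euc m → E} (i : Fin m) (L : ℕ) (hf : IsHom (L + k) f) :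
    IsHom k ((GMT.pd i)^[L] f) := by
  induction L generalizing f with
  | zero => simpa using hf
  | succ L ih =>
    rw [Function.iterate_succ_apply]
    exact ih (IsHom.pd (by rwa [show L + k + 1 = L + 1 + k by ring]) i)

end Partial

/-! ### Clifford algebra valued maps -/

/-- A linear map between Clifford algebras as a continuous real-linear map. -/
def clmOf (T : Cl 𝕜 m →ₗ[𝕜] Cl 𝕜 n) : Cl 𝕜 m →L[ℝ] Cl 𝕜 n :=
  LinearMap.toContinuousLinearMap (T.restrictScalars ℝ)

lemma pd_lin (i : Fin r) (T : Cl 𝕜 m →ₗ[𝕜] Cl 𝕜 n) {f : Euc r → Cl 𝕜 m} {x : Euc r}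
    (hf : DifferentiableAt ℝ f x) : pd i (fun x => T (f x)) x = T (pd i f x) :=
  pd_clm i (clmOf T) hf

lemma contDiff_lin (T : Cl 𝕜 m →ₗ[𝕜] Cl 𝕜 n) {f : Euc r → Cl 𝕜 m} (hf : ContDiff ℝ ∞ f) :
    ContDiff ℝ ∞ fun x => T (f x) := (clmOf T).contDiff.comp hf

lemma IsHom.lin {k : ℕ} (T : Cl 𝕜 m →ₗ[𝕜] Cl 𝕜 n) {f : Euc r → Cl 𝕜 m} (hf : IsHom k f) :
    IsHom k fun x => T (f x) := hf.clm (clmOf T)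

lemma pd_mem (i : Fin r) (S : Submodule 𝕜 (Cl 𝕜 m)) {f : Euc r → Cl 𝕜 m}
    (hf : ∀ x, f x ∈ S) (x : Euc r) (hx : DifferentiableAt ℝ f x) : pd i f x ∈ S := by
  have h1 := (hx.hasFDerivAt.hasLineDerivAt (EuclideanSpace.single i 1))
  rw [hasLineDerivAt_iff_tendsto_slope_zero] at h1
  refine (S.closed_of_finiteDimensional).mem_of_tendsto h1 (Filter.Eventually.of_forall fun t => ?_)
  rw [← real_smul_eq]
  exact S.smul_mem _ (S.sub_mem (hf _) (hf _))

lemma eq_zero_of_eq_neg_self {a : Cl 𝕜 m} (h : a = -a) : a = 0 := by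
  have h2 : (2 : 𝕜) • a = 0 := by
    rw [two_smul]; nth_rewrite 1 [h]; exact neg_add_cancel _
  exact (smul_eq_zero.1 h2).resolve_left two_ne_zero

/-- `∑_i T_i ∂_{x_i} f` for a family of linear maps. -/
def dOp (T : Fin m → Cl 𝕜 m →ₗ[𝕜] Cl 𝕜 m) (f : Euc m → Cl 𝕜 m) (x : Euc m) : Cl 𝕜 m :=
  ∑ i, T i (pd i f x)

/-- `∂ ∧ f` -/
abbrev dw (f : Euc m → Cl 𝕜 m) (x : Euc m) : Cl 𝕜 m := dOp wedge f x

/-- `∂ • f` -/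
abbrev dc (f : Euc m → Cl 𝕜 m) (x : Euc m) : Cl 𝕜 m := dOp dot f x

lemma dirac_eq (f : Euc m → Cl 𝕜 m) (x : Euc m) : dirac f x = ∑ i, gen 𝕜 i * pd i f x := rfl

lemma dirac_eq_dOp (f : Euc m → Cl 𝕜 m) (x : Euc m) :
    dirac f x = dOp (fun i => LinearMap.mulLeft 𝕜 (gen 𝕜 i)) f x := rfl

lemma dirac_eq_dw_add_dc (f : Euc m → Cl 𝕜 m) (x : Euc m) : dirac f x = dw f x + dc f x := by
  simp only [dirac_eq, dOp, ← Finset.sum_add_distrib, wedge_add_dot]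

/-! ### First-order operators with constant Clifford coefficients -/

section dOp

variable (T U : Fin m → Cl 𝕜 m →ₗ[𝕜] Cl 𝕜 m)

lemma dOp_add {f g : Euc m → Cl 𝕜 m} {x : Euc m} (hf : DifferentiableAt ℝ f x)
    (hg : DifferentiableAt ℝ g x) : dOp T (fun x => f x + g x) x = dOp T f x + dOp T g x := by
  simp only [dOp, pd_add _ hf hg, map_add, Finset.sum_add_distrib]

lemma dOp_sub {f g : Euc m → Cl 𝕜 m} {x : Euc m} (hf : DifferentiableAt ℝ f x)
    (hg : DifferentiableAt ℝ g x) : dOp T (fun x => f x - g x) x = dOp T f x - dOp T g x := by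
  simp only [dOp, pd_sub _ hf hg, map_sub, Finset.sum_sub_distrib]

lemma dOp_real_smul (c : ℝ) {f : Euc m → Cl 𝕜 m} {x : Euc m} (hf : DifferentiableAt ℝ f x) :
    dOp T (fun x => c • f x) x = c • dOp T f x := by
  simp only [dOp, pd_const_smul _ c hf, LinearMap.map_smul_of_tower, Finset.smul_sum]

lemma dOp_smul (c : 𝕜) {f : Euc m → Cl 𝕜 m} {x : Euc m} (hf : DifferentiableAt ℝ f x) :
    dOp T (fun x => c • f x) x = c • dOp T f x := by
  have h (i : Fin m) : pd i (fun x => c • f x) x = c • pd i f x :=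
    pd_lin i (c • LinearMap.id) hf
  simp only [dOp, h, map_smul, Finset.smul_sum]

lemma dOp_sum {ι : Type*} (s : Finset ι) {f : ι → Euc m → Cl 𝕜 m} {x : Euc m}
    (hf : ∀ a ∈ s, DifferentiableAt ℝ (f a) x) :
    dOp T (fun x => ∑ a ∈ s, f a x) x = ∑ a ∈ s, dOp T (f a) x := by
  simp only [dOp, pd_sum _ s hf, map_sum]
  exact Finset.sum_comm

lemma dOp_mul_smul {g : Euc m → ℝ} {f : Euc m → Cl 𝕜 m} {x : Euc m} (hg : DifferentiableAt ℝ g x)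
    (hf : DifferentiableAt ℝ f x) :
    dOp T (fun x => g x • f x) x = ∑ i, pd i g x • T i (f x) + g x • dOp T f x := by
  simp only [dOp, pd_smul _ hg hf, map_add, LinearMap.map_smul_of_tower, Finset.sum_add_distrib,
    Finset.smul_sum]

/-- The Leibniz rule behind every commutation relation between a part of `∂` and a multiplication by
`x`, with `T` and `U` chosen among `wedge`, `dot` and left multiplications. -/
lemma dOp_x_smul {f : Euc m → Cl 𝕜 m} {x : Euc m} (hf : DifferentiableAt ℝ f x) :
    dOp T (fun x => ∑ j, x j • U j (f x)) x =
      ∑ i, T i (U i (f x)) + ∑ j, x j • ∑ i, T i (U j (pd i f x)) := by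
  have hU (j : Fin m) : DifferentiableAt ℝ (fun x => U j (f x)) x :=
    ((clmOf (U j)).differentiableAt).comp x hf
  rw [dOp_sum T _ fun j _ => ((contDiff_coord j).diffAt x).fun_smul (hU j)]
  have h (j : Fin m) : dOp T (fun x => x j • U j (f x)) x =
      T j (U j (f x)) + x j • ∑ i, T i (U j (pd i f x)) := by
    rw [dOp_mul_smul T ((contDiff_coord j).diffAt x) (hU j)]
    simp only [pd_coord, ite_smul, one_smul, zero_smul, Finset.sum_ite_eq', Finset.mem_univ, if_true,
      dOp, pd_lin _ (U j) hf]
  simp only [h, Finset.sum_add_distrib]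

lemma contDiff_dOp {f : Euc m → Cl 𝕜 m} (hf : ContDiff ℝ ∞ f) : ContDiff ℝ ∞ (dOp T f) :=
  ContDiff.sum fun i _ => contDiff_lin (T i) (contDiff_pd i hf)

lemma IsHom.dOp {k : ℕ} {f : Euc m → Cl 𝕜 m} (hf : IsHom (k + 1) f) : IsHom k (dOp T f) :=
  IsHom.sum _ fun i _ => (hf.pd i).lin (T i)

lemma pd_dOp (i : Fin m) {f : Euc m → Cl 𝕜 m} (hf : ContDiff ℝ ∞ f) (x : Euc m) :
    pd i (dOp T f) x = dOp T (pd i f) x := by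
  unfold GMT.dOp
  rw [pd_sum i _ fun j _ => (contDiff_lin (T j) (contDiff_pd j hf)).diffAt x]
  simp only [pd_lin i _ ((contDiff_pd _ hf).diffAt x), pd_comm i _ hf x]

/-- Second derivatives are symmetric while `T_i T_j` is antisymmetric, so the double sum equals its
negative. -/
lemma dOp_dOp {f : Euc m → Cl 𝕜 m} (hT : ∀ i j a, T i (T j a) = -T j (T i a))
    (hf : ContDiff ℝ ∞ f) (x : Euc m) : dOp T (dOp T f) x = 0 := by
  have h : dOp T (dOp T f) x = ∑ i, ∑ j, T i (T j (pd j (pd i f) x)) := by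
    rw [GMT.dOp]
    simp only [pd_dOp T _ hf]
    simp only [GMT.dOp, map_sum]
  have h2 : dOp T (dOp T f) x = -dOp T (dOp T f) x := by
    conv_lhs => rw [h, Finset.sum_comm]
    rw [h, ← Finset.sum_neg_distrib]
    refine Finset.sum_congr rfl fun i _ => ?_
    rw [← Finset.sum_neg_distrib]
    refine Finset.sum_congr rfl fun j _ => ?_
    rw [hT j i, pd_comm i j hf]
  exact eq_zero_of_eq_neg_self h2

end dOp

/-! ### The operators `∂∧`, `∂•` and their relations with `x∧`, `x•` -/

lemma dw_dw {f : Euc m → Cl 𝕜 m} (hf : ContDiff ℝ ∞ f) (x : Euc m) : dw (dw f) x = 0 :=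
  dOp_dOp _ wedge_wedge hf x

lemma dc_dc {f : Euc m → Cl 𝕜 m} (hf : ContDiff ℝ ∞ f) (x : Euc m) : dc (dc f) x = 0 :=
  dOp_dOp _ dot_dot hf x

lemma dw_mem {s : ℕ} {f : Euc m → Cl 𝕜 m} (hf : ContDiff ℝ ∞ f)
    (h : ∀ x, f x ∈ multivectors 𝕜 m s) (x : Euc m) : dw f x ∈ multivectors 𝕜 m (s + 1) :=
  Submodule.sum_mem _ fun i _ => wedge_mem i (pd_mem i _ h x (hf.diffAt x))

lemma dc_mem {s : ℕ} {f : Euc m → Cl 𝕜 m} (hf : ContDiff ℝ ∞ f)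
    (h : ∀ x, f x ∈ multivectors 𝕜 m (s + 1)) (x : Euc m) : dc f x ∈ multivectors 𝕜 m s :=
  Submodule.sum_mem _ fun i _ => dot_mem i (pd_mem i _ h x (hf.diffAt x))

lemma dc_scalar {f : Euc m → Cl 𝕜 m} (hf : ContDiff ℝ ∞ f)
    (h : ∀ x, f x ∈ multivectors 𝕜 m 0) (x : Euc m) : dc f x = 0 :=
  Finset.sum_eq_zero fun i _ => dot_scalar i (pd_mem i _ h x (hf.diffAt x))

lemma IsHom.xWedge {k : ℕ} {f : Euc m → Cl 𝕜 m} (hf : IsHom k f) :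
    IsHom (k + 1) fun x => xWedge x (f x) :=
  (IsHom.sum Finset.univ fun i _ => (hf.lin (wedge i)).coord_smul i).congr
    fun x => (xWedge_eq x (f x)).symm

lemma IsHom.xDot {k : ℕ} {f : Euc m → Cl 𝕜 m} (hf : IsHom k f) :
    IsHom (k + 1) fun x => xDot x (f x) :=
  (IsHom.sum Finset.univ fun i _ => (hf.lin (dot i)).coord_smul i).congr
    fun x => (xDot_eq x (f x)).symm

lemma IsHom.vec_mul {k : ℕ} {f : Euc m → Cl 𝕜 m} (hf : IsHom k f) :
    IsHom (k + 1) fun x => vec 𝕜 x * f x :=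
  (hf.xWedge.add hf.xDot).congr fun x => xWedge_add_xDot x (f x)

lemma dw_xWedge {f : Euc m → Cl 𝕜 m} {x : Euc m} (hf : DifferentiableAt ℝ f x) :
    dw (fun x => xWedge x (f x)) x = -xWedge x (dw f x) := by
  have h0 (i : Fin m) (a : Cl 𝕜 m) : wedge i (wedge i a) = 0 := eq_zero_of_eq_neg_self (wedge_wedge i i a)
  simp only [xWedge_eq]
  rw [dw, dOp_x_smul wedge wedge hf]
  simp only [h0, Finset.sum_const_zero, zero_add, dOp, map_sum, ← Finset.sum_neg_distrib]
  refine Finset.sum_congr rfl fun j _ => ?_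
  rw [← smul_neg, ← Finset.sum_neg_distrib]
  congr 1
  exact Finset.sum_congr rfl fun i _ => wedge_wedge _ _ _

lemma dc_xDot {f : Euc m → Cl 𝕜 m} {x : Euc m} (hf : DifferentiableAt ℝ f x) :
    dc (fun x => xDot x (f x)) x = -xDot x (dc f x) := by
  have h0 (i : Fin m) (a : Cl 𝕜 m) : dot i (dot i a) = 0 := eq_zero_of_eq_neg_self (dot_dot i i a)
  simp only [xDot_eq]
  rw [dc, dOp_x_smul dot dot hf]
  simp only [h0, Finset.sum_const_zero, zero_add, dOp, map_sum, ← Finset.sum_neg_distrib]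
  refine Finset.sum_congr rfl fun j _ => ?_
  rw [← smul_neg, ← Finset.sum_neg_distrib]
  congr 1
  exact Finset.sum_congr rfl fun i _ => dot_dot _ _ _

/-- The anticommutator of `∂∧` and `x•` is minus the Euler operator plus the grade: `k` comes from
Euler's formula and `s` from `sum_wedge_dot`. In `dc_xWedge` the grade is replaced by `m - s`. -/
lemma dw_xDot {s k : ℕ} {f : Euc m → Cl 𝕜 m} (hf : IsHom k f) {x : Euc m}
    (h : f x ∈ multivectors 𝕜 m s) :
    dw (fun x => xDot x (f x)) x = -xDot x (dw f x) - ((k : ℝ) + s) • f x := by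
  simp only [xDot_eq]
  rw [dw, dOp_x_smul wedge dot (hf.diffAt x), sum_wedge_dot h]
  simp only [wedge_dot, Finset.sum_sub_distrib, Finset.sum_ite_eq', Finset.mem_univ, if_true,
    smul_sub, Finset.sum_neg_distrib, smul_neg, hf.euler, dOp, map_sum, add_smul]
  rw [← RCLike.ofReal_natCast (K := 𝕜) s, real_smul_eq]
  abel

lemma dc_xWedge {s k : ℕ} {f : Euc m → Cl 𝕜 m} (hf : IsHom k f) {x : Euc m}
    (h : f x ∈ multivectors 𝕜 m s) :
    dc (fun x => xWedge x (f x)) x = -xWedge x (dc f x) - ((k : ℝ) + m - s) • f x := by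
  simp only [xWedge_eq]
  rw [dc, dOp_x_smul dot wedge (hf.diffAt x), sum_dot_wedge h]
  simp only [dot_wedge, Finset.sum_sub_distrib, Finset.sum_ite_eq', Finset.mem_univ, if_true,
    smul_sub, Finset.sum_neg_distrib, smul_neg, hf.euler, dOp, map_sum, add_smul, sub_smul]
  rw [← RCLike.ofReal_natCast (K := 𝕜) s, real_smul_eq, ← RCLike.ofReal_natCast (K := 𝕜) m,
    real_smul_eq]
  abel

/-! ### Homogeneous monogenic multivector fields -/

/-- `f` is an `s`-vector valued homogeneous polynomial of degree `k` with `∂f = 0`. -/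
structure HomMonogenic (s k : ℕ) (f : Euc m → Cl 𝕜 m) : Prop where
  hom : IsHom k f
  grade : ∀ x, f x ∈ multivectors 𝕜 m s
  dirac_eq : ∀ x, dirac f x = 0

namespace HomMonogenic

variable {s k : ℕ} {f g : Euc m → Cl 𝕜 m}

/-- The two parts of `∂f` have grades `s + 1` and `s - 1`, so they are orthogonal; their sum being
zero, each is zero. For `s = 0` the lowering part is absent. -/
lemma dw_eq (hf : HomMonogenic s k f) (x : Euc m) : dw f x = 0 := by
  have h := hf.dirac_eq x
  rw [dirac_eq_dw_add_dc] at h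
  have h1 := dw_mem hf.hom.smooth hf.grade x
  rcases s with _ | s
  · rwa [dc_scalar hf.hom.smooth hf.grade, add_zero] at h
  · have h2 := dc_mem hf.hom.smooth hf.grade x
    have h3 := inner_eq_zero_of_grade_ne (by omega) h1 h2
    rw [eq_neg_of_add_eq_zero_right h, inner_neg_right, neg_eq_zero] at h3
    exact inner_self_eq_zero.1 h3

lemma dc_eq (hf : HomMonogenic s k f) (x : Euc m) : dc f x = 0 := by
  have h := hf.dirac_eq x
  rwa [dirac_eq_dw_add_dc, hf.dw_eq, zero_add] at h

lemma of_dw_dc (h : IsHom k f) (hs : ∀ x, f x ∈ multivectors 𝕜 m s) (h1 : ∀ x, dw f x = 0)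
    (h2 : ∀ x, dc f x = 0) : HomMonogenic s k f :=
  ⟨h, hs, fun x => by rw [dirac_eq_dw_add_dc, h1, h2, add_zero]⟩

lemma add (hf : HomMonogenic s k f) (hg : HomMonogenic s k g) :
    HomMonogenic s k fun x => f x + g x :=
  ⟨hf.hom.add hg.hom, fun x => Submodule.add_mem _ (hf.grade x) (hg.grade x), fun x => by
    rw [dirac_eq_dOp, dOp_add _ (hf.hom.diffAt x) (hg.hom.diffAt x), ← dirac_eq_dOp, ← dirac_eq_dOp,
      hf.dirac_eq, hg.dirac_eq, add_zero]⟩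

lemma smul (c : 𝕜) (hf : HomMonogenic s k f) : HomMonogenic s k fun x => c • f x :=
  ⟨hf.hom.lin (c • LinearMap.id), fun x => Submodule.smul_mem _ _ (hf.grade x), fun x => by
    rw [dirac_eq_dOp, dOp_smul _ c (hf.hom.diffAt x), ← dirac_eq_dOp, hf.dirac_eq, smul_zero]⟩

/-- Here `x • f = 0`, so the anticommutator relation reads `(k + 1) f = 0`. With `eq_zero_of_top`,
this is why `branching` allows only degree zero in the extreme grades. -/
lemma eq_zero_of_scalar (hf : HomMonogenic 0 (k + 1) f) (x : Euc m) : f x = 0 := by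
  have h := dw_xDot hf.hom (hf.grade x)
  have h0 (x : Euc m) : GMT.xDot x (f x) = 0 := xDot_scalar x (hf.grade x)
  rw [hf.dw_eq, map_zero, neg_zero, zero_sub] at h
  simp only [h0, dw, dOp, pd_const, map_zero, Finset.sum_const_zero] at h
  refine (smul_eq_zero.1 (neg_eq_zero.1 h.symm)).resolve_left ?_
  push_cast; positivity

lemma eq_zero_of_top (hf : HomMonogenic m (k + 1) f) (x : Euc m) : f x = 0 := by
  have h := dc_xWedge hf.hom (hf.grade x)
  have h0 (x : Euc m) : GMT.xWedge x (f x) = 0 := xWedge_top x (hf.grade x)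
  rw [hf.dc_eq, map_zero, neg_zero, zero_sub] at h
  simp only [h0, dc, dOp, pd_const, map_zero, Finset.sum_const_zero] at h
  refine (smul_eq_zero.1 (neg_eq_zero.1 h.symm)).resolve_left ?_
  push_cast; ring_nf; positivity

end HomMonogenic

/-! ### The operator `x∧ + βx•` on monogenic fields -/

variable (m) in
/-- The factor `β = -(k + m - s)/(k + s)`. -/
def betaFactor (s k : ℕ) : ℝ := -((k : ℝ) + m - s) / (k + s)

/-- `x ∧ f + β x • f` -/
def raise (s k : ℕ) (f : Euc m → Cl 𝕜 m) (x : Euc m) : Cl 𝕜 m :=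
  xWedge x (f x) + betaFactor m s k • xDot x (f x)

lemma IsHom.raise {s k : ℕ} {f : Euc m → Cl 𝕜 m} (hf : IsHom k f) : IsHom (k + 1) (raise s k f) :=
  hf.xWedge.add (hf.xDot.clm (betaFactor m s k • ContinuousLinearMap.id ℝ _))

lemma dw_raise {s k : ℕ} {f : Euc m → Cl 𝕜 m} (hf : HomMonogenic s k f) (x : Euc m) :
    dw (raise s k f) x = -((betaFactor m s k * (k + s)) • f x) := by
  unfold raise
  rw [dw, dOp_add _ (hf.hom.xWedge.diffAt x) ((hf.hom.xDot.diffAt x).fun_const_smul _),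
    dOp_real_smul _ _ (hf.hom.xDot.diffAt x)]
  have h1 := dw_xWedge (hf.hom.diffAt x)
  have h2 := dw_xDot hf.hom (hf.grade x)
  rw [hf.dw_eq, map_zero] at h1 h2
  rw [dw] at h1 h2
  rw [h1, h2, mul_smul]
  simp

lemma dc_raise {s k : ℕ} {f : Euc m → Cl 𝕜 m} (hf : HomMonogenic s k f) (x : Euc m) :
    dc (raise s k f) x = -(((k : ℝ) + m - s) • f x) := by
  unfold raise
  rw [dc, dOp_add _ (hf.hom.xWedge.diffAt x) ((hf.hom.xDot.diffAt x).fun_const_smul _),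
    dOp_real_smul _ _ (hf.hom.xDot.diffAt x)]
  have h1 := dc_xDot (hf.hom.diffAt x)
  have h2 := dc_xWedge hf.hom (hf.grade x)
  rw [hf.dc_eq, map_zero] at h1 h2
  rw [dc] at h1 h2
  rw [h1, h2]
  simp

lemma betaFactor_mul {s : ℕ} (k : ℕ) (hs : 1 ≤ s) :
    betaFactor m s k * (k + s) = -((k : ℝ) + m - s) := by
  have : (k : ℝ) + s ≠ 0 := by positivity
  rw [betaFactor, div_mul_cancel₀ _ this]

lemma betaFactor_neg {s : ℕ} (k : ℕ) (hs : 1 ≤ s) (hs' : s < m) : betaFactor m s k < 0 := by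
  rw [betaFactor, neg_div, neg_lt_zero]
  have h : (s : ℝ) < m := by exact_mod_cast hs'
  have h1 : (1 : ℝ) ≤ s := by exact_mod_cast hs
  have h2 : (0 : ℝ) ≤ k := by positivity
  exact div_pos (by linarith) (by linarith)

/-- The weight `β` is chosen so that the multiples of `f` given by `∂∧` and `∂•` cancel; `1 ≤ s`
keeps its denominator `k + s` nonzero. -/
lemma dirac_raise {s k : ℕ} (hs : 1 ≤ s) {f : Euc m → Cl 𝕜 m} (hf : HomMonogenic s k f)
    (x : Euc m) : dirac (raise s k f) x = 0 := by
  rw [dirac_eq_dw_add_dc, dw_raise hf, dc_raise hf, betaFactor_mul k hs, neg_smul, neg_neg, add_neg_cancel]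

/-! ### Gegenbauer polynomials -/

lemma rising_zero (a : ℝ) : rising a 0 = 1 := by simp [rising]

lemma rising_succ (a : ℝ) (n : ℕ) : rising a (n + 1) = rising a n * (a + n) :=
  ascPochhammer_succ_eval n a

lemma rising_succ_left (a : ℝ) (n : ℕ) : rising a (n + 1) = a * rising (a + 1) n := by
  rw [rising, rising, ascPochhammer_succ_left]
  simp

lemma rising_pos {a : ℝ} (ha : 0 < a) (n : ℕ) : 0 < rising a n := ascPochhammer_pos n a ha

/-- The coefficient of `(2z)^{n-2i} w^i` in `w^{n/2} C_n^ν(z/√w)`. -/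
def gegCoef (ν : ℝ) (n i : ℕ) : ℝ :=
  if 2 * i ≤ n then (-1) ^ i * rising ν (n - i) / (i.factorial * (n - 2 * i).factorial) else 0

/-- The homogeneous Gegenbauer polynomial `w^{n/2} C_n^ν(z/√w)`. -/
def geg (ν : ℝ) (n : ℕ) (z w : ℝ) : ℝ :=
  ∑ i ∈ Finset.range (n + 1), gegCoef ν n i * ((2 * z) ^ (n - 2 * i) * w ^ i)

lemma geg_zero (ν z w : ℝ) : geg ν 0 z w = 1 := by simp [geg, gegCoef, rising_zero]

lemma pow_mul_gegenbauer (ν : ℝ) (n : ℕ) {z ρ : ℝ} (h : ρ = 0 → z = 0) :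
    ρ ^ n * gegenbauer ν n (z / ρ) = geg ν n z (ρ ^ 2) := by
  rw [geg, gegenbauer, Finset.mul_sum]
  rw [← Finset.sum_subset (Finset.range_mono (show n / 2 + 1 ≤ n + 1 by omega))]
  · refine Finset.sum_congr rfl fun i hi => ?_
    rw [Finset.mem_range] at hi
    have hi' : 2 * i ≤ n := by omega
    rw [gegCoef, if_pos hi']
    -- For `ρ = 0` the quotient `z / ρ` has a default value. Both sides are still equal, since `z =
    -- 0` and a homogeneous polynomial of positive degree vanishes at the origin.
    by_cases hρ : ρ = 0
    · subst hρ
      rw [h rfl]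
      rcases Nat.eq_zero_or_pos n with rfl | hn
      · have : i = 0 := by omega
        subst this; simp
      · rw [zero_pow (by omega : n ≠ 0), zero_mul]
        rcases Nat.eq_zero_or_pos i with rfl | hi0
        · simp; omega
        · simp; omega
    · obtain ⟨l, rfl⟩ := Nat.exists_eq_add_of_le hi'
      rw [show 2 * i + l - 2 * i = l by omega]
      have : ρ ^ (2 * i + l) * (2 * (z / ρ)) ^ l = (2 * z) ^ l * (ρ ^ 2) ^ i := by
        rw [pow_add, pow_mul, mul_assoc, ← mul_pow, show ρ * (2 * (z / ρ)) = 2 * z by field_simp]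
        ring
      rw [← this]; ring
  · intro i _ hi
    rw [Finset.mem_range] at hi
    rw [gegCoef, if_neg (by omega), zero_mul]

/-- `∂_z` of the homogeneous Gegenbauer polynomial -/
def gegZ (ν : ℝ) : ℕ → ℝ → ℝ → ℝ
  | 0, _, _ => 0
  | n + 1, z, w => 2 * ν * geg (ν + 1) n z w

/-- `∂_w` of the homogeneous Gegenbauer polynomial -/
def gegW (ν : ℝ) : ℕ → ℝ → ℝ → ℝ
  | 0, _, _ => 0
  | 1, _, _ => 0
  | n + 2, z, w => -ν * geg (ν + 1) n z w

/-- The rule `∂_z C_n^ν = 2ν C_{n-1}^{ν+1}`, coefficient by coefficient from `(ν)_{k+1} = ν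
(ν+1)_k`. The companion `sum_gegCoef_w` differentiates in `w`, which lowers `n` by two. -/
lemma sum_gegCoef_z (ν : ℝ) (n : ℕ) (z w : ℝ) :
    ∑ i ∈ Finset.range (n + 1),
      gegCoef ν n i * (((n - 2 * i : ℕ) : ℝ) * (2 * z) ^ (n - 2 * i - 1) * 2 * w ^ i) =
      gegZ ν n z w := by
  rcases n with _ | n
  · simp [gegZ]
  rw [Finset.sum_range_succ, gegCoef, if_neg (by omega), zero_mul, add_zero, gegZ, geg,
    Finset.mul_sum]
  refine Finset.sum_congr rfl fun i _ => ?_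
  rw [gegCoef, gegCoef]
  by_cases hi : 2 * i ≤ n
  · obtain ⟨l, rfl⟩ := Nat.exists_eq_add_of_le hi
    rw [if_pos hi, if_pos (by omega), show 2 * i + l + 1 - i = i + l + 1 by omega,
      show 2 * i + l + 1 - 2 * i = l + 1 by omega, show 2 * i + l - i = i + l by omega,
      show 2 * i + l - 2 * i = l by omega, rising_succ_left, Nat.factorial_succ, Nat.add_sub_cancel]
    have h1 : (i.factorial : ℝ) ≠ 0 := by positivity
    have h2 : (l.factorial : ℝ) ≠ 0 := by positivity
    have h3 : (l : ℝ) + 1 ≠ 0 := by positivity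
    push_cast
    field_simp
  · rw [if_neg hi, show n + 1 - 2 * i = 0 by omega]
    simp

lemma sum_gegCoef_w (ν : ℝ) (n : ℕ) (z w : ℝ) :
    ∑ i ∈ Finset.range (n + 1), gegCoef ν n i * ((2 * z) ^ (n - 2 * i) * (i * w ^ (i - 1))) =
      gegW ν n z w := by
  rcases n with _ | _ | n
  · simp [gegW]
  · simp [gegW, gegCoef, Finset.sum_range_succ]
  rw [Finset.sum_range_succ', gegW, geg, Finset.mul_sum, Finset.sum_range_succ, gegCoef,
    if_neg (by omega), zero_mul, add_zero]
  simp only [Nat.cast_zero, zero_mul, mul_zero, add_zero]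
  refine Finset.sum_congr rfl fun i _ => ?_
  rw [gegCoef, gegCoef]
  by_cases hi : 2 * i ≤ n
  · obtain ⟨l, rfl⟩ := Nat.exists_eq_add_of_le hi
    rw [if_pos hi, if_pos (by omega), show 2 * i + l + 2 - (i + 1) = i + l + 1 by omega,
      show 2 * i + l + 2 - 2 * (i + 1) = l by omega, show 2 * i + l - i = i + l by omega,
      show 2 * i + l - 2 * i = l by omega, rising_succ_left, Nat.factorial_succ, Nat.add_sub_cancel]
    have h1 : (i.factorial : ℝ) ≠ 0 := by positivity
    have h2 : (l.factorial : ℝ) ≠ 0 := by positivity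
    have h3 : (i : ℝ) + 1 ≠ 0 := by positivity
    push_cast
    field_simp
    ring
  · rw [if_neg hi, if_neg (by omega)]
    simp

/-- The contiguous relation between the parameters `ν` and `ν + 1`. It yields both the Appell
property of `harmonicFactor` and the normal equation in `pd_last_harmonicFactor_eq`. -/
lemma geg_contiguous (ν : ℝ) (n : ℕ) (z w : ℝ) :
    (n + 1 + 2 * ν) * geg ν (n + 1) z w =
      2 * ν * (geg (ν + 1) (n + 1) z w - z * geg (ν + 1) n z w) := by
  have h : z * geg (ν + 1) n z w = ∑ i ∈ Finset.range (n + 1 + 1),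
      (if i ≤ n then gegCoef (ν + 1) n i else 0) * (z * ((2 * z) ^ (n - 2 * i) * w ^ i)) := by
    rw [Finset.sum_range_succ, if_neg (by omega), zero_mul, add_zero, geg, Finset.mul_sum]
    refine Finset.sum_congr rfl fun i hi => ?_
    rw [Finset.mem_range] at hi
    rw [if_pos (by omega)]; ring
  rw [h, geg, geg, ← Finset.sum_sub_distrib, Finset.mul_sum, Finset.mul_sum]
  refine Finset.sum_congr rfl fun i _ => ?_
  rw [gegCoef, gegCoef, gegCoef]
  by_cases hi : 2 * i ≤ n
  · obtain ⟨l, rfl⟩ := Nat.exists_eq_add_of_le hi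
    rw [if_pos hi, if_pos (by omega), if_pos (by omega), if_pos (by omega),
      show 2 * i + l + 1 - i = i + l + 1 by omega,
      show 2 * i + l + 1 - 2 * i = l + 1 by omega, show 2 * i + l - i = i + l by omega,
      show 2 * i + l - 2 * i = l by omega, rising_succ_left, rising_succ, Nat.factorial_succ]
    have h1 : (i.factorial : ℝ) ≠ 0 := by positivity
    have h2 : (l.factorial : ℝ) ≠ 0 := by positivity
    have h3 : (l : ℝ) + 1 ≠ 0 := by positivity
    push_cast
    field_simp
    ring
  -- This is the term free of `z`: it occurs in the two polynomials of degree `n + 1` but not in `z`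
  -- times the one of degree `n`.
  · by_cases hi2 : 2 * i = n + 1
    · have e : n + 1 - i = i := by omega
      obtain ⟨i', rfl⟩ : ∃ i', i = i' + 1 := ⟨i - 1, by omega⟩
      rw [if_neg hi, if_pos (by omega), if_pos (by omega), e, hi2, Nat.sub_self, rising_succ_left,
        rising_succ]
      have hn : (n : ℝ) + 1 = 2 * (i' + 1) := by exact_mod_cast hi2.symm
      rw [hn]
      have h1 : ((i' + 1).factorial : ℝ) ≠ 0 := by positivity
      simp only [ite_self, zero_mul, sub_zero]
      field_simp
      ring
    · rw [if_neg hi, if_neg (by omega), if_neg (by omega)]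
      simp

/-! ### Product, power and chain rules for the Gegenbauer polynomials -/

section PartialMul

lemma pd_mul (i : Fin m) {f g : Euc m → ℝ} {x : Euc m} (hf : DifferentiableAt ℝ f x)
    (hg : DifferentiableAt ℝ g x) :
    pd i (fun x => f x * g x) x = pd i f x * g x + f x * pd i g x :=
  pd_smul i hf hg

lemma pd_pow (i : Fin m) (k : ℕ) {f : Euc m → ℝ} {x : Euc m} (hf : DifferentiableAt ℝ f x) :
    pd i (fun x => f x ^ k) x = k * f x ^ (k - 1) * pd i f x := by
  have h := hf.hasFDerivAt.pow k
  rw [pd, h.fderiv]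
  simp [pd, mul_assoc]

lemma contDiff_geg (ν : ℝ) (n : ℕ) {z w : Euc m → ℝ} (hz : ContDiff ℝ ∞ z) (hw : ContDiff ℝ ∞ w) :
    ContDiff ℝ ∞ fun x => geg ν n (z x) (w x) := by
  unfold geg
  fun_prop

lemma pd_geg (i : Fin m) (ν : ℝ) (n : ℕ) {z w : Euc m → ℝ} (hz : ContDiff ℝ ∞ z)
    (hw : ContDiff ℝ ∞ w) (x : Euc m) :
    pd i (fun x => geg ν n (z x) (w x)) x =
      pd i z x * gegZ ν n (z x) (w x) + pd i w x * gegW ν n (z x) (w x) := by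
  rw [← sum_gegCoef_z, ← sum_gegCoef_w]
  unfold geg
  have h2z : ContDiff ℝ ∞ fun x => 2 * z x := contDiff_const.mul hz
  rw [pd_sum i _ fun a _ => (contDiff_const.mul ((h2z.pow _).mul (hw.pow _))).diffAt x,
    Finset.mul_sum, Finset.mul_sum, ← Finset.sum_add_distrib]
  refine Finset.sum_congr rfl fun a _ => ?_
  rw [pd_mul i (contDiff_const.diffAt x) (((h2z.pow _).mul (hw.pow _)).diffAt x), pd_const,
    pd_mul i ((h2z.pow _).diffAt x) ((hw.pow _).diffAt x), pd_pow i _ (h2z.diffAt x),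
    pd_pow i _ (hw.diffAt x), pd_mul i (contDiff_const.diffAt x) (hz.diffAt x), pd_const]
  ring

end PartialMul

/-! ### The scalar factors -/

/-- The normalizing constant `(j+1)_n / (r-1+2j)_n`. -/
def normCoef (r n j : ℕ) : ℝ := rising (j + 1) n / rising ((r : ℝ) - 1 + 2 * j) n

lemma harmonicFactor_eq (n j : ℕ) (x : Euc (r + 1)) :
    harmonicFactor n j x =
      normCoef r n j * geg (((r : ℝ) - 1) / 2 + j) n (x (Fin.last r)) (‖x‖ ^ 2) := by
  rw [harmonicFactor, pow_mul_gegenbauer, normCoef]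
  · push_cast
    rw [show (r : ℝ) + 1 - 2 + 2 * j = r - 1 + 2 * j by ring,
      show ((r : ℝ) + 1) / 2 + j - 1 = (r - 1) / 2 + j by ring]
  · intro h
    rw [norm_eq_zero.1 h]; rfl

lemma contDiff_harmonicFactor (n j : ℕ) :
    ContDiff ℝ ∞ (harmonicFactor n j : Euc (r + 1) → ℝ) := by
  rw [show (harmonicFactor n j : Euc (r + 1) → ℝ) = _ from funext (harmonicFactor_eq n j)]
  exact contDiff_const.mul (contDiff_geg _ _ (contDiff_coord _) contDiff_normSq)

lemma harmonicFactor_zero (j : ℕ) (x : Euc (r + 1)) : harmonicFactor 0 j x = 1 := by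
  rw [harmonicFactor_eq, geg_zero, normCoef, rising_zero, rising_zero]; norm_num

lemma geg_smul (ν : ℝ) (n : ℕ) (c z w : ℝ) : geg ν n (c * z) (c ^ 2 * w) = c ^ n * geg ν n z w := by
  rw [geg, geg, Finset.mul_sum]
  refine Finset.sum_congr rfl fun i _ => ?_
  by_cases hi : 2 * i ≤ n
  · obtain ⟨l, rfl⟩ := Nat.exists_eq_add_of_le hi
    rw [show 2 * i + l - 2 * i = l by omega]
    ring
  · rw [gegCoef, if_neg hi]; simp

lemma isHom_harmonicFactor (n j : ℕ) : IsHom n (harmonicFactor n j : Euc (r + 1) → ℝ) := by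
  refine ⟨contDiff_harmonicFactor n j, fun c x => ?_⟩
  rw [harmonicFactor_eq, harmonicFactor_eq, norm_smul, mul_pow, Real.norm_eq_abs, sq_abs,
    PiLp.smul_apply, smul_eq_mul, smul_eq_mul, geg_smul]
  ring

lemma pd_harmonicFactor (i : Fin (r + 1)) (n j : ℕ) (x : Euc (r + 1)) :
    pd i (harmonicFactor n j) x = normCoef r n j *
      ((if i = Fin.last r then 1 else 0) * gegZ (((r : ℝ) - 1) / 2 + j) n (x (Fin.last r)) (‖x‖ ^ 2) +
        2 * x i * gegW (((r : ℝ) - 1) / 2 + j) n (x (Fin.last r)) (‖x‖ ^ 2)) := by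
  rw [pd_congr (harmonicFactor_eq n j), pd_mul i (contDiff_const.diffAt x)
    ((contDiff_geg _ _ (contDiff_coord _) contDiff_normSq).diffAt x), pd_const,
    pd_geg i _ _ (contDiff_coord _) contDiff_normSq, pd_coord, pd_normSq]
  ring

/-- The constant `(j+1)/(r+2j)`. -/
def sideCoef (r j : ℕ) : ℝ := (j + 1) / (r + 2 * j)

lemma index_pos (hr : 2 ≤ r) (j : ℕ) : 0 < (r : ℝ) - 1 + 2 * j := by
  have : (2 : ℝ) ≤ r := by exact_mod_cast hr
  have h0 : (0 : ℝ) ≤ j := by positivity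
  linarith

lemma normCoef_succ (hr : 2 ≤ r) (n j : ℕ) :
    normCoef r (n + 1) j * ((r : ℝ) - 1 + 2 * j + n) = (j + 1 + n) * normCoef r n j := by
  have h := index_pos hr j
  have h1 := (rising_pos h n).ne'
  have h2 : (r : ℝ) - 1 + 2 * j + n ≠ 0 := by positivity
  rw [normCoef, normCoef, rising_succ, rising_succ]
  generalize (r : ℝ) - 1 + 2 * j = a at *
  field_simp

/-- Compares the normalizations at `j + 1` and `j`. Numerators shift by one and denominators by two,
which is why `sideCoef` appears. -/
lemma sideCoef_mul_normCoef (hr : 2 ≤ r) (n j : ℕ) :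
    sideCoef r j * normCoef r n (j + 1) * ((r : ℝ) + 2 * j + n) * ((r : ℝ) - 1 + 2 * j + n) =
      normCoef r n j * ((r : ℝ) - 1 + 2 * j) * (j + 1 + n) := by
  have h := index_pos hr j
  have h1 : 0 < (r : ℝ) - 1 + 2 * j + 1 := by positivity
  have h2 : 0 < (r : ℝ) - 1 + 2 * j + 1 + 1 := by positivity
  have e0 := rising_succ ((j : ℝ) + 1) n
  have e1 := rising_succ_left ((j : ℝ) + 1) n
  have e2 := rising_succ_left ((r : ℝ) - 1 + 2 * j) (n + 1)
  have e3 := rising_succ_left ((r : ℝ) - 1 + 2 * j + 1) n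
  have e4 := rising_succ ((r : ℝ) - 1 + 2 * j) (n + 1)
  have e5 := rising_succ ((r : ℝ) - 1 + 2 * j) n
  have p1 := rising_pos h n
  have p2 := rising_pos h2 n
  rw [sideCoef, normCoef, normCoef]
  push_cast at *
  rw [show (r : ℝ) - 1 + 2 * (j + 1) = r - 1 + 2 * j + 1 + 1 by ring,
    show (r : ℝ) + 2 * j = r - 1 + 2 * j + 1 by ring]
  rw [e3, e4, e5] at e2
  rw [e0] at e1
  set a := (r : ℝ) - 1 + 2 * j
  have e2' : rising a n * (a + n) * (a + (n + 1)) = a * ((a + 1) * rising (a + 1 + 1) n) := e2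
  field_simp
  linear_combination (-(a * (a + 1) * rising (a + 1 + 1) n)) * e1 +
    ((j + 1) * rising (j + 1 + 1) n) * e2'

/-- The Appell property in the last variable, for which the constant `normCoef` is designed. The
derivatives through `x_{r+1}` and through `|x|²` combine by `geg_contiguous`. -/
lemma pd_last_harmonicFactor (hr : 2 ≤ r) (n j : ℕ) (x : Euc (r + 1)) :
    pd (Fin.last r) (harmonicFactor (n + 1) j) x = (j + 1 + n) * harmonicFactor n j x := by
  have hν : (r : ℝ) - 1 + 2 * j = 2 * (((r : ℝ) - 1) / 2 + j) := by ring
  rw [pd_harmonicFactor, if_pos rfl, harmonicFactor_eq]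
  have hc := normCoef_succ hr n j
  set ν := ((r : ℝ) - 1) / 2 + j
  set z := x (Fin.last r)
  set w := ‖x‖ ^ 2
  rw [hν] at hc
  rcases n with _ | n
  · simp only [gegZ, gegW, geg_zero]
    push_cast at *
    linear_combination hc
  · have h := geg_contiguous ν n z w
    simp only [gegZ, gegW]
    push_cast at *
    linear_combination geg ν (n + 1) z w * hc - normCoef r (n + 1 + 1) j * h

lemma pd_castSucc_harmonicFactor (hr : 2 ≤ r) (n j : ℕ) (i : Fin r) (x : Euc (r + 1)) :
    pd i.castSucc (harmonicFactor (n + 2) j) x =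
      -(sideCoef r j * (j + n + 2) * x i.castSucc * harmonicFactor n (j + 1) x) := by
  have hν : (r : ℝ) - 1 + 2 * j = 2 * (((r : ℝ) - 1) / 2 + j) := by ring
  rw [pd_harmonicFactor, if_neg (Fin.castSucc_lt_last i).ne, harmonicFactor_eq]
  have hc1 := normCoef_succ hr (n + 1) j
  have hc2 := normCoef_succ hr n j
  have hc3 := sideCoef_mul_normCoef hr n j
  have h := index_pos hr j
  have hp : (r : ℝ) + 2 * j + n ≠ 0 := by
    have : 0 < (r : ℝ) - 1 + 2 * j + n := by positivity
    linarith
  have hp' : (r : ℝ) - 1 + 2 * j + n ≠ 0 := by positivity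
  simp only [gegW]
  push_cast at *
  rw [show ((r : ℝ) - 1) / 2 + (j + 1) = ((r : ℝ) - 1) / 2 + j + 1 by ring]
  have key : normCoef r (n + 2) j * ((r : ℝ) - 1 + 2 * j) =
      sideCoef r j * (j + n + 2) * normCoef r n (j + 1) := by
    have h2 : (r : ℝ) - 1 + 2 * j + (n + 1) ≠ 0 := by positivity
    refine mul_right_cancel₀ (mul_ne_zero h2 hp') ?_
    linear_combination ((r : ℝ) - 1 + 2 * j) * (((r : ℝ) - 1 + 2 * j + n) * hc1 +
      (j + 1 + (n + 1)) * hc2) - (j + n + 2) * hc3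
  linear_combination (-(x i.castSucc) * geg (((r : ℝ) - 1) / 2 + j + 1) n (x (Fin.last r)) (‖x‖ ^ 2)) *
    key

/-- `geg_contiguous` with the normalizing constants inserted, in the shape needed for the normal
derivative in `pd_last_harmonicFactor_eq`. -/
lemma harmonicFactor_contiguous (hr : 2 ≤ r) (n j : ℕ) (x : Euc (r + 1)) :
    (j + n + 2) * harmonicFactor (n + 1) j x =
      sideCoef r j * ((n + 1 + r + 2 * j) * harmonicFactor (n + 1) (j + 1) x -
        x (Fin.last r) * ((j + n + 2) * harmonicFactor n (j + 1) x)) := by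
  simp only [harmonicFactor_eq]
  have h := geg_contiguous (((r : ℝ) - 1) / 2 + j) n (x (Fin.last r)) (‖x‖ ^ 2)
  have hc1 := normCoef_succ hr n (j + 1)
  have hc2 := normCoef_succ hr n j
  have hc3 := sideCoef_mul_normCoef hr n j
  have hc4 := sideCoef_mul_normCoef hr (n + 1) j
  have hi := index_pos hr j
  have hp' : (r : ℝ) - 1 + 2 * j + n ≠ 0 := by positivity
  have hp2 : (r : ℝ) - 1 + 2 * j + n + 1 ≠ 0 := by positivity
  have hp3 : (r : ℝ) - 1 + 2 * j + n + 2 ≠ 0 := by positivity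
  push_cast at *
  rw [show ((r : ℝ) - 1) / 2 + (j + 1) = ((r : ℝ) - 1) / 2 + j + 1 by ring]
  set ν := ((r : ℝ) - 1) / 2 + j with hνd
  set z := x (Fin.last r)
  set w := ‖x‖ ^ 2
  set G1 := geg (ν + 1) (n + 1) z w
  set G0 := geg (ν + 1) n z w
  set G := geg ν (n + 1) z w
  have k1 : sideCoef r j * normCoef r n (j + 1) * ((r : ℝ) - 1 + 2 * j + n + 1) =
      normCoef r (n + 1) j * ((r : ℝ) - 1 + 2 * j) := by
    refine mul_right_cancel₀ hp' ?_
    linear_combination hc3 - ((r : ℝ) - 1 + 2 * j) * hc2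
  have k2 : sideCoef r j * normCoef r (n + 1) (j + 1) * ((r : ℝ) - 1 + 2 * j + n + 2) *
      ((r : ℝ) - 1 + 2 * j + n + 1) =
      normCoef r (n + 1) j * ((r : ℝ) - 1 + 2 * j) * (j + n + 2) := by
    linear_combination hc4
  have h2ν : (r : ℝ) - 1 + 2 * j = 2 * ν := by rw [hνd]; ring
  have k3 : sideCoef r j * normCoef r (n + 1) (j + 1) * (n + 1 + r + 2 * j) *
      ((r : ℝ) - 1 + 2 * j + n + 1) = normCoef r (n + 1) j * (2 * ν) * (j + n + 2) := by
    rw [← h2ν]; linear_combination k2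
  rw [h2ν] at k1
  refine mul_right_cancel₀ hp2 ?_
  rw [h2ν] at *
  linear_combination ((j + n + 2) * normCoef r (n + 1) j) * h - G1 * k3 +
    (z * (j + n + 2) * G0) * k1

/-! ### Functions of the first `r` variables -/

variable (r) in
/-- `x ↦ x̲` as a continuous linear map -/
def podL : Euc (r + 1) →L[ℝ] Euc r :=
  LinearMap.toContinuousLinearMap
    { toFun := pod
      map_add' := fun x y => by ext i; simp [pod]
      map_smul' := fun c x => by ext i; simp [pod] }

lemma podL_apply (x : Euc (r + 1)) : podL r x = pod x := rfl

lemma pod_apply (x : Euc (r + 1)) (i : Fin r) : pod x i = x i.castSucc := rfl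

lemma norm_sq_pod (x : Euc (r + 1)) : ‖x‖ ^ 2 = ‖pod x‖ ^ 2 + x (Fin.last r) ^ 2 := by
  rw [norm_sq_eq_sum, norm_sq_eq_sum, Fin.sum_univ_castSucc, pow_two]; rfl

/-! ### Composition with the projection `x ↦ x̲` -/

section

variable {E : Type*} [NormedAddCommGroup E] [NormedSpace ℝ E]

lemma pd_comp_pod (i : Fin (r + 1)) {f : Euc r → E} {x : Euc (r + 1)}
    (hf : DifferentiableAt ℝ f (pod x)) :
    pd i (fun x => f (pod x)) x = fderiv ℝ f (pod x) (pod (EuclideanSpace.single i 1)) := by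
  have h : HasFDerivAt (fun x => f (pod x)) ((fderiv ℝ f (pod x)).comp (podL r)) x :=
    HasFDerivAt.comp x (g := f) (f := podL r) hf.hasFDerivAt (podL r).hasFDerivAt
  rw [pd, h.fderiv]; rfl

lemma pd_castSucc_comp_pod (i : Fin r) {f : Euc r → E} {x : Euc (r + 1)}
    (hf : DifferentiableAt ℝ f (pod x)) :
    pd i.castSucc (fun x => f (pod x)) x = pd i f (pod x) := by
  rw [pd_comp_pod _ hf, pd]
  congr 1
  ext j
  simp [pod]

lemma pd_last_comp_pod {f : Euc r → E} {x : Euc (r + 1)} (hf : DifferentiableAt ℝ f (pod x)) :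
    pd (Fin.last r) (fun x => f (pod x)) x = 0 := by
  rw [pd_comp_pod _ hf, show pod (EuclideanSpace.single (Fin.last r) (1 : ℝ)) = 0 from ?_, map_zero]
  ext j
  simp [pod]

lemma contDiff_comp_pod {f : Euc r → E} (hf : ContDiff ℝ ∞ f) :
    ContDiff ℝ ∞ fun x : Euc (r + 1) => f (pod x) := hf.comp (podL r).contDiff

lemma IsHom.comp_pod {k : ℕ} {f : Euc r → E} (hf : IsHom k f) :
    IsHom k fun x : Euc (r + 1) => f (pod x) :=
  ⟨contDiff_comp_pod hf.smooth, fun c x => by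
    rw [← hf.map_smul, ← podL_apply, ← podL_apply, _root_.map_smul]⟩

end

/-! ### The monogenic factors -/

/-- `P : ℝ^r → Cl_{r+1}` is homogeneous of degree `j` and annihilated by
`e₁∂_{x₁} + ⋯ + e_r∂_{x_r}`. -/
structure UpperMonogenic (j : ℕ) (P : Euc r → Cl 𝕜 (r + 1)) : Prop where
  hom : IsHom j P
  eq_zero : ∀ y, ∑ i : Fin r, gen 𝕜 i.castSucc * pd i P y = 0

lemma UpperMonogenic.lastGen_mul {j : ℕ} {P : Euc r → Cl 𝕜 (r + 1)} (hP : UpperMonogenic j P) :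
    UpperMonogenic j fun y => lastGen 𝕜 r * P y := by
  refine ⟨hP.hom.lin (LinearMap.mulLeft 𝕜 (lastGen 𝕜 r)), fun y => ?_⟩
  have h (i : Fin r) : gen 𝕜 i.castSucc * pd i (fun y => lastGen 𝕜 r * P y) y =
      -(lastGen 𝕜 r * (gen 𝕜 i.castSucc * pd i P y)) := by
    have := pd_lin i (LinearMap.mulLeft 𝕜 (lastGen 𝕜 r)) (hP.hom.diffAt y)
    simp only [LinearMap.mulLeft_apply] at this
    rw [this, ← mul_assoc, incl_gen_mul_lastGen, neg_mul, mul_assoc]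
  simp only [h, Finset.sum_neg_distrib, ← Finset.mul_sum, hP.eq_zero, mul_zero, neg_zero]

lemma upperMonogenic_incl {j : ℕ} {p : Euc r → Cl 𝕜 r} (hp : IsHom j p)
    (h : ∀ y, dirac p y = 0) : UpperMonogenic j fun y => incl 𝕜 r (p y) := by
  refine ⟨hp.lin (incl 𝕜 r).toLinearMap, fun y => ?_⟩
  have h1 (i : Fin r) : gen 𝕜 i.castSucc * pd i (fun y => incl 𝕜 r (p y)) y =
      incl 𝕜 r (gen 𝕜 i * pd i p y) := by
    have := pd_lin i (incl 𝕜 r).toLinearMap (hp.diffAt y)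
    simp only [AlgHom.toLinearMap_apply] at this
    rw [this, map_mul, incl_gen]
  simp only [h1, ← map_sum, ← dirac_eq, h, map_zero]

/-- `x̲ a = ∑_{i ≤ r} x_i e_i a` -/
def podMul (x : Euc (r + 1)) (a : Cl 𝕜 (r + 1)) : Cl 𝕜 (r + 1) :=
  ∑ i : Fin r, x i.castSucc • (gen 𝕜 i.castSucc * a)

lemma incl_vec_mul (x : Euc (r + 1)) (a : Cl 𝕜 (r + 1)) :
    incl 𝕜 r (vec 𝕜 (pod x)) * a = podMul x a := by
  simp only [vec, map_sum, map_smul, incl_gen, Finset.sum_mul, smul_mul_assoc, pod_apply]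
  simp only [podMul, real_smul_eq]

lemma podMul_incl (x : Euc (r + 1)) (a : Cl 𝕜 r) :
    podMul x (incl 𝕜 r a) = incl 𝕜 r (vec 𝕜 (pod x) * a) := by
  rw [← incl_vec_mul, map_mul]

lemma podMul_lastGen (x : Euc (r + 1)) (a : Cl 𝕜 (r + 1)) :
    podMul x (lastGen 𝕜 r * a) = -(lastGen 𝕜 r * podMul x a) := by
  simp only [podMul, Finset.mul_sum, ← Finset.sum_neg_distrib]
  refine Finset.sum_congr rfl fun i _ => ?_
  rw [← mul_assoc, incl_gen_mul_lastGen, mul_smul_comm, neg_mul, mul_assoc, smul_neg]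

lemma podMul_podMul (x : Euc (r + 1)) (a : Cl 𝕜 (r + 1)) :
    podMul x (podMul x a) = -(‖pod x‖ ^ 2 • a) := by
  have h := vec_mul_vec_mul (pod x) (1 : Cl 𝕜 r)
  rw [mul_one] at h
  rw [← incl_vec_mul, ← incl_vec_mul, ← mul_assoc, ← map_mul, h, map_neg, neg_mul]
  rw [← real_smul_eq, map_smul, map_one, smul_mul_assoc, one_mul, real_smul_eq]

lemma isHom_podMul {j : ℕ} {f : Euc (r + 1) → Cl 𝕜 (r + 1)} (hf : IsHom j f) :
    IsHom (j + 1) fun x => podMul x (f x) :=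
  IsHom.sum _ fun i _ => (hf.lin (LinearMap.mulLeft 𝕜 (gen 𝕜 i.castSucc))).coord_smul i.castSucc

/-- The scalar coefficient of `x̲ e_{r+1}` in the monogenic factor. -/
def sideFactor (n j : ℕ) (x : Euc (r + 1)) : ℝ :=
  sideCoef r j * (if 1 ≤ n then harmonicFactor (n - 1) (j + 1) x else 0)

lemma monogenicFactor_mul (n j : ℕ) (x : Euc (r + 1)) (a : Cl 𝕜 (r + 1)) :
    monogenicFactor 𝕜 n j x * a = harmonicFactor n j x • a +
      sideFactor n j x • podMul x (lastGen 𝕜 r * a) := by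
  rw [monogenicFactor, add_mul, Algebra.algebraMap_eq_smul_one, smul_mul_assoc, one_mul,
    real_smul_eq, real_smul_eq, smul_mul_assoc, mul_assoc, incl_vec_mul, sideFactor, sideCoef]
  push_cast
  rw [show (r : ℝ) + 1 + 2 * j - 1 = r + 2 * j by ring]

lemma sideFactor_zero (j : ℕ) (x : Euc (r + 1)) : sideFactor 0 j x = 0 := by simp [sideFactor]

lemma sideFactor_succ (n j : ℕ) (x : Euc (r + 1)) :
    sideFactor (n + 1) j x = sideCoef r j * harmonicFactor n (j + 1) x := by simp [sideFactor]

lemma contDiff_sideFactor (n j : ℕ) : ContDiff ℝ ∞ (sideFactor n j : Euc (r + 1) → ℝ) := by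
  rcases n with _ | n
  · rw [show (sideFactor 0 j : Euc (r + 1) → ℝ) = _ from funext (sideFactor_zero j)]
    exact contDiff_const
  · rw [show (sideFactor (n + 1) j : Euc (r + 1) → ℝ) = _ from funext (sideFactor_succ n j)]
    exact contDiff_const.mul (contDiff_harmonicFactor _ _)

lemma pd_sideFactor_succ (i : Fin (r + 1)) (n j : ℕ) (x : Euc (r + 1)) :
    pd i (sideFactor (n + 1) j) x = sideCoef r j * pd i (harmonicFactor n (j + 1)) x := by
  rw [pd_congr (sideFactor_succ n j), pd_mul i (contDiff_const.diffAt x)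
    ((contDiff_harmonicFactor n (j + 1)).diffAt x), pd_const, zero_mul, zero_add]

lemma pd_sideFactor_zero (i : Fin (r + 1)) (j : ℕ) (x : Euc (r + 1)) :
    pd i (sideFactor 0 j) x = 0 := by
  rw [pd_congr (sideFactor_zero j), pd_const]

lemma pd_harmonicFactor_zero (i : Fin (r + 1)) (j : ℕ) (x : Euc (r + 1)) :
    pd i (harmonicFactor 0 j) x = 0 := by
  rw [pd_congr (harmonicFactor_zero j), pd_const]

lemma pd_castSucc_harmonicFactor_one (i : Fin r) (j : ℕ) (x : Euc (r + 1)) :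
    pd i.castSucc (harmonicFactor 1 j) x = 0 := by
  rw [pd_harmonicFactor, if_neg (Fin.castSucc_lt_last i).ne]
  simp [gegW]

lemma pd_last_sideFactor (hr : 2 ≤ r) (n j : ℕ) (x : Euc (r + 1)) :
    pd (Fin.last r) (sideFactor (n + 1) j) x = (j + 1 + n) * sideFactor n j x := by
  rw [pd_sideFactor_succ]
  rcases n with _ | n
  · rw [pd_harmonicFactor_zero, sideFactor_zero]; ring
  · rw [pd_last_harmonicFactor hr, sideFactor_succ]; push_cast; ring

/-- One half of the Cauchy–Riemann system for `F = harmonicFactor`, `G = sideFactor`: the tangential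
gradient of `F` is `-x̲ ∂_{r+1}G`. The other half is `pd_last_harmonicFactor_eq`; together they make
`F P + G x̲ e_{r+1} P` monogenic. -/
lemma pd_castSucc_harmonicFactor_eq (hr : 2 ≤ r) (n j : ℕ) (i : Fin r) (x : Euc (r + 1)) :
    pd i.castSucc (harmonicFactor n j) x =
      -(x i.castSucc * pd (Fin.last r) (sideFactor n j) x) := by
  rcases n with _ | _ | n
  · rw [pd_harmonicFactor_zero, pd_sideFactor_zero]; simp
  · rw [pd_castSucc_harmonicFactor_one, pd_last_sideFactor hr, sideFactor_zero]; simp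
  · rw [pd_castSucc_harmonicFactor hr, pd_last_sideFactor hr, sideFactor_succ]; push_cast; ring

/-- `sideFactor` depends on `x̲` only through `|x̲|`, so its tangential gradient is parallel to
`x̲`. -/
lemma exists_pd_castSucc_sideFactor (hr : 2 ≤ r) (n j : ℕ) (x : Euc (r + 1)) :
    ∃ g : ℝ, ∀ i : Fin r, pd i.castSucc (sideFactor n j) x = x i.castSucc * g := by
  rcases n with _ | n
  · exact ⟨0, fun i => by rw [pd_sideFactor_zero, mul_zero]⟩
  · refine ⟨-(sideCoef r j * pd (Fin.last r) (sideFactor n (j + 1)) x), fun i => ?_⟩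
    rw [pd_sideFactor_succ, pd_castSucc_harmonicFactor_eq hr]; ring

lemma pd_last_harmonicFactor_eq (hr : 2 ≤ r) (n j : ℕ) (x : Euc (r + 1)) :
    pd (Fin.last r) (harmonicFactor n j) x =
      ∑ i : Fin r, x i.castSucc * pd i.castSucc (sideFactor n j) x +
        (r + 2 * j) * sideFactor n j x := by
  rcases n with _ | n
  · simp [pd_harmonicFactor_zero, pd_sideFactor_zero, sideFactor_zero]
  have he := (isHom_harmonicFactor (r := r) n (j + 1)).euler x
  simp only [smul_eq_mul, Fin.sum_univ_castSucc] at he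
  simp only [pd_sideFactor_succ, sideFactor_succ, pd_last_harmonicFactor hr]
  simp only [mul_left_comm _ (sideCoef r j), ← Finset.mul_sum]
  -- Euler's formula trades the tangential part of the radial derivative for the degree and the
  -- derivative in the last variable.
  rw [eq_sub_of_add_eq he]
  rcases n with _ | n
  · have : (r : ℝ) + 2 * j ≠ 0 := by
      have : (2 : ℝ) ≤ r := by exact_mod_cast hr
      positivity
    simp only [harmonicFactor_zero, pd_harmonicFactor_zero, sideCoef]
    push_cast
    field_simp
    ring
  · have hc := harmonicFactor_contiguous hr n j x
    rw [pd_last_harmonicFactor hr]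
    push_cast
    linear_combination hc

/-- The embedding of `P` by a monogenic factor. -/
def lift (n j : ℕ) (P : Euc r → Cl 𝕜 (r + 1)) (x : Euc (r + 1)) : Cl 𝕜 (r + 1) :=
  monogenicFactor 𝕜 n j x * P (pod x)

lemma lift_eq (n j : ℕ) (P : Euc r → Cl 𝕜 (r + 1)) (x : Euc (r + 1)) :
    lift n j P x = harmonicFactor n j x • P (pod x) +
      sideFactor n j x • podMul x (lastGen 𝕜 r * P (pod x)) := monogenicFactor_mul ..

lemma lift_zero (j : ℕ) (P : Euc r → Cl 𝕜 (r + 1)) (x : Euc (r + 1)) :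
    lift 0 j P x = P (pod x) := by
  rw [lift_eq, harmonicFactor_zero, sideFactor_zero, one_smul, zero_smul, add_zero]

section lift

variable {j : ℕ} {P : Euc r → Cl 𝕜 (r + 1)}

lemma isHom_side (hP : IsHom j P) :
    IsHom (j + 1) fun x : Euc (r + 1) => podMul x (lastGen 𝕜 r * P (pod x)) :=
  isHom_podMul (hP.comp_pod.lin (LinearMap.mulLeft 𝕜 (lastGen 𝕜 r)))

lemma isHom_lift (n : ℕ) (hP : IsHom j P) : IsHom (n + j) (lift n j P) := by
  rcases n with _ | n
  · rw [show lift 0 j P = _ from funext (lift_zero j P), zero_add]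
    exact hP.comp_pod
  · refine IsHom.congr ?_ fun x => (lift_eq (n + 1) j P x).symm
    refine ((isHom_harmonicFactor (n + 1) j).smul hP.comp_pod).add ?_
    rw [show n + 1 + j = n + (j + 1) by ring]
    refine IsHom.congr (((isHom_harmonicFactor n (j + 1)).smul (isHom_side hP)).clm
      (sideCoef r j • ContinuousLinearMap.id ℝ _)) fun x => ?_
    rw [sideFactor_succ, mul_smul]
    rfl

lemma pd_lift (n : ℕ) (hP : IsHom j P) (i : Fin (r + 1)) (x : Euc (r + 1)) :
    pd i (lift n j P) x = pd i (harmonicFactor n j) x • P (pod x) +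
      harmonicFactor n j x • pd i (fun x => P (pod x)) x +
      (pd i (sideFactor n j) x • podMul x (lastGen 𝕜 r * P (pod x)) +
        sideFactor n j x • pd i (fun x => podMul x (lastGen 𝕜 r * P (pod x))) x) := by
  rw [pd_congr (lift_eq n j P), pd_add, pd_smul, pd_smul]
  · exact (contDiff_sideFactor n j).diffAt x
  · exact (isHom_side hP).diffAt x
  · exact (contDiff_harmonicFactor n j).diffAt x
  · exact hP.comp_pod.diffAt x
  · exact ((contDiff_harmonicFactor n j).diffAt x).fun_smul (hP.comp_pod.diffAt x)
  · exact ((contDiff_sideFactor n j).diffAt x).fun_smul ((isHom_side hP).diffAt x)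

lemma pd_last_side (hP : IsHom j P) (x : Euc (r + 1)) :
    pd (Fin.last r) (fun x => podMul x (lastGen 𝕜 r * P (pod x))) x = 0 := by
  unfold podMul
  have hs (i : Fin r) : IsHom j fun x : Euc (r + 1) =>
      gen 𝕜 i.castSucc * (lastGen 𝕜 r * P (pod x)) :=
    (hP.comp_pod.lin (LinearMap.mulLeft 𝕜 (lastGen 𝕜 r))).lin
      (LinearMap.mulLeft 𝕜 (gen 𝕜 i.castSucc))
  rw [pd_sum _ _ fun i _ => ((hs i).coord_smul i.castSucc).diffAt x]
  refine Finset.sum_eq_zero fun i _ => ?_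
  rw [pd_coord_smul _ _ ((hs i).diffAt x), if_neg (Fin.castSucc_lt_last i).ne', zero_add]
  have := pd_lin (Fin.last r) ((LinearMap.mulLeft 𝕜 (gen 𝕜 i.castSucc)).comp
    (LinearMap.mulLeft 𝕜 (lastGen 𝕜 r))) (hP.comp_pod.diffAt x)
  simp only [LinearMap.comp_apply, LinearMap.mulLeft_apply] at this
  rw [this, pd_last_comp_pod (hP.diffAt _)]
  simp

/-- This is `∂(x̲Q) = -(r + 2j)Q` for `Q = e_{r+1}P`: the squares `e_i² = -1` give `r`, and moving
`e_i` past `e_l` gives twice the Euler operator plus a multiple of `∂Q = 0`. -/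
lemma dirac_side (hP : UpperMonogenic j P) (x : Euc (r + 1)) :
    dirac (fun x => podMul x (lastGen 𝕜 r * P (pod x))) x =
      -(((r : ℝ) + 2 * j) • (lastGen 𝕜 r * P (pod x))) := by
  have hQ := hP.lastGen_mul
  set Q : Euc r → Cl 𝕜 (r + 1) := fun y => lastGen 𝕜 r * P y with hQd
  have hs (l : Fin r) : IsHom j fun x : Euc (r + 1) => gen 𝕜 l.castSucc * Q (pod x) :=
    hQ.hom.comp_pod.lin (LinearMap.mulLeft 𝕜 (gen 𝕜 l.castSucc))
  have h1 (i l : Fin r) : gen 𝕜 i.castSucc *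
      pd i.castSucc (fun x : Euc (r + 1) => x l.castSucc • (gen 𝕜 l.castSucc * Q (pod x))) x =
      (if i = l then -Q (pod x) else 0) +
        x l.castSucc • (gen 𝕜 i.castSucc * (gen 𝕜 l.castSucc * pd i Q (pod x))) := by
    rw [pd_coord_smul _ _ ((hs l).diffAt x)]
    have := pd_lin i.castSucc (LinearMap.mulLeft 𝕜 (gen 𝕜 l.castSucc)) (hQ.hom.comp_pod.diffAt x)
    simp only [LinearMap.mulLeft_apply] at this
    rw [this, pd_castSucc_comp_pod _ (hQ.hom.diffAt _), mul_add, mul_smul_comm]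
    congr 1
    by_cases h : i = l
    · subst h; rw [if_pos rfl, if_pos rfl, ← mul_assoc, gen_mul_self, neg_one_mul]
    · rw [if_neg (fun h' => h (Fin.castSucc_injective r h')), if_neg h, mul_zero]
  have h2 (i l : Fin r) : gen 𝕜 i.castSucc * (gen 𝕜 l.castSucc * pd i Q (pod x)) =
      -(gen 𝕜 l.castSucc * (gen 𝕜 i.castSucc * pd i Q (pod x))) +
        if i = l then -(pd i Q (pod x) + pd i Q (pod x)) else 0 := by
    rw [← mul_assoc, ← mul_assoc]
    by_cases h : i = l
    · subst h
      rw [if_pos rfl, gen_mul_self]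
      simp only [neg_mul, one_mul]; abel
    · rw [if_neg h, gen_mul_gen_of_ne (fun h' => h (Fin.castSucc_injective r h')), neg_mul, add_zero]
  have hd (l : Fin r) : DifferentiableAt ℝ
      (fun x : Euc (r + 1) => x l.castSucc • (gen 𝕜 l.castSucc * Q (pod x))) x :=
    ((hs l).coord_smul l.castSucc).diffAt x
  rw [dirac_eq, Fin.sum_univ_castSucc, pd_last_side hP.hom, mul_zero, add_zero]
  simp only [podMul]
  have h3 (i : Fin r) : gen 𝕜 i.castSucc * pd i.castSucc (fun x : Euc (r + 1) =>
      ∑ l : Fin r, x l.castSucc • (gen 𝕜 l.castSucc * (lastGen 𝕜 r * P (pod x)))) x =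
      -Q (pod x) + ∑ l : Fin r, x l.castSucc •
        (gen 𝕜 i.castSucc * (gen 𝕜 l.castSucc * pd i Q (pod x))) := by
    change gen 𝕜 i.castSucc * pd i.castSucc (fun x : Euc (r + 1) =>
      ∑ l : Fin r, x l.castSucc • (gen 𝕜 l.castSucc * Q (pod x))) x = _
    rw [pd_sum _ _ fun l _ => hd l, Finset.mul_sum]
    simp only [h1, Finset.sum_add_distrib, Finset.sum_ite_eq, Finset.mem_univ, if_true]
  simp only [h3, h2, Finset.sum_add_distrib, Finset.sum_const, Finset.card_univ, Fintype.card_fin,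
    smul_add, smul_ite, smul_zero, Finset.sum_ite_eq, Finset.mem_univ, if_true]
  rw [Finset.sum_comm]
  simp only [smul_neg, Finset.sum_neg_distrib, ← Finset.smul_sum, ← Finset.mul_sum, hQ.eq_zero,
    mul_zero, smul_zero, Finset.sum_const_zero, neg_zero, zero_add]
  have he := hQ.hom.euler (pod x)
  simp only [pod_apply] at he
  simp only [smul_add, neg_add, Finset.sum_add_distrib, he]
  simp only [add_smul, two_mul, Nat.cast_smul_eq_nsmul, hQd]
  abel

/-- The Leibniz rule gives multiples of `x̲P` and of `e_{r+1}P`; the two Cauchy–Riemann equations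
for the scalar factors make the coefficients of each sum to zero. -/
lemma dirac_lift (hr : 2 ≤ r) (n : ℕ) (hP : UpperMonogenic j P) (x : Euc (r + 1)) :
    dirac (lift n j P) x = 0 := by
  obtain ⟨g, hg⟩ := exists_pd_castSucc_sideFactor hr n j x
  have hd := dirac_side hP x
  have h0 : ∑ i, gen 𝕜 i * pd i (fun x => P (pod x)) x = 0 := by
    rw [Fin.sum_univ_castSucc, pd_last_comp_pod (hP.hom.diffAt _), mul_zero, add_zero]
    simp only [pd_castSucc_comp_pod _ (hP.hom.diffAt _), hP.eq_zero]
  rw [dirac_eq] at hd ⊢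
  simp only [pd_lift n hP.hom, mul_add, mul_smul_comm, Finset.sum_add_distrib, ← Finset.smul_sum, hd,
    h0, smul_zero, add_zero]
  simp only [Fin.sum_univ_castSucc, pd_castSucc_harmonicFactor_eq hr, hg,
    pd_last_harmonicFactor_eq hr]
  have e1 : ∑ i : Fin r, (-(x i.castSucc * pd (Fin.last r) (sideFactor n j) x)) •
      (gen 𝕜 i.castSucc * P (pod x)) =
      -(pd (Fin.last r) (sideFactor n j) x • podMul x (P (pod x))) := by
    simp only [podMul, Finset.smul_sum, ← Finset.sum_neg_distrib, smul_smul, neg_smul, mul_comm]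
  have e2 : ∑ i : Fin r, (x i.castSucc * g) •
      (gen 𝕜 i.castSucc * podMul x (lastGen 𝕜 r * P (pod x))) =
      -((g * ‖pod x‖ ^ 2) • (lastGen 𝕜 r * P (pod x))) := by
    rw [mul_smul, ← smul_neg, ← podMul_podMul]
    generalize podMul x (lastGen 𝕜 r * P (pod x)) = b
    rw [podMul, Finset.smul_sum]
    simp only [smul_smul, mul_comm]
  have e3 : gen 𝕜 (Fin.last r) * podMul x (lastGen 𝕜 r * P (pod x)) = podMul x (P (pod x)) := by
    rw [podMul_lastGen, mul_neg, lastGen_mul_lastGen_mul, neg_neg]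
  have e4 : ∑ i : Fin r, x i.castSucc * (x i.castSucc * g) = g * ‖pod x‖ ^ 2 := by
    rw [norm_sq_eq_sum, Finset.mul_sum]
    exact Finset.sum_congr rfl fun i _ => by rw [pod_apply]; ring
  rw [e1, e2, e3, e4, smul_neg, smul_smul, add_smul, mul_comm (sideFactor n j x)]
  abel

lemma pd_last_lift (hr : 2 ≤ r) (n : ℕ) (hP : IsHom j P) (x : Euc (r + 1)) :
    pd (Fin.last r) (lift (n + 1) j P) x = ((j : ℝ) + 1 + n) • lift n j P x := by
  rw [pd_lift _ hP, pd_last_comp_pod (hP.diffAt _), pd_last_side hP, pd_last_harmonicFactor hr,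
    pd_last_sideFactor hr, lift_eq]
  simp only [smul_zero, add_zero, mul_smul, smul_add]

lemma pd_last_lift_zero (hP : IsHom j P) (x : Euc (r + 1)) :
    pd (Fin.last r) (lift 0 j P) x = 0 := by
  rw [pd_congr (lift_zero j P), pd_last_comp_pod (hP.diffAt _)]

end lift

/-! ### Sums of two lifts -/

/-- The embedding `X^{(n)}_j P₁ + C X^{(n-1)}_{j+1} P₂`. -/
def tower (C : ℝ) (j : ℕ) (P₁ P₂ : Euc r → Cl 𝕜 (r + 1)) : ℕ → Euc (r + 1) → Cl 𝕜 (r + 1)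
  | 0 => lift 0 j P₁
  | n + 1 => fun x => lift (n + 1) j P₁ x + C • lift n (j + 1) P₂ x

lemma tower_succ_apply (C : ℝ) (j : ℕ) (P₁ P₂ : Euc r → Cl 𝕜 (r + 1)) (n : ℕ) (x : Euc (r + 1)) :
    tower C j P₁ P₂ (n + 1) x = lift (n + 1) j P₁ x + C • lift n (j + 1) P₂ x := rfl

section tower

variable {C : ℝ} {j : ℕ} {P₁ P₂ : Euc r → Cl 𝕜 (r + 1)}

lemma isHom_tower (h₁ : IsHom j P₁) (h₂ : IsHom (j + 1) P₂) (n : ℕ) :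
    IsHom (n + j) (tower C j P₁ P₂ n) := by
  rcases n with _ | n
  · exact isHom_lift 0 h₁
  · refine (isHom_lift (n + 1) h₁).add ?_
    have := (isHom_lift n h₂).clm (C • ContinuousLinearMap.id ℝ _)
    rw [show n + 1 + j = n + (j + 1) by ring]
    exact this

/-- The alternative `C = 0` serves the extreme grades `t ∈ {0, r}`, where the second summand is
switched off and no monogenicity of `P₂` is claimed. -/
lemma dirac_tower (hr : 2 ≤ r) (h₁ : UpperMonogenic j P₁) (h₂ : IsHom (j + 1) P₂)
    (h : C = 0 ∨ UpperMonogenic (j + 1) P₂) (n : ℕ) (x : Euc (r + 1)) :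
    dirac (tower C j P₁ P₂ n) x = 0 := by
  rcases n with _ | n
  · exact dirac_lift hr 0 h₁ x
  · have h3 := (isHom_lift n h₂).diffAt x
    rw [tower, dirac_eq_dOp, dOp_add _ ((isHom_lift (n + 1) h₁.hom).diffAt x) (h3.fun_const_smul C),
      dOp_real_smul _ C h3, ← dirac_eq_dOp, ← dirac_eq_dOp, dirac_lift hr _ h₁, zero_add]
    rcases h with h | h
    · rw [h, zero_smul]
    · rw [dirac_lift hr _ h, smul_zero]

/-- The Appell factor depends only on the total degree, which the two lifts share, so the sum
inherits the property. -/
lemma pd_last_tower (hr : 2 ≤ r) (h₁ : IsHom j P₁) (h₂ : IsHom (j + 1) P₂) (n : ℕ)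
    (x : Euc (r + 1)) :
    pd (Fin.last r) (tower C j P₁ P₂ (n + 1)) x = ((j : ℝ) + 1 + n) • tower C j P₁ P₂ n x := by
  have h3 := (isHom_lift n h₂).diffAt x
  rw [tower, pd_add _ ((isHom_lift (n + 1) h₁).diffAt x) (h3.fun_const_smul C),
    pd_const_smul _ _ h3, pd_last_lift hr _ h₁]
  rcases n with _ | n
  · rw [pd_last_lift_zero h₂, smul_zero, add_zero, tower]
  · rw [pd_last_lift hr _ h₂, tower, smul_add, smul_comm C]
    push_cast
    rw [show (j : ℝ) + 1 + 1 + n = j + 1 + (n + 1) by ring]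

lemma iterate_pd_const_smul {E : Type*} [NormedAddCommGroup E] [NormedSpace ℝ E] (i : Fin m) (c : ℝ)
    (L : ℕ) {f : Euc m → E} (hf : ContDiff ℝ ∞ f) :
    (pd i)^[L] (fun x => c • f x) = fun x => c • (pd i)^[L] f x := by
  induction L generalizing f with
  | zero => rfl
  | succ L ih =>
    rw [Function.iterate_succ_apply, Function.iterate_succ_apply, ← ih (contDiff_pd i hf)]
    congr 1
    funext x
    exact pd_const_smul i c (hf.diffAt x)

lemma iterate_pd_sub {E : Type*} [NormedAddCommGroup E] [NormedSpace ℝ E] (i : Fin m)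
    (L : ℕ) {f g : Euc m → E} (hf : ContDiff ℝ ∞ f) (hg : ContDiff ℝ ∞ g) :
    (pd i)^[L] (fun x => f x - g x) = fun x => (pd i)^[L] f x - (pd i)^[L] g x := by
  induction L generalizing f g with
  | zero => rfl
  | succ L ih =>
    simp only [Function.iterate_succ_apply]
    rw [← ih (contDiff_pd i hf) (contDiff_pd i hg)]
    congr 1
    funext x
    exact pd_sub i (hf.diffAt x) (hg.diffAt x)

/-- After `n` derivatives only the leading field `P₁` is left, so an embedded field determines the
field it was built from. Injectivity and the spanning argument both rely on this. -/
lemma iterate_pd_tower (hr : 2 ≤ r) (h₁ : IsHom j P₁) (h₂ : IsHom (j + 1) P₂) (n : ℕ)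
    (x : Euc (r + 1)) :
    (pd (Fin.last r))^[n] (tower C j P₁ P₂ n) x = rising (j + 1) n • P₁ (pod x) := by
  induction n generalizing x with
  | zero => rw [rising_zero, one_smul, Function.iterate_zero_apply, tower, lift_zero]
  | succ n ih =>
    rw [Function.iterate_succ_apply, show pd (Fin.last r) (tower C j P₁ P₂ (n + 1)) = _ from
      funext (pd_last_tower hr h₁ h₂ n), iterate_pd_const_smul _ _ _ (isHom_tower h₁ h₂ n).smooth]
    beta_reduce
    rw [ih, smul_smul, rising_succ, mul_comm]

end tower

/-! ### The embedding factors as sums of two lifts -/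

/-- The weight of the second summand if `s = t`. -/
def sameCoef (r t j : ℕ) : ℝ := if t = 0 ∨ t = r then 0 else sideCoef r j

/-- The weight of the second summand if `s = t + 1`. -/
def succCoef (r t j : ℕ) : ℝ := if t = 0 ∨ t = r then 0 else sideCoef r j / betaFactor r t j

lemma wedge_castSucc_lastGen (i : Fin r) (a : Cl 𝕜 (r + 1)) :
    wedge i.castSucc (lastGen 𝕜 r * a) = -(lastGen 𝕜 r * wedge i.castSucc a) := by
  rw [← wedge_add_dot, ← wedge_add_dot, map_add, wedge_wedge, wedge_dot,
    if_neg (Fin.castSucc_lt_last i).ne]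
  abel

lemma dot_castSucc_lastGen (i : Fin r) (a : Cl 𝕜 (r + 1)) :
    dot i.castSucc (lastGen 𝕜 r * a) = -(lastGen 𝕜 r * dot i.castSucc a) := by
  rw [← wedge_add_dot, ← wedge_add_dot, map_add, dot_dot, dot_wedge,
    if_neg (Fin.castSucc_lt_last i).ne]
  abel

lemma outer_incl_vec (y : Euc r) (a : Cl 𝕜 (r + 1)) :
    outer (incl 𝕜 r (vec 𝕜 y)) a = ∑ i, y i • wedge i.castSucc a := by
  simp only [vec, map_sum, map_smul, incl_gen]
  simp only [outer, outerL_apply, Finset.sum_mul, Finset.mul_sum, smul_mul_assoc,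
    mul_smul_comm, ← Finset.sum_add_distrib, Finset.smul_sum]
  refine Finset.sum_congr rfl fun i _ => ?_
  rw [← smul_add, smul_comm, real_smul_eq]

lemma contract_incl_vec (y : Euc r) (a : Cl 𝕜 (r + 1)) :
    contract (incl 𝕜 r (vec 𝕜 y)) a = ∑ i, y i • dot i.castSucc a := by
  simp only [vec, map_sum, map_smul, incl_gen]
  simp only [contract, contractL_apply, Finset.sum_mul, Finset.mul_sum, smul_mul_assoc,
    mul_smul_comm, ← Finset.sum_sub_distrib, Finset.smul_sum]
  refine Finset.sum_congr rfl fun i _ => ?_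
  rw [← smul_sub, smul_comm, real_smul_eq]

lemma outer_lastGen (y : Euc r) (a : Cl 𝕜 (r + 1)) :
    outer (incl 𝕜 r (vec 𝕜 y)) (lastGen 𝕜 r * a) =
      -(lastGen 𝕜 r * outer (incl 𝕜 r (vec 𝕜 y)) a) := by
  simp only [outer_incl_vec, wedge_castSucc_lastGen, smul_neg, Finset.sum_neg_distrib,
    Finset.mul_sum, mul_smul_comm]

lemma contract_lastGen (y : Euc r) (a : Cl 𝕜 (r + 1)) :
    contract (incl 𝕜 r (vec 𝕜 y)) (lastGen 𝕜 r * a) =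
      -(lastGen 𝕜 r * contract (incl 𝕜 r (vec 𝕜 y)) a) := by
  simp only [contract_incl_vec, dot_castSucc_lastGen, smul_neg, Finset.sum_neg_distrib,
    Finset.mul_sum, mul_smul_comm]

lemma incl_real_smul (c : ℝ) (a : Cl 𝕜 r) : incl 𝕜 r (c • a) = c • incl 𝕜 r a := by
  rw [← real_smul_eq, map_smul, real_smul_eq]

/-- Moving `e_{r+1}` in front of `x̲∧` and `x̲•` costs one sign, which the sign of `α` absorbs. -/
lemma embeddingFactor_same (t j n : ℕ) (p : Euc r → Cl 𝕜 r) :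
    embeddingFactor t t (j + n) j p =
      tower (sameCoef r t j) j (fun y => incl 𝕜 r (p y))
        (fun y => lastGen 𝕜 r * incl 𝕜 r (raise t j p y)) n := by
  funext x
  have hβ : -((j : ℝ) + ((r + 1 : ℕ) : ℝ) - 1 - t) / (j + t) = betaFactor r t j := by
    rw [betaFactor]; push_cast; ring
  have hα : (if t = 0 ∨ t = r then (0 : ℝ) else -((j : ℝ) + 1) / (((r + 1 : ℕ) : ℝ) + 2 * j - 1)) =
      -sameCoef r t j := by
    rw [sameCoef, sideCoef]
    push_cast
    rw [show (r : ℝ) + 1 + 2 * j - 1 = r + 2 * j by ring, neg_div]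
    split_ifs <;> simp
  simp only [embeddingFactor, hβ, hα, Nat.sub_self, pow_zero, one_mul, zero_add, pow_one, sub_self,
    zpow_zero, zpow_one, outer_lastGen, contract_lastGen, outer_incl, contract_incl, real_smul_eq,
    Nat.add_sub_cancel_left]
  rcases n with _ | n
  · simp [tower, lift]
  · rw [if_pos (by omega), tower_succ_apply, show j + (n + 1) - 1 - j = n by omega, lift, lift, raise, map_add,
      incl_real_smul]
    simp only [mul_add, mul_smul_comm, one_smul, smul_neg, ← neg_add, mul_neg, neg_smul, neg_neg]
    rfl

/-- Now `e_{r+1}² = -1` supplies the sign, and pulling `β⁻¹` out of `β⁻¹ x̲∧ + x̲•` turns the weight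
into `sideCoef / β`. Nonvanishing of `β` matters only in the interior grades. -/
lemma embeddingFactor_succ (t j n : ℕ) (p : Euc r → Cl 𝕜 r)
    (h : t ≠ 0 → t ≠ r → betaFactor r t j ≠ 0) :
    embeddingFactor (t + 1) t (j + n) j p =
      tower (succCoef r t j) j (fun y => lastGen 𝕜 r * incl 𝕜 r (p y))
        (fun y => incl 𝕜 r (raise t j p y)) n := by
  funext x
  have hβ : -((j : ℝ) + ((r + 1 : ℕ) : ℝ) - 1 - t) / (j + t) = betaFactor r t j := by
    rw [betaFactor]; push_cast; ring
  have hα : (if t = 0 ∨ t = r then (0 : ℝ) else -((j : ℝ) + 1) / (((r + 1 : ℕ) : ℝ) + 2 * j - 1)) =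
      -(succCoef r t j * betaFactor r t j) := by
    rw [succCoef]
    push_cast
    rw [show (r : ℝ) + 1 + 2 * j - 1 = r + 2 * j by ring, neg_div]
    split_ifs with h'
    · simp
    · rw [not_or] at h'
      rw [div_mul_cancel₀ _ (h h'.1 h'.2), sideCoef]
  simp only [embeddingFactor, hβ, hα, Nat.add_sub_cancel_left, pow_one, real_smul_eq]
  rcases n with _ | n
  · simp [tower, lift]
  · rw [if_pos (by omega), tower_succ_apply, show j + (n + 1) - 1 - j = n by omega, lift, lift, raise]
    congr 1
    rw [pow_succ, pow_one, mul_assoc, lastGen_mul_lastGen_mul]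
    have e1 (u a : Cl 𝕜 (r + 1)) : outer u (-a) = -outer u a := (outerL u).map_neg a
    have e2 (u a : Cl 𝕜 (r + 1)) : contract u (-a) = -contract u a := (contractL u).map_neg a
    rw [e1, e2, outer_incl, contract_incl, map_add, incl_real_smul]
    push_cast
    rw [show (t : ℤ) - (t + 1) = -1 by ring, show (-1 : ℤ) + 1 = 0 by ring, zpow_zero, one_smul,
      zpow_neg_one]
    by_cases h' : t = 0 ∨ t = r
    · simp [succCoef, h']
    · rw [not_or] at h'
      have hb := h h'.1 h'.2
      rw [mul_add, mul_add, mul_smul_comm, mul_smul_comm, mul_neg, mul_neg]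
      simp only [outerL_apply, contractL_apply]
      generalize betaFactor r t j = b at *
      match_scalars <;> field_simp

/-! ### Explicit form of the embedding -/

/-- The scalar factor as a function of `x_{r+1}` and `|x̲|`. -/
def radialHarmonic (r n j : ℕ) (q : ℝ × ℝ) : ℝ :=
  normCoef r n j * geg (((r : ℝ) - 1) / 2 + j) n q.1 (q.2 ^ 2 + q.1 ^ 2)

/-- The scalar coefficient of `x̲ e_{r+1}` as a function of `x_{r+1}` and `|x̲|`. -/
def radialSide (r n j : ℕ) (q : ℝ × ℝ) : ℝ :=
  sideCoef r j * (if 1 ≤ n then radialHarmonic r (n - 1) (j + 1) q else 0)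

/-- The pair `(x_{r+1}, |x̲|)` -/
def radial (x : Euc (r + 1)) : ℝ × ℝ := (x (Fin.last r), ‖pod x‖)

lemma harmonicFactor_eq_radial (n j : ℕ) (x : Euc (r + 1)) :
    harmonicFactor n j x = radialHarmonic r n j (radial x) := by
  rw [harmonicFactor_eq, radialHarmonic, norm_sq_pod]; rfl

lemma sideFactor_eq_radial (n j : ℕ) (x : Euc (r + 1)) :
    sideFactor n j x = radialSide r n j (radial x) := by
  rw [sideFactor, radialSide]
  split_ifs <;> simp [harmonicFactor_eq_radial]

@[fun_prop]
lemma continuous_radialHarmonic (r n j : ℕ) : Continuous (radialHarmonic r n j) := by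
  unfold radialHarmonic geg
  fun_prop

@[fun_prop]
lemma continuous_radialSide (r n j : ℕ) : Continuous (radialSide r n j) := by
  unfold radialSide
  split_ifs <;> fun_prop

lemma radialSide_succ (r n j : ℕ) (q : ℝ × ℝ) :
    radialSide r (n + 1) j q = sideCoef r j * radialHarmonic r n (j + 1) q := by simp [radialSide]

/-- `y∧` and `y•` square to zero, and their anticommutator is `-|y|²`. -/
lemma vec_mul_raise (t j : ℕ) (p : Euc r → Cl 𝕜 r) (y : Euc r) :
    vec 𝕜 y * raise t j p y = (betaFactor r t j - 1) • xWedge y (xDot y (p y)) - ‖y‖ ^ 2 • p y := by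
  rw [← xWedge_add_xDot, raise, map_add, map_add, LinearMap.map_smul_of_tower,
    LinearMap.map_smul_of_tower, xWedge_xWedge, xDot_xDot, xDot_xWedge]
  module

/-- The two lifts both produce `e_{r+1}(x̲∧p)`, of the wrong grade `t + 2`; the weight `sideCoef`
makes these terms cancel. What remains has grade `t` and coefficients depending only on `x_{r+1}`
and `|x̲|`. -/
lemma exists_form_same {t k j : ℕ} (h : (t, j) ∈ branching (r + 1) t k) :
    ∃ A B C : ℝ × ℝ → ℝ, Continuous A ∧ Continuous B ∧ Continuous C ∧
      ∀ p : Euc r → Cl 𝕜 r, (∀ y, p y ∈ multivectors 𝕜 r t) → ∀ x : Euc (r + 1),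
        embeddingFactor t t k j p x = A (radial x) • incl 𝕜 r (p (pod x)) +
          B (radial x) • (lastGen 𝕜 r * incl 𝕜 r (xDot (pod x) (p (pod x)))) +
          C (radial x) • incl 𝕜 r (xWedge (pod x) (xDot (pod x) (p (pod x)))) := by
  obtain ⟨h1, h2, h3, -, h4⟩ := h
  simp only at h1 h2 h3 h4
  obtain ⟨n, rfl⟩ := Nat.exists_eq_add_of_le h3
  simp only [embeddingFactor_same]
  rcases n with _ | n
  · refine ⟨1, 0, 0, continuous_const, continuous_const, continuous_const, fun p _ x => ?_⟩
    simp [tower, lift_zero]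
  -- A scalar target forces `k = 0`, whereas here `k = j + n + 1`. So `t = r` is the only extreme
  -- grade left, and there `x̲∧p = 0`.
  have ht : t ≠ 0 := fun ht => by have := h1 (Or.inl ht); omega
  by_cases ht' : t = r
  · refine ⟨radialHarmonic r (n + 1) j, fun q => -radialSide r (n + 1) j q, 0, by fun_prop,
      by fun_prop, continuous_const, fun p hp x => ?_⟩
    have hw : xWedge (pod x) (p (pod x)) = 0 := by
      subst ht'; exact xWedge_top _ (hp _)
    rw [tower_succ_apply, lift_eq, sameCoef, if_pos (Or.inr ht'), zero_smul, podMul_lastGen, podMul_incl,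
      ← xWedge_add_xDot, hw, harmonicFactor_eq_radial, sideFactor_eq_radial]
    simp
  · refine ⟨fun q => radialHarmonic r (n + 1) j q + sideCoef r j * radialSide r n (j + 1) q * q.2 ^ 2,
      fun q => sideCoef r j * (betaFactor r t j - 1) * radialHarmonic r n (j + 1) q,
      fun q => sideCoef r j * (1 - betaFactor r t j) * radialSide r n (j + 1) q,
      by fun_prop, by fun_prop, by fun_prop, fun p _ x => ?_⟩
    rw [tower_succ_apply, lift_eq, lift_eq, sameCoef, if_neg (by tauto), podMul_lastGen, podMul_incl,
      lastGen_mul_lastGen_mul]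
    have e : podMul x (-incl 𝕜 r (raise t j p (pod x))) =
        -incl 𝕜 r (vec 𝕜 (pod x) * raise t j p (pod x)) := by
      rw [← podMul_incl]; simp [podMul]
    rw [e, vec_mul_raise, raise, ← xWedge_add_xDot, harmonicFactor_eq_radial,
      harmonicFactor_eq_radial, sideFactor_eq_radial, sideFactor_eq_radial, radialSide_succ]
    simp only [map_add, map_sub, incl_real_smul, mul_add, mul_smul_comm, radial]
    module

/-- The counterpart of `exists_form_same`: the unwanted term is now `x̲•p`, of grade `t - 1`, and
the weight `sideCoef / β` makes its two occurrences cancel. -/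
lemma exists_form_succ {t k j : ℕ} (h : (t, j) ∈ branching (r + 1) (t + 1) k) :
    ∃ A B C : ℝ × ℝ → ℝ, Continuous A ∧ Continuous B ∧ Continuous C ∧
      ∀ p : Euc r → Cl 𝕜 r, (∀ y, p y ∈ multivectors 𝕜 r t) → ∀ x : Euc (r + 1),
        embeddingFactor (t + 1) t k j p x =
          A (radial x) • (lastGen 𝕜 r * incl 𝕜 r (p (pod x))) +
          B (radial x) • incl 𝕜 r (xWedge (pod x) (p (pod x))) +
          C (radial x) • (lastGen 𝕜 r *
            incl 𝕜 r (xWedge (pod x) (xDot (pod x) (p (pod x))))) := by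
  obtain ⟨h1, h2, h3, -, h4⟩ := h
  simp only at h1 h2 h3 h4
  obtain ⟨n, rfl⟩ := Nat.exists_eq_add_of_le h3
  have hβ : t ≠ 0 → t ≠ r → betaFactor r t j ≠ 0 := fun h h' =>
    (betaFactor_neg j (by omega) (by omega)).ne
  simp only [embeddingFactor_succ t j _ _ hβ]
  rcases n with _ | n
  · refine ⟨1, 0, 0, continuous_const, continuous_const, continuous_const, fun p _ x => ?_⟩
    simp [tower, lift_zero]
  -- A pseudoscalar target has degree zero, so only `t = 0` remains as an extreme grade, and there
  -- `x̲•p = 0`.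
  have ht : t ≠ r := fun ht => by have := h1 (Or.inr (by omega)); omega
  by_cases ht' : t = 0
  · refine ⟨radialHarmonic r (n + 1) j, fun q => -radialSide r (n + 1) j q, 0, by fun_prop,
      by fun_prop, continuous_const, fun p hp x => ?_⟩
    have hw : xDot (pod x) (p (pod x)) = 0 := by
      subst ht'; exact xDot_scalar _ (hp _)
    rw [tower_succ_apply, lift_eq, succCoef, if_pos (Or.inl ht'), zero_smul, podMul_lastGen, podMul_lastGen,
      mul_neg, lastGen_mul_lastGen_mul, neg_neg, podMul_incl,
      ← xWedge_add_xDot, hw, harmonicFactor_eq_radial, sideFactor_eq_radial]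
    simp
  · have hb := hβ ht' ht
    set b := betaFactor r t j with hbd
    -- With `D = sideCoef / β` as parameter no division is left in the coefficient comparison.
    obtain ⟨D, hD⟩ : ∃ D, sideCoef r j = D * b := ⟨sideCoef r j / b, by field_simp⟩
    refine ⟨fun q => radialHarmonic r (n + 1) j q + D * radialSide r n (j + 1) q * q.2 ^ 2,
      fun q => D * (1 - b) * radialHarmonic r n (j + 1) q,
      fun q => D * (1 - b) * radialSide r n (j + 1) q,
      by fun_prop, by fun_prop, by fun_prop, fun p _ x => ?_⟩
    have hD' : succCoef r t j = D := by
      rw [succCoef, if_neg (by tauto), hD, ← hbd, mul_div_cancel_right₀ _ hb]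
    rw [tower_succ_apply, lift_eq, lift_eq, hD', podMul_lastGen, podMul_lastGen, podMul_lastGen,
      podMul_incl, podMul_incl, mul_neg, lastGen_mul_lastGen_mul, neg_neg,
      vec_mul_raise, raise, ← xWedge_add_xDot, harmonicFactor_eq_radial,
      harmonicFactor_eq_radial, sideFactor_eq_radial, sideFactor_eq_radial, radialSide_succ, hD,
      ← hbd]
    simp only [map_add, map_sub, incl_real_smul, mul_sub, mul_smul_comm, radial]
    module

/-! ### The embedding preserves monogenicity -/

lemma dirac_raise_incl {t j : ℕ} (ht : 1 ≤ t) {p : Euc r → Cl 𝕜 r} (hp : HomMonogenic t j p) :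
    UpperMonogenic (j + 1) fun y => incl 𝕜 r (raise t j p y) :=
  upperMonogenic_incl hp.hom.raise (dirac_raise ht hp)

lemma betaFactor_ne_zero_of_branching {s t k j : ℕ} (h : (t, j) ∈ branching (r + 1) s k) :
    t ≠ 0 → t ≠ r → betaFactor r t j ≠ 0 := fun h1 h2 =>
  (betaFactor_neg j (by omega) (by have := h.2.1; simp only at this; omega)).ne

/-- Homogeneity and `∂ = 0` are read off the `tower` form, and the grade off the explicit form in
which the terms of wrong grade have cancelled. -/
lemma HomMonogenic.embed_same (hr : 2 ≤ r) {t k j : ℕ} (h : (t, j) ∈ branching (r + 1) t k)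
    {p : Euc r → Cl 𝕜 r} (hp : HomMonogenic t j p) :
    HomMonogenic t k (embeddingFactor t t k j p) := by
  obtain ⟨A, B, C, -, -, -, hf⟩ := exists_form_same (𝕜 := 𝕜) h
  obtain ⟨n, rfl⟩ := Nat.exists_eq_add_of_le h.2.2.1
  have h2 : IsHom (j + 1) fun y => lastGen 𝕜 r * incl 𝕜 r (GMT.raise t j p y) :=
    hp.hom.raise.lin ((LinearMap.mulLeft 𝕜 (lastGen 𝕜 r)).comp (incl 𝕜 r).toLinearMap)
  refine ⟨?_, fun x => ?_, fun x => ?_⟩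
  · rw [embeddingFactor_same]
    have := isHom_tower (C := sameCoef r t j) (hp.hom.lin (incl 𝕜 r).toLinearMap) h2 n
    rwa [add_comm n j] at this
  · rw [hf p hp.grade]
    have hz : ∀ a : Cl 𝕜 r, a ∈ multivectors 𝕜 r t → ∀ y : Euc r,
        lastGen 𝕜 r * incl 𝕜 r (xDot y a) ∈ multivectors 𝕜 (r + 1) t ∧
          xWedge y (xDot y a) ∈ multivectors 𝕜 r t := by
      intro a ha y
      rcases t with _ | t
      · rw [xDot_scalar y ha, map_zero, map_zero, mul_zero]
        exact ⟨Submodule.zero_mem _, Submodule.zero_mem _⟩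
      · exact ⟨lastGen_incl_mem (xDot_mem y ha), xWedge_mem y (xDot_mem y ha)⟩
    obtain ⟨h3, h4⟩ := hz _ (hp.grade (pod x)) (pod x)
    simp only [← real_smul_eq (𝕜 := 𝕜)]
    exact add_mem (add_mem (Submodule.smul_mem _ _ (incl_mem (hp.grade _)))
      (Submodule.smul_mem _ _ h3)) (Submodule.smul_mem _ _ (incl_mem h4))
  · rw [embeddingFactor_same]
    refine dirac_tower hr (upperMonogenic_incl hp.hom hp.dirac_eq) h2 ?_ n x
    by_cases h' : t = 0 ∨ t = r
    · exact Or.inl (if_pos h')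
    · exact Or.inr (dirac_raise_incl (by omega) hp).lastGen_mul

lemma HomMonogenic.embed_succ (hr : 2 ≤ r) {t k j : ℕ} (h : (t, j) ∈ branching (r + 1) (t + 1) k)
    {p : Euc r → Cl 𝕜 r} (hp : HomMonogenic t j p) :
    HomMonogenic (t + 1) k (embeddingFactor (t + 1) t k j p) := by
  obtain ⟨A, B, C, -, -, -, hf⟩ := exists_form_succ (𝕜 := 𝕜) h
  have hβ := betaFactor_ne_zero_of_branching h
  obtain ⟨n, rfl⟩ := Nat.exists_eq_add_of_le h.2.2.1
  have h2 : IsHom (j + 1) fun y => incl 𝕜 r (GMT.raise t j p y) :=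
    hp.hom.raise.lin (incl 𝕜 r).toLinearMap
  have h1 := (upperMonogenic_incl hp.hom hp.dirac_eq).lastGen_mul
  refine ⟨?_, fun x => ?_, fun x => ?_⟩
  · rw [embeddingFactor_succ t j n p hβ]
    have := isHom_tower (C := succCoef r t j) h1.hom h2 n
    rwa [add_comm n j] at this
  · rw [hf p hp.grade]
    have h4 : xWedge (pod x) (GMT.xDot (pod x) (p (pod x))) ∈ multivectors 𝕜 r t := by
      have ha := hp.grade (pod x)
      revert ha
      generalize p (pod x) = a
      intro ha
      rcases t with _ | t
      · rw [xDot_scalar _ ha, map_zero]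
        exact Submodule.zero_mem _
      · exact xWedge_mem _ (xDot_mem _ ha)
    simp only [← real_smul_eq (𝕜 := 𝕜)]
    exact add_mem (add_mem (Submodule.smul_mem _ _ (lastGen_incl_mem (hp.grade _)))
      (Submodule.smul_mem _ _ (incl_mem (xWedge_mem _ (hp.grade _)))))
      (Submodule.smul_mem _ _ (lastGen_incl_mem h4))
  · rw [embeddingFactor_succ t j n p hβ]
    refine dirac_tower hr h1 h2 ?_ n x
    by_cases h' : t = 0 ∨ t = r
    · exact Or.inl (if_pos h')
    · exact Or.inr (dirac_raise_incl (by omega) hp)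

lemma iterate_pd_embed_same (hr : 2 ≤ r) {t j : ℕ} (n : ℕ) {p : Euc r → Cl 𝕜 r}
    (hp : IsHom j p) (x : Euc (r + 1)) :
    (pd (Fin.last r))^[n] (embeddingFactor t t (j + n) j p) x =
      rising (j + 1) n • incl 𝕜 r (p (pod x)) := by
  rw [embeddingFactor_same]
  exact iterate_pd_tower hr (hp.lin (incl 𝕜 r).toLinearMap)
    (hp.raise.lin ((LinearMap.mulLeft 𝕜 (lastGen 𝕜 r)).comp (incl 𝕜 r).toLinearMap)) n x

lemma iterate_pd_embed_succ (hr : 2 ≤ r) {t j n : ℕ}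
    (h : (t, j) ∈ branching (r + 1) (t + 1) (j + n)) {p : Euc r → Cl 𝕜 r}
    (hp : IsHom j p) (x : Euc (r + 1)) :
    (pd (Fin.last r))^[n] (embeddingFactor (t + 1) t (j + n) j p) x =
      rising (j + 1) n • (lastGen 𝕜 r * incl 𝕜 r (p (pod x))) := by
  rw [embeddingFactor_succ t j n p (betaFactor_ne_zero_of_branching h)]
  exact iterate_pd_tower hr
    (hp.lin ((LinearMap.mulLeft 𝕜 (lastGen 𝕜 r)).comp (incl 𝕜 r).toLinearMap))
    (hp.raise.lin (incl 𝕜 r).toLinearMap) n x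

/-! ### Functions independent of the last coordinate -/

/-- `y ↦ (y, 0)` -/
def padL (r : ℕ) : Euc r →L[ℝ] Euc (r + 1) :=
  LinearMap.toContinuousLinearMap
    { toFun := fun y => WithLp.toLp 2 (Fin.snoc (α := fun _ => ℝ) (fun i => y i) 0)
      map_add' := fun a b => by
        ext i; refine Fin.lastCases ?_ (fun i => ?_) i <;> simp
      map_smul' := fun a b => by
        ext i; refine Fin.lastCases ?_ (fun i => ?_) i <;> simp }

lemma padL_castSucc (y : Euc r) (i : Fin r) : padL r y i.castSucc = y i := by
  simp [padL]

lemma padL_last (y : Euc r) : padL r y (Fin.last r) = 0 := by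
  simp [padL]

lemma pod_padL (y : Euc r) : pod (padL r y) = y := by
  ext i; rw [pod_apply, padL_castSucc]

lemma padL_pod_add (x : Euc (r + 1)) :
    padL r (pod x) + x (Fin.last r) • EuclideanSpace.single (Fin.last r) (1 : ℝ) = x := by
  ext i
  refine Fin.lastCases ?_ (fun i => ?_) i
  · simp [padL_last]
  · simp [padL_castSucc, pod_apply, (Fin.castSucc_lt_last i).ne]

lemma apply_padL_pod {E : Type*} [NormedAddCommGroup E] [NormedSpace ℝ E] {f : Euc (r + 1) → E}
    (hf : ContDiff ℝ ∞ f) (h : ∀ x, pd (Fin.last r) f x = 0) (x : Euc (r + 1)) :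
    f (padL r (pod x)) = f x := by
  have hd (c : ℝ) : HasDerivAt (fun c : ℝ => f (padL r (pod x) +
      c • EuclideanSpace.single (Fin.last r) (1 : ℝ))) 0 c := by
    have h1 : HasDerivAt (fun c : ℝ => padL r (pod x) +
        c • EuclideanSpace.single (Fin.last r) (1 : ℝ)) (EuclideanSpace.single (Fin.last r) 1) c := by
      simpa using ((hasDerivAt_id c).smul_const
        (EuclideanSpace.single (Fin.last r) (1 : ℝ))).const_add (padL r (pod x))
    have h2 := (hf.diffAt (padL r (pod x) +
      c • EuclideanSpace.single (Fin.last r) (1 : ℝ))).hasFDerivAt.comp_hasDerivAt c h1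
    have h3 := h (padL r (pod x) + c • EuclideanSpace.single (Fin.last r) (1 : ℝ))
    rw [pd] at h3
    rwa [h3] at h2
  have := is_const_of_deriv_eq_zero (fun c => (hd c).differentiableAt) (fun c => (hd c).deriv)
    0 (x (Fin.last r))
  simpa [padL_pod_add] using this

/-! ### Spanning by the embedded polynomials -/

lemma HomMonogenic.sub {s k : ℕ} {f g : Euc m → Cl 𝕜 m} (hf : HomMonogenic s k f)
    (hg : HomMonogenic s k g) : HomMonogenic s k fun x => f x - g x := by
  have := hf.add (hg.smul (-1))
  simpa [sub_eq_add_neg] using this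

lemma HomMonogenic.zero (s k : ℕ) : HomMonogenic s k (fun _ : Euc m => (0 : Cl 𝕜 m)) :=
  ⟨IsHom.zero k, fun _ => Submodule.zero_mem _, fun x => by simp [dirac]⟩

lemma HomMonogenic.pd {s k : ℕ} {f : Euc m → Cl 𝕜 m} (i : Fin m)
    (hf : HomMonogenic s (k + 1) f) : HomMonogenic s k (pd i f) :=
  ⟨hf.hom.pd i, fun x => pd_mem i _ hf.grade x (hf.hom.diffAt x), fun x => by
    rw [dirac_eq_dOp, ← pd_dOp _ i hf.hom.smooth]
    exact (pd_congr (f := dirac f) (g := fun _ => 0) hf.dirac_eq i x).trans (pd_const ..)⟩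

lemma HomMonogenic.iterate_pd {s k : ℕ} {f : Euc m → Cl 𝕜 m} (i : Fin m) (L : ℕ)
    (hf : HomMonogenic s (L + k) f) : HomMonogenic s k ((GMT.pd i)^[L] f) := by
  induction L generalizing f with
  | zero => simpa using hf
  | succ L ih =>
    rw [Function.iterate_succ_apply]
    exact ih (HomMonogenic.pd i (by rwa [show L + k + 1 = L + 1 + k by ring]))

/-- A monogenic field independent of `x_{r+1}` is the sum of two fields in the variables `x̲`. -/
lemma HomMonogenic.exists_split {s j : ℕ} {G : Euc (r + 1) → Cl 𝕜 (r + 1)}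
    (hG : HomMonogenic s j G) (h : ∀ x, GMT.pd (Fin.last r) G x = 0) :
    ∃ a b : Euc r → Cl 𝕜 r, HomMonogenic s j a ∧
      ((∀ y, b y = 0) ∨ ∃ t, s = t + 1 ∧ HomMonogenic t j b) ∧
      ∀ x, G x = incl 𝕜 r (a (pod x)) + lastGen 𝕜 r * incl 𝕜 r (b (pod x)) := by
  have hg : IsHom j fun y => G (padL r y) :=
    ⟨hG.hom.smooth.comp (padL r).contDiff, fun c y => by rw [_root_.map_smul, hG.hom.map_smul]⟩
  set a : Euc r → Cl 𝕜 r := fun y => restrictL r (G (padL r y)) with ha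
  set b : Euc r → Cl 𝕜 r := fun y => restrictLastL r (G (padL r y)) with hb
  have ha' : IsHom j a := hg.lin (restrictL r)
  have hb' : IsHom j b := hg.lin (restrictLastL r)
  have hsplit : ∀ x, G x = incl 𝕜 r (a (pod x)) + lastGen 𝕜 r * incl 𝕜 r (b (pod x)) := by
    intro x
    rw [ha, hb, incl_restrictL_add, apply_padL_pod hG.hom.smooth h]
  have hpd (i : Fin r) (x : Euc (r + 1)) : GMT.pd i.castSucc G x =
      incl 𝕜 r (GMT.pd i a (pod x)) + lastGen 𝕜 r * incl 𝕜 r (GMT.pd i b (pod x)) := by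
    rw [pd_congr hsplit]
    have h1 := ha'.lin (incl 𝕜 r).toLinearMap
    have h2 := hb'.lin ((LinearMap.mulLeft 𝕜 (lastGen 𝕜 r)).comp (incl 𝕜 r).toLinearMap)
    have e1 := pd_castSucc_comp_pod i (h1.diffAt (pod x))
    have e2 := pd_castSucc_comp_pod i (h2.diffAt (pod x))
    rw [pd_lin _ _ (ha'.diffAt _)] at e1
    rw [pd_lin _ _ (hb'.diffAt _)] at e2
    have := pd_add i.castSucc (h1.comp_pod.diffAt x) (h2.comp_pod.diffAt x)
    rw [e1, e2] at this
    exact this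
  -- The derivative in the last variable drops out, and `e_i` anticommutes with `e_{r+1}`, hence the
  -- minus sign. Since the sum `Cl_r ⊕ e_{r+1}Cl_r` is direct, `a` and `b` are monogenic separately.
  have hdir (y : Euc r) : incl 𝕜 r (dirac a y) + lastGen 𝕜 r * incl 𝕜 r (-dirac b y) = 0 := by
    have h0 := hG.dirac_eq (padL r y)
    rw [GMT.dirac_eq, Fin.sum_univ_castSucc, h, mul_zero, add_zero] at h0
    rw [← h0, GMT.dirac_eq, GMT.dirac_eq, map_sum, map_neg, map_sum, mul_neg, Finset.mul_sum,
      ← Finset.sum_neg_distrib, ← Finset.sum_add_distrib]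
    refine Finset.sum_congr rfl fun i _ => ?_
    rw [hpd, pod_padL, mul_add, map_mul, map_mul, incl_gen, ← mul_assoc (gen 𝕜 i.castSucc),
      incl_gen_mul_lastGen, neg_mul, mul_assoc]
  refine ⟨a, b, ⟨ha', fun y => restrictL_mem (hG.grade _), fun y => ?_⟩, ?_, hsplit⟩
  · have := congrArg (restrictL r) (hdir y)
    rwa [map_add, restrictL_incl, restrictL_lastGen_incl, add_zero, map_zero] at this
  · rcases s with _ | t
    · exact Or.inl fun y => restrictLastL_scalar (hG.grade _)
    · refine Or.inr ⟨t, rfl, hb', fun y => restrictLastL_mem (hG.grade _), fun y => ?_⟩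
      have := congrArg (restrictLastL r) (hdir y)
      rw [map_add, restrictLastL_incl, restrictLastL_lastGen_incl, zero_add, map_zero] at this
      exact neg_eq_zero.1 this

/-- Nothing is lost by the restrictions on indices: grades above the dimension are empty, and the
extreme grades carry only constants. -/
lemma HomMonogenic.eq_zero_of_not_branching {t j : ℕ} {a : Euc r → Cl 𝕜 r}
    (ha : HomMonogenic t j a) (h : ¬(t ≤ r ∧ (t = 0 ∨ t = r → j = 0))) (y : Euc r) : a y = 0 := by
  by_cases ht : t ≤ r
  · have h1 : (t = 0 ∨ t = r) ∧ j ≠ 0 := by tauto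
    obtain ⟨j, rfl⟩ := Nat.exists_eq_succ_of_ne_zero h1.2
    rcases h1.1 with h0 | h0
    · subst h0; exact ha.eq_zero_of_scalar y
    · subst h0; exact ha.eq_zero_of_top y
  · exact multivectors_eq_bot (not_le.1 ht) (ha.grade y)

lemma rising_ne_zero (j n : ℕ) : rising ((j : ℝ) + 1) n ≠ 0 := by
  induction n with
  | zero => rw [rising_zero]; exact one_ne_zero
  | succ n ih => rw [rising_succ]; exact mul_ne_zero ih (by positivity)

lemma iterate_pd_smul (i : Fin m) (c : ℝ) (L : ℕ) {f : Euc m → Cl 𝕜 m} (hf : ContDiff ℝ ∞ f)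
    (x : Euc m) : (pd i)^[L] (fun x => c • f x) x = c • (pd i)^[L] f x := by
  rw [iterate_pd_const_smul i c L hf]

lemma HomMonogenic.real_smul {s k : ℕ} (c : ℝ) {f : Euc m → Cl 𝕜 m} (hf : HomMonogenic s k f) :
    HomMonogenic s k fun x => c • f x := by
  simpa [real_smul_eq] using hf.smul (c : 𝕜)

lemma iterate_pd_zero (i : Fin m) (L : ℕ) (x : Euc m) :
    (pd i)^[L] (0 : Euc m → Cl 𝕜 m) x = 0 := by
  have := iterate_pd_smul (𝕜 := 𝕜) i 0 L (f := fun _ => 0) contDiff_const x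
  simp only [zero_smul] at this
  exact this

/-- Fields are peeled off by their order in `x_{r+1}`. If `L + 1` derivatives in `x_{r+1}` kill `P`,
the `L`-th one is a field in `x̲`, split by `exists_split` into a monogenic `s`-vector part and a
monogenic `(s-1)`-vector part. Embeddings with these leading parts are subtracted, which lowers the
order. -/
theorem HomMonogenic.mem_of_embeddings (hr : 2 ≤ r) {s k : ℕ}
    (W : Submodule 𝕜 (Euc (r + 1) → Cl 𝕜 (r + 1)))
    (hW : ∀ t j, (t, j) ∈ branching (r + 1) s k → ∀ p : Euc r → Cl 𝕜 r, HomMonogenic t j p →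
      embeddingFactor s t k j p ∈ W)
    {P : Euc (r + 1) → Cl 𝕜 (r + 1)} (hP : HomMonogenic s k P) : P ∈ W := by
  by_cases hs : s ≤ r + 1 ∧ (s = 0 ∨ s = r + 1 → k = 0)
  swap
  · rw [show P = 0 from funext (hP.eq_zero_of_not_branching hs)]
    exact W.zero_mem
  obtain ⟨hs1, hs2⟩ := hs
  -- Every admissible leading part is attained inside `W`, after division by the rising factorial. A
  -- part with an excluded index is zero and is matched by the zero field.
  have same (j L : ℕ) (hk : k = j + L) (a : Euc r → Cl 𝕜 r) (ha : HomMonogenic s j a) :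
      ∃ Q ∈ W, HomMonogenic s k Q ∧ ∀ x, (GMT.pd (Fin.last r))^[L] Q x = incl 𝕜 r (a (pod x)) := by
    by_cases hb : s ≤ r ∧ (s = 0 ∨ s = r → j = 0)
    · have hbr : (s, j) ∈ branching (r + 1) s k :=
        ⟨hs2, by simpa using hb.1, by simp only; omega, Or.inr rfl, by simpa using hb.2⟩
      have he := HomMonogenic.embed_same hr hbr ha
      refine ⟨_, ?_, he.real_smul (rising ((j : ℝ) + 1) L)⁻¹, fun x => ?_⟩
      · simp only [← real_smul_eq (𝕜 := 𝕜)]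
        exact W.smul_mem _ (hW s j hbr a ha)
      · rw [iterate_pd_smul _ _ _ he.hom.smooth]
        subst hk
        rw [iterate_pd_embed_same hr L ha.hom, smul_smul, inv_mul_cancel₀ (rising_ne_zero j L),
          one_smul]
    · refine ⟨0, W.zero_mem, HomMonogenic.zero s k, fun x => ?_⟩
      rw [ha.eq_zero_of_not_branching hb, map_zero]
      exact iterate_pd_zero _ L x
  have succ (t j L : ℕ) (hst : s = t + 1) (hk : k = j + L) (b : Euc r → Cl 𝕜 r)
      (hb : HomMonogenic t j b) :
      ∃ Q ∈ W, HomMonogenic s k Q ∧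
        ∀ x, (GMT.pd (Fin.last r))^[L] Q x = lastGen 𝕜 r * incl 𝕜 r (b (pod x)) := by
    subst hst
    by_cases hb' : t ≤ r ∧ (t = 0 ∨ t = r → j = 0)
    · have hbr : (t, j) ∈ branching (r + 1) (t + 1) k :=
        ⟨hs2, by simpa using hb'.1, by simp only; omega, Or.inl rfl, by simpa using hb'.2⟩
      have he := HomMonogenic.embed_succ hr hbr hb
      refine ⟨_, ?_, he.real_smul (rising ((j : ℝ) + 1) L)⁻¹, fun x => ?_⟩
      · simp only [← real_smul_eq (𝕜 := 𝕜)]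
        exact W.smul_mem _ (hW t j hbr b hb)
      · rw [iterate_pd_smul _ _ _ he.hom.smooth]
        subst hk
        rw [iterate_pd_embed_succ hr hbr hb.hom, smul_smul, inv_mul_cancel₀ (rising_ne_zero j L),
          one_smul]
    · refine ⟨0, W.zero_mem, HomMonogenic.zero _ k, fun x => ?_⟩
      rw [hb.eq_zero_of_not_branching hb', map_zero, mul_zero]
      exact iterate_pd_zero _ L x
  -- Induction on the number of derivatives in the last variable needed to annihilate the field.
  have main : ∀ L ≤ k + 1, ∀ P : Euc (r + 1) → Cl 𝕜 (r + 1), HomMonogenic s k P →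
      (∀ x, (GMT.pd (Fin.last r))^[L] P x = 0) → P ∈ W := by
    intro L
    induction L with
    | zero =>
      intro _ P _ h
      rw [show P = 0 from funext h]
      exact W.zero_mem
    | succ L ih =>
      intro hL P hP h
      obtain ⟨j, hj⟩ := Nat.exists_eq_add_of_le (show L ≤ k by omega)
      have hG : HomMonogenic s j ((GMT.pd (Fin.last r))^[L] P) :=
        HomMonogenic.iterate_pd _ L (by rwa [← hj])
      obtain ⟨a, b, ha, hb, hsp⟩ := hG.exists_split fun x => by
        have := h x
        rwa [Function.iterate_succ_apply'] at this
      obtain ⟨Q₁, hQ₁, hm₁, he₁⟩ := same j L (by omega) a ha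
      obtain ⟨Q₂, hQ₂, hm₂, he₂⟩ : ∃ Q ∈ W, HomMonogenic s k Q ∧
          ∀ x, (GMT.pd (Fin.last r))^[L] Q x = lastGen 𝕜 r * incl 𝕜 r (b (pod x)) := by
        rcases hb with hb | ⟨t, hst, hb⟩
        · obtain ⟨Q, hQ, hm, he⟩ := same j L (by omega) (fun _ => 0) (HomMonogenic.zero s j)
          exact ⟨Q, hQ, hm, fun x => by rw [he, hb, map_zero, mul_zero]⟩
        · exact succ t j L hst (by omega) b hb
      have hm := (hP.sub hm₁).sub hm₂
      have hmem := ih (by omega) _ hm fun x => by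
        rw [iterate_pd_sub _ _ (hP.sub hm₁).hom.smooth hm₂.hom.smooth,
          iterate_pd_sub _ _ hP.hom.smooth hm₁.hom.smooth]
        simp only [he₁, he₂, hsp]
        abel
      have : P = (fun x => P x - Q₁ x - Q₂ x) + Q₁ + Q₂ := by
        funext x
        simp only [Pi.add_apply]
        abel
      rw [this]
      exact W.add_mem (W.add_mem hmem hQ₁) hQ₂
  -- `k + 1` derivatives annihilate any polynomial of degree `k`.
  refine main (k + 1) le_rfl P hP fun x => ?_
  rw [Function.iterate_succ_apply']
  exact IsHom.pd_of_zero (IsHom.iterate_pd (k := 0) _ k (by simpa using hP.hom)) _ x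

/-! ### Integration by parts on the unit ball -/

section Stokes

open Filter Topology

/-- A continuous approximation of the indicator function of `(0, ∞)` vanishing near `0`. -/
def ramp (n : ℕ) (t : ℝ) : ℝ := min 1 (max 0 ((n + 1) * t - 1))

/-- A primitive of `ramp n`, approximating the positive part. -/
def rampInt (n : ℕ) (t : ℝ) : ℝ := ∫ s in (0 : ℝ)..t, ramp n s

lemma continuous_ramp (n : ℕ) : Continuous (ramp n) := by unfold ramp; fun_prop

lemma abs_ramp_le (n : ℕ) (t : ℝ) : |ramp n t| ≤ 1 := by
  rw [ramp, abs_of_nonneg (le_min zero_le_one (le_max_left _ _))]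
  exact min_le_left _ _

lemma ramp_eq_zero {n : ℕ} {t : ℝ} (h : t ≤ 1 / ((n : ℝ) + 1)) : ramp n t = 0 := by
  have : ((n : ℝ) + 1) * t - 1 ≤ 0 := by
    rw [le_div_iff₀ (by positivity)] at h
    linarith
  rw [ramp, max_eq_left this, min_eq_right zero_le_one]

lemma hasDerivAt_rampInt (n : ℕ) (t : ℝ) : HasDerivAt (rampInt n) (ramp n t) t :=
  intervalIntegral.integral_hasDerivAt_right ((continuous_ramp n).intervalIntegrable _ _)
    ((continuous_ramp n).stronglyMeasurableAtFilter _ _) (continuous_ramp n).continuousAt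

lemma rampInt_eq_zero {n : ℕ} {t : ℝ} (h : t ≤ 1 / ((n : ℝ) + 1)) : rampInt n t = 0 := by
  rw [rampInt, intervalIntegral.integral_congr (g := fun _ => 0), intervalIntegral.integral_zero]
  intro s hs
  refine ramp_eq_zero (hs.2.trans (max_le (by positivity) h))

lemma abs_rampInt_le (n : ℕ) (t : ℝ) : |rampInt n t| ≤ |t| := by
  have := intervalIntegral.norm_integral_le_of_norm_le_const (a := 0) (b := t) (f := ramp n) (C := 1)
    fun s _ => abs_ramp_le n s
  simpa [rampInt] using this

lemma tendsto_ramp {t : ℝ} (ht : 0 < t) : Tendsto (fun n => ramp n t) atTop (𝓝 1) := by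
  refine tendsto_const_nhds.congr' ?_
  obtain ⟨N, hN⟩ := exists_nat_gt (2 / t)
  filter_upwards [eventually_ge_atTop N] with n hn
  have h1 : 2 / t < n := hN.trans_le (by exact_mod_cast hn)
  rw [div_lt_iff₀ ht] at h1
  have h2 : (1 : ℝ) ≤ (n + 1) * t - 1 := by linarith
  rw [ramp, max_eq_right (by linarith), min_eq_left h2]

lemma tendsto_rampInt {t : ℝ} (ht : 0 < t) : Tendsto (fun n => rampInt n t) atTop (𝓝 t) := by
  have h := intervalIntegral.tendsto_integral_filter_of_dominated_convergence (μ := volume)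
    (a := 0) (b := t) (F := ramp) (f := fun _ => 1) (l := atTop) (fun _ => 1)
    (Eventually.of_forall fun n => (continuous_ramp n).aestronglyMeasurable)
    (Eventually.of_forall fun n => Eventually.of_forall fun s _ => abs_ramp_le n s)
    (intervalIntegrable_const) (Eventually.of_forall fun s hs => tendsto_ramp (by
      rw [Set.uIoc_of_le ht.le] at hs; exact hs.1))
  simpa [rampInt] using h

variable {E : Type*} [NormedAddCommGroup E] [NormedSpace ℝ E]

instance instIsFiniteMeasureBall : IsFiniteMeasure (ballMeasure m) :=
  ⟨by rw [ballMeasure, Measure.restrict_apply_univ]; exact measure_ball_lt_top⟩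

lemma ae_ball : ∀ᵐ x ∂ballMeasure m, x ∈ Metric.ball (0 : Euc m) 1 :=
  ae_restrict_mem measurableSet_ball

lemma integrable_of_continuous {E : Type*} [NormedAddCommGroup E] {f : Euc m → E} (hf : Continuous f) :
    Integrable f (ballMeasure m) :=
  ((hf.continuousOn.integrableOn_compact (isCompact_closedBall (0 : Euc m) 1))).mono_set
    Metric.ball_subset_closedBall

lemma integrable_smul_of_continuous {g : Euc m → ℝ} (hg : Continuous g) {f : Euc m → E}
    (hf : Integrable f (ballMeasure m)) : Integrable (fun x => g x • f x) (ballMeasure m) := by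
  obtain ⟨C, hC⟩ := (isCompact_closedBall (0 : Euc m) 1).exists_bound_of_continuousOn hg.continuousOn
  exact hf.bdd_smul C hg.aestronglyMeasurable (ae_ball.mono fun x hx =>
    hC x (Metric.ball_subset_closedBall hx))

lemma integral_pd_eq_zero [CompleteSpace E] (i : Fin m) {W : Euc m → E} (hW : ContDiff ℝ 1 W)
    (hc : HasCompactSupport W) : ∫ x, pd i W x = 0 := by
  have h := integral_smul_fderiv_eq_neg_fderiv_smul_of_integrable (𝕜 := ℝ) (μ := volume)
    (f := fun _ : Euc m => (1 : ℝ)) (g := W) (v := EuclideanSpace.single i 1) (by simp) ?_ ?_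
    (fun x _ => differentiableAt_const _) (fun x _ => hW.differentiable one_ne_zero x)
  · simpa [pd] using h
  · simp only [one_smul]
    exact ((hW.continuous_fderiv one_ne_zero).clm_apply continuous_const).integrable_of_hasCompactSupport
      (hc.fderiv_apply (𝕜 := ℝ) _)
  · simp only [one_smul]
    exact hW.continuous.integrable_of_hasCompactSupport hc

/-- `rampInt n` vanishes up to `1/(n+1)`, so the cut-off field is zero near and outside the unit
sphere. It is therefore C¹ on the whole space although `V` is controlled only inside the ball. -/
lemma cutoff_contDiff (n : ℕ) {V : Euc m → E} (hV : ContDiffOn ℝ 1 V (Metric.ball 0 1)) :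
    ContDiff ℝ 1 (fun x => rampInt n (1 - ‖x‖ ^ 2) • V x) ∧
      HasCompactSupport (fun x => rampInt n (1 - ‖x‖ ^ 2) • V x) := by
  have hr : ContDiff ℝ 1 (rampInt n) := by
    rw [contDiff_one_iff_deriv]
    refine ⟨fun t => (hasDerivAt_rampInt n t).differentiableAt, ?_⟩
    rw [show deriv (rampInt n) = ramp n from funext fun t => (hasDerivAt_rampInt n t).deriv]
    exact continuous_ramp n
  have hu : ContDiff ℝ 1 fun x : Euc m => 1 - ‖x‖ ^ 2 :=
    contDiff_const.sub (contDiff_normSq.of_le (by simp))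
  have hz : ∀ x : Euc m, 1 - 1 / ((n : ℝ) + 1) ≤ ‖x‖ ^ 2 → rampInt n (1 - ‖x‖ ^ 2) = 0 :=
    fun x hx => rampInt_eq_zero (by linarith)
  refine ⟨contDiff_iff_contDiffAt.2 fun x => ?_, ?_⟩
  · by_cases hx : x ∈ Metric.ball (0 : Euc m) 1
    · exact (hr.comp hu).contDiffAt.smul (hV.contDiffAt (Metric.isOpen_ball.mem_nhds hx))
    · have hx1 : 1 ≤ ‖x‖ := by simpa using hx
      have h0 : (fun x => rampInt n (1 - ‖x‖ ^ 2) • V x) =ᶠ[𝓝 x] fun _ => 0 := by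
        have hc : Continuous fun x : Euc m => ‖x‖ ^ 2 := by fun_prop
        have : ∀ᶠ y in 𝓝 x, 1 - 1 / ((n : ℝ) + 1) < ‖y‖ ^ 2 := by
          refine hc.continuousAt.eventually (lt_mem_nhds ?_)
          have : (0 : ℝ) < 1 / ((n : ℝ) + 1) := by positivity
          nlinarith
        filter_upwards [this] with y hy
        rw [hz y hy.le, zero_smul]
      exact contDiffAt_const.congr_of_eventuallyEq h0
  · refine HasCompactSupport.intro (isCompact_closedBall (0 : Euc m) 1) fun x hx => ?_
    have hx1 : 1 < ‖x‖ := by simpa using hx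
    rw [hz x, zero_smul]
    have : (0 : ℝ) < 1 / ((n : ℝ) + 1) := by positivity
    nlinarith

lemma integral_cutoff [CompleteSpace E] (i : Fin m) (n : ℕ) {V : Euc m → E}
    (hV : ContDiffOn ℝ 1 V (Metric.ball 0 1)) :
    Integrable (fun x => rampInt n (1 - ‖x‖ ^ 2) • pd i V x -
      (2 * ramp n (1 - ‖x‖ ^ 2)) • (x i • V x)) (ballMeasure m) ∧
    ∫ x, rampInt n (1 - ‖x‖ ^ 2) • pd i V x -
      (2 * ramp n (1 - ‖x‖ ^ 2)) • (x i • V x) ∂ballMeasure m = 0 := by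
  obtain ⟨h1, h2⟩ := cutoff_contDiff n hV
  have hpd : ∀ x ∈ Metric.ball (0 : Euc m) 1, pd i (fun x => rampInt n (1 - ‖x‖ ^ 2) • V x) x =
      rampInt n (1 - ‖x‖ ^ 2) • pd i V x - (2 * ramp n (1 - ‖x‖ ^ 2)) • (x i • V x) := by
    intro x hx
    have hVx := (hV.contDiffAt (Metric.isOpen_ball.mem_nhds hx)).differentiableAt one_ne_zero
    have hu : DifferentiableAt ℝ (fun x : Euc m => 1 - ‖x‖ ^ 2) x :=
      (differentiableAt_const _).sub (contDiff_normSq.diffAt x)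
    have hc := (hasDerivAt_rampInt n (1 - ‖x‖ ^ 2)).comp_hasFDerivAt x hu.hasFDerivAt
    have hcd : DifferentiableAt ℝ (fun x : Euc m => rampInt n (1 - ‖x‖ ^ 2)) x :=
      hc.differentiableAt
    rw [pd_smul i hcd hVx]
    have e : pd i (fun x : Euc m => rampInt n (1 - ‖x‖ ^ 2)) x =
        ramp n (1 - ‖x‖ ^ 2) * pd i (fun x : Euc m => 1 - ‖x‖ ^ 2) x := by
      rw [pd, show (fun x : Euc m => rampInt n (1 - ‖x‖ ^ 2)) =
        rampInt n ∘ (fun x : Euc m => 1 - ‖x‖ ^ 2) from rfl, hc.fderiv]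
      rfl
    rw [e, pd_sub i (contDiff_const.diffAt x) (contDiff_normSq.diffAt x), pd_const, pd_normSq]
    module
  have hInt : Integrable (pd i fun x => rampInt n (1 - ‖x‖ ^ 2) • V x) :=
    ((h1.continuous_fderiv one_ne_zero).clm_apply continuous_const).integrable_of_hasCompactSupport
      (h2.fderiv_apply (𝕜 := ℝ) _)
  have hzero : ∀ x, x ∉ Metric.ball (0 : Euc m) 1 →
      pd i (fun x => rampInt n (1 - ‖x‖ ^ 2) • V x) x = 0 := by
    intro x hx
    have hx1 : 1 ≤ ‖x‖ := by simpa using hx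
    have h0 : (fun x => rampInt n (1 - ‖x‖ ^ 2) • V x) =ᶠ[𝓝 x] fun _ => 0 := by
      have hc : Continuous fun x : Euc m => ‖x‖ ^ 2 := by fun_prop
      have : ∀ᶠ y in 𝓝 x, 1 - 1 / ((n : ℝ) + 1) < ‖y‖ ^ 2 := by
        refine hc.continuousAt.eventually (lt_mem_nhds ?_)
        have : (0 : ℝ) < 1 / ((n : ℝ) + 1) := by positivity
        nlinarith
      filter_upwards [this] with y hy
      rw [rampInt_eq_zero (by linarith), zero_smul]
    rw [pd, h0.fderiv_eq]
    simp
  constructor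
  · refine (hInt.mono_measure Measure.restrict_le_self).congr ?_
    filter_upwards [ae_ball] with x hx using hpd x hx
  · have h3 := integral_pd_eq_zero i h1 h2
    rw [← setIntegral_eq_integral_of_forall_compl_eq_zero hzero,
      setIntegral_congr_fun measurableSet_ball hpd] at h3
    exact h3

/-- The divergence theorem with the weight `1 - |x|²`. -/
theorem integral_one_sub_smul_div [CompleteSpace E] {V : Fin m → Euc m → E}
    (hV : ∀ i, ContDiffOn ℝ 1 (V i) (Metric.ball 0 1)) (hi : ∀ i, Integrable (V i) (ballMeasure m))
    (hd : Integrable (fun x => ∑ i, pd i (V i) x) (ballMeasure m)) :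
    ∫ x, (1 - ‖x‖ ^ 2) • ∑ i, pd i (V i) x ∂ballMeasure m =
      (2 : ℝ) • ∫ x, ∑ i, x i • V i x ∂ballMeasure m := by
  -- The divergence of the cut-off field, whose integral is zero. As the cutoff tends to `1 - |x|²`
  -- and its derivative to one, dominated convergence gives the formula. Only `V` and its total
  -- divergence need to be integrable, not the single partial derivatives.
  set F : ℕ → Euc m → E := fun n x => rampInt n (1 - ‖x‖ ^ 2) • ∑ i, pd i (V i) x -
      (2 * ramp n (1 - ‖x‖ ^ 2)) • ∑ i, x i • V i x with hF
  have hFs (n : ℕ) : F n = fun x => ∑ i, (rampInt n (1 - ‖x‖ ^ 2) • pd i (V i) x -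
      (2 * ramp n (1 - ‖x‖ ^ 2)) • (x i • V i x)) := by
    funext x
    simp only [hF, Finset.sum_sub_distrib, Finset.smul_sum]
  have hFi (n : ℕ) : Integrable (F n) (ballMeasure m) := by
    rw [hFs]; exact integrable_finsetSum _ fun i _ => (integral_cutoff i n (hV i)).1
  have hF0 (n : ℕ) : ∫ x, F n x ∂ballMeasure m = 0 := by
    rw [hFs, integral_finsetSum _ fun i _ => (integral_cutoff i n (hV i)).1]
    exact Finset.sum_eq_zero fun i _ => (integral_cutoff i n (hV i)).2
  have hxV : Integrable (fun x => ∑ i, x i • V i x) (ballMeasure m) :=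
    integrable_finsetSum _ fun i _ =>
      integrable_smul_of_continuous (contDiff_coord i).continuous (hi i)
  have hu : Integrable (fun x => (1 - ‖x‖ ^ 2) • ∑ i, pd i (V i) x) (ballMeasure m) :=
    integrable_smul_of_continuous (by fun_prop) hd
  have hlim : Tendsto (fun n => ∫ x, F n x ∂ballMeasure m) atTop
      (𝓝 (∫ x, ((1 - ‖x‖ ^ 2) • ∑ i, pd i (V i) x - (2 : ℝ) • ∑ i, x i • V i x) ∂ballMeasure m)) := by
    refine tendsto_integral_filter_of_dominated_convergence
      (fun x => ‖∑ i, pd i (V i) x‖ + 2 * ‖∑ i, x i • V i x‖)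
      (Eventually.of_forall fun n => (hFi n).aestronglyMeasurable)
      (Eventually.of_forall fun n => ?_) (hd.norm.add (hxV.norm.const_mul 2)) ?_
    · filter_upwards [ae_ball] with x hx
      have hx1 : ‖x‖ < 1 := by simpa using hx
      have h1 : |rampInt n (1 - ‖x‖ ^ 2)| ≤ 1 := (abs_rampInt_le _ _).trans (by
        rw [abs_le]; constructor <;> nlinarith [norm_nonneg x])
      refine (norm_sub_le _ _).trans (add_le_add ?_ ?_)
      · rw [norm_smul]
        exact mul_le_of_le_one_left (norm_nonneg _) h1
      · rw [norm_smul, Real.norm_eq_abs, abs_mul]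
        refine mul_le_mul_of_nonneg_right ?_ (norm_nonneg _)
        have := abs_ramp_le n (1 - ‖x‖ ^ 2)
        rw [abs_two]; linarith
    · filter_upwards [ae_ball] with x hx
      have hx1 : ‖x‖ < 1 := by simpa using hx
      have h0 : 0 < 1 - ‖x‖ ^ 2 := by nlinarith [norm_nonneg x]
      have h2 := (tendsto_ramp h0).const_mul 2
      rw [mul_one] at h2
      exact ((tendsto_rampInt h0).smul_const _).sub (h2.smul_const _)
  simp only [hF0] at hlim
  have h := tendsto_nhds_unique tendsto_const_nhds hlim
  have hxV2 : Integrable (fun x => (2 : ℝ) • ∑ i, x i • V i x) (ballMeasure m) := hxV.smul (2 : ℝ)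
  rw [integral_sub hu hxV2, integral_smul] at h
  exact (sub_eq_zero.1 h.symm)

end Stokes

/-! ### Integrals of homogeneous functions over the ball -/

section Homogeneous

variable {E : Type*} [NormedAddCommGroup E] [NormedSpace ℝ E]

lemma IsHom.integrable {d : ℕ} {h : Euc m → E} (hh : IsHom d h) : Integrable h (ballMeasure m) :=
  integrable_of_continuous hh.smooth.continuous

variable [CompleteSpace E]

lemma integral_one_sub_smul_pd (i : Fin m) {h : Euc m → E} (hh : ContDiff ℝ ∞ h) :
    ∫ x, (1 - ‖x‖ ^ 2) • pd i h x ∂ballMeasure m = (2 : ℝ) • ∫ x, x i • h x ∂ballMeasure m := by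
  classical
  have hs (j : Fin m) : ContDiff ℝ ∞ (if j = i then h else fun _ => 0) := by
    split_ifs
    · exact hh
    · exact contDiff_const
  have e1 (x : Euc m) : ∑ j, pd j (if j = i then h else fun _ => 0) x = pd i h x := by
    rw [Finset.sum_eq_single i]
    · simp
    · intro j _ hj; rw [if_neg hj, pd_const]
    · simp
  have e2 (x : Euc m) : ∑ j, x j • (if j = i then h else fun _ => 0) x = x i • h x := by
    rw [Finset.sum_eq_single i]
    · simp
    · intro j _ hj; rw [if_neg hj, smul_zero]
    · simp
  have := integral_one_sub_smul_div (V := fun j => if j = i then h else fun _ => 0)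
    (fun j => ((hs j).of_le (by simp)).contDiffOn)
    (fun j => integrable_of_continuous (hs j).continuous)
    (by simp only [e1]; exact integrable_of_continuous (contDiff_pd i hh).continuous)
  simpa only [e1, e2] using this

/-- The divergence theorem for the radial field `x_j h`, whose divergence is `(d + m) h` by Euler's
formula. -/
lemma IsHom.integral_one_sub {d : ℕ} {h : Euc m → E} (hh : IsHom d h) :
    ((d : ℝ) + m + 2) • ∫ x, (1 - ‖x‖ ^ 2) • h x ∂ballMeasure m =
      (2 : ℝ) • ∫ x, h x ∂ballMeasure m := by
  have e1 (x : Euc m) : ∑ j, GMT.pd j (fun x => x j • h x) x = ((d : ℝ) + m) • h x := by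
    simp only [pd_coord_smul _ _ (hh.diffAt x), if_true, Finset.sum_add_distrib, hh.euler]
    simp only [Finset.sum_const, Finset.card_univ, Fintype.card_fin, add_smul, Nat.cast_smul_eq_nsmul]
    abel
  have e2 (x : Euc m) : ∑ j, x j • x j • h x = ‖x‖ ^ 2 • h x := by
    simp only [smul_smul, ← Finset.sum_smul, norm_sq_eq_sum]
  have hi := hh.integrable
  have hui : Integrable (fun x => ‖x‖ ^ 2 • h x) (ballMeasure m) :=
    integrable_smul_of_continuous (by fun_prop) hi
  have := integral_one_sub_smul_div (V := fun j x => x j • h x)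
    (fun j => ((hh.coord_smul j).smooth.of_le (by simp)).contDiffOn)
    (fun j => (hh.coord_smul j).integrable)
    (by simp only [e1]; exact hi.smul _)
  simp only [e1, e2, smul_comm _ ((d : ℝ) + m), integral_smul] at this
  have h3 : ∫ x, (1 - ‖x‖ ^ 2) • h x ∂ballMeasure m =
      ∫ x, h x ∂ballMeasure m - ∫ x, ‖x‖ ^ 2 • h x ∂ballMeasure m := by
    rw [← integral_sub hi hui]
    simp only [sub_smul, one_smul]
  rw [add_smul, this, h3]
  module

/-- The boundary term of the divergence theorem rewritten as a ball integral by homogeneity. It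
follows from the two weighted identities, the second one applied to `∂_i h`, of degree `d - 1`. -/
lemma IsHom.integral_pd {d : ℕ} {h : Euc m → E} (hh : IsHom d h) (i : Fin m) :
    ∫ x, GMT.pd i h x ∂ballMeasure m = ((d : ℝ) + m + 1) • ∫ x, x i • h x ∂ballMeasure m := by
  have h1 := integral_one_sub_smul_pd i hh.smooth
  rcases d with _ | d
  · simp only [hh.pd_of_zero, smul_zero, integral_zero] at h1 ⊢
    rw [(smul_eq_zero.1 h1.symm).resolve_left two_ne_zero, smul_zero]
  · have h2 := (hh.pd i).integral_one_sub
    rw [h1, smul_comm] at h2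
    have := smul_right_injective E (two_ne_zero (α := ℝ)) h2
    rw [← this]
    push_cast
    ring_nf

end Homogeneous

/-! ### The inner product of homogeneous multivector fields -/

/-- `∫_{B_m} [f̄ g]₀` -/
def ip (f g : Euc m → Cl 𝕜 m) : 𝕜 := ∫ x, inner 𝕜 (f x) (g x) ∂ballMeasure m

/-- The inner product as a real bilinear map. -/
def innerBilin (𝕜 : Type) [RCLike 𝕜] (m : ℕ) : Cl 𝕜 m →L[ℝ] Cl 𝕜 m →L[ℝ] 𝕜 :=
  LinearMap.mkContinuous₂ (LinearMap.mk₂ ℝ (fun a b : Cl 𝕜 m => inner 𝕜 a b)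
    (fun a b c => inner_add_left a b c)
    (fun c a b => by rw [inner_real_smul_left, RCLike.real_smul_eq_coe_mul])
    (fun a b c => inner_add_right a b c)
    (fun c a b => by rw [inner_real_smul_right, RCLike.real_smul_eq_coe_mul])) 1
    (fun a b => by simpa using norm_inner_le_norm a b)

lemma innerBilin_apply (a b : Cl 𝕜 m) : innerBilin 𝕜 m a b = inner 𝕜 a b := rfl

lemma contDiff_inner_fun {k : ℕ∞} {f g : Euc m → Cl 𝕜 m} (hf : ContDiff ℝ k f) (hg : ContDiff ℝ k g) :
    ContDiff ℝ k fun x => inner 𝕜 (f x) (g x) :=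
  ((innerBilin 𝕜 m).contDiff.comp hf).clm_apply hg

lemma pd_inner (i : Fin m) {f g : Euc m → Cl 𝕜 m} {x : Euc m} (hf : DifferentiableAt ℝ f x)
    (hg : DifferentiableAt ℝ g x) :
    pd i (fun x => inner 𝕜 (f x) (g x)) x = inner 𝕜 (pd i f x) (g x) + inner 𝕜 (f x) (pd i g x) := by
  have h : HasFDerivAt (fun x => inner 𝕜 (f x) (g x)) _ x :=
    (innerBilin 𝕜 m).hasFDerivAt_of_bilinear hf.hasFDerivAt hg.hasFDerivAt
  rw [pd, h.fderiv]
  simp [innerBilin_apply, pd, add_comm]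

lemma IsHom.inner {j k : ℕ} {f g : Euc m → Cl 𝕜 m} (hf : IsHom j f) (hg : IsHom k g) :
    IsHom (j + k) fun x => inner 𝕜 (f x) (g x) :=
  ⟨contDiff_inner_fun (k := ⊤) hf.smooth hg.smooth, fun c x => by
    rw [hf.map_smul, hg.map_smul, inner_real_smul_left, inner_real_smul_right,
      RCLike.real_smul_eq_coe_mul]
    push_cast
    ring⟩

lemma ip_conj_symm (f g : Euc m → Cl 𝕜 m) : starRingEnd 𝕜 (ip g f) = ip f g := by
  rw [ip, ip, ← integral_conj]
  simp only [inner_conj_symm]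

lemma ip_eq_zero_symm {f g : Euc m → Cl 𝕜 m} (h : ip f g = 0) : ip g f = 0 := by
  rw [← ip_conj_symm, h, map_zero]

section

variable {j k : ℕ} {P Q : Euc m → Cl 𝕜 m}

/-- Integration by parts on the ball: skew adjointness of `T_i` and `U_i` cancels the sign in the
interior term, and `IsHom.integral_pd` expresses the sphere term through `x`. -/
lemma ip_dOp (hP : IsHom j P) (hQ : IsHom k Q) (T U : Fin m → Cl 𝕜 m →ₗ[𝕜] Cl 𝕜 m)
    (hTU : ∀ i (a b : Cl 𝕜 m), inner 𝕜 (T i a) b = -inner 𝕜 a (U i b)) :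
    ip (dOp T P) Q = ip P (dOp U Q) -
      ((j : 𝕜) + k + m + 1) * ip P (fun x => ∑ i, x i • U i (Q x)) := by
  have hPi (i : Fin m) : Continuous (GMT.pd i P) := (contDiff_pd i hP.smooth).continuous
  have hUQ (i : Fin m) : IsHom k fun x => U i (Q x) := hQ.lin (U i)
  have hc {f g : Euc m → Cl 𝕜 m} (hf : Continuous f) (hg : Continuous g) :
      Integrable (fun x => Inner.inner 𝕜 (f x) (g x)) (ballMeasure m) :=
    integrable_of_continuous (hf.inner hg)
  have key (i : Fin m) :
      ∫ x, Inner.inner 𝕜 (T i (GMT.pd i P x)) (Q x) ∂ballMeasure m =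
        ∫ x, Inner.inner 𝕜 (P x) (U i (GMT.pd i Q x)) ∂ballMeasure m -
          ((j : 𝕜) + k + m + 1) * ∫ x, Inner.inner 𝕜 (P x) (x i • U i (Q x)) ∂ballMeasure m := by
    have h1 := (hP.inner (hUQ i)).integral_pd i
    simp only [pd_inner i (hP.diffAt _) ((hUQ i).diffAt _), pd_lin i (U i) (hQ.diffAt _)] at h1
    rw [integral_add (hc (hPi i) (hUQ i).smooth.continuous)
      (hc hP.smooth.continuous (contDiff_lin (U i) (contDiff_pd i hQ.smooth)).continuous)] at h1
    simp only [hTU, inner_real_smul_right, RCLike.real_smul_eq_coe_mul] at h1 ⊢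
    rw [integral_neg, eq_sub_of_add_eq h1]
    push_cast
    ring
  simp only [ip, dOp, sum_inner, inner_sum]
  rw [integral_finsetSum _ fun i _ => hc (contDiff_lin (T i) (contDiff_pd i hP.smooth)).continuous
      hQ.smooth.continuous,
    integral_finsetSum _ fun i _ => hc hP.smooth.continuous
      (contDiff_lin (U i) (contDiff_pd i hQ.smooth)).continuous,
    integral_finsetSum _ fun i _ => hc hP.smooth.continuous ((hUQ i).coord_smul i).smooth.continuous,
    Finset.mul_sum, ← Finset.sum_sub_distrib]
  exact Finset.sum_congr rfl fun i _ => key i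

lemma ip_dw (hP : IsHom j P) (hQ : IsHom k Q) :
    ip (dw P) Q = ip P (dc Q) - ((j : 𝕜) + k + m + 1) * ip P (fun x => xDot x (Q x)) := by
  simp only [xDot_eq]
  exact ip_dOp hP hQ wedge dot inner_wedge_left

lemma ip_dc (hP : IsHom j P) (hQ : IsHom k Q) :
    ip (dc P) Q = ip P (dw Q) - ((j : 𝕜) + k + m + 1) * ip P (fun x => xWedge x (Q x)) := by
  simp only [xWedge_eq]
  exact ip_dOp hP hQ dot wedge inner_dot_left

lemma natCast_add_ne_zero (a b c d : ℕ) : (a : 𝕜) + b + c + (d + 1 : ℕ) ≠ 0 := by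
  have : (a : 𝕜) + b + c + (d + 1 : ℕ) = ((a + b + c + d + 1 : ℕ) : 𝕜) := by push_cast; ring
  rw [this]
  exact Nat.cast_ne_zero.2 (by omega)

/-- Both interior terms in the integration by parts vanish and the boundary coefficient is positive.
No relation between the grades or degrees of `P` and `Q` is needed. -/
lemma ip_xDot_eq_zero (hP : IsHom j P) (hQ : IsHom k Q) (h1 : ∀ x, dw P x = 0)
    (h2 : ∀ x, dc Q x = 0) : ip P (fun x => xDot x (Q x)) = 0 := by
  have h := ip_dw hP hQ
  rw [show dw P = fun _ => 0 from funext h1, show dc Q = fun _ => 0 from funext h2] at h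
  simp only [ip, inner_zero_left, inner_zero_right, integral_zero, zero_sub, zero_eq_neg] at h
  refine (mul_eq_zero.1 h).resolve_left ?_
  exact_mod_cast natCast_add_ne_zero (𝕜 := 𝕜) j k m 0

lemma ip_xWedge_eq_zero (hP : IsHom j P) (hQ : IsHom k Q) (h1 : ∀ x, dc P x = 0)
    (h2 : ∀ x, dw Q x = 0) : ip P (fun x => xWedge x (Q x)) = 0 := by
  have h := ip_dc hP hQ
  rw [show dc P = fun _ => 0 from funext h1, show dw Q = fun _ => 0 from funext h2] at h
  simp only [ip, inner_zero_left, inner_zero_right, integral_zero, zero_sub, zero_eq_neg] at h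
  refine (mul_eq_zero.1 h).resolve_left ?_
  exact_mod_cast natCast_add_ne_zero (𝕜 := 𝕜) j k m 0

lemma ip_real_smul_left (c : ℝ) (f g : Euc m → Cl 𝕜 m) :
    ip (fun x => c • f x) g = (c : 𝕜) * ip f g := by
  simp only [ip, inner_real_smul_left]
  exact integral_const_mul _ _

end

namespace HomMonogenic

variable {s j k : ℕ} {p q : Euc m → Cl 𝕜 m}

/-- Integration by parts with `∂•` on `x∧p`, which is a multiple of `p`, while `∂∧q = 0`. The factor
on the left involves only `j`, the one on the right is symmetric in `j` and `k`. -/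
lemma ip_xWedge (hp : HomMonogenic s j p) (hq : HomMonogenic s k q) :
    (((j : ℝ) + m - s : ℝ) : 𝕜) * ip p q =
      ((j : 𝕜) + k + m + 2) * ip (fun x => GMT.xWedge x (p x)) (fun x => GMT.xWedge x (q x)) := by
  have h := ip_dc (hp.hom.xWedge) hq.hom
  have e1 : dc (fun x => GMT.xWedge x (p x)) = fun x => (-((j : ℝ) + m - s)) • p x := by
    funext x
    rw [dc_xWedge hp.hom (hp.grade x), hp.dc_eq, map_zero, neg_zero, zero_sub, neg_smul]
  rw [e1, ip_real_smul_left, show dw q = fun _ => 0 from funext hq.dw_eq] at h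
  have e2 : ip (fun x => GMT.xWedge x (p x)) (fun _ => (0 : Cl 𝕜 m)) = 0 := by simp [ip]
  rw [e2, zero_sub] at h
  push_cast at h ⊢
  linear_combination -h

lemma ip_xDot (hp : HomMonogenic s j p) (hq : HomMonogenic s k q) :
    (((j : ℝ) + s : ℝ) : 𝕜) * ip p q =
      ((j : 𝕜) + k + m + 2) * ip (fun x => GMT.xDot x (p x)) (fun x => GMT.xDot x (q x)) := by
  have h := ip_dw (hp.hom.xDot) hq.hom
  have e1 : dw (fun x => GMT.xDot x (p x)) = fun x => (-((j : ℝ) + s)) • p x := by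
    funext x
    rw [dw_xDot hp.hom (hp.grade x), hp.dw_eq, map_zero, neg_zero, zero_sub, neg_smul]
  rw [e1, ip_real_smul_left, show dc q = fun _ => 0 from funext hq.dc_eq] at h
  have e2 : ip (fun x => GMT.xDot x (p x)) (fun _ => (0 : Cl 𝕜 m)) = 0 := by simp [ip]
  rw [e2, zero_sub] at h
  push_cast at h ⊢
  linear_combination -h

/-- `ip_xDot` with the roles of `p` and `q` exchanged, then conjugated, has the same right-hand
side; subtracting leaves `(j - k)` times the inner product. -/
lemma ip_eq_zero_of_degree_ne (hjk : j ≠ k) (hp : HomMonogenic s j p) (hq : HomMonogenic s k q) :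
    ip p q = 0 := by
  have h1 := ip_xDot hp hq
  have h2 := congrArg (starRingEnd 𝕜) (ip_xDot hq hp)
  simp only [map_mul, map_add, ip_conj_symm, map_natCast, map_ofNat] at h2
  have h3 : ((j : 𝕜) - k) * ip p q = 0 := by
    push_cast at h1 h2
    linear_combination h1 - h2
  refine (mul_eq_zero.1 h3).resolve_left (sub_ne_zero.2 ?_)
  exact_mod_cast hjk

lemma ip_xDot_eq_zero (hp : HomMonogenic s j p) (hq : HomMonogenic s k q) (h : ip p q = 0) :
    ip (fun x => GMT.xDot x (p x)) (fun x => GMT.xDot x (q x)) = 0 := by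
  have h1 := ip_xDot hp hq
  rw [h, mul_zero] at h1
  refine (mul_eq_zero.1 h1.symm).resolve_left ?_
  exact_mod_cast natCast_add_ne_zero (𝕜 := 𝕜) j k m 1

lemma ip_xWedge_eq_zero (hp : HomMonogenic s j p) (hq : HomMonogenic s k q) (h : ip p q = 0) :
    ip (fun x => GMT.xWedge x (p x)) (fun x => GMT.xWedge x (q x)) = 0 := by
  have h1 := ip_xWedge hp hq
  rw [h, mul_zero] at h1
  refine (mul_eq_zero.1 h1.symm).resolve_left ?_
  exact_mod_cast natCast_add_ne_zero (𝕜 := 𝕜) j k m 1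

end HomMonogenic

/-! ### Integration in polar coordinates -/

/-- In polar coordinates the integrand is a product of a function on the sphere and a function of
the radius, so the integral factors without any integrability assumption. -/
lemma integral_radial_mul (hn : 1 ≤ n) (d : ℕ) (φ : ℝ → 𝕜) {h : Euc n → 𝕜}
    (hh : ∀ (c : ℝ) (x : Euc n), h (c • x) = c ^ d • h x) :
    ∫ y, φ ‖y‖ * h y = (∫ θ : Metric.sphere (0 : Euc n) 1, h θ ∂(volume : Measure (Euc n)).toSphere) *
      ∫ t : Set.Ioi (0 : ℝ), φ t * ((t.1 ^ d : ℝ) : 𝕜)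
        ∂Measure.volumeIoiPow (Module.finrank ℝ (Euc n) - 1) := by
  rw [← integral_prod_mul]
  have : Nonempty (Fin n) := ⟨⟨0, hn⟩⟩
  have h1 : ∫ y : Euc n, φ ‖y‖ * h y =
      ∫ y : ({(0)}ᶜ : Set (Euc n)), φ ‖y.1‖ * h y.1 ∂(Measure.comap Subtype.val volume) := by
    rw [integral_subtype_comap (measurableSet_singleton _).compl fun y => φ ‖y‖ * h y,
      restrict_compl_singleton]
  rw [h1, ← (volume : Measure (Euc n)).measurePreserving_homeomorphUnitSphereProd.integral_comp
        (Homeomorph.measurableEmbedding _)]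
  refine integral_congr_ae (Filter.Eventually.of_forall fun y => ?_)
  beta_reduce
  have hy : (y : Euc n) ≠ 0 := y.2
  have e : (y : Euc n) = ‖(y : Euc n)‖ • ((homeomorphUnitSphereProd (Euc n) y).1 : Euc n) := by
    simp [smul_smul, norm_ne_zero_iff.2 hy]
  have e2 : ((homeomorphUnitSphereProd (Euc n) y).2 : ℝ) = ‖(y : Euc n)‖ := by simp
  have e3 := hh ‖(y : Euc n)‖ ((homeomorphUnitSphereProd (Euc n) y).1 : Euc n)
  rw [← e] at e3
  rw [e3, e2, RCLike.real_smul_eq_coe_mul]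
  ring

lemma integral_volumeIoiPow_pos (l d : ℕ) :
    0 < ∫ t : Set.Ioi (0 : ℝ), (if t.1 < 1 then t.1 ^ d else 0) ∂Measure.volumeIoiPow l := by
  have hs : MeasurableSet (Set.Iio (⟨1, Set.mem_Ioi.2 one_pos⟩ : Set.Ioi (0 : ℝ))) := measurableSet_Iio
  have e : (fun t : Set.Ioi (0 : ℝ) => if t.1 < 1 then t.1 ^ d else 0) =
      (Set.Iio (⟨1, Set.mem_Ioi.2 one_pos⟩ : Set.Ioi (0 : ℝ))).indicator fun t => t.1 ^ d := by
    funext t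
    by_cases ht : t.1 < 1
    · rw [if_pos ht, Set.indicator_of_mem]
      exact ht
    · rw [if_neg ht, Set.indicator_of_notMem]
      exact ht
  have hfin := Measure.volumeIoiPow_apply_Iio l ⟨1, Set.mem_Ioi.2 one_pos⟩
  rw [e, integral_indicator hs, setIntegral_pos_iff_support_of_nonneg_ae]
  · rw [Set.inter_eq_right.2, hfin]
    · rw [ENNReal.ofReal_pos]; positivity
    · intro t _
      exact (pow_pos t.2 d).ne'
  · exact Filter.Eventually.of_forall fun t => (pow_pos t.2 d).le
  · refine Measure.integrableOn_of_bounded (M := 1) (by rw [hfin]; exact ENNReal.ofReal_ne_top)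
      (measurable_subtype_coe.pow_const d).aestronglyMeasurable ?_
    rw [ae_restrict_iff' hs]
    refine Filter.Eventually.of_forall fun t ht => ?_
    have ht1 : t.1 < 1 := ht
    have ht0 : 0 < t.1 := t.2
    rw [Real.norm_of_nonneg (pow_pos ht0 d).le]
    exact pow_le_one₀ ht0.le ht1.le

/-- The ball integral is the sphere integral times a positive radial integral. -/
lemma integral_sphere_eq_zero (hn : 1 ≤ n) {d : ℕ} {h : Euc n → 𝕜}
    (hh : ∀ (c : ℝ) (x : Euc n), h (c • x) = c ^ d • h x) (h0 : ∫ x, h x ∂ballMeasure n = 0) :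
    ∫ θ : Metric.sphere (0 : Euc n) 1, h θ ∂(volume : Measure (Euc n)).toSphere = 0 := by
  have h1 := integral_radial_mul hn d (fun t => if t < 1 then (1 : 𝕜) else 0) hh
  have h2 : ∫ y, (fun t => if t < 1 then (1 : 𝕜) else 0) ‖y‖ * h y = ∫ x, h x ∂ballMeasure n := by
    rw [ballMeasure, ← integral_indicator measurableSet_ball]
    congr 1
    funext y
    by_cases hy : ‖y‖ < 1
    · rw [Set.indicator_of_mem (by simpa using hy)]; simp [hy]
    · rw [Set.indicator_of_notMem (by simpa using hy)]; simp [hy]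
  rw [h2, h0] at h1
  refine (mul_eq_zero.1 h1.symm).resolve_right ?_
  have h3 (t : Set.Ioi (0 : ℝ)) : (if t.1 < 1 then (1 : 𝕜) else 0) * ((t.1 ^ d : ℝ) : 𝕜) =
      ((if t.1 < 1 then t.1 ^ d else 0 : ℝ) : 𝕜) := by
    split_ifs <;> simp
  simp only [h3]
  rw [integral_ofReal]
  exact RCLike.ofReal_ne_zero.2 (integral_volumeIoiPow_pos _ d).ne'

/-! ### Integration over the last coordinate -/

/-- `x ↦ (x_{n+1}, x̲)` -/
def splitLast (n : ℕ) : Euc (n + 1) ≃ᵐ ℝ × Euc n :=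
  ((MeasurableEquiv.toLp 2 (Fin (n + 1) → ℝ)).symm.trans
    (MeasurableEquiv.piFinSuccAbove (fun _ => ℝ) (Fin.last n))).trans
    ((MeasurableEquiv.refl ℝ).prodCongr (MeasurableEquiv.toLp 2 (Fin n → ℝ)))

lemma splitLast_apply (x : Euc (n + 1)) : splitLast n x = (x (Fin.last n), pod x) := by
  refine Prod.ext rfl ?_
  ext i
  change x ((Fin.last n).succAbove i) = x i.castSucc
  rw [Fin.succAbove_last]

lemma measurePreserving_splitLast (n : ℕ) :
    MeasurePreserving (splitLast n) volume (volume : Measure (ℝ × Euc n)) :=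
  ((MeasurePreserving.id volume).prod (PiLp.volume_preserving_toLp (Fin n))).comp
    ((volume_preserving_piFinSuccAbove (fun _ => ℝ) (Fin.last n)).comp
      (PiLp.volume_preserving_ofLp (Fin (n + 1))))

/-- On each slice of fixed last coordinate the integrand is a radial function times `h`, and the
sphere integral of `h` is zero. This transports orthogonality from dimension `n` to `n + 1`. -/
theorem integral_radial_mul_eq_zero (hn : 1 ≤ n) {d : ℕ} {h : Euc n → 𝕜} (hh : IsHom d h)
    (h0 : ∫ x, h x ∂ballMeasure n = 0) (g : ℝ × ℝ → 𝕜) :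
    ∫ x, g (radial x) * h (pod x) ∂ballMeasure (n + 1) = 0 := by
  set G : ℝ × Euc n → 𝕜 := fun q =>
    (if ‖q.2‖ ^ 2 + q.1 ^ 2 < 1 then g (q.1, ‖q.2‖) else 0) * h q.2 with hG
  have h1 : ∫ x, g (radial x) * h (pod x) ∂ballMeasure (n + 1) = ∫ q, G q := by
    rw [← (measurePreserving_splitLast n).integral_comp (splitLast n).measurableEmbedding,
      ballMeasure, ← integral_indicator measurableSet_ball]
    congr 1
    funext x
    have e : ‖x‖ < 1 ↔ ‖pod x‖ ^ 2 + x (Fin.last n) ^ 2 < 1 := by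
      rw [← norm_sq_pod, sq_lt_one_iff₀ (norm_nonneg x)]
    rw [splitLast_apply, hG]
    by_cases hx : ‖x‖ < 1
    · rw [Set.indicator_of_mem (by simpa using hx)]
      simp only [if_pos (e.1 hx)]
      rfl
    · rw [Set.indicator_of_notMem (by simpa using hx)]
      simp only [if_neg (fun h' => hx (e.2 h')), zero_mul]
  rw [h1]
  -- Fubini needs integrability; without it the Bochner integral is zero by convention.
  by_cases hi : Integrable G
  · have h2 : ∫ q, G q = ∫ z, ∫ y, G (z, y) := integral_prod G hi
    rw [h2]
    have h3 (z : ℝ) : ∫ y, G (z, y) = 0 := by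
      have := integral_radial_mul hn d (fun t => if t ^ 2 + z ^ 2 < 1 then g (z, t) else 0) hh.map_smul
      rw [integral_sphere_eq_zero hn hh.map_smul h0, zero_mul] at this
      exact this
    simp [h3]
  · exact integral_undef hi

/-! ### Orthogonality of embedded fields -/

section branching

lemma ip_eq_zero_of_eq_add {f g : Euc (r + 1) → Cl 𝕜 (r + 1)} (hr : 1 ≤ r)
    {d₁ d₂ d₃ : ℕ} {h₁ h₂ h₃ : Euc r → 𝕜} (hh₁ : IsHom d₁ h₁) (hh₂ : IsHom d₂ h₂)
    (hh₃ : IsHom d₃ h₃) (z₁ : ∫ x, h₁ x ∂ballMeasure r = 0) (z₂ : ∫ x, h₂ x ∂ballMeasure r = 0)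
    (z₃ : ∫ x, h₃ x ∂ballMeasure r = 0) {g₁ g₂ g₃ : ℝ × ℝ → ℝ} (c₁ : Continuous g₁)
    (c₂ : Continuous g₂) (c₃ : Continuous g₃)
    (h : ∀ x, inner 𝕜 (f x) (g x) = (g₁ (radial x) : 𝕜) * h₁ (pod x) +
      (g₂ (radial x) : 𝕜) * h₂ (pod x) + (g₃ (radial x) : 𝕜) * h₃ (pod x)) : ip f g = 0 := by
  have hrad : Continuous (radial : Euc (r + 1) → ℝ × ℝ) :=
    (contDiff_coord _).continuous.prodMk (podL r).continuous.norm
  have hInt {d : ℕ} {h : Euc r → 𝕜} (hh : IsHom d h) {g : ℝ × ℝ → ℝ} (hg : Continuous g) :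
      Integrable (fun x => (g (radial x) : 𝕜) * h (pod x)) (ballMeasure (r + 1)) :=
    integrable_of_continuous ((RCLike.continuous_ofReal.comp (hg.comp hrad)).mul
      (hh.smooth.continuous.comp (podL r).continuous))
  have h12 : Integrable (fun x => (g₁ (radial x) : 𝕜) * h₁ (pod x) + (g₂ (radial x) : 𝕜) * h₂ (pod x))
      (ballMeasure (r + 1)) := (hInt hh₁ c₁).add (hInt hh₂ c₂)
  simp only [ip, h]
  rw [integral_add h12 (hInt hh₃ c₃),
    integral_add (hInt hh₁ c₁) (hInt hh₂ c₂),
    integral_radial_mul_eq_zero hr hh₁ z₁ (fun q => (g₁ q : 𝕜)),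
    integral_radial_mul_eq_zero hr hh₂ z₂ (fun q => (g₂ q : 𝕜)),
    integral_radial_mul_eq_zero hr hh₃ z₃ (fun q => (g₃ q : 𝕜)), add_zero, add_zero]

variable {s t k j j' : ℕ} {p q : Euc r → Cl 𝕜 r}

lemma inner_xWedge_xWedge_xDot (y : Euc r) (a b : Cl 𝕜 r) :
    inner 𝕜 (xWedge y (xDot y a)) (xWedge y b) = ((‖y‖ ^ 2 : ℝ) : 𝕜) * inner 𝕜 (xDot y a) b := by
  rw [inner_xWedge_left, xDot_xWedge, inner_sub_right, inner_neg_right, inner_real_smul_right]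
  have : inner 𝕜 (xDot y a) (xWedge y (xDot y b)) = 0 := by
    rw [inner_xDot_left, xWedge_xWedge, inner_zero_right, neg_zero]
  rw [this]
  push_cast
  ring

lemma inner_xWedge_right (y : Euc r) (a b : Cl 𝕜 r) :
    inner 𝕜 a (xWedge y b) = -inner 𝕜 (xDot y a) b := by
  rw [inner_xDot_left, neg_neg]

/-- Pointwise only the products of `p, q` and of `x̲•p, x̲•q` survive, with radial coefficients.
Both have zero integral on the lower ball, the second by `ip_xDot_eq_zero`. -/
theorem ip_embed_same_same (hr : 2 ≤ r) (h : (t, j) ∈ branching (r + 1) t k)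
    (h' : (t, j') ∈ branching (r + 1) t k) (hp : HomMonogenic t j p) (hq : HomMonogenic t j' q)
    (h0 : ip p q = 0) : ip (embeddingFactor t t k j p) (embeddingFactor t t k j' q) = 0 := by
  obtain ⟨A, B, C, cA, cB, cC, hf⟩ := exists_form_same (𝕜 := 𝕜) h
  obtain ⟨A', B', C', cA', cB', cC', hf'⟩ := exists_form_same (𝕜 := 𝕜) h'
  refine ip_eq_zero_of_eq_add (by omega) (hp.hom.inner hq.hom) (hp.hom.xDot.inner hq.hom.xDot)
    (IsHom.zero 0) h0 (hp.ip_xDot_eq_zero hq h0) (by simp) (g₁ := fun q => A q * A' q)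
    (g₂ := fun q => B q * B' q - A q * C' q - C q * A' q + C q * C' q * q.2 ^ 2)
    (g₃ := 0) (by fun_prop) (by fun_prop) continuous_const fun x => ?_
  rw [hf p hp.grade, hf' q hq.grade]
  simp only [inner_add_left, inner_add_right, inner_real_smul_left, inner_real_smul_right,
    inner_incl_incl, inner_incl_lastGen, inner_lastGen_incl, inner_lastGen_lastGen]
  rw [inner_xWedge_xWedge_xDot, inner_xWedge_right (pod x) (p (pod x)), inner_xWedge_left]
  simp only [radial]
  push_cast
  ring

/-- As before, with the product of `x̲∧p` and `x̲∧q` as a third term. -/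
theorem ip_embed_succ_succ (hr : 2 ≤ r) (h : (t, j) ∈ branching (r + 1) (t + 1) k)
    (h' : (t, j') ∈ branching (r + 1) (t + 1) k) (hp : HomMonogenic t j p)
    (hq : HomMonogenic t j' q) (h0 : ip p q = 0) :
    ip (embeddingFactor (t + 1) t k j p) (embeddingFactor (t + 1) t k j' q) = 0 := by
  obtain ⟨A, B, C, cA, cB, cC, hf⟩ := exists_form_succ (𝕜 := 𝕜) h
  obtain ⟨A', B', C', cA', cB', cC', hf'⟩ := exists_form_succ (𝕜 := 𝕜) h'
  refine ip_eq_zero_of_eq_add (by omega) (hp.hom.inner hq.hom) (hp.hom.xDot.inner hq.hom.xDot)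
    (hp.hom.xWedge.inner hq.hom.xWedge) h0 (hp.ip_xDot_eq_zero hq h0) (hp.ip_xWedge_eq_zero hq h0)
    (g₁ := fun q => A q * A' q)
    (g₂ := fun q => C q * C' q * q.2 ^ 2 - A q * C' q - C q * A' q)
    (g₃ := fun q => B q * B' q) (by fun_prop) (by fun_prop) (by fun_prop) fun x => ?_
  rw [hf p hp.grade, hf' q hq.grade]
  simp only [inner_add_left, inner_add_right, inner_real_smul_left, inner_real_smul_right,
    inner_incl_incl, inner_incl_lastGen, inner_lastGen_incl, inner_lastGen_lastGen]
  rw [inner_xWedge_xWedge_xDot, inner_xWedge_right (pod x) (p (pod x)),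
    inner_xWedge_left (pod x) (xDot (pod x) (p (pod x))) (q (pod x))]
  simp only [radial]
  push_cast
  ring

/-- All cross terms reduce to the product of `x̲•p` with `q`. Its integral vanishes because `∂∧q =
0` and `∂•p = 0`, so orthogonality of `p` and `q` is not needed. -/
theorem ip_embed_same_succ (hr : 2 ≤ r) (h : (t + 1, j) ∈ branching (r + 1) (t + 1) k)
    (h' : (t, j') ∈ branching (r + 1) (t + 1) k) (hp : HomMonogenic (t + 1) j p)
    (hq : HomMonogenic t j' q) :
    ip (embeddingFactor (t + 1) (t + 1) k j p) (embeddingFactor (t + 1) t k j' q) = 0 := by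
  obtain ⟨A, B, C, cA, cB, cC, hf⟩ := exists_form_same (𝕜 := 𝕜) h
  obtain ⟨A', B', C', cA', cB', cC', hf'⟩ := exists_form_succ (𝕜 := 𝕜) h'
  have h0 : ip (fun x => xDot x (p x)) q = 0 :=
    ip_eq_zero_symm (ip_xDot_eq_zero hq.hom hp.hom hq.dw_eq hp.dc_eq)
  refine ip_eq_zero_of_eq_add (by omega) (hp.hom.xDot.inner hq.hom) (IsHom.zero 0)
    (IsHom.zero 0) h0 (by simp) (by simp)
    (g₁ := fun q => B q * A' q - A q * B' q + C q * B' q * q.2 ^ 2)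
    (g₂ := 0) (g₃ := 0) (by fun_prop) continuous_const continuous_const fun x => ?_
  rw [hf p hp.grade, hf' q hq.grade]
  simp only [inner_add_left, inner_add_right, inner_real_smul_left, inner_real_smul_right,
    inner_incl_incl, inner_incl_lastGen, inner_lastGen_incl, inner_lastGen_lastGen]
  have e : inner 𝕜 (xDot (pod x) (p (pod x))) (xWedge (pod x) (xDot (pod x) (q (pod x)))) = 0 := by
    rw [inner_xWedge_right, xDot_xDot, inner_zero_left, neg_zero]
  rw [inner_xWedge_xWedge_xDot, e, inner_xWedge_right (pod x) (p (pod x))]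
  simp only [radial]
  push_cast
  ring

end branching

/-! ### Dimension two -/

lemma blade_singleton (i : Fin m) : blade 𝕜 {i} = gen 𝕜 i := by simp [blade]

lemma blade_empty : blade 𝕜 (∅ : Finset (Fin m)) = 1 := by simp [blade]

lemma blade_univ_two : blade 𝕜 (Finset.univ : Finset (Fin 2)) = gen 𝕜 0 * gen 𝕜 1 := by
  rw [blade, Fin.sort_univ]
  simp [List.finRange_succ]

lemma gen_mem (i : Fin m) : gen 𝕜 i ∈ multivectors 𝕜 m 1 :=
  Submodule.subset_span ⟨{i}, Finset.card_singleton i, (blade_singleton i).symm⟩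

lemma one_mem_multivectors : (1 : Cl 𝕜 m) ∈ multivectors 𝕜 m 0 :=
  Submodule.subset_span ⟨∅, Finset.card_empty, blade_empty.symm⟩

lemma exists_eq_smul_one {a : Cl 𝕜 m} (ha : a ∈ multivectors 𝕜 m 0) : ∃ c : 𝕜, a = c • 1 := by
  have h : multivectors 𝕜 m 0 ≤ Submodule.span 𝕜 {1} := by
    refine Submodule.span_le.2 ?_
    rintro _ ⟨A, hA, rfl⟩
    rw [Finset.card_eq_zero.1 hA, blade_empty]
    exact Submodule.subset_span rfl
  obtain ⟨c, hc⟩ := Submodule.mem_span_singleton.1 (h ha)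
  exact ⟨c, hc.symm⟩

lemma exists_eq_smul_bivector {a : Cl 𝕜 2} (ha : a ∈ multivectors 𝕜 2 2) :
    ∃ c : 𝕜, a = c • (gen 𝕜 1 * gen 𝕜 0) := by
  have h : multivectors 𝕜 2 2 ≤ Submodule.span 𝕜 {gen 𝕜 1 * gen 𝕜 0} := by
    refine Submodule.span_le.2 ?_
    rintro _ ⟨A, hA, rfl⟩
    have : A = Finset.univ := Finset.eq_univ_of_card A (by simpa using hA)
    rw [this, blade_univ_two, gen_mul_gen_of_ne (i := (0 : Fin 2)) (j := 1) (by decide)]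
    exact Submodule.neg_mem _ (Submodule.mem_span_singleton_self _)
  obtain ⟨c, hc⟩ := Submodule.mem_span_singleton.1 (h ha)
  exact ⟨c, hc.symm⟩

lemma bivector_mem : gen 𝕜 (1 : Fin 2) * gen 𝕜 0 ∈ multivectors 𝕜 2 2 := by
  rw [gen_mul_gen_of_ne (by decide), ← blade_univ_two]
  exact Submodule.neg_mem _ (Submodule.subset_span ⟨Finset.univ, by simp, rfl⟩)

lemma exists_eq_smul_gen {a : Cl 𝕜 2} (ha : a ∈ multivectors 𝕜 2 1) :
    ∃ c d : 𝕜, a = c • gen 𝕜 0 + d • gen 𝕜 1 := by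
  have h : multivectors 𝕜 2 1 ≤ Submodule.span 𝕜 {gen 𝕜 0, gen 𝕜 1} := by
    refine Submodule.span_le.2 ?_
    rintro _ ⟨A, hA, rfl⟩
    obtain ⟨i, rfl⟩ := Finset.card_eq_one.1 hA
    rw [blade_singleton]
    fin_cases i
    · exact Submodule.subset_span (Or.inl rfl)
    · exact Submodule.subset_span (Or.inr rfl)
  obtain ⟨c, d, hc⟩ := Submodule.mem_span_pair.1 (h ha)
  exact ⟨c, d, hc.symm⟩

lemma gen_ne_zero (i : Fin m) : gen 𝕜 i ≠ 0 := by
  intro h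
  have := gen_mul_self (𝕜 := 𝕜) i
  rw [h, mul_zero] at this
  exact one_ne_zero (neg_eq_zero.1 this.symm)

lemma gen_mul_eq_zero {i : Fin m} {a : Cl 𝕜 m} (h : gen 𝕜 i * a = 0) : a = 0 := by
  have := congrArg (gen 𝕜 i * ·) h
  simpa [← mul_assoc, gen_mul_self] using this

/-- `f` is the sequence of fields `f_k = (x₁ + x₂ J)^k w`, where `e₁ + e₂ J` vanishes on an invariant
subspace of vectors containing `w`. -/
structure PlanarSeq (J : Cl 𝕜 2 →ₗ[𝕜] Cl 𝕜 2) (U : Submodule 𝕜 (Cl 𝕜 2)) (w : Cl 𝕜 2)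
    (f : ℕ → Euc 2 → Cl 𝕜 2) : Prop where
  mem : w ∈ U
  map_mem : ∀ v ∈ U, J v ∈ U
  le : U ≤ multivectors 𝕜 2 1
  kill : ∀ v ∈ U, gen 𝕜 0 * v + gen 𝕜 1 * J v = 0
  zero : ∀ x, f 0 x = w
  succ : ∀ k x, f (k + 1) x = x 0 • f k x + x 1 • J (f k x)

namespace PlanarSeq

variable {J : Cl 𝕜 2 →ₗ[𝕜] Cl 𝕜 2} {U : Submodule 𝕜 (Cl 𝕜 2)} {w : Cl 𝕜 2}
  {f : ℕ → Euc 2 → Cl 𝕜 2}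

lemma apply_mem (h : PlanarSeq J U w f) (k : ℕ) (x : Euc 2) : f k x ∈ U := by
  induction k with
  | zero => rw [h.zero]; exact h.mem
  | succ k ih =>
    rw [h.succ, ← real_smul_eq, ← real_smul_eq]
    exact U.add_mem (U.smul_mem _ ih) (U.smul_mem _ (h.map_mem _ ih))

lemma isHom (h : PlanarSeq J U w f) (k : ℕ) : IsHom k (f k) := by
  induction k with
  | zero => exact (IsHom.const w).congr fun x => (h.zero x).symm
  | succ k ih =>
    exact ((ih.coord_smul 0).add ((ih.lin J).coord_smul 1)).congr fun x => (h.succ k x).symm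

lemma pd_succ (h : PlanarSeq J U w f) (k : ℕ) (x : Euc 2) :
    pd 0 (f (k + 1)) x = ((k : ℝ) + 1) • f k x ∧
      pd 1 (f (k + 1)) x = ((k : ℝ) + 1) • J (f k x) := by
  have hrec (i : Fin 2) (k : ℕ) : pd i (f (k + 1)) x =
      ((if i = 0 then f k x else 0) + x 0 • pd i (f k) x) +
        ((if i = 1 then J (f k x) else 0) + x 1 • J (pd i (f k) x)) := by
    rw [pd_congr (h.succ k), pd_add i (((h.isHom k).coord_smul 0).diffAt x)
      ((((h.isHom k).lin J).coord_smul 1).diffAt x), pd_coord_smul i 0 ((h.isHom k).diffAt x),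
      pd_coord_smul i 1 (((h.isHom k).lin J).diffAt x), pd_lin i J ((h.isHom k).diffAt x)]
  induction k with
  | zero =>
    rw [hrec, hrec]
    simp only [(h.isHom 0).pd_of_zero]
    simp
  | succ k ih =>
    rw [hrec 0 (k + 1), hrec 1 (k + 1), ih.1, ih.2]
    simp only [if_true, zero_ne_one, one_ne_zero, if_false, LinearMap.map_smul_of_tower, h.succ k,
      map_add]
    push_cast
    constructor <;> module

lemma homMonogenic (h : PlanarSeq J U w f) (k : ℕ) : HomMonogenic 1 k (f k) := by
  refine ⟨h.isHom k, fun x => h.le (h.apply_mem k x), fun x => ?_⟩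
  rw [dirac_eq, Fin.sum_univ_two]
  rcases k with _ | k
  · simp [(h.isHom 0).pd_of_zero]
  · rw [(h.pd_succ k x).1, (h.pd_succ k x).2, mul_smul_comm, mul_smul_comm, ← smul_add,
      h.kill _ (h.apply_mem k x), smul_zero]

lemma iterate_pd (h : PlanarSeq J U w f) (k : ℕ) (x : Euc 2) :
    (pd 0)^[k] (f k) x = (k.factorial : ℝ) • w := by
  induction k with
  | zero => simp [h.zero]
  | succ k ih =>
    rw [Function.iterate_succ_apply, show pd 0 (f (k + 1)) = _ from funext fun x => (h.pd_succ k x).1,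
      iterate_pd_smul _ _ _ (h.isHom k).smooth, ih, smul_smul, Nat.factorial_succ]
    push_cast
    rfl

lemma apply_single (h : PlanarSeq J U w f) (k : ℕ) : f k (EuclideanSpace.single 0 1) = w := by
  induction k with
  | zero => exact h.zero _
  | succ k ih => rw [h.succ, ih]; simp

end PlanarSeq

/-- In the plane `e₁∂₁ + e₂∂₂ = 0` shows that `∂₁G = 0` forces `∂₂G = 0`. The derivatives met on the
way have positive degree, so a constant one is zero. -/
lemma HomMonogenic.eq_zero_of_iterate_pd {s k : ℕ} {P : Euc 2 → Cl 𝕜 2} (hP : HomMonogenic s k P)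
    (L : ℕ) (hL : L ≤ k) (h : ∀ x, (GMT.pd 0)^[L] P x = 0) (x : Euc 2) : P x = 0 := by
  induction L with
  | zero => exact h x
  | succ L ih =>
    refine ih (by omega) ?_
    obtain ⟨d, hd⟩ := Nat.exists_eq_add_of_le hL
    have hG : HomMonogenic s (d + 1) ((GMT.pd 0)^[L] P) :=
      HomMonogenic.iterate_pd 0 L (by rwa [show L + (d + 1) = k by omega])
    have h0 (x : Euc 2) : GMT.pd 0 ((GMT.pd 0)^[L] P) x = 0 := by
      have := h x
      rwa [Function.iterate_succ_apply'] at this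
    refine hG.hom.eq_zero_of_pd fun i x => ?_
    fin_cases i
    · exact h0 x
    · have := hG.dirac_eq x
      rw [GMT.dirac_eq, Fin.sum_univ_two, h0, mul_zero, zero_add] at this
      exact gen_mul_eq_zero this

/-- The two sequences of planar fields are orthogonal bases of the spaces of homogeneous monogenic
vector fields in the plane. -/
structure PlanarBasis (b : Bool → ℕ → Euc 2 → Cl 𝕜 2) : Prop where
  homMonogenic : ∀ ε k, HomMonogenic 1 k (b ε k)
  orthogonal : ∀ k, ip (b true k) (b false k) = 0
  ne_zero : ∀ ε k, b ε k ≠ 0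
  mem_span : ∀ k P, HomMonogenic 1 k P → P ∈ Submodule.span 𝕜 {b true k, b false k}

/-- A planar monogenic field of degree `k` is determined by its `k`-th derivative in `x₁`, a
constant vector. Matching that vector with the two starting vectors gives spanning. -/
lemma planarBasis_of_planarSeq {b : Bool → ℕ → Euc 2 → Cl 𝕜 2} {J : Bool → Cl 𝕜 2 →ₗ[𝕜] Cl 𝕜 2}
    {U : Bool → Submodule 𝕜 (Cl 𝕜 2)} {w : Bool → Cl 𝕜 2}
    (h : ∀ ε, PlanarSeq (J ε) (U ε) (w ε) (b ε))
    (horth : ∀ k x, inner 𝕜 (b true k x) (b false k x) = 0) (hne : ∀ ε, w ε ≠ 0)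
    (hspan : ∀ v ∈ multivectors 𝕜 2 1, ∃ c d : 𝕜, v = c • w true + d • w false) :
    PlanarBasis b := by
  refine ⟨fun ε k => (h ε).homMonogenic k, fun k => by simp [ip, horth], fun ε k h0 => ?_,
    fun k P hP => ?_⟩
  · have := (h ε).apply_single k
    rw [h0] at this
    exact hne ε this.symm
  · have hG : HomMonogenic 1 0 ((pd 0)^[k] P) := HomMonogenic.iterate_pd 0 k hP
    obtain ⟨c, d, hcd⟩ := hspan _ (hG.grade 0)
    -- The `k`-th derivative of the `k`-th field in `x₁` is `k!` times its starting vector.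
    set κ : 𝕜 := ((k.factorial : ℝ) : 𝕜)⁻¹ with hκ
    have hk : κ * ((k.factorial : ℝ) : 𝕜) = 1 :=
      inv_mul_cancel₀ (RCLike.ofReal_ne_zero.2 (by exact_mod_cast k.factorial_ne_zero))
    have hb (ε : Bool) := (h ε).homMonogenic k
    have hsm (c : 𝕜) (ε : Bool) (x : Euc 2) :
        (pd 0)^[k] (fun x => (κ * c) • b ε k x) x = c • w ε := by
      have : ∀ (L : ℕ) {f : Euc 2 → Cl 𝕜 2}, ContDiff ℝ ∞ f → ∀ x,
          (pd 0)^[L] (fun x => (κ * c) • f x) x = (κ * c) • (pd 0)^[L] f x := by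
        intro L
        induction L with
        | zero => intro f _ x; rfl
        | succ L ih =>
          intro f hf x
          rw [Function.iterate_succ_apply, Function.iterate_succ_apply,
            ← ih (contDiff_pd 0 hf) x]
          exact congrArg (fun g => (pd 0)^[L] g x)
            (funext fun y => pd_lin 0 ((κ * c) • LinearMap.id) (hf.diffAt y))
      rw [this k (hb ε).hom.smooth, (h ε).iterate_pd, ← real_smul_eq, smul_smul, mul_right_comm, hk,
        one_mul]
    have hQ := (hP.sub ((hb true).smul (κ * c))).sub ((hb false).smul (κ * d))
    have hz := hQ.eq_zero_of_iterate_pd k le_rfl fun x => by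
      rw [iterate_pd_sub _ _ (hP.sub ((hb true).smul (κ * c))).hom.smooth
        ((hb false).smul (κ * d)).hom.smooth,
        iterate_pd_sub _ _ hP.hom.smooth ((hb true).smul (κ * c)).hom.smooth]
      simp only [hsm]
      rw [hG.hom.eq_const x, hcd]
      abel
    refine Submodule.mem_span_pair.2 ⟨κ * c, κ * d, ?_⟩
    funext x
    have := hz x
    simp only [Pi.add_apply, Pi.smul_apply]
    rw [sub_sub, sub_eq_zero] at this
    exact this.symm

/-! ### The real planar fields -/

lemma gen_zero_one_zero : gen 𝕜 (0 : Fin 2) * (gen 𝕜 1 * gen 𝕜 0) = gen 𝕜 1 := by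
  rw [gen_mul_gen_of_ne (i := (1 : Fin 2)) (j := 0) (by decide), mul_neg, ← mul_assoc, gen_mul_self]
  simp

lemma planarReal_succ (ε : Bool) (k : ℕ) (x : Euc 2) :
    planarReal 𝕜 ε (k + 1) x = x 0 • planarReal 𝕜 ε k x +
      x 1 • (-LinearMap.mulLeft 𝕜 (gen 𝕜 0 * gen 𝕜 1)) (planarReal 𝕜 ε k x) := by
  rw [planarReal, pow_succ', mul_assoc]
  change (_ - _) * planarReal 𝕜 ε k x = _
  rw [sub_mul, ← Algebra.smul_def, real_smul_eq, real_smul_eq, smul_mul_assoc, LinearMap.neg_apply,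
    smul_neg, LinearMap.mulLeft_apply, sub_eq_add_neg]

lemma planarSeq_planarReal (ε : Bool) :
    PlanarSeq (-LinearMap.mulLeft 𝕜 (gen 𝕜 0 * gen 𝕜 1)) (multivectors 𝕜 2 1)
      (if ε then gen 𝕜 0 else gen 𝕜 1) (planarReal 𝕜 ε) := by
  refine ⟨?_, fun v hv => ?_, le_rfl, fun v _ => ?_, fun x => by simp [planarReal],
    planarReal_succ ε⟩
  · split_ifs <;> exact gen_mem _
  · obtain ⟨c, d, rfl⟩ := exists_eq_smul_gen hv
    have e : (-LinearMap.mulLeft 𝕜 (gen 𝕜 0 * gen 𝕜 1)) (c • gen 𝕜 0 + d • gen 𝕜 1 : Cl 𝕜 2) =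
        d • gen 𝕜 0 - c • gen 𝕜 1 := by
      rw [LinearMap.neg_apply, LinearMap.mulLeft_apply, mul_add, mul_smul_comm, mul_smul_comm,
        mul_assoc, mul_assoc, gen_zero_one_zero, gen_mul_self]
      simp only [mul_neg, mul_one, smul_neg]
      abel
    rw [e]
    exact Submodule.sub_mem _ (Submodule.smul_mem _ _ (gen_mem _)) (Submodule.smul_mem _ _ (gen_mem _))
  · rw [LinearMap.neg_apply, LinearMap.mulLeft_apply, mul_neg, ← mul_assoc, ← mul_assoc,
      gen_mul_gen_of_ne (i := (1 : Fin 2)) (j := 0) (by decide), neg_mul, mul_assoc (gen 𝕜 0),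
      gen_mul_self]
    simp

/-- Left multiplication by `e₁e₂` is skew adjoint with square `-1`, so `x₁ - x₂e₁e₂` acts as `|x|`
times an isometry. -/
lemma inner_planar (x : Euc 2) (u v : Cl 𝕜 2) :
    inner 𝕜 (x 0 • u + x 1 • (-LinearMap.mulLeft 𝕜 (gen 𝕜 0 * gen 𝕜 1)) u)
      (x 0 • v + x 1 • (-LinearMap.mulLeft 𝕜 (gen 𝕜 0 * gen 𝕜 1)) v) =
      ((x 0 ^ 2 + x 1 ^ 2 : ℝ) : 𝕜) * inner 𝕜 u v := by
  have e0 (a b : Cl 𝕜 2) : inner 𝕜 (gen 𝕜 0 * gen 𝕜 1 * a) b = -inner 𝕜 a (gen 𝕜 0 * gen 𝕜 1 * b) := by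
    rw [mul_assoc, inner_gen_mul_left, inner_gen_mul_left, neg_neg, ← mul_assoc,
      gen_mul_gen_of_ne (i := (1 : Fin 2)) (j := 0) (by decide), neg_mul, inner_neg_right]
  have e1 : gen 𝕜 0 * gen 𝕜 1 * (gen 𝕜 0 * gen 𝕜 1 * v) = -v := by
    rw [← mul_assoc, mul_assoc (gen 𝕜 0), ← mul_assoc (gen 𝕜 1),
      gen_mul_gen_of_ne (i := (1 : Fin 2)) (j := 0) (by decide)]
    simp only [neg_mul, mul_neg, ← mul_assoc, gen_mul_self]
    rw [one_mul, gen_mul_self]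
    simp
  simp only [LinearMap.neg_apply, LinearMap.mulLeft_apply, inner_add_left, inner_add_right,
    inner_real_smul_left, inner_real_smul_right, inner_neg_left, inner_neg_right, e0, e1]
  push_cast
  ring

lemma inner_gen_gen_of_ne {i j : Fin m} (h : i ≠ j) : inner 𝕜 (gen 𝕜 i) (gen 𝕜 j) = 0 := by
  rw [← blade_singleton, ← blade_singleton, inner_eq_sum_coord]
  refine Finset.sum_eq_zero fun A _ => ?_
  rw [coord_blade, coord_blade]
  by_cases hA : {i} = A
  · rw [if_neg (fun h' : {j} = A => h (Finset.singleton_injective (hA.trans h'.symm))), mul_zero]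
  · rw [if_neg hA, map_zero, zero_mul]

lemma inner_gen_gen_self (i : Fin m) : inner 𝕜 (gen 𝕜 i) (gen 𝕜 i) = 1 := by
  rw [← blade_singleton, inner_eq_sum_coord, Finset.sum_eq_single {i}]
  · simp only [coord_blade, if_true, map_one, mul_one]
  · intro A _ hA
    rw [coord_blade, if_neg hA.symm, mul_zero]
  · simp

lemma planarBasis_planarReal : PlanarBasis (planarReal 𝕜) := by
  refine planarBasis_of_planarSeq planarSeq_planarReal (fun k x => ?_) (fun ε => ?_) fun v hv => ?_
  · induction k with
    | zero => simpa [planarReal] using inner_gen_gen_of_ne (𝕜 := 𝕜) (m := 2) (by decide)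
    | succ k ih => rw [planarReal_succ, planarReal_succ, inner_planar, ih, mul_zero]
  · split_ifs <;> exact gen_ne_zero _
  · simpa using exists_eq_smul_gen hv

/-! ### The complex planar fields -/

lemma planarSeq_planarComplex (ε : Bool) :
    PlanarSeq ((if ε then -Complex.I else Complex.I : ℂ) • LinearMap.id)
      (Submodule.span ℂ {gen ℂ 0 + (if ε then -Complex.I else Complex.I : ℂ) • gen ℂ 1})
      (gen ℂ 0 + (if ε then -Complex.I else Complex.I : ℂ) • gen ℂ 1) (planarComplex ε) := by
  set c : ℂ := if ε then -Complex.I else Complex.I with hc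
  have hc2 : c * c = -1 := by
    rw [hc]; split_ifs <;> simp
  refine ⟨Submodule.mem_span_singleton_self _, fun v hv => Submodule.smul_mem _ _ hv, ?_,
    fun v hv => ?_, fun x => by simp [planarComplex, hc], fun k x => ?_⟩
  · rw [Submodule.span_singleton_le_iff_mem]
    exact Submodule.add_mem _ (gen_mem _) (Submodule.smul_mem _ _ (gen_mem _))
  · obtain ⟨a, rfl⟩ := Submodule.mem_span_singleton.1 hv
    have e : gen ℂ 0 * (gen ℂ 0 + c • gen ℂ 1) + gen ℂ (1 : Fin 2) * (c • (gen ℂ 0 + c • gen ℂ 1)) =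
        0 := by
      rw [smul_add, mul_add, mul_add, smul_smul, hc2, mul_smul_comm, mul_smul_comm, mul_smul_comm,
        gen_mul_self, gen_mul_self, gen_mul_gen_of_ne (i := (1 : Fin 2)) (j := 0) (by decide)]
      simp
    change gen ℂ 0 * (a • (gen ℂ 0 + c • gen ℂ 1)) +
      gen ℂ 1 * (c • a • (gen ℂ 0 + c • gen ℂ 1)) = 0
    rw [smul_comm c a, mul_smul_comm, mul_smul_comm, ← smul_add, e, smul_zero]
  · change ((x 0 : ℂ) + c * (x 1 : ℂ)) ^ (k + 1) • (gen ℂ 0 + c • gen ℂ 1) =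
      x 0 • ((x 0 : ℂ) + c * (x 1 : ℂ)) ^ k • (gen ℂ 0 + c • gen ℂ 1) +
      x 1 • c • ((x 0 : ℂ) + c * (x 1 : ℂ)) ^ k • (gen ℂ 0 + c • gen ℂ 1)
    rw [← real_smul_eq (𝕜 := ℂ), ← real_smul_eq (𝕜 := ℂ), smul_smul, smul_smul, smul_smul, ← add_smul]
    congr 1
    simp only [Complex.coe_algebraMap]
    ring

lemma planarBasis_planarComplex : PlanarBasis planarComplex := by
  have h0 : inner ℂ (gen ℂ 0 + (-Complex.I) • gen ℂ 1) (gen ℂ (0 : Fin 2) + Complex.I • gen ℂ 1) = 0 := by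
    simp only [inner_add_left, inner_add_right, inner_smul_left, inner_smul_right, inner_gen_gen_self,
      inner_gen_gen_of_ne (𝕜 := ℂ) (show (0 : Fin 2) ≠ 1 by decide),
      inner_gen_gen_of_ne (𝕜 := ℂ) (show (1 : Fin 2) ≠ 0 by decide)]
    simp
  refine planarBasis_of_planarSeq planarSeq_planarComplex (fun k x => ?_) (fun ε h => ?_)
    fun v hv => ?_
  · simp only [planarComplex, inner_smul_left, inner_smul_right]
    simp only [if_true, Bool.false_eq_true, if_false, h0, mul_zero]
  · have := congrArg (fun v => inner ℂ (gen ℂ (0 : Fin 2)) v) h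
    simp only [inner_add_right, inner_smul_right, inner_gen_gen_self, inner_zero_right,
      inner_gen_gen_of_ne (𝕜 := ℂ) (show (0 : Fin 2) ≠ 1 by decide)] at this
    simp at this
  · obtain ⟨c, d, rfl⟩ := exists_eq_smul_gen hv
    -- The solution `a, b` of `a + b = c` and `-i a + i b = d`.
    refine ⟨(c + Complex.I * d) / 2, (c - Complex.I * d) / 2, ?_⟩
    simp only [if_true, Bool.false_eq_true, if_false, smul_add, smul_smul]
    have h1 : (c + Complex.I * d) / 2 * -Complex.I + (c - Complex.I * d) / 2 * Complex.I = d := by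
      linear_combination (-d) * Complex.I_mul_I
    have h2 : (c + Complex.I * d) / 2 + (c - Complex.I * d) / 2 = c := by ring
    nth_rewrite 1 [← h2]
    nth_rewrite 3 [← h1]
    rw [add_smul, add_smul]
    abel

/-! ### The Gelfand–Tsetlin polynomials -/

lemma GTIndex.two_le {m s k : ℕ} (i : GTIndex m s k) : 2 ≤ m := by
  induction i with
  | scalar | bivector | vector => exact le_rfl
  | step h i ih => omega

lemma HomMonogenic.embed (hr : 2 ≤ r) {s t k j : ℕ} (h : (t, j) ∈ branching (r + 1) s k)
    {p : Euc r → Cl 𝕜 r} (hp : HomMonogenic t j p) :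
    HomMonogenic s k (embeddingFactor s t k j p) := by
  rcases h.2.2.2.1 with h1 | h1
  · simp only at h1
    subst h1
    exact hp.embed_succ hr h
  · simp only at h1
    subst h1
    exact hp.embed_same hr h

/-- The embedding as a linear map. -/
def embeddingL (s t k j : ℕ) : (Euc r → Cl 𝕜 r) →ₗ[𝕜] (Euc (r + 1) → Cl 𝕜 (r + 1)) where
  toFun := embeddingFactor s t k j
  map_add' p q := by
    funext x
    simp only [embeddingFactor, Pi.add_apply, map_add, mul_add, ← outerL_apply, ← contractL_apply,
      smul_add]
    abel
  map_smul' c p := by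
    funext x
    simp only [embeddingFactor, Pi.smul_apply, map_smul, mul_smul_comm, ← outerL_apply,
      ← contractL_apply, RingHom.id_apply, smul_comm _ c, ← smul_add]

/-- Derivatives in the last variable return a nonzero multiple of `p` or of `e_{r+1}p`. -/
lemma embed_ne_zero (hr : 2 ≤ r) {s t k j : ℕ} (h : (t, j) ∈ branching (r + 1) s k)
    {p : Euc r → Cl 𝕜 r} (hp : HomMonogenic t j p) (h0 : p ≠ 0) :
    embeddingFactor s t k j p ≠ 0 := by
  intro he
  obtain ⟨y, hy⟩ := Function.ne_iff.1 h0
  obtain ⟨n, hn⟩ := Nat.exists_eq_add_of_le h.2.2.1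
  simp only at hn
  subst hn
  rcases h.2.2.2.1 with h1 | h1
  · simp only at h1
    subst h1
    have := iterate_pd_embed_succ hr h hp.hom (padL r y)
    rw [he, iterate_pd_zero, pod_padL, eq_comm, smul_eq_zero] at this
    have h2 := gen_mul_eq_zero (this.resolve_left (rising_ne_zero j n))
    exact hy (incl_injective (h2.trans (map_zero _).symm))
  · simp only at h1
    subst h1
    have := iterate_pd_embed_same (t := t) hr n hp.hom (padL r y)
    rw [he, iterate_pd_zero, pod_padL, eq_comm, smul_eq_zero] at this
    exact hy (incl_injective ((this.resolve_left (rising_ne_zero j n)).trans (map_zero _).symm))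

/-- Since `t` and `t'` lie in `{s - 1, s}`, there are only three cases up to symmetry, and the mixed
one needs no information about `p` and `q`. -/
theorem ip_embed_eq_zero (hr : 2 ≤ r) {s k t j t' j' : ℕ} (h : (t, j) ∈ branching (r + 1) s k)
    (h' : (t', j') ∈ branching (r + 1) s k) {p q : Euc r → Cl 𝕜 r} (hp : HomMonogenic t j p)
    (hq : HomMonogenic t' j' q) (h0 : t = t' → ip p q = 0) :
    ip (embeddingFactor s t k j p) (embeddingFactor s t' k j' q) = 0 := by
  rcases h.2.2.2.1 with h1 | h1 <;> rcases h'.2.2.2.1 with h2 | h2 <;> simp only at h1 h2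
  · subst h1
    obtain rfl : t' = t := by omega
    exact ip_embed_succ_succ hr h h' hp hq (h0 rfl)
  · subst h1 h2
    exact ip_eq_zero_symm (ip_embed_same_succ hr h' h hq hp)
  · subst h1 h2
    exact ip_embed_same_succ hr h h' hp hq
  · subst h1 h2
    exact ip_embed_same_same hr h h' hp hq (h0 rfl)

lemma homMonogenic_const {s : ℕ} {a : Cl 𝕜 m} (ha : a ∈ multivectors 𝕜 m s) :
    HomMonogenic s 0 (fun _ : Euc m => a) :=
  ⟨IsHom.const a, fun _ => ha, fun x => by simp [dirac]⟩

namespace PlanarBasis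

variable {b : Bool → ℕ → Euc 2 → Cl 𝕜 2}

theorem homMonogenic_gtPoly (hb : PlanarBasis b) {m s k : ℕ} (i : GTIndex m s k) :
    HomMonogenic s k (gtPoly b i) := by
  induction i with
  | scalar => exact homMonogenic_const one_mem_multivectors
  | bivector => exact homMonogenic_const bivector_mem
  | vector ε k => exact hb.homMonogenic ε k
  | step h i ih => exact ih.embed i.two_le h

theorem gtPoly_ne_zero (hb : PlanarBasis b) {m s k : ℕ} (i : GTIndex m s k) : gtPoly b i ≠ 0 := by
  induction i with
  | scalar => exact fun h => one_ne_zero (congrFun h 0)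
  | bivector => exact fun h => gen_ne_zero (𝕜 := 𝕜) 0 (gen_mul_eq_zero (congrFun h (0 : Euc 2)))
  | vector ε k => exact hb.ne_zero ε k
  | step h i ih => exact embed_ne_zero i.two_le h (hb.homMonogenic_gtPoly i) ih

theorem ip_gtPoly_same (hb : PlanarBasis b) {m s k : ℕ} (i i' : GTIndex m s k) (hne : i ≠ i') :
    ip (gtPoly b i) (gtPoly b i') = 0 := by
  induction i with
  | scalar =>
    cases i' with
    | scalar => exact absurd rfl hne
    | step _ i' => exact absurd i'.two_le (by decide)
  | bivector =>
    cases i' with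
    | bivector => exact absurd rfl hne
    | step _ i' => exact absurd i'.two_le (by decide)
  | vector ε k =>
    cases i' with
    | vector ε' _ =>
      cases ε <;> cases ε'
      · exact absurd rfl hne
      · exact ip_eq_zero_symm (hb.orthogonal k)
      · exact hb.orthogonal k
      · exact absurd rfl hne
    | step _ i' => exact absurd i'.two_le (by decide)
  | @step r s k t j h i ih =>
    cases i' with
    | scalar => exact absurd i.two_le (by decide)
    | bivector => exact absurd i.two_le (by decide)
    | vector _ _ => exact absurd i.two_le (by decide)
    | @step _ _ _ t' j' h' i' =>
      refine ip_embed_eq_zero i.two_le h h' (hb.homMonogenic_gtPoly i) (hb.homMonogenic_gtPoly i') ?_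
      rintro rfl
      -- For equal grade and degree the induction hypothesis applies; for different degrees the
      -- lower fields are orthogonal anyway.
      by_cases hj : j = j'
      · subst hj
        exact ih i' fun hi => hne (by rw [hi])
      · exact HomMonogenic.ip_eq_zero_of_degree_ne hj (hb.homMonogenic_gtPoly i)
          (hb.homMonogenic_gtPoly i')

/-- Induction on the dimension: embeddings are linear, so they carry spanning sets of the lower
fields into the span of the `step` polynomials, and `mem_of_embeddings` says that embeddings exhaust
everything. -/
theorem mem_span_gtPoly (hb : PlanarBasis b) {m : ℕ} (hm : 2 ≤ m) {s k : ℕ} {P : Euc m → Cl 𝕜 m}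
    (hP : HomMonogenic s k P) :
    P ∈ Submodule.span 𝕜 (Set.range fun i : GTIndex m s k => gtPoly b i) := by
  induction m, hm using Nat.le_induction generalizing s k with
  | base =>
    by_cases hs : s ≤ 2 ∧ (s = 0 ∨ s = 2 → k = 0)
    swap
    · rw [show P = 0 from funext (hP.eq_zero_of_not_branching hs)]
      exact Submodule.zero_mem _
    obtain ⟨hs, hk⟩ := hs
    interval_cases s
    · obtain rfl := hk (Or.inl rfl)
      obtain ⟨c, hc⟩ := exists_eq_smul_one (hP.grade 0)
      have : P = c • gtPoly b GTIndex.scalar := funext fun x => by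
        rw [hP.hom.eq_const x, hc]; rfl
      rw [this]
      exact Submodule.smul_mem _ _ (Submodule.subset_span ⟨_, rfl⟩)
    · refine Submodule.span_mono ?_ (hb.mem_span k P hP)
      rintro _ (rfl | rfl)
      · exact ⟨.vector true k, rfl⟩
      · exact ⟨.vector false k, rfl⟩
    · obtain rfl := hk (Or.inr rfl)
      obtain ⟨c, hc⟩ := exists_eq_smul_bivector (hP.grade 0)
      have : P = c • gtPoly b GTIndex.bivector := funext fun x => by
        rw [hP.hom.eq_const x, hc]; rfl
      rw [this]
      exact Submodule.smul_mem _ _ (Submodule.subset_span ⟨_, rfl⟩)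
  | succ r hr ih =>
    refine hP.mem_of_embeddings hr _ fun t j h p hp => ?_
    have h1 := Submodule.mem_map_of_mem (f := embeddingL (𝕜 := 𝕜) s t k j) (ih hp)
    rw [Submodule.map_span] at h1
    refine Submodule.span_mono ?_ h1
    rintro _ ⟨_, ⟨i, rfl⟩, rfl⟩
    exact ⟨.step h i, rfl⟩

end PlanarBasis

/-! ### Homogeneous solutions of the generalized Moisil–Théodoresco system -/

/-- `P` is a homogeneous polynomial of degree `k` with values in the sum of the spaces of `s`-vectors,
`s ∈ S`, and `∂P = 0`. -/
structure HomSolution (S : Set ℕ) (k : ℕ) (P : Euc m → Cl 𝕜 m) : Prop where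
  hom : IsHom k P
  grade : ∀ x, P x ∈ multivectorsOf 𝕜 m S
  dirac_eq : ∀ x, dirac P x = 0

lemma HomMonogenic.homSolution {S : Set ℕ} {s k : ℕ} (hs : s ∈ S) {P : Euc m → Cl 𝕜 m}
    (hP : HomMonogenic s k P) : HomSolution S k P :=
  ⟨hP.hom, fun x => multivectors_le_multivectorsOf hs (hP.grade x), hP.dirac_eq⟩

lemma raise_mem {S : Set ℕ} {s k : ℕ} (hs : s ∈ between S) {P : Euc m → Cl 𝕜 m}
    (hP : ∀ x, P x ∈ multivectors 𝕜 m s) (x : Euc m) : raise s k P x ∈ multivectorsOf 𝕜 m S := by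
  obtain ⟨h1, h2, h3⟩ := hs
  obtain ⟨t, rfl⟩ := Nat.exists_eq_add_of_le' h1
  rw [raise, ← real_smul_eq]
  exact Submodule.add_mem _ (multivectors_le_multivectorsOf h3 (xWedge_mem x (hP x)))
    (Submodule.smul_mem _ _ (multivectors_le_multivectorsOf h2 (xDot_mem x (hP x))))

lemma HomMonogenic.homSolution_raise {S : Set ℕ} {s k : ℕ} (hs : s ∈ between S)
    {P : Euc m → Cl 𝕜 m} (hP : HomMonogenic s k P) : HomSolution S (k + 1) (GMT.raise s k P) :=
  ⟨hP.hom.raise, raise_mem hs hP.grade, dirac_raise hs.1 hP⟩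

lemma gradeProj_singleton_eq_zero {S : Set ℕ} {s : ℕ} (hs : s ∉ S) {a : Cl 𝕜 m}
    (ha : a ∈ multivectorsOf 𝕜 m S) : gradeProj {s} a = 0 := by
  classical
  refine coord_ext fun A => ?_
  rw [coord_gradeProj, map_zero]
  split_ifs with h
  · exact mem_multivectorsOf.1 ha A (by rw [show A.card = s from h]; exact hs)
  · rfl

lemma dw_gradeProj (s : ℕ) {F : Euc m → Cl 𝕜 m} {x : Euc m} (hF : DifferentiableAt ℝ F x) :
    dw (fun x => gradeProj {s} (F x)) x = gradeProj {s + 1} (dw F x) := by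
  simp only [dw, dOp, map_sum, gradeProj_wedge, pd_lin _ _ hF]

lemma gradeProj_dc (s : ℕ) {F : Euc m → Cl 𝕜 m} {x : Euc m} (hF : DifferentiableAt ℝ F x) :
    gradeProj {s} (dc F x) = dc (fun x => gradeProj {s + 1} (F x)) x := by
  simp only [dc, dOp, map_sum, gradeProj_dot, pd_lin _ _ hF]

/-- `∂∧` and `∂•` shift grades by exactly one, so they vanish on each graded component as soon as
they vanish on `F`; the condition `∂F = 0` alone would not suffice. -/
lemma homMonogenic_gradeProj (s : ℕ) {k : ℕ} {F : Euc m → Cl 𝕜 m} (hF : IsHom k F)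
    (h1 : ∀ x, dw F x = 0) (h2 : ∀ x, dc F x = 0) :
    HomMonogenic s k fun x => gradeProj {s} (F x) := by
  refine HomMonogenic.of_dw_dc (hF.lin _) (fun x => gradeProj_singleton_mem s _) (fun x => ?_)
    fun x => ?_
  · rw [dw_gradeProj s (hF.diffAt x), h1, map_zero]
  · rcases s with _ | s
    · exact dc_scalar (hF.lin (gradeProj {0})).smooth (fun x => gradeProj_singleton_mem 0 _) x
    · rw [← gradeProj_dc s (hF.diffAt x), h2, map_zero]

lemma raise_zero (s k : ℕ) (x : Euc m) : raise s k (fun _ => (0 : Cl 𝕜 m)) x = 0 := by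
  simp [raise]

/-- `raise` as a linear map. -/
def raiseL (s k : ℕ) : (Euc m → Cl 𝕜 m) →ₗ[𝕜] (Euc m → Cl 𝕜 m) where
  toFun := raise s k
  map_add' p q := by
    funext x
    simp only [raise, Pi.add_apply, map_add, smul_add]
    abel
  map_smul' c p := by
    funext x
    simp only [raise, Pi.smul_apply, map_smul, RingHom.id_apply, smul_add, smul_comm c]

/-- Every solution is the sum of one with homogeneous monogenic components and of images under
`raise` of homogeneous monogenic multivector fields. -/
theorem HomSolution.mem_of_mem {S : Set ℕ} {k : ℕ} {P : Euc m → Cl 𝕜 m} (hP : HomSolution S k P)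
    (W : Submodule 𝕜 (Euc m → Cl 𝕜 m))
    (h1 : ∀ s ∈ S, ∀ Q : Euc m → Cl 𝕜 m, HomMonogenic s k Q → Q ∈ W)
    (h2 : ∀ s ∈ between S, ∀ j, k = j + 1 → ∀ Q : Euc m → Cl 𝕜 m, HomMonogenic s j Q →
      raise s j Q ∈ W) : P ∈ W := by
  have key (Q : Euc m → Cl 𝕜 m) (hQ : IsHom k Q) (hS : ∀ x, Q x ∈ multivectorsOf 𝕜 m S)
      (hw : ∀ x, dw Q x = 0) (hc : ∀ x, dc Q x = 0) : Q ∈ W := by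
    -- If `∂∧` and `∂•` vanish separately, the field is the sum of its monogenic graded components.
    -- The remaining work reduces `P` to this case.
    have e : Q = ∑ s ∈ Finset.range (m + 1), fun x => gradeProj {s} (Q x) := by
      funext x
      rw [Finset.sum_apply, sum_gradeProj]
    rw [e]
    refine Submodule.sum_mem _ fun s _ => ?_
    by_cases hs : s ∈ S
    · exact h1 s hs _ (homMonogenic_gradeProj s hQ hw hc)
    · rw [show (fun x => gradeProj {s} (Q x)) = 0 from
        funext fun x => gradeProj_singleton_eq_zero hs (hS x)]
      exact W.zero_mem
  have hdir (x : Euc m) : dw P x + dc P x = 0 := by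
    rw [← dirac_eq_dw_add_dc]; exact hP.dirac_eq x
  rcases k with _ | k
  · exact key P hP.hom hP.grade (fun x => by simp [dw, dOp, hP.hom.pd_of_zero])
      fun x => by simp [dc, dOp, hP.hom.pd_of_zero]
  have hR : IsHom k (dw P) := hP.hom.dOp wedge
  have hcP : dc P = fun x => -dw P x := funext fun x => eq_neg_of_add_eq_zero_right (hdir x)
  have hcR (x : Euc m) : dc (dw P) x = 0 := by
    have h3 := dc_dc hP.hom.smooth x
    rw [hcP] at h3
    have e : (fun x => -dw P x) = fun x => (-1 : ℝ) • dw P x := funext fun x => by simp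
    rw [e, dc, dOp_real_smul _ _ (hR.diffAt x)] at h3
    simpa using h3
  set R : ℕ → Euc m → Cl 𝕜 m := fun s x => gradeProj {s} (dw P x) with hRdef
  have hRm (s : ℕ) : HomMonogenic s k (R s) := homMonogenic_gradeProj s hR (dw_dw hP.hom.smooth) hcR
  -- The `s`-component of `∂∧P` is `∂∧` of the `(s-1)`-component of `P`, and also minus `∂•` of its
  -- `(s+1)`-component. One of the two is absent unless `s ∈ S'`.
  have hR0 (s : ℕ) (hs : s ∉ between S) (x : Euc m) : R s x = 0 := by
    rcases s with _ | s
    · simp only [hRdef, dw, dOp, map_sum, gradeProj_zero_wedge, Finset.sum_const_zero]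
    · have hs' : s ∉ S ∨ s + 2 ∉ S := by
        by_contra h
        rw [not_or, not_not, not_not] at h
        exact hs ⟨by omega, by simpa using h.1, h.2⟩
      rcases hs' with h | h
      · simp only [hRdef]
        rw [← dw_gradeProj s (hP.hom.diffAt x)]
        simp only [fun y => gradeProj_singleton_eq_zero h (hP.grade y), dw, dOp, pd_const, map_zero,
          Finset.sum_const_zero]
      · have e : dw P x = -dc P x := eq_neg_of_add_eq_zero_left (hdir x)
        simp only [hRdef]
        rw [e, map_neg, gradeProj_dc (s + 1) (hP.hom.diffAt x)]
        simp only [fun y => gradeProj_singleton_eq_zero h (hP.grade y), dc, dOp, pd_const, map_zero,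
          Finset.sum_const_zero, neg_zero]
  -- Treated separately because the set `S` is not assumed to lie in `{0, …, m}` here: the
  -- `(m+1)`-component is empty in any case.
  have hRtop (x : Euc m) : R m x = 0 := by
    have e : dw P x = -dc P x := eq_neg_of_add_eq_zero_left (hdir x)
    simp only [hRdef]
    rw [e, map_neg, gradeProj_dc m (hP.hom.diffAt x)]
    simp only [fun y => multivectors_eq_bot (Nat.lt_succ_self m)
      (gradeProj_singleton_mem (m + 1) (P y)), dc, dOp, pd_const, map_zero, Finset.sum_const_zero,
      neg_zero]
  -- The inverse of the scalar produced by `dw_raise` and `dc_raise`. For `s = m`, `k = 0` it is the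
  -- default value zero, which is harmless as `R m = 0`.
  set c : ℕ → ℝ := fun s => ((k : ℝ) + m - s)⁻¹ with hcdef
  set T : Euc m → Cl 𝕜 m := fun x => ∑ s ∈ Finset.range (m + 1), c s • raise s k (R s) x with hT
  have hTh (s : ℕ) : IsHom (k + 1) fun x => c s • raise s k (R s) x :=
    (hRm s).hom.raise.clm (c s • ContinuousLinearMap.id ℝ _)
  have hTm : IsHom (k + 1) T := IsHom.sum _ fun s _ => hTh s
  have hcs (s : ℕ) (hs : s ∈ Finset.range (m + 1)) (x : Euc m) :
      (c s * ((k : ℝ) + m - s)) • R s x = R s x := by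
    rcases Nat.lt_or_ge s m with h | h
    · have h' : (s : ℝ) < m := by exact_mod_cast h
      have h'' : (0 : ℝ) ≤ k := by positivity
      rw [hcdef, inv_mul_cancel₀ (by linarith), one_smul]
    · obtain rfl : s = m := by have := Finset.mem_range.1 hs; omega
      rw [hRtop, smul_zero]
  -- `T` is built to reproduce both `∂∧P` and `∂•P`, so both parts of `∂` vanish on `P - T`.
  have hdwT (x : Euc m) : dw T x = dw P x := by
    rw [hT, dw, dOp_sum _ _ fun s _ => (hTh s).diffAt x, ← sum_gradeProj (dw P x)]
    refine Finset.sum_congr rfl fun s hs => ?_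
    rw [dOp_real_smul _ _ ((hRm s).hom.raise.diffAt x)]
    rcases s with _ | s
    · have h0 : R 0 = fun _ => 0 := funext fun x => hR0 0 (fun h => by simpa using h.1) x
      have : raise 0 k (R 0) = fun _ => 0 := funext fun x => by rw [h0, raise_zero]
      rw [this]
      simp only [dOp, pd_const, map_zero, Finset.sum_const_zero, smul_zero]
      exact (congrFun h0 x).symm
    · have h := dw_raise (hRm (s + 1)) x
      rw [betaFactor_mul k (by omega), neg_smul, neg_neg] at h
      rw [dw] at h
      rw [h, smul_smul, hcs _ hs]
  have hdcT (x : Euc m) : dc T x = dc P x := by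
    rw [show dc P x = -dw P x from congrFun hcP x, hT, dc,
      dOp_sum _ _ fun s _ => (hTh s).diffAt x, ← sum_gradeProj (dw P x),
      ← Finset.sum_neg_distrib]
    refine Finset.sum_congr rfl fun s hs => ?_
    have h := dc_raise (hRm s) x
    rw [dc] at h
    rw [dOp_real_smul _ _ ((hRm s).hom.raise.diffAt x), h, smul_neg, smul_smul, hcs _ hs]
  have hTsum : T = ∑ s ∈ Finset.range (m + 1), (c s : 𝕜) • raise s k (R s) := by
    funext x
    simp only [hT, Finset.sum_apply, Pi.smul_apply, real_smul_eq]
  have hraise0 (s : ℕ) (hs : s ∉ between S) : raise s k (R s) = 0 := by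
    rw [show R s = fun _ => 0 from funext (hR0 s hs)]
    exact funext (raise_zero s k)
  have hTW : T ∈ W := by
    rw [hTsum]
    refine Submodule.sum_mem _ fun s _ => W.smul_mem _ ?_
    by_cases hs : s ∈ between S
    · exact h2 s hs k rfl _ (hRm s)
    · rw [hraise0 s hs]; exact W.zero_mem
  have hTS (x : Euc m) : T x ∈ multivectorsOf 𝕜 m S := by
    rw [hTsum, Finset.sum_apply]
    refine Submodule.sum_mem _ fun s _ => Submodule.smul_mem _ _ ?_
    by_cases hs : s ∈ between S
    · exact raise_mem hs (hRm s).grade x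
    · rw [hraise0 s hs]; exact Submodule.zero_mem _
  have hQW := key (fun x => P x - T x) (hP.hom.sub hTm)
    (fun x => Submodule.sub_mem _ (hP.grade x) (hTS x))
    (fun x => by rw [dw, dOp_sub _ (hP.hom.diffAt x) (hTm.diffAt x)]; exact sub_eq_zero.2 (hdwT x).symm)
    (fun x => by rw [dc, dOp_sub _ (hP.hom.diffAt x) (hTm.diffAt x)]; exact sub_eq_zero.2 (hdcT x).symm)
  have : P = (fun x => P x - T x) + T := by
    funext x; simp
  rw [this]
  exact W.add_mem hQW hTW

/-! ### The family of basis polynomials -/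

lemma gmtFamily_inl (b : Bool → ℕ → Euc 2 → Cl 𝕜 2) {S : Set ℕ} (s : S) (k : ℕ)
    (i : GTIndex m s k) : gmtFamily b m S (.inl ⟨s, k, i⟩) = gtPoly b i := rfl

lemma gmtFamily_inr (b : Bool → ℕ → Euc 2 → Cl 𝕜 2) {S : Set ℕ} (s : between S) (k : ℕ)
    (i : GTIndex m s k) : gmtFamily b m S (.inr ⟨s, k, i⟩) = raise s k (gtPoly b i) := by
  funext x
  simp only [gmtFamily, raise, betaFactor, real_smul_eq]
  rfl

lemma ip_add_smul_right {f g h : Euc m → Cl 𝕜 m} (c : ℝ) (hf : Continuous f) (hg : Continuous g)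
    (hh : Continuous h) : ip f (fun x => g x + c • h x) = ip f g + (c : 𝕜) * ip f h := by
  have h1 : Integrable (fun x => inner 𝕜 (f x) (g x)) (ballMeasure m) :=
    integrable_of_continuous (hf.inner hg)
  have h2 : Integrable (fun x => (c : 𝕜) * inner 𝕜 (f x) (h x)) (ballMeasure m) :=
    (integrable_of_continuous (hf.inner hh)).const_mul _
  simp only [ip, inner_add_right, inner_real_smul_right]
  rw [integral_add h1 h2]
  congr 1
  exact integral_const_mul _ _

/-- `∂∧` and `∂•` annihilate both fields, so `f` is orthogonal to `x∧g` and to `x•g` separately. -/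
lemma HomMonogenic.ip_raise_eq_zero {s k t j : ℕ} {f g : Euc m → Cl 𝕜 m} (hf : HomMonogenic s k f)
    (hg : HomMonogenic t j g) : ip f (GMT.raise t j g) = 0 := by
  unfold GMT.raise
  rw [ip_add_smul_right _ hf.hom.smooth.continuous hg.hom.xWedge.smooth.continuous
    hg.hom.xDot.smooth.continuous, GMT.ip_xWedge_eq_zero hf.hom hg.hom hf.dc_eq hg.dw_eq,
    GMT.ip_xDot_eq_zero hf.hom hg.hom hf.dw_eq hg.dc_eq, mul_zero, add_zero]

/-- The mixed terms vanish pointwise since `x∧` and `x•` square to zero. The others vanish by grade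
if `s ≠ t`, and are multiples of the product of `f` and `g` after integration if `s = t`. -/
lemma HomMonogenic.ip_raise_raise {s k t j : ℕ} {f g : Euc m → Cl 𝕜 m} (hf : HomMonogenic s k f)
    (hg : HomMonogenic t j g) (h : s = t → ip f g = 0) :
    ip (GMT.raise s k f) (GMT.raise t j g) = 0 := by
  have e (x : Euc m) : Inner.inner 𝕜 (GMT.raise s k f x) (GMT.raise t j g x) =
      Inner.inner 𝕜 (GMT.xWedge x (f x)) (GMT.xWedge x (g x)) +
        ((betaFactor m s k * betaFactor m t j : ℝ) : 𝕜) *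
          Inner.inner 𝕜 (GMT.xDot x (f x)) (GMT.xDot x (g x)) := by
    have e1 : Inner.inner 𝕜 (GMT.xWedge x (f x)) (GMT.xDot x (g x)) = 0 := by
      rw [inner_xWedge_left, xDot_xDot, inner_zero_right, neg_zero]
    have e2 : Inner.inner 𝕜 (GMT.xDot x (f x)) (GMT.xWedge x (g x)) = 0 := by
      rw [inner_xDot_left, xWedge_xWedge, inner_zero_right, neg_zero]
    simp only [GMT.raise, inner_add_left, inner_add_right, inner_real_smul_left,
      inner_real_smul_right, e1, e2]
    push_cast
    ring
  by_cases hst : s = t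
  · subst hst
    have h0 := h rfl
    have i1 : Integrable (fun x => Inner.inner 𝕜 (GMT.xWedge x (f x)) (GMT.xWedge x (g x)))
        (ballMeasure m) :=
      integrable_of_continuous (hf.hom.xWedge.smooth.continuous.inner hg.hom.xWedge.smooth.continuous)
    have i2 : Integrable (fun x => ((betaFactor m s k * betaFactor m s j : ℝ) : 𝕜) *
        Inner.inner 𝕜 (GMT.xDot x (f x)) (GMT.xDot x (g x))) (ballMeasure m) :=
      (integrable_of_continuous
        (hf.hom.xDot.smooth.continuous.inner hg.hom.xDot.smooth.continuous)).const_mul _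
    have e3 := hf.ip_xWedge_eq_zero hg h0
    have e4 := hf.ip_xDot_eq_zero hg h0
    rw [ip] at e3 e4 ⊢
    simp only [e]
    rw [integral_add i1 i2, e3, integral_const_mul, e4, mul_zero, add_zero]
  · have e5 (x : Euc m) : Inner.inner 𝕜 (GMT.raise s k f x) (GMT.raise t j g x) = 0 := by
      have e7 : Inner.inner 𝕜 (GMT.xDot x (f x)) (GMT.xDot x (g x)) = 0 := by
        have ha := hf.grade x
        have hb := hg.grade x
        rcases s with _ | s
        · rw [xDot_scalar x ha, inner_zero_left]
        rcases t with _ | t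
        · rw [xDot_scalar x hb, inner_zero_right]
        exact inner_eq_zero_of_grade_ne (by omega) (xDot_mem x ha) (xDot_mem x hb)
      rw [e, e7, inner_eq_zero_of_grade_ne (by omega) (xWedge_mem x (hf.grade x))
        (xWedge_mem x (hg.grade x)), mul_zero, add_zero]
    simp [ip, e5]

namespace PlanarBasis

variable {b : Bool → ℕ → Euc 2 → Cl 𝕜 2}

theorem ip_gtPoly (hb : PlanarBasis b) {s k s' k' : ℕ} (i : GTIndex m s k) (i' : GTIndex m s' k')
    (hne : s = s' → k = k' → ¬HEq i i') : ip (gtPoly b i) (gtPoly b i') = 0 := by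
  have h1 := hb.homMonogenic_gtPoly i
  have h2 := hb.homMonogenic_gtPoly i'
  by_cases hs : s = s'
  · subst hs
    by_cases hk : k = k'
    · subst hk
      exact hb.ip_gtPoly_same i i' fun h => hne rfl rfl (heq_of_eq h)
    · exact h1.ip_eq_zero_of_degree_ne hk h2
  · simp [ip, fun x => inner_eq_zero_of_grade_ne hs (h1.grade x) (h2.grade x)]

theorem exists_homSolution_gmtFamily (hb : PlanarBasis b) (S : Set ℕ) (i : GMTIndex m S) :
    ∃ k, HomSolution S k (gmtFamily b m S i) := by
  rcases i with ⟨s, k, i⟩ | ⟨s, k, i⟩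
  · exact ⟨k, (hb.homMonogenic_gtPoly i).homSolution s.2⟩
  · rw [gmtFamily_inr]
    exact ⟨k + 1, (hb.homMonogenic_gtPoly i).homSolution_raise s.2⟩

/-- `∂•` recovers `f` from its image with factor `k + m - s`, which is positive because `s + 1 ∈ S`
is at most `m`. -/
theorem gmtFamily_ne_zero (hb : PlanarBasis b) {S : Set ℕ} (hS : ∀ s ∈ S, s ≤ m)
    (i : GMTIndex m S) : gmtFamily b m S i ≠ 0 := by
  rcases i with ⟨s, k, i⟩ | ⟨s, k, i⟩
  · exact hb.gtPoly_ne_zero i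
  · rw [gmtFamily_inr]
    intro h
    refine hb.gtPoly_ne_zero i (funext fun x => ?_)
    have h1 := dc_raise (hb.homMonogenic_gtPoly i) x
    rw [h] at h1
    have h0 : dc (0 : Euc m → Cl 𝕜 m) x = 0 := by
      simp only [dc, dOp]
      exact Finset.sum_eq_zero fun j _ => by
        rw [show pd j (0 : Euc m → Cl 𝕜 m) x = 0 from pd_const j 0 x, map_zero]
    rw [h0, eq_comm, neg_eq_zero, smul_eq_zero] at h1
    refine h1.resolve_left ?_
    have h3 : ((s : ℕ) : ℝ) + 1 ≤ m := by exact_mod_cast hS _ s.2.2.2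
    have h4 : (0 : ℝ) ≤ k := by positivity
    linarith

theorem ip_gmtFamily (hb : PlanarBasis b) {S : Set ℕ} (i j : GMTIndex m S) (hij : i ≠ j) :
    ip (gmtFamily b m S i) (gmtFamily b m S j) = 0 := by
  rcases i with ⟨⟨s, hs⟩, k, i⟩ | ⟨⟨s, hs⟩, k, i⟩ <;> rcases j with ⟨⟨t, ht⟩, l, j⟩ | ⟨⟨t, ht⟩, l, j⟩
  · refine hb.ip_gtPoly (m := m) i j ?_
    rintro rfl rfl h
    obtain rfl := eq_of_heq h
    exact hij rfl
  · rw [gmtFamily_inl, gmtFamily_inr]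
    exact (hb.homMonogenic_gtPoly i).ip_raise_eq_zero (hb.homMonogenic_gtPoly j)
  · rw [gmtFamily_inl, gmtFamily_inr]
    exact ip_eq_zero_symm ((hb.homMonogenic_gtPoly j).ip_raise_eq_zero (hb.homMonogenic_gtPoly i))
  · rw [gmtFamily_inr, gmtFamily_inr]
    refine (hb.homMonogenic_gtPoly i).ip_raise_raise (hb.homMonogenic_gtPoly j) fun hst => ?_
    refine hb.ip_gtPoly (m := m) i j ?_
    rintro h1 rfl h
    simp only at h1
    subst h1
    obtain rfl := eq_of_heq h
    exact hij rfl

theorem mem_span_gmtFamily (hb : PlanarBasis b) (hm : 2 ≤ m) {S : Set ℕ} {k : ℕ}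
    {P : Euc m → Cl 𝕜 m} (hP : HomSolution S k P) :
    P ∈ Submodule.span 𝕜 (Set.range (gmtFamily b m S)) := by
  refine hP.mem_of_mem _ (fun s hs Q hQ => ?_) fun s hs j _ Q hQ => ?_
  · refine Submodule.span_mono ?_ (hb.mem_span_gtPoly hm hQ)
    rintro _ ⟨i, rfl⟩
    exact ⟨.inl ⟨⟨s, hs⟩, k, i⟩, rfl⟩
  · have h1 := Submodule.mem_map_of_mem (f := raiseL (𝕜 := 𝕜) s j) (hb.mem_span_gtPoly hm hQ)
    rw [Submodule.map_span] at h1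
    refine Submodule.span_mono ?_ h1
    rintro _ ⟨_, ⟨i, rfl⟩, rfl⟩
    exact ⟨.inr ⟨⟨s, hs⟩, j, i⟩, gmtFamily_inr b ⟨s, hs⟩ j i⟩

end PlanarBasis

/-! ### The Fischer inner product -/

lemma IsHom.const_smul {k : ℕ} {P : Euc m → Cl 𝕜 m} (c : 𝕜) (hP : IsHom k P) :
    IsHom k fun x => c • P x := hP.lin (c • LinearMap.id)

lemma pd_scalar_smul (i : Fin m) (c : 𝕜) {P : Euc m → Cl 𝕜 m} (hP : ContDiff ℝ ∞ P) :
    pd i (fun x => c • P x) = fun x => c • pd i P x :=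
  funext fun x => pd_lin i (c • LinearMap.id) (hP.diffAt x)

variable (𝕜 m) in
/-- The space of homogeneous polynomials of degree `k` with values in the Clifford algebra. -/
def homSpace (k : ℕ) : Submodule 𝕜 (Euc m → Cl 𝕜 m) where
  carrier := {P | IsHom k P}
  zero_mem' := IsHom.zero k
  add_mem' hP hQ := IsHom.add hP hQ
  smul_mem' c _ hP := IsHom.const_smul c hP

/-- The gradient embeds degree `k + 1` into `m` copies of degree `k`, and degree zero consists of
constants. -/
lemma finiteDimensional_homSpace (k : ℕ) : FiniteDimensional 𝕜 (homSpace 𝕜 m k) := by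
  induction k with
  | zero =>
    let T : homSpace 𝕜 m 0 →ₗ[𝕜] Cl 𝕜 m := (LinearMap.proj 0).comp (homSpace 𝕜 m 0).subtype
    refine FiniteDimensional.of_injective T (LinearMap.ker_eq_bot.1 (LinearMap.ker_eq_bot'.2 ?_))
    intro P hP
    exact Subtype.ext (funext fun x => (IsHom.eq_const P.2 x).trans hP)
  | succ k ih =>
    let T : homSpace 𝕜 m (k + 1) →ₗ[𝕜] (Fin m → homSpace 𝕜 m k) :=
      { toFun := fun P i => ⟨pd i P.1, IsHom.pd P.2 i⟩
        map_add' := fun P Q => funext fun i => Subtype.ext (funext fun x =>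
          pd_add i (IsHom.diffAt P.2 x) (IsHom.diffAt Q.2 x))
        map_smul' := fun c P => funext fun i => Subtype.ext (pd_scalar_smul i c P.2.smooth) }
    refine FiniteDimensional.of_injective T (LinearMap.ker_eq_bot.1 (LinearMap.ker_eq_bot'.2 ?_))
    intro P hP
    refine Subtype.ext (funext fun x => IsHom.eq_zero_of_pd P.2 (fun i x => ?_) x)
    exact congrFun (congrArg Subtype.val (congrFun hP i)) x

/-- The Fischer inner product of homogeneous polynomials of degree `k`. -/
def fischer : ℕ → (Euc m → Cl 𝕜 m) → (Euc m → Cl 𝕜 m) → 𝕜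
  | 0, P, Q => inner 𝕜 (P 0) (Q 0)
  | k + 1, P, Q => ∑ i, fischer k (pd i P) (pd i Q)

lemma fischer_conj_symm (k : ℕ) (P Q : Euc m → Cl 𝕜 m) :
    starRingEnd 𝕜 (fischer k Q P) = fischer k P Q := by
  induction k generalizing P Q with
  | zero => exact inner_conj_symm _ _
  | succ k ih => simp only [fischer, map_sum, ih]

lemma fischer_re_nonneg (k : ℕ) (P : Euc m → Cl 𝕜 m) : 0 ≤ RCLike.re (fischer k P P) := by
  induction k generalizing P with
  | zero => exact inner_self_nonneg
  | succ k ih =>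
    rw [fischer, map_sum]
    exact Finset.sum_nonneg fun i _ => ih _

lemma fischer_add_left (k : ℕ) {P Q : Euc m → Cl 𝕜 m} (hP : ContDiff ℝ ∞ P) (hQ : ContDiff ℝ ∞ Q)
    (R : Euc m → Cl 𝕜 m) :
    fischer k (fun x => P x + Q x) R = fischer k P R + fischer k Q R := by
  induction k generalizing P Q R with
  | zero => exact inner_add_left _ _ _
  | succ k ih =>
    simp only [fischer, ← Finset.sum_add_distrib]
    refine Finset.sum_congr rfl fun i _ => ?_
    rw [show pd i (fun x => P x + Q x) = fun x => pd i P x + pd i Q x from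
      funext fun x => pd_add i (hP.diffAt x) (hQ.diffAt x)]
    exact ih (contDiff_pd i hP) (contDiff_pd i hQ) _

lemma fischer_zero_left (k : ℕ) (R : Euc m → Cl 𝕜 m) :
    fischer k (fun _ => 0) R = 0 := by
  have h := fischer_add_left k (P := fun _ : Euc m => (0 : Cl 𝕜 m)) (Q := fun _ => 0)
    contDiff_const contDiff_const R
  simpa using h

lemma fischer_sum_left {ι : Type*} (s : Finset ι) (k : ℕ) {P : ι → Euc m → Cl 𝕜 m}
    (hP : ∀ a, ContDiff ℝ ∞ (P a)) (R : Euc m → Cl 𝕜 m) :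
    fischer k (fun x => ∑ a ∈ s, P a x) R = ∑ a ∈ s, fischer k (P a) R := by
  classical
  induction s using Finset.induction with
  | empty => simpa using fischer_zero_left k R
  | insert a s ha ih =>
    simp only [Finset.sum_insert ha]
    rw [fischer_add_left k (hP a) (ContDiff.sum fun b _ => hP b), ih]

lemma fischer_smul_left (k : ℕ) (c : 𝕜) {P : Euc m → Cl 𝕜 m} (hP : ContDiff ℝ ∞ P)
    (R : Euc m → Cl 𝕜 m) :
    fischer k (fun x => c • P x) R = starRingEnd 𝕜 c * fischer k P R := by
  induction k generalizing P R with
  | zero => exact inner_smul_left _ _ _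
  | succ k ih =>
    simp only [fischer, Finset.mul_sum]
    refine Finset.sum_congr rfl fun i _ => ?_
    rw [pd_scalar_smul i c hP, ih (contDiff_pd i hP)]

lemma IsHom.eq_zero_of_fischer {k : ℕ} {P : Euc m → Cl 𝕜 m} (hP : IsHom k P)
    (h : fischer k P P = 0) (x : Euc m) : P x = 0 := by
  induction k generalizing P x with
  | zero => rw [hP.eq_const, inner_self_eq_zero (𝕜 := 𝕜) |>.1 h]
  | succ k ih =>
    refine hP.eq_zero_of_pd (fun i x => ih (hP.pd i) ?_ x) x
    have him (i : Fin m) : RCLike.im (fischer k (GMT.pd i P) (GMT.pd i P)) = 0 :=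
      RCLike.conj_eq_iff_im.1 (fischer_conj_symm k _ _)
    have hre := congrArg RCLike.re h
    rw [fischer, map_sum, map_zero] at hre
    have := (Finset.sum_eq_zero_iff_of_nonneg fun i _ => fischer_re_nonneg k _).1 hre i
      (Finset.mem_univ i)
    exact RCLike.ext (by rw [this, map_zero]) (by rw [him, map_zero])

lemma fischer_lin_left (k : ℕ) (T U : Cl 𝕜 m →ₗ[𝕜] Cl 𝕜 m)
    (hTU : ∀ a b, inner 𝕜 (T a) b = inner 𝕜 a (U b)) {P Q : Euc m → Cl 𝕜 m}
    (hP : ContDiff ℝ ∞ P) (hQ : ContDiff ℝ ∞ Q) :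
    fischer k (fun x => T (P x)) Q = fischer k P (fun x => U (Q x)) := by
  induction k generalizing P Q with
  | zero => exact hTU _ _
  | succ k ih =>
    simp only [fischer]
    refine Finset.sum_congr rfl fun i _ => ?_
    rw [show pd i (fun x => T (P x)) = fun x => T (pd i P x) from
        funext fun x => pd_lin i T (hP.diffAt x),
      show pd i (fun x => U (Q x)) = fun x => U (pd i Q x) from
        funext fun x => pd_lin i U (hQ.diffAt x)]
    exact ih (contDiff_pd i hP) (contDiff_pd i hQ)

lemma fischer_succ_coord_smul (k : ℕ) (j : Fin m) {P : Euc m → Cl 𝕜 m} (hP : ContDiff ℝ ∞ P)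
    (Q : Euc m → Cl 𝕜 m) :
    fischer (k + 1) (fun x => x j • P x) Q =
      fischer k P (pd j Q) + ∑ i, fischer k (fun x => x j • pd i P x) (pd i Q) := by
  have h1 (i : Fin m) : fischer k (pd i (fun x => x j • P x)) (pd i Q) =
      (if i = j then fischer k P (pd j Q) else 0) +
        fischer k (fun x => x j • pd i P x) (pd i Q) := by
    rw [show pd i (fun x => x j • P x) = fun x => (if i = j then P x else 0) + x j • pd i P x from
      funext fun x => pd_coord_smul i j (hP.diffAt x)]
    split_ifs with h
    · subst h
      exact fischer_add_left k hP ((contDiff_coord i).smul (contDiff_pd i hP)) _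
    · simp only [zero_add]
  simp only [fischer, h1, Finset.sum_add_distrib, Finset.sum_ite_eq', Finset.mem_univ, if_true]

/-- Multiplication by `x_j` is adjoint to `∂_j`. The factor `k + 1` arises because `fischer` sums
over all ordered sequences of derivatives. -/
lemma fischer_coord_smul {k : ℕ} (j : Fin m) {P Q : Euc m → Cl 𝕜 m} (hP : IsHom k P)
    (hQ : ContDiff ℝ ∞ Q) :
    fischer (k + 1) (fun x => x j • P x) Q = (k + 1 : ℕ) * fischer k P (pd j Q) := by
  induction k generalizing P Q with
  | zero =>
    rw [fischer_succ_coord_smul _ _ hP.smooth]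
    have h0 (i : Fin m) : (fun x : Euc m => x j • pd i P x) = fun _ => 0 := by
      funext x; rw [hP.pd_of_zero, smul_zero]
    simp only [h0, fischer_zero_left, Finset.sum_const_zero, add_zero]
    simp
  | succ k ih =>
    rw [fischer_succ_coord_smul _ _ hP.smooth]
    have h1 (i : Fin m) : fischer (k + 1) (fun x => x j • pd i P x) (pd i Q) =
        (k + 1 : ℕ) * fischer k (pd i P) (pd i (pd j Q)) := by
      rw [ih (hP.pd i) (contDiff_pd i hQ),
        show pd j (pd i Q) = pd i (pd j Q) from funext fun x => pd_comm j i hQ x]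
    simp only [h1, ← Finset.mul_sum]
    rw [← fischer]
    push_cast
    ring

/-- Multiplication by `x` is adjoint to `-∂`, up to the factor of the scalar case. -/
lemma fischer_vec_mul {k : ℕ} {P Q : Euc m → Cl 𝕜 m} (hP : IsHom k P) (hQ : ContDiff ℝ ∞ Q) :
    fischer (k + 1) (fun x => vec 𝕜 x * P x) Q = -((k + 1 : ℕ) * fischer k P (dirac Q)) := by
  let G (i : Fin m) : Cl 𝕜 m →ₗ[𝕜] Cl 𝕜 m := LinearMap.mulLeft 𝕜 (gen 𝕜 i)
  have hadj (i : Fin m) (a b : Cl 𝕜 m) : inner 𝕜 (G i a) b = inner 𝕜 a ((-G i) b) := by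
    rw [LinearMap.neg_apply, inner_neg_right]
    exact inner_gen_mul_left i a b
  have hsm (i : Fin m) : ContDiff ℝ ∞ fun x => G i (pd i Q x) :=
    contDiff_lin (G i) (contDiff_pd i hQ)
  have h1 : (fun x => vec 𝕜 x * P x) = fun x => ∑ i, x i • G i (P x) :=
    funext fun x => vec_mul x (P x)
  rw [h1, fischer_sum_left (P := fun i x => x i • G i (P x)) _ _ fun i =>
    (contDiff_coord i).smul (contDiff_lin (G i) hP.smooth)]
  have h2 (i : Fin m) : fischer (k + 1) (fun x => x i • G i (P x)) Q =
      -((k + 1 : ℕ) * fischer k P fun x => G i (pd i Q x)) := by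
    rw [fischer_coord_smul i (hP.lin (G i)) hQ,
      fischer_lin_left k _ _ (hadj i) hP.smooth (contDiff_pd i hQ), ← fischer_conj_symm]
    have h3 : (fun x => (-G i) (pd i Q x)) = fun x => (-1 : 𝕜) • G i (pd i Q x) := by
      funext x; rw [LinearMap.neg_apply, neg_one_smul]
    rw [h3, fischer_smul_left k (-1) (hsm i), map_mul, fischer_conj_symm]
    simp
  simp only [h2, Finset.sum_neg_distrib, ← Finset.mul_sum]
  congr 2
  rw [← fischer_conj_symm, show dirac Q = fun x => ∑ i, G i (pd i Q x) from rfl,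
    fischer_sum_left _ _ hsm, map_sum]
  simp only [fischer_conj_symm]

variable (𝕜 m) in
/-- The Fischer inner product as the core of an inner product space. -/
abbrev fischerCore (k : ℕ) : InnerProductSpace.Core 𝕜 (homSpace 𝕜 m k) where
  inner P Q := fischer k P.1 Q.1
  conj_inner_symm _ _ := fischer_conj_symm k _ _
  re_inner_nonneg _ := fischer_re_nonneg k _
  add_left P Q _ := fischer_add_left k P.2.smooth Q.2.smooth _
  smul_left P _ c := fischer_smul_left k c P.2.smooth _
  definite P h := Subtype.ext (funext (IsHom.eq_zero_of_fischer P.2 h))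

/-- A subspace of the space of homogeneous polynomials has an orthogonal complement with respect to
the Fischer inner product. -/
lemma exists_add_fischer_orthogonal {k : ℕ} (W : Submodule 𝕜 (homSpace 𝕜 m k))
    (Q : homSpace 𝕜 m k) :
    ∃ y ∈ W, ∃ z : homSpace 𝕜 m k, (∀ w ∈ W, fischer k w.1 z.1 = 0) ∧ Q = y + z := by
  have := finiteDimensional_homSpace (𝕜 := 𝕜) (m := m) k
  let _ : NormedAddCommGroup (homSpace 𝕜 m k) :=
    @InnerProductSpace.Core.toNormedAddCommGroup 𝕜 _ _ _ _ (fischerCore 𝕜 m k)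
  let _ : InnerProductSpace 𝕜 (homSpace 𝕜 m k) :=
    InnerProductSpace.ofCore (fischerCore 𝕜 m k).toCore
  obtain ⟨y, hy, z, hz, h⟩ := W.exists_add_mem_mem_orthogonal Q
  exact ⟨y, hy, z, fun w hw => (Submodule.mem_orthogonal W z).1 hz w hw, h⟩

/-- The Fischer decomposition. -/
lemma IsHom.exists_fischer_decomposition {S : Set ℕ} {k : ℕ} {Q : Euc m → Cl 𝕜 m}
    (hQ : IsHom (k + 1) Q) (hS : ∀ x, Q x ∈ multivectorsOf 𝕜 m S) :
    ∃ R M : Euc m → Cl 𝕜 m, IsHom k R ∧ HomSolution S (k + 1) M ∧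
      ∀ x, Q x = gradeProj S (vec 𝕜 x * R x) + M x := by
  let T : homSpace 𝕜 m k →ₗ[𝕜] homSpace 𝕜 m (k + 1) :=
    { toFun := fun P => ⟨fun x => gradeProj S (vec 𝕜 x * P.1 x), (IsHom.vec_mul P.2).lin _⟩
      map_add' := fun P R => Subtype.ext (funext fun x => by
        change gradeProj S (vec 𝕜 x * (P.1 x + R.1 x)) = _
        rw [mul_add, map_add]; rfl)
      map_smul' := fun c P => Subtype.ext (funext fun x => by
        change gradeProj S (vec 𝕜 x * (c • P.1 x)) = _
        rw [mul_smul_comm, _root_.map_smul]; rfl) }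
  -- `M` is orthogonal to all `π_S(xR)`. As `M` has grades in `S`, the projection can be dropped,
  -- and testing with `R = ∂M` below gives `∂M = 0`.
  obtain ⟨_, ⟨R, rfl⟩, M, hM, h⟩ := exists_add_fischer_orthogonal (LinearMap.range T) ⟨Q, hQ⟩
  have hx (x : Euc m) : Q x = gradeProj S (vec 𝕜 x * R.1 x) + M.1 x :=
    congrFun (congrArg Subtype.val h) x
  have hMS (x : Euc m) : M.1 x ∈ multivectorsOf 𝕜 m S := by
    rw [← sub_eq_iff_eq_add'.2 (hx x)]
    exact Submodule.sub_mem _ (hS x) (gradeProj_mem S _)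
  refine ⟨R.1, M.1, R.2, ⟨M.2, hMS, ?_⟩, hx⟩
  have hd : IsHom k (dirac M.1) :=
    IsHom.dOp (fun i => LinearMap.mulLeft 𝕜 (gen 𝕜 i)) M.2
  refine hd.eq_zero_of_fischer ?_
  have h1 : fischer (k + 1) (fun x => gradeProj S (vec 𝕜 x * dirac M.1 x)) M.1 = 0 :=
    hM _ ⟨⟨_, hd⟩, rfl⟩
  rw [fischer_lin_left _ _ (gradeProj S) (inner_gradeProj_left S) hd.vec_mul.smooth M.2.smooth,
    show (fun x => gradeProj S (M.1 x)) = M.1 from funext fun x => gradeProj_of_mem (hMS x),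
    fischer_vec_mul hd M.2.smooth, neg_eq_zero] at h1
  exact (mul_eq_zero.1 h1).resolve_left (Nat.cast_ne_zero.2 k.succ_ne_zero)

/-! ### Moments of monogenic functions on the ball -/

lemma integrable_inner_of_continuous {f Q : Euc m → Cl 𝕜 m} (hQ : Continuous Q)
    (hf : Integrable f (ballMeasure m)) :
    Integrable (fun x => inner 𝕜 (Q x) (f x)) (ballMeasure m) := by
  obtain ⟨c, hc⟩ := (isCompact_closedBall (0 : Euc m) 1).exists_bound_of_continuousOn
    hQ.continuousOn
  refine (hf.norm.const_mul c).mono'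
    (hQ.aestronglyMeasurable.inner hf.aestronglyMeasurable) ?_
  filter_upwards [ae_ball] with x hx
  exact (norm_inner_le_norm _ _).trans
    (mul_le_mul_of_nonneg_right (hc x (Metric.ball_subset_closedBall hx)) (norm_nonneg _))

section Moments

variable {f : Euc m → Cl 𝕜 m}

/-- The weighted divergence theorem for the field with components `(e_iR, f)`. The derivatives of
`f` enter only through `∂f = 0`, so integrability of `f` is enough. -/
lemma IsMonogenicOn.integral_inner_dirac (hf : IsMonogenicOn f (Metric.ball 0 1))
    (hi : Integrable f (ballMeasure m)) {R : Euc m → Cl 𝕜 m} (hR : ContDiff ℝ ∞ R) :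
    ∫ x, (1 - ‖x‖ ^ 2) • inner 𝕜 (dirac R x) (f x) ∂ballMeasure m =
      (2 : ℝ) • ∫ x, inner 𝕜 (vec 𝕜 x * R x) (f x) ∂ballMeasure m := by
  let G (i : Fin m) : Cl 𝕜 m →ₗ[𝕜] Cl 𝕜 m := LinearMap.mulLeft 𝕜 (gen 𝕜 i)
  let V (i : Fin m) (x : Euc m) : 𝕜 := inner 𝕜 (G i (R x)) (f x)
  have hG (i : Fin m) : ContDiff ℝ ∞ fun x => G i (R x) := contDiff_lin (G i) hR
  have hdiv (x : Euc m) (hx : x ∈ Metric.ball (0 : Euc m) 1) :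
      ∑ i, pd i (V i) x = inner 𝕜 (dirac R x) (f x) := by
    have hfx : DifferentiableAt ℝ f x :=
      (hf.1.contDiffAt (Metric.isOpen_ball.mem_nhds hx)).differentiableAt one_ne_zero
    have h (i : Fin m) : pd i (V i) x =
        inner 𝕜 (gen 𝕜 i * pd i R x) (f x) - inner 𝕜 (R x) (gen 𝕜 i * pd i f x) := by
      rw [pd_inner i ((hG i).diffAt x) hfx, pd_lin i (G i) (hR.diffAt x), sub_eq_add_neg,
        ← inner_gen_mul_left]
      rfl
    simp only [h, Finset.sum_sub_distrib, ← sum_inner, ← inner_sum, ← dirac_eq, hf.2 x hx,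
      inner_zero_right, sub_zero]
  have hdiv' : (fun x => inner 𝕜 (dirac R x) (f x)) =ᵐ[ballMeasure m] fun x => ∑ i, pd i (V i) x := by
    filter_upwards [ae_ball] with x hx using (hdiv x hx).symm
  have hdR : Continuous (dirac R) :=
    (contDiff_dOp (fun i => LinearMap.mulLeft 𝕜 (gen 𝕜 i)) hR).continuous
  have key := integral_one_sub_smul_div (V := V)
    (fun i => ((innerBilin 𝕜 m).contDiff.comp_contDiffOn
      ((hG i).of_le (by simp)).contDiffOn).clm_apply hf.1)
    (fun i => integrable_inner_of_continuous (hG i).continuous hi)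
    ((integrable_inner_of_continuous hdR hi).congr hdiv')
  have h1 : ∫ x, (1 - ‖x‖ ^ 2) • inner 𝕜 (dirac R x) (f x) ∂ballMeasure m =
      ∫ x, (1 - ‖x‖ ^ 2) • ∑ i, pd i (V i) x ∂ballMeasure m :=
    by
    refine integral_congr_ae ?_
    filter_upwards [hdiv'] with x hx using congrArg _ hx
  rw [h1, key]
  congr 2
  funext x
  rw [vec_mul, sum_inner]
  exact Finset.sum_congr rfl fun i _ => by
    rw [inner_real_smul_left, RCLike.real_smul_eq_coe_mul]; rfl

variable (f) in
/-- The moment `∫_{B_m} |x|^{2i} [Q̄ f]₀`. -/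
def moment (i : ℕ) (Q : Euc m → Cl 𝕜 m) : 𝕜 :=
  ∫ x, inner 𝕜 ((‖x‖ ^ 2) ^ i • Q x) (f x) ∂ballMeasure m

lemma contDiff_normSq_pow_smul (i : ℕ) {Q : Euc m → Cl 𝕜 m} (hQ : ContDiff ℝ ∞ Q) :
    ContDiff ℝ ∞ fun x => (‖x‖ ^ 2) ^ i • Q x := (contDiff_normSq.pow i).smul hQ

lemma integrable_moment (hi : Integrable f (ballMeasure m)) (i : ℕ) {Q : Euc m → Cl 𝕜 m}
    (hQ : ContDiff ℝ ∞ Q) :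
    Integrable (fun x => inner 𝕜 ((‖x‖ ^ 2) ^ i • Q x) (f x)) (ballMeasure m) :=
  integrable_inner_of_continuous (contDiff_normSq_pow_smul i hQ).continuous hi

lemma moment_add (hi : Integrable f (ballMeasure m)) (i : ℕ) {P Q : Euc m → Cl 𝕜 m}
    (hP : ContDiff ℝ ∞ P) (hQ : ContDiff ℝ ∞ Q) :
    moment f i (fun x => P x + Q x) = moment f i P + moment f i Q := by
  simp only [moment, smul_add, inner_add_left]
  exact integral_add (integrable_moment hi i hP) (integrable_moment hi i hQ)

lemma moment_real_smul (i : ℕ) (c : ℝ) (Q : Euc m → Cl 𝕜 m) :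
    moment f i (fun x => c • Q x) = (c : 𝕜) * moment f i Q := by
  simp only [moment, smul_comm _ c, inner_real_smul_left, integral_const_mul]

lemma moment_normSq_smul (i : ℕ) (Q : Euc m → Cl 𝕜 m) :
    moment f i (fun x => ‖x‖ ^ 2 • Q x) = moment f (i + 1) Q := by
  simp only [moment, smul_smul, ← pow_succ]

lemma moment_gradeProj (i : ℕ) {S : Set ℕ}
    (hS : ∀ x ∈ Metric.ball (0 : Euc m) 1, f x ∈ multivectorsOf 𝕜 m S) (Q : Euc m → Cl 𝕜 m) :
    moment f i (fun x => gradeProj S (Q x)) = moment f i Q := by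
  refine integral_congr_ae ?_
  filter_upwards [ae_ball] with x hx
  rw [← LinearMap.map_smul_of_tower, inner_gradeProj_left, gradeProj_of_mem (hS x hx)]

lemma dirac_normSq_pow_smul (i : ℕ) {R : Euc m → Cl 𝕜 m} (hR : ContDiff ℝ ∞ R) (x : Euc m) :
    dirac (fun x => (‖x‖ ^ 2) ^ i • R x) x =
      (2 * i : ℝ) • ((‖x‖ ^ 2) ^ (i - 1) • (vec 𝕜 x * R x)) + (‖x‖ ^ 2) ^ i • dirac R x := by
  rw [dirac_eq_dOp, dOp_mul_smul _ ((contDiff_normSq.pow i).diffAt x) (hR.diffAt x)]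
  congr 1
  rw [vec_mul, Finset.smul_sum, Finset.smul_sum]
  refine Finset.sum_congr rfl fun j _ => ?_
  rw [pd_pow j i (contDiff_normSq.diffAt x), pd_normSq, smul_smul, smul_smul]
  congr 1
  ring

/-- `integral_inner_dirac` for `|x|^{2i}R`. For `i = 0` the truncated `i - 1` is harmless, since its
term carries the factor `i`. -/
lemma moment_recurrence (hf : IsMonogenicOn f (Metric.ball 0 1))
    (hi : Integrable f (ballMeasure m)) (i : ℕ) {R : Euc m → Cl 𝕜 m} (hR : ContDiff ℝ ∞ R) :
    2 * i * (moment f (i - 1) (fun x => vec 𝕜 x * R x) - moment f (i - 1 + 1) fun x => vec 𝕜 x * R x) +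
      (moment f i (dirac R) - moment f (i + 1) (dirac R)) =
      2 * moment f i fun x => vec 𝕜 x * R x := by
  have hx : ContDiff ℝ ∞ fun x => vec 𝕜 x * R x := by
    simp only [vec_mul]
    exact ContDiff.sum fun j _ => (contDiff_coord j).smul
      (contDiff_lin (LinearMap.mulLeft 𝕜 (gen 𝕜 j)) hR)
  have hd : ContDiff ℝ ∞ (dirac R) := contDiff_dOp (fun i => LinearMap.mulLeft 𝕜 (gen 𝕜 i)) hR
  have h := hf.integral_inner_dirac hi (contDiff_normSq_pow_smul i hR)
  have h1 : (fun x : Euc m => (1 - ‖x‖ ^ 2) •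
        inner 𝕜 (dirac (fun x => (‖x‖ ^ 2) ^ i • R x) x) (f x)) =
      fun x => (2 * i : 𝕜) * (inner 𝕜 ((‖x‖ ^ 2) ^ (i - 1) • (vec 𝕜 x * R x)) (f x) -
          inner 𝕜 ((‖x‖ ^ 2) ^ (i - 1 + 1) • (vec 𝕜 x * R x)) (f x)) +
        (inner 𝕜 ((‖x‖ ^ 2) ^ i • dirac R x) (f x) -
          inner 𝕜 ((‖x‖ ^ 2) ^ (i + 1) • dirac R x) (f x)) := by
    funext x
    rw [dirac_normSq_pow_smul i hR, inner_add_left]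
    simp only [inner_real_smul_left, RCLike.real_smul_eq_coe_mul]
    push_cast
    ring
  have e1 := integrable_moment hi (i - 1) hx
  have e2 := integrable_moment hi (i - 1 + 1) hx
  have e3 := integrable_moment hi i hd
  have e4 := integrable_moment hi (i + 1) hd
  have e12 : Integrable (fun x => inner 𝕜 ((‖x‖ ^ 2) ^ (i - 1) • (vec 𝕜 x * R x)) (f x) -
      inner 𝕜 ((‖x‖ ^ 2) ^ (i - 1 + 1) • (vec 𝕜 x * R x)) (f x)) (ballMeasure m) := e1.sub e2
  have e34 : Integrable (fun x => inner 𝕜 ((‖x‖ ^ 2) ^ i • dirac R x) (f x) -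
      inner 𝕜 ((‖x‖ ^ 2) ^ (i + 1) • dirac R x) (f x)) (ballMeasure m) := e3.sub e4
  rw [h1, integral_add (e12.const_mul _) e34, integral_const_mul,
    integral_sub e1 e2, integral_sub e3 e4] at h
  simp only [mul_smul_comm, RCLike.real_smul_eq_coe_mul] at h
  simpa only [moment, RCLike.ofReal_ofNat] using h

lemma dirac_vec_mul {k : ℕ} {M : Euc m → Cl 𝕜 m} (hM : IsHom k M) {x : Euc m}
    (h : dirac M x = 0) : dirac (fun x => vec 𝕜 x * M x) x = -((2 * k + m : ℝ) • M x) := by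
  let G (i : Fin m) : Cl 𝕜 m →ₗ[𝕜] Cl 𝕜 m := LinearMap.mulLeft 𝕜 (gen 𝕜 i)
  have h1 : (fun x => vec 𝕜 x * M x) = fun x => ∑ i, x i • G i (M x) :=
    funext fun x => vec_mul x (M x)
  have h2 (j : Fin m) : ∑ i, G i (G j (pd i M x)) = -((2 : ℝ) • pd j M x) := by
    have h3 (i : Fin m) : G i (G j (pd i M x)) =
        -(gen 𝕜 j * (gen 𝕜 i * pd i M x)) + if i = j then -((2 : ℝ) • pd j M x) else 0 := by
      change gen 𝕜 i * (gen 𝕜 j * pd i M x) = _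
      rw [← mul_assoc, ← mul_assoc]
      split_ifs with hij
      · subst hij
        rw [gen_mul_self, two_smul]
        simp
      · rw [gen_mul_gen_of_ne hij, neg_mul, add_zero]
    simp only [h3, Finset.sum_add_distrib, Finset.sum_neg_distrib, ← Finset.mul_sum, ← dirac_eq, h,
      mul_zero, neg_zero, zero_add, Finset.sum_ite_eq', Finset.mem_univ, if_true]
  have h4 (i : Fin m) : G i (G i (M x)) = -M x := by
    change gen 𝕜 i * (gen 𝕜 i * M x) = _
    rw [← mul_assoc, gen_mul_self, neg_one_mul]
  rw [h1, show dirac = dOp G from rfl, dOp_x_smul G G (hM.diffAt x)]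
  simp only [h2, h4, smul_neg, Finset.sum_neg_distrib, smul_comm _ (2 : ℝ), ← Finset.smul_sum,
    hM.euler]
  rw [Finset.sum_const, Finset.card_univ, Fintype.card_fin, ← Nat.cast_smul_eq_nsmul ℝ,
    ← neg_add, smul_smul, ← add_smul, add_comm]

variable {S : Set ℕ}

/-- The recurrence with `R = xM`: as `x²M = -|x|²M` and `∂(xM)` is a multiple of `M`, the moment of
order `i + 1` is a multiple of that of order `i`, and order zero is the hypothesis. -/
lemma HomSolution.moment_eq_zero (hf : IsMonogenicOn f (Metric.ball 0 1))
    (hi : Integrable f (ballMeasure m)) {k : ℕ} {M : Euc m → Cl 𝕜 m} (hM : HomSolution S k M)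
    (h0 : ip M f = 0) (i : ℕ) : moment f i M = 0 := by
  induction i with
  | zero => simpa [moment, ip] using h0
  | succ i ih =>
    have h := moment_recurrence hf hi i hM.hom.vec_mul.smooth
    have h1 (j : ℕ) : moment f j (fun x => vec 𝕜 x * (vec 𝕜 x * M x)) = -moment f (j + 1) M := by
      rw [← moment_normSq_smul]
      have := moment_real_smul (f := f) j (-1) fun x => ‖x‖ ^ 2 • M x
      simp only [neg_smul, one_smul, RCLike.ofReal_neg, RCLike.ofReal_one, neg_mul, one_mul] at this
      rw [← this]
      simp only [vec_mul_vec_mul]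
    have h2 (j : ℕ) : moment f j (dirac fun x => vec 𝕜 x * M x) =
        -((2 * k + m) * moment f j M) := by
      rw [show dirac (fun x => vec 𝕜 x * M x) = fun x => (-(2 * k + m) : ℝ) • M x from
        funext fun x => by rw [dirac_vec_mul hM.hom (hM.dirac_eq x), neg_smul], moment_real_smul]
      push_cast
      ring
    simp only [h1, h2, ih] at h
    have h3 : (2 * (i : 𝕜) + 2 * k + m + 2) * moment f (i + 1) M = 0 := by
      rcases i with _ | i
      · simp only [Nat.cast_zero, mul_zero, zero_mul] at h ⊢
        linear_combination h
      · simp only [Nat.add_sub_cancel, ih] at h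
        linear_combination h
    refine (mul_eq_zero.1 h3).resolve_left ?_
    have : ((2 * i + 2 * k + m + 2 : ℕ) : 𝕜) ≠ 0 := Nat.cast_ne_zero.2 (by omega)
    push_cast at this
    exact this

/-- A square-integrable solution that is orthogonal to all polynomial solutions is orthogonal to all
polynomials. -/
theorem IsHom.moment_eq_zero (hf : IsMonogenicOn f (Metric.ball 0 1))
    (hi : Integrable f (ballMeasure m))
    (hS : ∀ x ∈ Metric.ball (0 : Euc m) 1, f x ∈ multivectorsOf 𝕜 m S)
    (horth : ∀ k P, HomSolution S k P → ip P f = 0) {k : ℕ} {Q : Euc m → Cl 𝕜 m} (hQ : IsHom k Q)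
    (i : ℕ) : moment f i Q = 0 := by
  induction k using Nat.strong_induction_on generalizing Q i with
  | _ k ih =>
    -- `f` has grades in `S`, so `Q` may be replaced by its projection, to which the Fischer
    -- decomposition applies.
    rw [← moment_gradeProj i hS]
    have hQS : IsHom k fun x => gradeProj S (Q x) := hQ.lin _
    rcases k with _ | k
    · have hM : HomSolution S 0 fun x => gradeProj S (Q x) :=
        ⟨hQS, fun x => gradeProj_mem S _, fun x => by
          rw [dirac_eq]
          simp only [hQS.pd_of_zero, mul_zero, Finset.sum_const_zero]⟩
      exact hM.moment_eq_zero hf hi (horth _ _ hM) i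
    · obtain ⟨R, M, hR, hM, hdec⟩ := hQS.exists_fischer_decomposition fun x => gradeProj_mem S _
      rw [show (fun x => gradeProj S (Q x)) = fun x => gradeProj S (vec 𝕜 x * R x) + M x from
          funext hdec,
        moment_add hi i (hR.vec_mul.lin _).smooth hM.hom.smooth, hM.moment_eq_zero hf hi (horth _ _ hM),
        add_zero, moment_gradeProj i hS]
      -- The degree of `∂R` is two less than that of `Q`, so strong induction applies; for constant
      -- `R` it is zero.
      have hd (j : ℕ) : moment f j (dirac R) = 0 := by
        rcases k with _ | k
        · have : dirac R = fun _ => (0 : ℝ) • (0 : Cl 𝕜 m) := by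
            funext x
            rw [dirac_eq]
            simp only [hR.pd_of_zero, mul_zero, Finset.sum_const_zero, smul_zero]
          rw [this, moment_real_smul]
          simp
        · exact ih k (by omega) (IsHom.dOp (fun i => LinearMap.mulLeft 𝕜 (gen 𝕜 i)) hR) j
      -- With the moments of `∂R` gone, the recurrence determines those of `xR` one after another,
      -- starting from zero.
      induction i with
      | zero =>
        have h := moment_recurrence hf hi 0 hR.smooth
        simp only [hd] at h
        simpa using h.symm
      | succ i ihi =>
        have h := moment_recurrence hf hi (i + 1) hR.smooth
        simp only [hd, Nat.add_sub_cancel, ihi] at h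
        have h3 : ((i + 1 + 1 : ℕ) : 𝕜) * moment f (i + 1) (fun x => vec 𝕜 x * R x) = 0 := by
          push_cast at h ⊢
          linear_combination (-1 / 2) * h
        exact (mul_eq_zero.1 h3).resolve_left (Nat.cast_ne_zero.2 (by omega))

end Moments

/-! ### Completeness of the polynomials -/

/-- The restrictions of polynomials to the closed unit ball. -/
def polySubalgebra (m : ℕ) : Subalgebra ℝ C(Metric.closedBall (0 : Euc m) 1, ℝ) :=
  (Submodule.span ℝ {g | ∃ (k : ℕ) (p : Euc m → ℝ), IsHom k p ∧ ∀ x, g x = p x.1}).toSubalgebra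
    (Submodule.subset_span ⟨0, fun _ => 1, IsHom.const 1, fun _ => rfl⟩) (by
      intro g h hg hh
      induction hg, hh using Submodule.span_induction₂ with
      | mem_mem g h hg hh =>
        obtain ⟨j, p, hp, hgp⟩ := hg
        obtain ⟨k, q, hq, hhq⟩ := hh
        exact Submodule.subset_span ⟨j + k, _, hp.smul hq, fun x => by
          rw [ContinuousMap.mul_apply, hgp, hhq, smul_eq_mul]⟩
      | zero_left => rw [zero_mul]; exact Submodule.zero_mem _
      | zero_right => rw [mul_zero]; exact Submodule.zero_mem _
      | add_left _ _ _ _ _ _ h1 h2 => rw [add_mul]; exact Submodule.add_mem _ h1 h2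
      | add_right _ _ _ _ _ _ h1 h2 => rw [mul_add]; exact Submodule.add_mem _ h1 h2
      | smul_left _ _ _ _ _ h => rw [smul_mul_assoc]; exact Submodule.smul_mem _ _ h
      | smul_right _ _ _ _ _ h => rw [mul_smul_comm]; exact Submodule.smul_mem _ _ h)

lemma polySubalgebra_separatesPoints (m : ℕ) : (polySubalgebra m).SeparatesPoints := by
  intro x y hxy
  have : ∃ i, x.1 i ≠ y.1 i := by
    by_contra! h
    exact hxy (Subtype.ext (PiLp.ext h))
  obtain ⟨i, hi⟩ := this
  exact ⟨_, ⟨⟨fun x => x.1 i, by fun_prop⟩, Submodule.subset_span ⟨1, _, IsHom.coord i, fun _ => rfl⟩,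
    rfl⟩, hi⟩

/-- An integrable function on the ball that is orthogonal to all homogeneous polynomials vanishes. -/
theorem ae_eq_zero_of_integral_isHom {E : Type*} [NormedAddCommGroup E] [NormedSpace ℝ E]
    [CompleteSpace E] {f : Euc m → E} (hf : Integrable f (ballMeasure m))
    (h : ∀ (k : ℕ) (p : Euc m → ℝ), IsHom k p → ∫ x, p x • f x ∂ballMeasure m = 0) :
    ∀ᵐ x ∂ballMeasure m, f x = 0 := by
  refine ae_eq_zero_of_integral_contDiff_smul_eq_zero hf.locallyIntegrable fun g hg _ => ?_
  -- Elements of the subalgebra live on the closed ball only; a representative on the whole space is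
  -- carried along so that it can be integrated against `f`.
  have hpoly (q : C(Metric.closedBall (0 : Euc m) 1, ℝ)) (hq : q ∈ polySubalgebra m) :
      ∃ p : Euc m → ℝ, Continuous p ∧ (∀ x, p x.1 = q x) ∧ ∫ x, p x • f x ∂ballMeasure m = 0 := by
    change q ∈ Submodule.span ℝ _ at hq
    induction hq using Submodule.span_induction with
    | mem q hq =>
      obtain ⟨k, p, hp, hqp⟩ := hq
      exact ⟨p, hp.smooth.continuous, fun x => (hqp x).symm, h k p hp⟩
    | zero => exact ⟨fun _ => 0, continuous_const, fun _ => rfl, by simp⟩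
    | add q q' _ _ h1 h2 =>
      obtain ⟨p, hp, hpq, hp0⟩ := h1
      obtain ⟨p', hp', hpq', hp0'⟩ := h2
      refine ⟨fun x => p x + p' x, hp.add hp', fun x => by
        simp only [hpq, hpq']; rfl, ?_⟩
      simp only [add_smul]
      rw [integral_add (integrable_smul_of_continuous hp hf) (integrable_smul_of_continuous hp' hf),
        hp0, hp0', add_zero]
    | smul c q _ h1 =>
      obtain ⟨p, hp, hpq, hp0⟩ := h1
      refine ⟨fun x => c * p x, hp.const_mul c, fun x => by simp only [hpq]; rfl, ?_⟩
      simp only [mul_smul]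
      rw [integral_smul, hp0, smul_zero]
  rw [← norm_le_zero_iff]
  -- Stone–Weierstrass: a polynomial `ε`-close to the test function on the closed ball integrates to
  -- zero against `f`.
  have key (ε : ℝ) (hε : 0 < ε) :
      ‖∫ x, g x • f x ∂ballMeasure m‖ ≤ ε * ∫ x, ‖f x‖ ∂ballMeasure m := by
    obtain ⟨⟨q, hq⟩, hqg⟩ := ContinuousMap.exists_mem_subalgebra_near_continuous_of_separatesPoints
      (polySubalgebra m) (polySubalgebra_separatesPoints m) (fun x => g x.1)
      (hg.continuous.comp continuous_subtype_val) ε hε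
    obtain ⟨p, hp, hpq, hp0⟩ := hpoly q hq
    have h1 : ∫ x, g x • f x ∂ballMeasure m = ∫ x, (g x - p x) • f x ∂ballMeasure m := by
      simp only [sub_smul]
      rw [integral_sub (integrable_smul_of_continuous hg.continuous hf)
        (integrable_smul_of_continuous hp hf), hp0, sub_zero]
    rw [h1, ← integral_const_mul]
    refine norm_integral_le_of_norm_le (hf.norm.const_mul ε) ?_
    filter_upwards [ae_ball] with x hx
    rw [norm_smul]
    refine mul_le_mul_of_nonneg_right ?_ (norm_nonneg _)
    have := (hqg ⟨x, Metric.ball_subset_closedBall hx⟩).le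
    rw [← norm_neg, neg_sub]
    rwa [← hpq] at this
  have hlim : Filter.Tendsto (fun ε : ℝ => ε * ∫ x, ‖f x‖ ∂ballMeasure m) (nhdsWithin 0 (Set.Ioi 0))
      (nhds 0) := by
    have : Filter.Tendsto (fun ε : ℝ => ε * ∫ x, ‖f x‖ ∂ballMeasure m) (nhds 0)
        (nhds (0 * ∫ x, ‖f x‖ ∂ballMeasure m)) := (continuous_id.mul continuous_const).tendsto 0
    rw [zero_mul] at this
    exact this.mono_left nhdsWithin_le_nhds
  exact ge_of_tendsto hlim (eventually_nhdsWithin_of_forall fun ε hε => key ε hε)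

/-- A square-integrable solution that is orthogonal to all polynomial solutions vanishes. -/
theorem IsMonogenicOn.ae_eq_zero {S : Set ℕ} {f : Euc m → Cl 𝕜 m}
    (hf : IsMonogenicOn f (Metric.ball 0 1)) (hi : Integrable f (ballMeasure m))
    (hS : ∀ x ∈ Metric.ball (0 : Euc m) 1, f x ∈ multivectorsOf 𝕜 m S)
    (horth : ∀ k P, HomSolution S k P → ip P f = 0) : ∀ᵐ x ∂ballMeasure m, f x = 0 := by
  refine ae_eq_zero_of_integral_isHom hi fun k p hp => ?_
  have hpf := integrable_smul_of_continuous hp.smooth.continuous hi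
  refine ext_inner_left 𝕜 fun a => ?_
  rw [inner_zero_right, ← integral_inner hpf]
  -- The scalar polynomial `p` is tested in each direction `a` through the polynomial `p a`.
  have h := (hp.smul (IsHom.const a)).moment_eq_zero hf hi hS horth 0
  rw [moment] at h
  rw [← h]
  refine integral_congr_ae (Filter.Eventually.of_forall fun x => ?_)
  simp only [pow_zero, one_smul, inner_real_smul_left, inner_real_smul_right]

/-! ### The mean value property -/

section MeanValue

variable {E : Type*} [NormedAddCommGroup E] [NormedSpace ℝ E]

lemma contDiff_comp_add_smul {h : Euc m → E} (hh : ContDiff ℝ ∞ h) (y : Euc m) (t : ℝ) :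
    ContDiff ℝ ∞ fun x => h (y + t • x) := hh.comp (by fun_prop)

lemma pd_comp_add_smul (i : Fin m) {h : Euc m → E} (hh : ContDiff ℝ ∞ h) (y : Euc m) (t : ℝ)
    (x : Euc m) : pd i (fun x => h (y + t • x)) x = t • pd i h (y + t • x) := by
  have h1 : HasFDerivAt (fun x : Euc m => y + t • x) (t • ContinuousLinearMap.id ℝ (Euc m)) x :=
    ((hasFDerivAt_id x).const_smul t).const_add y
  have h2 := (hh.diffAt (y + t • x)).hasFDerivAt.comp x h1
  rw [pd, show (fun x => h (y + t • x)) = h ∘ fun x => y + t • x from rfl, h2.fderiv]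
  simp [pd]

lemma norm_integral_smul_le {h : Euc m → E} {g : Euc m → ℝ} (hg : ∀ x, ‖x‖ < 1 → |g x| ≤ 1)
    (hh : Continuous h) :
    ‖∫ x, g x • h x ∂ballMeasure m‖ ≤ ∫ x, ‖h x‖ ∂ballMeasure m := by
  refine norm_integral_le_of_norm_le (integrable_of_continuous hh).norm ?_
  filter_upwards [ae_ball] with x hx
  rw [norm_smul]
  exact mul_le_of_le_one_left (norm_nonneg _) (hg x (by simpa using hx))

variable [CompleteSpace E] {h : Euc m → E}

/-- For the field `(1 - |x|²)∇h(t x)` harmonicity leaves the divergence `-2 x·∇h`, so the weighted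
divergence theorem equates the integral, times `-2`, with itself times `2`. -/
lemma integral_one_sub_smul_radial (hh : ContDiff ℝ ∞ h)
    (hΔ : ∀ x, ∑ i, pd i (pd i h) x = 0) (t : ℝ) :
    ∫ x, (1 - ‖x‖ ^ 2) • ∑ i, x i • pd i h (t • x) ∂ballMeasure m = 0 := by
  have hw : ContDiff ℝ ∞ fun x : Euc m => 1 - ‖x‖ ^ 2 := contDiff_const.sub contDiff_normSq
  have hg (i : Fin m) : ContDiff ℝ ∞ fun x => pd i h (t • x) := by
    simpa using contDiff_comp_add_smul (contDiff_pd i hh) 0 t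
  have hV (i : Fin m) : ContDiff ℝ ∞ fun x => (1 - ‖x‖ ^ 2) • pd i h (t • x) := hw.smul (hg i)
  have hdiv (x : Euc m) : ∑ i, pd i (fun x => (1 - ‖x‖ ^ 2) • pd i h (t • x)) x =
      (-2 : ℝ) • ∑ i, x i • pd i h (t • x) := by
    have h1 (i : Fin m) : pd i (fun x => (1 - ‖x‖ ^ 2) • pd i h (t • x)) x =
        (-2 : ℝ) • (x i • pd i h (t • x)) + ((1 - ‖x‖ ^ 2) * t) • pd i (pd i h) (t • x) := by
      have h2 := pd_comp_add_smul i (contDiff_pd i hh) 0 t x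
      simp only [zero_add] at h2
      rw [pd_smul i (hw.diffAt x) ((hg i).diffAt x), h2, smul_smul, smul_smul,
        pd_sub i (differentiableAt_const _) (contDiff_normSq.diffAt x), pd_const, pd_normSq]
      congr 2
      ring
    simp only [h1, Finset.sum_add_distrib, ← Finset.smul_sum, hΔ, smul_zero, add_zero]
  have hc : Continuous fun x : Euc m => ∑ i, x i • pd i h (t • x) :=
    continuous_finsetSum _ fun i _ => (contDiff_coord i).continuous.smul (hg i).continuous
  have key := integral_one_sub_smul_div (V := fun i x => (1 - ‖x‖ ^ 2) • pd i h (t • x))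
    (fun i => ((hV i).of_le (by simp)).contDiffOn)
    (fun i => integrable_of_continuous (hV i).continuous)
    (integrable_of_continuous (by simp only [hdiv]; exact hc.const_smul _))
  simp only [hdiv, smul_comm _ (-2 : ℝ)] at key
  rw [integral_smul] at key
  have h3 : ∫ x, ∑ i, x i • (1 - ‖x‖ ^ 2) • pd i h (t • x) ∂ballMeasure m =
      ∫ x, (1 - ‖x‖ ^ 2) • ∑ i, x i • pd i h (t • x) ∂ballMeasure m := by
    simp only [Finset.smul_sum, smul_comm (1 - ‖_‖ ^ 2)]
  rw [h3] at key
  have h4 : (4 : ℝ) • ∫ x, (1 - ‖x‖ ^ 2) • ∑ i, x i • pd i h (t • x) ∂ballMeasure m = 0 := by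
    rw [show (4 : ℝ) = 2 - -2 by norm_num, sub_smul, key, sub_self]
  exact (smul_eq_zero.1 h4).resolve_left (by norm_num)

/-- The mean value property of harmonic functions, with the weight `1 - |x|²`. -/
theorem integral_one_sub_smul_eq (hh : ContDiff ℝ ∞ h) (hΔ : ∀ x, ∑ i, pd i (pd i h) x = 0) :
    ∫ x, (1 - ‖x‖ ^ 2) • h x ∂ballMeasure m =
      (∫ x, (1 - ‖x‖ ^ 2) ∂ballMeasure m : ℝ) • h 0 := by
  -- The weighted average of the dilated function has zero derivative in `t`; `t = 1` and `t = 0`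
  -- are compared.
  let F (t : ℝ) (x : Euc m) : E := (1 - ‖x‖ ^ 2) • h (t • x)
  let F' (t : ℝ) (x : Euc m) : E := (1 - ‖x‖ ^ 2) • ∑ i, x i • pd i h (t • x)
  have hF : Continuous fun q : ℝ × Euc m => F q.1 q.2 := by
    have := hh.continuous
    fun_prop
  have hF' : Continuous fun q : ℝ × Euc m => F' q.1 q.2 := by
    have := fun i => (contDiff_pd i hh).continuous
    fun_prop
  have hder (t : ℝ) : HasDerivAt (fun t => ∫ x, F t x ∂ballMeasure m) 0 t := by
    obtain ⟨c, hc⟩ := ((isCompact_closedBall t 1).prod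
      (isCompact_closedBall (0 : Euc m) 1)).exists_bound_of_continuousOn hF'.continuousOn
    have hFt (t : ℝ) : Continuous (F t) := hF.comp (f := fun x => (t, x)) (by fun_prop)
    have hFt' : Continuous (F' t) := hF'.comp (f := fun x => (t, x)) (by fun_prop)
    have hi (t : ℝ) : Integrable (F t) (ballMeasure m) := integrable_of_continuous (hFt t)
    have h1 := hasDerivAt_integral_of_dominated_loc_of_deriv_le (μ := ballMeasure m) (F := F)
      (F' := F') (x₀ := t) (bound := fun _ => c) (Metric.closedBall_mem_nhds t one_pos)
      (Filter.Eventually.of_forall fun t => (hi t).aestronglyMeasurable) (hi t)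
      hFt'.aestronglyMeasurable ?_ (integrable_const c) ?_
    · have h2 := h1.2
      rwa [integral_one_sub_smul_radial hh hΔ t] at h2
    · filter_upwards [ae_ball] with x hx s hs
      exact hc (s, x) ⟨hs, Metric.ball_subset_closedBall hx⟩
    · filter_upwards with x s _
      have h2 : HasDerivAt (fun s : ℝ => s • x) x s := by
        simpa using (hasDerivAt_id s).smul_const x
      have h3 := ((hh.diffAt (s • x)).hasFDerivAt.comp_hasDerivAt s h2).const_smul (1 - ‖x‖ ^ 2)
      rw [← sum_coord_smul_pd] at h3
      exact h3
  have hconst := is_const_of_deriv_eq_zero (fun t => (hder t).differentiableAt)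
    (fun t => (hder t).deriv) 1 0
  simp only [F, one_smul, zero_smul] at hconst
  rw [hconst, integral_smul_const]

lemma integral_one_sub_pos (m : ℕ) : 0 < ∫ x : Euc m, (1 - ‖x‖ ^ 2) ∂ballMeasure m := by
  have h := (IsHom.const (m := m) (1 : ℝ)).integral_one_sub
  simp only [smul_eq_mul, mul_one, integral_const, Nat.cast_zero, zero_add] at h
  have hv : 0 < (ballMeasure m).real Set.univ := by
    rw [Measure.real, ballMeasure, Measure.restrict_apply_univ]
    exact ENNReal.toReal_pos (Metric.measure_ball_pos _ _ one_pos).ne' measure_ball_lt_top.ne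
  have : (0 : ℝ) < m + 2 := by positivity
  nlinarith

lemma norm_zero_le (hh : ContDiff ℝ ∞ h) (hΔ : ∀ x, ∑ i, pd i (pd i h) x = 0) :
    (∫ x : Euc m, (1 - ‖x‖ ^ 2) ∂ballMeasure m) * ‖h 0‖ ≤ ∫ x, ‖h x‖ ∂ballMeasure m := by
  have h1 := norm_integral_smul_le (g := fun x => 1 - ‖x‖ ^ 2) (fun x hx => by
    rw [abs_le]; constructor <;> nlinarith [norm_nonneg x]) hh.continuous
  rwa [integral_one_sub_smul_eq hh hΔ, norm_smul, Real.norm_eq_abs,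
    abs_of_pos (integral_one_sub_pos m)] at h1

/-- The mean value property applies to `∂_i h`, and the weight `1 - |x|²` allows the derivative to
be moved off, leaving `2∫ x_i h`. -/
lemma norm_pd_zero_le (hh : ContDiff ℝ ∞ h) (hΔ : ∀ x, ∑ i, pd i (pd i h) x = 0) (i : Fin m) :
    (∫ x : Euc m, (1 - ‖x‖ ^ 2) ∂ballMeasure m) * ‖pd i h 0‖ ≤
      2 * ∫ x, ‖h x‖ ∂ballMeasure m := by
  have hΔ' (x : Euc m) : ∑ j, pd j (pd j (pd i h)) x = 0 := by
    have h1 : (fun x => ∑ j, pd j (pd j h) x) = fun _ => 0 := funext hΔ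
    have h2 : pd i (fun x => ∑ j, pd j (pd j h) x) x = 0 := by rw [h1, pd_const]
    rw [pd_sum i _ fun j _ => (contDiff_pd j (contDiff_pd j hh)).diffAt x] at h2
    rw [← h2]
    refine Finset.sum_congr rfl fun j _ => ?_
    rw [pd_comm i j (contDiff_pd j hh)]
    exact pd_congr (fun x => pd_comm j i hh x) j x
  have h1 := norm_integral_smul_le (g := fun x => x i) (fun x hx => by
    have := PiLp.norm_apply_le x i
    rw [Real.norm_eq_abs] at this
    linarith) hh.continuous
  have h2 := integral_one_sub_smul_pd i hh
  rw [integral_one_sub_smul_eq (contDiff_pd i hh) hΔ'] at h2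
  have h3 := congrArg norm h2
  rw [norm_smul, Real.norm_eq_abs, abs_of_pos (integral_one_sub_pos m), norm_smul,
    Real.norm_eq_abs, abs_two] at h3
  rw [h3]
  linarith

end MeanValue

/-- Symmetrizing the double sum `∂² p` by the Clifford relations gives minus the Laplacian. -/
lemma sum_pd_pd_eq_zero {p : Euc m → Cl 𝕜 m} (hp : ContDiff ℝ ∞ p) (hd : ∀ x, dirac p x = 0)
    (x : Euc m) : ∑ i, pd i (pd i p) x = 0 := by
  let G (i : Fin m) : Cl 𝕜 m →ₗ[𝕜] Cl 𝕜 m := LinearMap.mulLeft 𝕜 (gen 𝕜 i)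
  have h0 : ∑ i, ∑ j, gen 𝕜 i * (gen 𝕜 j * pd j (pd i p) x) = 0 := by
    have h1 (i : Fin m) : ∑ j, gen 𝕜 j * pd j (pd i p) x = 0 := by
      have h2 := pd_dOp G i hp x
      rw [show dOp G p = fun _ => 0 from funext hd, pd_const] at h2
      exact h2.symm
    simp only [← Finset.mul_sum, h1, mul_zero, Finset.sum_const_zero]
  have h1 : ∑ i, ∑ j, (gen 𝕜 i * gen 𝕜 j + gen 𝕜 j * gen 𝕜 i) * pd j (pd i p) x = 0 := by
    simp only [add_mul, Finset.sum_add_distrib, mul_assoc, h0, zero_add]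
    rw [Finset.sum_comm, ← h0]
    simp only [pd_comm _ _ hp x]
  have h2 (i j : Fin m) : (gen 𝕜 i * gen 𝕜 j + gen 𝕜 j * gen 𝕜 i) * pd j (pd i p) x =
      if i = j then (-2 : 𝕜) • pd i (pd i p) x else 0 := by
    split_ifs with h
    · subst h
      rw [gen_mul_self, add_mul, neg_one_mul, ← two_smul 𝕜, smul_neg, neg_smul]
    · rw [gen_mul_gen_of_ne h, neg_add_cancel, zero_mul]
  simp only [h2, Finset.sum_ite_eq, Finset.mem_univ, if_true, ← Finset.smul_sum] at h1
  exact (smul_eq_zero.1 h1).resolve_left (by norm_num)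

/-! ### Interior estimates -/

-- The affine change of variables maps the unit ball onto the ball of radius `ρ` about `y`, which
-- lies in the unit ball.
open scoped Pointwise in
lemma integral_norm_comp_add_smul_le {E : Type*} [NormedAddCommGroup E] {p : Euc m → E}
    (hp : Continuous p) {y : Euc m} {ρ : ℝ} (hρ : 0 < ρ) (hy : ‖y‖ + ρ ≤ 1) :
    ∫ x, ‖p (y + ρ • x)‖ ∂ballMeasure m ≤ (ρ ^ m)⁻¹ * ∫ x, ‖p x‖ ∂ballMeasure m := by
  have h1 := Measure.setIntegral_comp_smul_of_pos (volume : Measure (Euc m))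
    (fun x => ‖p (y + x)‖) (Metric.ball 0 1) hρ
  have h2 : ρ • Metric.ball (0 : Euc m) 1 = (fun x => y + x) ⁻¹' Metric.ball y ρ := by
    rw [smul_unitBall_of_pos hρ]
    ext x
    simp
  have h3 := (measurePreserving_add_left (volume : Measure (Euc m)) y).setIntegral_preimage_emb
    (measurableEmbedding_addLeft y) (fun x => ‖p x‖) (Metric.ball y ρ)
  rw [ballMeasure, h1, h2, h3, finrank_euclideanSpace, Fintype.card_fin, smul_eq_mul]
  refine mul_le_mul_of_nonneg_left ?_ (by positivity)
  refine setIntegral_mono_set (integrable_of_continuous hp).norm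
    (Filter.Eventually.of_forall fun x => norm_nonneg _) (LE.le.eventuallyLE ?_)
  refine Metric.ball_subset_ball' ?_
  rw [dist_zero_right]
  linarith

lemma integral_norm_le_norm_toLp {p : Euc m → Cl 𝕜 m} (hp : MemLp p 2 (ballMeasure m)) :
    ∫ x, ‖p x‖ ∂ballMeasure m ≤
      (ballMeasure m Set.univ ^ (1 / 2 : ℝ)).toReal * ‖hp.toLp p‖ := by
  have h := eLpNorm_le_eLpNorm_mul_rpow_measure_univ (p := 1) (q := 2) one_le_two
    hp.aestronglyMeasurable
  have hfin : ballMeasure m Set.univ ^ (1 / 2 : ℝ) ≠ ⊤ :=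
    ENNReal.rpow_ne_top_of_nonneg (by norm_num) (measure_ne_top _ _)
  rw [show (1 / (1 : ENNReal).toReal - 1 / (2 : ENNReal).toReal) = (1 / 2 : ℝ) by norm_num] at h
  rw [Lp.norm_toLp, mul_comm, ← ENNReal.toReal_mul,
    integral_norm_eq_lintegral_enorm hp.aestronglyMeasurable, ← eLpNorm_one_eq_lintegral_enorm]
  exact ENNReal.toReal_mono (ENNReal.mul_ne_top hp.eLpNorm_ne_top hfin) h

lemma norm_fderiv_le_sum {E : Type*} [NormedAddCommGroup E] [NormedSpace ℝ E] (p : Euc m → E)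
    (y : Euc m) : ‖fderiv ℝ p y‖ ≤ ∑ i, ‖pd i p y‖ := by
  refine ContinuousLinearMap.opNorm_le_bound _ (Finset.sum_nonneg fun i _ => norm_nonneg _) fun v => ?_
  rw [← sum_coord_smul_pd, Finset.sum_mul]
  refine (norm_sum_le _ _).trans (Finset.sum_le_sum fun i _ => ?_)
  rw [norm_smul, mul_comm]
  exact mul_le_mul_of_nonneg_left (PiLp.norm_apply_le v i) (norm_nonneg _)

/-- Interior estimates for monogenic functions in terms of their norm in `L²(B_m)`. -/
theorem exists_interior_estimate (𝕜 : Type) [RCLike 𝕜] (m : ℕ) {ρ : ℝ} (hρ : 0 < ρ) :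
    ∃ C : ℝ, ∀ (p : Euc m → Cl 𝕜 m) (_ : ContDiff ℝ ∞ p) (_ : ∀ x, dirac p x = 0)
      (hp : MemLp p 2 (ballMeasure m)) (y : Euc m), ‖y‖ + ρ ≤ 1 →
        ‖p y‖ ≤ C * ‖hp.toLp p‖ ∧ ‖fderiv ℝ p y‖ ≤ C * ‖hp.toLp p‖ := by
  set w : ℝ := ∫ x : Euc m, (1 - ‖x‖ ^ 2) ∂ballMeasure m with hw
  have hw0 : 0 < w := integral_one_sub_pos m
  set K : ℝ := (ρ ^ m)⁻¹ * (ballMeasure m Set.univ ^ (1 / 2 : ℝ)).toReal with hK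
  have hK0 : 0 ≤ K := by positivity
  -- `w` is the mass of the weight, `K` collects the rescaling to radius `ρ` and Cauchy–Schwarz, `2`
  -- comes from `norm_pd_zero_le` and `ρ⁻¹` from the chain rule.
  refine ⟨max (w⁻¹ * K) (∑ _i : Fin m, ρ⁻¹ * (w⁻¹ * (2 * K))), fun p hps hpd hp y hy => ?_⟩
  have hh := contDiff_comp_add_smul hps y ρ
  have hd (x : Euc m) : dirac (fun x => p (y + ρ • x)) x = 0 := by
    simp only [dirac_eq, pd_comp_add_smul _ hps, mul_smul_comm, ← Finset.smul_sum]
    rw [← dirac_eq, hpd, smul_zero]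
  have hΔ := sum_pd_pd_eq_zero hh hd
  have hI : ∫ x, ‖p (y + ρ • x)‖ ∂ballMeasure m ≤ K * ‖hp.toLp p‖ := by
    rw [hK, mul_assoc]
    exact (integral_norm_comp_add_smul_le hps.continuous hρ hy).trans
      (mul_le_mul_of_nonneg_left (integral_norm_le_norm_toLp hp) (by positivity))
  have hN := norm_nonneg (hp.toLp p)
  constructor
  · have h1 := norm_zero_le hh hΔ
    simp only [smul_zero, add_zero, ← hw] at h1
    refine le_trans ?_ (mul_le_mul_of_nonneg_right (le_max_left _ _) hN)
    rw [mul_assoc, ← div_eq_inv_mul, le_div_iff₀' hw0]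
    exact h1.trans hI
  · refine le_trans ?_ (mul_le_mul_of_nonneg_right (le_max_right _ _) hN)
    rw [Finset.sum_mul]
    refine (norm_fderiv_le_sum p y).trans (Finset.sum_le_sum fun i _ => ?_)
    have h1 := norm_pd_zero_le hh hΔ i
    rw [pd_comp_add_smul i hps] at h1
    simp only [smul_zero, add_zero, ← hw, norm_smul, Real.norm_eq_abs, abs_of_pos hρ] at h1
    rw [mul_assoc, ← div_eq_inv_mul, le_div_iff₀' hρ, mul_assoc, ← div_eq_inv_mul,
      le_div_iff₀' hw0]
    linarith

/-! ### Limits of monogenic functions -/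

/-- Interior bounds by a Cauchy sequence make `g` uniformly Cauchy on each smaller concentric ball.
It is used once for the fields and once for their derivatives. -/
lemma exists_locallyUniform_limit {F : Type*} [NormedAddCommGroup F] [CompleteSpace F]
    {α : Type*} [NormedAddCommGroup α] {g : ℕ → Euc m → F} {u : ℕ → α} (hu : CauchySeq u)
    (hg : ∀ ρ : ℝ, 0 < ρ → ∃ C : ℝ, ∀ i j (y : Euc m), ‖y‖ + ρ ≤ 1 →
      ‖g i y - g j y‖ ≤ C * ‖u i - u j‖) :
    ∃ f : Euc m → F, (∀ y ∈ Metric.ball (0 : Euc m) 1,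
        Filter.Tendsto (fun i => g i y) Filter.atTop (nhds (f y))) ∧
      TendstoLocallyUniformlyOn g f Filter.atTop (Metric.ball 0 1) := by
  have hunif (ρ : ℝ) (hρ : 0 < ρ) :
      UniformCauchySeqOn g Filter.atTop {y : Euc m | ‖y‖ + ρ ≤ 1} := by
    obtain ⟨C, hC⟩ := hg ρ hρ
    rw [Metric.uniformCauchySeqOn_iff]
    intro ε hε
    obtain ⟨N, hN⟩ := Metric.cauchySeq_iff.1 hu (ε / (|C| + 1)) (by positivity)
    refine ⟨N, fun i hi j hj y hy => ?_⟩
    have h1 := hN i hi j hj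
    rw [dist_eq_norm, lt_div_iff₀ (by positivity)] at h1
    rw [dist_eq_norm]
    refine (hC i j y hy).trans_lt (lt_of_le_of_lt ?_ h1)
    nlinarith [le_abs_self C, norm_nonneg (u i - u j)]
  have hmem (y : Euc m) (hy : y ∈ Metric.ball (0 : Euc m) 1) :
      0 < (1 - ‖y‖) / 2 ∧ ‖y‖ + (1 - ‖y‖) / 2 < 1 := by
    rw [mem_ball_zero_iff] at hy
    constructor <;> linarith
  have hlim (y : Euc m) (hy : y ∈ Metric.ball (0 : Euc m) 1) :
      ∃ z, Filter.Tendsto (fun i => g i y) Filter.atTop (nhds z) :=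
    cauchySeq_tendsto_of_complete ((hunif _ (hmem y hy).1).cauchySeq (hmem y hy).2.le)
  choose! f hf using hlim
  refine ⟨f, hf, fun V hV x hx => ?_⟩
  obtain ⟨hρ, hlt⟩ := hmem x hx
  refine ⟨{y : Euc m | ‖y‖ + (1 - ‖x‖) / 2 ≤ 1}, mem_nhdsWithin_of_mem_nhds ?_, ?_⟩
  · have hc : Continuous fun y : Euc m => ‖y‖ + (1 - ‖x‖) / 2 := by fun_prop
    exact Filter.mem_of_superset ((isOpen_lt hc continuous_const).mem_nhds hlt) fun y hy =>
      le_of_lt (show ‖y‖ + (1 - ‖x‖) / 2 < 1 from hy)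
  · refine (hunif _ hρ).tendstoUniformlyOn_of_tendsto (fun y hy => hf y ?_) V hV
    rw [mem_ball_zero_iff]
    have : ‖y‖ + (1 - ‖x‖) / 2 ≤ 1 := hy
    linarith

variable (𝕜 m) in
/-- The solutions that are smooth on the whole space, as a subspace of `L²(B_m)`. -/
def smoothSolutions (S : Set ℕ) : Submodule 𝕜 (Lp (Cl 𝕜 m) 2 (ballMeasure m)) where
  carrier := {u | ∃ (p : Euc m → Cl 𝕜 m) (hp : MemLp p 2 (ballMeasure m)), ContDiff ℝ ∞ p ∧
    (∀ x, dirac p x = 0) ∧ (∀ x, p x ∈ multivectorsOf 𝕜 m S) ∧ u = hp.toLp p}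
  zero_mem' := ⟨0, MemLp.zero, contDiff_const, fun x => by simp [dirac],
    fun _ => Submodule.zero_mem _, (MemLp.toLp_zero _).symm⟩
  add_mem' := by
    rintro _ _ ⟨p, hp, hps, hpd, hpS, rfl⟩ ⟨q, hq, hqs, hqd, hqS, rfl⟩
    refine ⟨p + q, hp.add hq, hps.add hqs, fun x => ?_,
      fun x => Submodule.add_mem _ (hpS x) (hqS x), (MemLp.toLp_add hp hq).symm⟩
    rw [show p + q = fun x => p x + q x from rfl, dirac_eq_dOp,
      dOp_add _ (hps.diffAt x) (hqs.diffAt x), ← dirac_eq_dOp, ← dirac_eq_dOp, hpd, hqd, add_zero]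
  smul_mem' := by
    rintro c _ ⟨p, hp, hps, hpd, hpS, rfl⟩
    refine ⟨c • p, hp.const_smul c, contDiff_lin (c • LinearMap.id) hps, fun x => ?_,
      fun x => Submodule.smul_mem _ c (hpS x), (MemLp.toLp_const_smul c hp).symm⟩
    rw [show c • p = fun x => c • p x from rfl, dirac_eq_dOp, dOp_smul _ c (hps.diffAt x),
      ← dirac_eq_dOp, hpd, smul_zero]

/-- By the interior estimates an `L²`-convergent sequence of smooth solutions converges together
with its first derivatives, locally uniformly in the ball; the limit is C¹ and the equation and the
grades pass to it. -/
theorem topologicalClosure_smoothSolutions_le (S : Set ℕ) :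
    (smoothSolutions 𝕜 m S).topologicalClosure ≤ gmtSpace 𝕜 m S := by
  intro u hu
  obtain ⟨v, hv, hlim⟩ := mem_closure_iff_seq_limit.1 hu
  choose p hp hps hpd hpS hvp using hv
  have hsub (ρ : ℝ) (hρ : 0 < ρ) : ∃ C : ℝ, ∀ i j (y : Euc m), ‖y‖ + ρ ≤ 1 →
      ‖p i y - p j y‖ ≤ C * ‖v i - v j‖ ∧
        ‖fderiv ℝ (p i) y - fderiv ℝ (p j) y‖ ≤ C * ‖v i - v j‖ := by
    obtain ⟨C, hC⟩ := exists_interior_estimate 𝕜 m hρ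
    refine ⟨C, fun i j y hy => ?_⟩
    have hd (x : Euc m) : dirac (p i - p j) x = 0 := by
      rw [show p i - p j = fun x => p i x - p j x from rfl, dirac_eq_dOp,
        dOp_sub _ ((hps i).diffAt x) ((hps j).diffAt x), ← dirac_eq_dOp, ← dirac_eq_dOp, hpd, hpd,
        sub_zero]
    have h := hC (p i - p j) ((hps i).sub (hps j)) hd ((hp i).sub (hp j)) y hy
    rwa [MemLp.toLp_sub (hp i) (hp j), ← hvp, ← hvp, fderiv_sub ((hps i).diffAt y) ((hps j).diffAt y)] at h
  obtain ⟨f, hf, -⟩ := exists_locallyUniform_limit (g := p) hlim.cauchySeq fun ρ hρ =>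
    (hsub ρ hρ).imp fun C hC i j y hy => (hC i j y hy).1
  obtain ⟨f', hf', hunif⟩ := exists_locallyUniform_limit (g := fun i => fderiv ℝ (p i))
    hlim.cauchySeq fun ρ hρ => (hsub ρ hρ).imp fun C hC i j y hy => (hC i j y hy).2
  have hder (x : Euc m) (hx : x ∈ Metric.ball (0 : Euc m) 1) : HasFDerivAt f (f' x) x :=
    hasFDerivAt_of_tendstoLocallyUniformlyOn Metric.isOpen_ball hunif
      (fun i y _ => ((hps i).diffAt y).hasFDerivAt) hf hx
  have hcont : ContinuousOn f' (Metric.ball 0 1) :=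
    hunif.continuousOn (Filter.Frequently.of_forall fun i =>
      ((hps i).continuous_fderiv (by simp)).continuousOn)
  refine ⟨f, ⟨?_, fun x hx => ?_⟩, fun x hx => ?_, ?_⟩
  · rw [show (1 : WithTop ℕ∞) = 0 + 1 from (zero_add 1).symm,
      contDiffOn_succ_iff_fderiv_of_isOpen Metric.isOpen_ball]
    refine ⟨fun x hx => (hder x hx).differentiableAt.differentiableWithinAt, by simp, ?_⟩
    rw [contDiffOn_zero]
    exact hcont.congr fun x hx => (hder x hx).fderiv
  · have h1 : Filter.Tendsto (fun i => dirac (p i) x) Filter.atTop (nhds (dirac f x)) := by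
      unfold dirac
      rw [(hder x hx).fderiv]
      refine tendsto_finsetSum _ fun i _ => ?_
      have h2 : Filter.Tendsto (fun j => fderiv ℝ (p j) x (EuclideanSpace.single i 1)) Filter.atTop
          (nhds (f' x (EuclideanSpace.single i 1))) :=
        ((ContinuousLinearMap.apply ℝ (Cl 𝕜 m) (EuclideanSpace.single i (1 : ℝ))).continuous.tendsto
          _).comp (hf' x hx)
      exact ((clmOf (LinearMap.mulLeft 𝕜 (gen 𝕜 i))).continuous.tendsto _).comp h2
    simp only [hpd] at h1
    exact tendsto_nhds_unique h1 tendsto_const_nhds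
  · exact (multivectorsOf 𝕜 m S).closed_of_finiteDimensional.mem_of_tendsto (hf x hx)
      (Filter.Eventually.of_forall fun i => hpS i x)
  -- A subsequence converges almost everywhere to the `L²` limit, which identifies it with the
  -- pointwise limit.
  · obtain ⟨ns, hns, hae⟩ := (tendstoInMeasure_of_tendsto_Lp hlim).exists_seq_tendsto_ae
    have hall : ∀ᵐ x ∂ballMeasure m, ∀ i, v i x = p i x := by
      rw [ae_all_iff]
      intro i
      rw [hvp]
      exact (hp i).coeFn_toLp
    filter_upwards [hae, hall, ae_ball] with x h1 h2 hx
    simp only [h2] at h1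
    exact tendsto_nhds_unique h1 ((hf x hx).comp hns.tendsto_atTop)

/-! ### The orthogonal basis -/

lemma memLp_of_continuous {E : Type*} [NormedAddCommGroup E] {p : Euc m → E} (hp : Continuous p)
    (q : ENNReal) : MemLp p q (ballMeasure m) := by
  obtain ⟨c, hc⟩ := (isCompact_closedBall (0 : Euc m) 1).exists_bound_of_continuousOn
    hp.continuousOn
  refine MemLp.of_bound hp.aestronglyMeasurable c ?_
  filter_upwards [ae_ball] with x hx using hc x (Metric.ball_subset_closedBall hx)

/-- Continuity removes the null set inside the ball, and homogeneity reaches every other point after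
scaling it into the ball. -/
lemma IsHom.eq_zero_of_ae {E : Type*} [NormedAddCommGroup E] [NormedSpace ℝ E] {k : ℕ}
    {p : Euc m → E} (hp : IsHom k p) (h : p =ᵐ[ballMeasure m] fun _ => 0) (x : Euc m) : p x = 0 := by
  have h1 : Set.EqOn p (fun _ => 0) (Metric.ball 0 1) :=
    Measure.eqOn_open_of_ae_eq h Metric.isOpen_ball hp.smooth.continuous.continuousOn
      continuousOn_const
  have h2 : (2 * (‖x‖ + 1))⁻¹ • x ∈ Metric.ball (0 : Euc m) 1 := by
    rw [mem_ball_zero_iff, norm_smul, Real.norm_eq_abs, abs_of_pos (by positivity),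
      inv_mul_lt_iff₀ (by positivity)]
    linarith [norm_nonneg x]
  have h3 := h1 h2
  rw [hp.map_smul] at h3
  exact (smul_eq_zero.1 h3).resolve_left (by positivity)

lemma inner_toLp {f : Euc m → Cl 𝕜 m} (hf : MemLp f 2 (ballMeasure m))
    (v : Lp (Cl 𝕜 m) 2 (ballMeasure m)) {g : Euc m → Cl 𝕜 m} (hg : v =ᵐ[ballMeasure m] g) :
    inner 𝕜 (hf.toLp f) v = ip f g := by
  rw [L2.inner_def, ip]
  refine integral_congr_ae ?_
  filter_upwards [hf.coeFn_toLp, hg] with x h1 h2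
  rw [h1, h2]

/-- The closed span consists of solutions by the closure theorem. Conversely, the component of a
solution orthogonal to the closed span is itself a solution, orthogonal to all polynomial solutions,
hence zero. -/
theorem PlanarBasis.isOrthogonalBasis_gmtFamily {b : Bool → ℕ → Euc 2 → Cl 𝕜 2}
    (hb : PlanarBasis b) (hm : 2 ≤ m) {S : Set ℕ} (hS : ∀ s ∈ S, s ≤ m) :
    IsOrthogonalBasis (gmtFamily b m S) (gmtSpace 𝕜 m S) := by
  have hsol := hb.exists_homSolution_gmtFamily (m := m) S
  have hL (i : GMTIndex m S) : MemLp (gmtFamily b m S i) 2 (ballMeasure m) :=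
    (hsol i).elim fun k h => memLp_of_continuous h.hom.smooth.continuous 2
  set W := Submodule.span 𝕜 (Set.range fun i => (hL i).toLp (gmtFamily b m S i)) with hW
  have hWle : W.topologicalClosure ≤ gmtSpace 𝕜 m S := by
    refine (Submodule.topologicalClosure_mono (Submodule.span_le.2 ?_)).trans
      (topologicalClosure_smoothSolutions_le S)
    rintro _ ⟨i, rfl⟩
    obtain ⟨k, hk⟩ := hsol i
    exact ⟨_, hL i, hk.hom.smooth, hk.dirac_eq, hk.grade, rfl⟩
  refine ⟨hL, fun i h0 => ?_, fun i j hij => ?_, le_antisymm hWle fun u hu => ?_⟩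
  · obtain ⟨k, hk⟩ := hsol i
    have h1 : gmtFamily b m S i =ᵐ[ballMeasure m] fun _ => 0 := by
      have h2 := (hL i).coeFn_toLp
      rw [h0] at h2
      exact h2.symm.trans (Lp.coeFn_zero _ _ _)
    exact hb.gmtFamily_ne_zero hS i (funext (hk.hom.eq_zero_of_ae h1))
  · rw [inner_toLp _ _ (hL j).coeFn_toLp]
    exact hb.ip_gmtFamily i j hij
  · have hmem (P : Euc m → Cl 𝕜 m) (hP : P ∈ Submodule.span 𝕜 (Set.range (gmtFamily b m S))) :
        ∃ hP : MemLp P 2 (ballMeasure m), hP.toLp P ∈ W := by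
      induction hP using Submodule.span_induction with
      | mem P hP =>
        obtain ⟨i, rfl⟩ := hP
        exact ⟨hL i, Submodule.subset_span ⟨i, rfl⟩⟩
      | zero => exact ⟨MemLp.zero, by rw [MemLp.toLp_zero]; exact W.zero_mem⟩
      | add P Q _ _ h1 h2 =>
        obtain ⟨hP, hPW⟩ := h1
        obtain ⟨hQ, hQW⟩ := h2
        exact ⟨hP.add hQ, by rw [MemLp.toLp_add hP hQ]; exact W.add_mem hPW hQW⟩
      | smul c P _ h1 =>
        obtain ⟨hP, hPW⟩ := h1
        exact ⟨hP.const_smul c, by rw [MemLp.toLp_const_smul c hP]; exact W.smul_mem c hPW⟩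
    have : CompleteSpace W.topologicalClosure :=
      W.isClosed_topologicalClosure.completeSpace_coe
    obtain ⟨y, hy, z, hz, rfl⟩ := W.topologicalClosure.exists_add_mem_mem_orthogonal u
    -- The remainder is a difference of two solutions. It therefore has a C¹ representative, to
    -- which the uniqueness theorem applies.
    have hzS : z ∈ gmtSpace 𝕜 m S := by
      have := Submodule.sub_mem _ hu (hWle hy)
      rwa [add_sub_cancel_left] at this
    obtain ⟨f, hf, hfS, hzf⟩ := hzS
    have hfL : MemLp f 2 (ballMeasure m) := (memLp_congr_ae hzf).1 (Lp.memLp z)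
    have hf0 := hf.ae_eq_zero (hfL.integrable one_le_two) hfS fun k P hP => by
      obtain ⟨hPL, hPW⟩ := hmem P (hb.mem_span_gmtFamily hm hP)
      rw [← inner_toLp hPL z hzf]
      exact (Submodule.mem_orthogonal _ z).1 hz _ (W.le_topologicalClosure hPW)
    have hz0 : z = 0 := Lp.ext ((hzf.trans hf0).trans (Lp.coeFn_zero _ _ _).symm)
    rw [hz0, add_zero]
    exact hy

end GMT

end

/-! ### The theorem for real and for complex scalars -/

theorem theorem4p8 (m : ℕ) (hm : 2 ≤ m) (S : Set ℕ) (hS : ∀ s ∈ S, s ≤ m) :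
    GMT.IsOrthogonalBasis (GMT.gmtFamily (GMT.planarReal ℝ) m S) (GMT.gmtSpace ℝ m S) ∧
      GMT.IsOrthogonalBasis (GMT.gmtFamily GMT.planarComplex m S) (GMT.gmtSpace ℂ m S) :=
  ⟨GMT.planarBasis_planarReal.isOrthogonalBasis_gmtFamily hm hS,
    GMT.planarBasis_planarComplex.isOrthogonalBasis_gmtFamily hm hS⟩
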